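/- **Theorem (J subdomain Ventcell optimization).** Let $J\ge 2$, $L,\hat L>0$, $\eta,\varepsilon\ge 0$. Consider $\Delta u-(\eta-i\varepsilon)u=f$ on a rectangle of height $\hat L$ decomposed into the strips $\Omega_j=(a_j,b_j)\times(0,\hat L)$, $j=1,\dots,J$, with $a_j=(j-1)L-\delta/2$, $b_j=jL+\delta/2$ and overlap $\delta>0$, with homogeneous Dirichlet conditions on the whole outer boundary. For the Fourier mode $\sin(ky)$, the parallel optimized Schwarz method imposes the transmission conditions $$(-\partial_x+P_j^-)v_j^n=(-\partial_x+P_j^-)v_{j-1}^{n-1}\ \text{ at } x=a_j\ (2\le j\le J),\qquad (\partial_x+P_j^+)v_j^n=(\partial_x+P_j^+)v_{j+1}^{n-1}\ \text{ at } x=b_j\ (1\le j\le J-1),$$ with $P_j^\pm=p_j^\pm+k^2q_j^\pm$. With $\lambda(k)=\sqrt{k^2+\eta-i\varepsilon}$ (root with positive real part), the interface traces $\mathcal R_+(b_j)=(\partial_xv_{j+1}+P_j^+v_{j+1})(b_j)$ and $\mathcal R_-(a_j)=(-\partial_xv_{j-1}+P_j^-v_{j-1})(a_j)$ satisfy $$\mathcal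 R_-^n(a_j)=\alpha_j^-\mathcal R_-^{n-1}(a_{j-1})+\beta_j^-\mathcal R_+^{n-1}(b_{j-1}),\qquad \mathcal R_+^n(b_j)=\beta_j^+\mathcal R_-^{n-1}(a_{j+1})+\alpha_j^+\mathcal R_+^{n-1}(b_{j+1}),$$ where $\mathcal R_-(a_1)=\mathcal R_+(b_J)=0$ and, with $D_j=(\lambda+P_j^+)(\lambda+P_j^-)e^{\lambda(L+\delta)}-(\lambda-P_j^+)(\lambda-P_j^-)e^{-\lambda(L+\delta)}$, $$\alpha_j^\mp=\frac{(\lambda+P_{j\mp1}^{\pm})(\lambda+P_j^{\mp})e^{\lambda\delta}-(\lambda-P_{j\mp1}^{\pm})(\lambda-P_j^{\mp})e^{-\lambda\delta}}{D_{j\mp1}},\qquad \beta_j^\mp=\frac{(\lambda+P_j^{\mp})(\lambda-P_{j\mp1}^{\mp})e^{-\lambda L}-(\lambda-P_j^{\mp})(\lambda+P_{j\mp1}^{\mp})e^{\lambda L}}{D_{j\mp1}},$$ the outer Dirichlet conditions being the limit $P_1^-,P_J^+\to\infty$. Let $T(k)$ be the $2(J-1)\times2(J-1)$ matrix of this iteration,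 and let the convergence factor be $\rho=\max_{k_{\min}\le k\le k_{\max}}\rho(T(k))$, where $k_{\min}=\pi/\hat L$ and $k_{\max}=k_{\max}(\delta)\ge c/\delta$ for some $c>0$ and all small $\delta$. Put $s=\lambda(k_{\min})$ and $$K_J^{(m)}=\Re\,\frac{s\left(e^{2sL}+1-2\cos(m\pi/J)e^{sL}\right)}{e^{2sL}-1},\qquad K_J=\min_{1\le m\le J-1}K_J^{(m)}=\min\{K_J^{(1)},K_J^{(J-1)}\}.$$ Then $K_J>0$, and $K_J=K_J^{(1)}$ whenever $J=2$ or $\Re\big(s/\sinh(sL)\big)\ge0$. All asymptotics below are for $\delta\to0^+$; $f\sim g$ means that $f/g\to1$. 1. *(One-sided)* Let all $p_j^\pm=p$ and $q_j^\pm=q$, and let $\rho^*(\delta)$ be the infimum of $\rho$ over $p,q>0$. For small $\delta$ it is a minimum, and $\rho^*=1-2^{8/5}K_J^{1/5}\delta^{1/5}+O(\delta^{2/5})$. A family $(p,q)=(p(\delta),q(\delta))$ of positive parameters is asymptotically optimal, i.e. $1-\rho\sim1-\rho^*$, if and only if $p\sim2^{-3/5}K_J^{4/5}\delta^{-1/5}$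 and $q\sim2^{-1/5}K_J^{-2/5}\delta^{3/5}$. In particular the exact minimizers $p^*,q^*$ have these asymptotics. 2. *(Two-sided)* For two pairs $(p_1,q_1),(p_2,q_2)$, let at every interface $j=1,\dots,J-1$ one of them be used as $(p_j^+,q_j^+)$ and the other one as $(p_{j+1}^-,q_{j+1}^-)$, in an arbitrary fixed arrangement, and let $\rho^*(\delta)$ be the infimum of $\rho$ over $p_1,q_1,p_2,q_2>0$. For small $\delta$ it is a minimum, and $1-\rho^*\sim2^{8/9}K_J^{1/9}\delta^{1/9}$. The parameters with $$(p_1,q_1)\sim\left(2^{-8/9}K_J^{8/9}\delta^{-1/9},\,2^{2/9}K_J^{-2/9}\delta^{7/9}\right),\qquad(p_2,q_2)\sim\left(2^{-2/3}K_J^{2/3}\delta^{-1/3},\,2^{4/9}K_J^{-4/9}\delta^{5/9}\right)$$ are asymptotically optimal ($1-\rho\sim1-\rho^*$), and they are the only asymptotically optimal families of positive parameters with $p_1\le p_2$ and $q_1\le q_2$ for all small $\delta$. -/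

import Mathlib

open Filter Topology Asymptotics

noncomputable section

namespace OSM

/-- The data of the strip decomposition of `(0, J L) × (0, Lhat)` into `J` subdomains
`Ω_j = (a_j, b_j) × (0, Lhat)`, `a_j = (j - 1) L - δ / 2`, `b_j = j L + δ / 2`, and of the operator
`Δ u - (η - i ε) u`. -/
structure Problem where
  /-- number of subdomains -/
  J : ℕ
  /-- width of the subdomains (without the overlap) -/
  L : ℝ
  /-- height of the domain -/
  Lhat : ℝ
  η : ℝ
  ε : ℝ

/-- Parameters of the Ventcell transmission conditions; `j = 1, …, J` numbers the subdomains: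
`-∂ₓ + (pm j + k² qm j)` is imposed on `Ω_j` at `x = a_j` (for `2 ≤ j`) and
`∂ₓ + (pp j + k² qp j)` at `x = b_j` (for `j ≤ J - 1`). The other values are not used. -/
structure Params where
  pm : ℕ → ℝ
  qm : ℕ → ℝ
  pp : ℕ → ℝ
  qp : ℕ → ℝ

namespace Problem

variable (D : Problem)

/-- `λ(k) = √(k² + η - i ε)`, principal square root. -/
def lam (k : ℝ) : ℂ := ((k : ℂ) ^ 2 + (D.η : ℂ) - Complex.I * (D.ε : ℂ)) ^ (1 / 2 : ℂ)

/-- The lowest frequency `π / Lhat`. -/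
def kmin : ℝ := Real.pi / D.Lhat

/-! The factors `λ ± p` belonging to the left (`x = a_j`) and right (`x = b_j`) boundary condition
of `Ω_j` at frequency `k`, where `p` is the symbol `p + k² q` of the Ventcell operator. On the outer
boundary (left of `Ω_1`, right of `Ω_J`) the condition is the Dirichlet condition, i.e. the limit
`p → ∞`: there `λ ± p` is replaced by `lim (λ ± p) / p = ± 1`. All the coefficients below in which
these outer factors occur are homogeneous of degree `0` in them. -/

def leftPlus (v : Params) (k : ℝ) (j : ℕ) : ℂ :=
  if j = 1 then 1 else D.lam k + ((v.pm j + k ^ 2 * v.qm j : ℝ) : ℂ)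

def leftMinus (v : Params) (k : ℝ) (j : ℕ) : ℂ :=
  if j = 1 then -1 else D.lam k - ((v.pm j + k ^ 2 * v.qm j : ℝ) : ℂ)

def rightPlus (v : Params) (k : ℝ) (j : ℕ) : ℂ :=
  if j = D.J then 1 else D.lam k + ((v.pp j + k ^ 2 * v.qp j : ℝ) : ℂ)

def rightMinus (v : Params) (k : ℝ) (j : ℕ) : ℂ :=
  if j = D.J then -1 else D.lam k - ((v.pp j + k ^ 2 * v.qp j : ℝ) : ℂ)

/-- The determinant `D_j` of the local problem on `Ω_j`. -/
def det (δ : ℝ) (v : Params) (k : ℝ) (j : ℕ) : ℂ :=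
  D.rightPlus v k j * D.leftPlus v k j * Complex.exp (D.lam k * (D.L + δ))
    - D.rightMinus v k j * D.leftMinus v k j * Complex.exp (-(D.lam k * (D.L + δ)))

/-- `α_j^-`: influence of the trace at `a_{j-1}` on the trace at `a_j`. -/
def alphaMinus (δ : ℝ) (v : Params) (k : ℝ) (j : ℕ) : ℂ :=
  (D.rightPlus v k (j - 1) * D.leftPlus v k j * Complex.exp (D.lam k * δ)
    - D.rightMinus v k (j - 1) * D.leftMinus v k j * Complex.exp (-(D.lam k * δ)))
    / D.det δ v k (j - 1)

/-- `α_j^+`: influence of the trace at `b_{j+1}` on the trace at `b_j`. -/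
def alphaPlus (δ : ℝ) (v : Params) (k : ℝ) (j : ℕ) : ℂ :=
  (D.leftPlus v k (j + 1) * D.rightPlus v k j * Complex.exp (D.lam k * δ)
    - D.leftMinus v k (j + 1) * D.rightMinus v k j * Complex.exp (-(D.lam k * δ)))
    / D.det δ v k (j + 1)

/-- `β_j^-`: influence of the trace at `b_{j-1}` on the trace at `a_j`. -/
def betaMinus (δ : ℝ) (v : Params) (k : ℝ) (j : ℕ) : ℂ :=
  (D.leftPlus v k j * D.leftMinus v k (j - 1) * Complex.exp (-(D.lam k * D.L))
    - D.leftMinus v k j * D.leftPlus v k (j - 1) * Complex.exp (D.lam k * D.L))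
    / D.det δ v k (j - 1)

/-- `β_j^+`: influence of the trace at `a_{j+1}` on the trace at `b_j`. -/
def betaPlus (δ : ℝ) (v : Params) (k : ℝ) (j : ℕ) : ℂ :=
  (D.rightPlus v k j * D.rightMinus v k (j + 1) * Complex.exp (-(D.lam k * D.L))
    - D.rightMinus v k j * D.rightPlus v k (j + 1) * Complex.exp (D.lam k * D.L))
    / D.det δ v k (j + 1)

/-- The iteration matrix of the optimized Schwarz method at frequency `k`, acting on the interface
traces `R_+(b_1), …, R_+(b_{J-1})` (left summand) and `R_-(a_2), …, R_-(a_J)` (right summand); the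
index `i` of either summand stands for the interface between `Ω_{i+1}` and `Ω_{i+2}`. It encodes
`R_+ⁿ(b_j) = β_j^+ R_-ⁿ⁻¹(a_{j+1}) + α_j^+ R_+ⁿ⁻¹(b_{j+1})` and
`R_-ⁿ(a_j) = α_j^- R_-ⁿ⁻¹(a_{j-1}) + β_j^- R_+ⁿ⁻¹(b_{j-1})`, with `R_-(a_1) = R_+(b_J) = 0`. -/
def T (δ : ℝ) (v : Params) (k : ℝ) :
    Matrix (Fin (D.J - 1) ⊕ Fin (D.J - 1)) (Fin (D.J - 1) ⊕ Fin (D.J - 1)) ℂ :=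
  Matrix.fromBlocks
    (Matrix.of fun i i' => if i'.val = i.val + 1 then D.alphaPlus δ v k (i.val + 1) else 0)
    (Matrix.diagonal fun i => D.betaPlus δ v k (i.val + 1))
    (Matrix.diagonal fun i => D.betaMinus δ v k (i.val + 2))
    (Matrix.of fun i i' => if i'.val + 1 = i.val then D.alphaMinus δ v k (i.val + 2) else 0)

/-- The convergence factor: the largest spectral radius of the iteration matrix over the frequency
range `[kmin, kmax]`. -/
def convFactor (kmax δ : ℝ) (v : Params) : ℝ :=
  sSup ((fun k => (spectralRadius ℂ (D.T δ v k)).toReal) '' Set.Icc D.kmin kmax)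

/-- The one-sided convergence factor, as a function of the pair `(p, q)` used everywhere. -/
def rho₁ (kmax δ p q : ℝ) : ℝ :=
  D.convFactor kmax δ ⟨fun _ => p, fun _ => q, fun _ => p, fun _ => q⟩

/-- The two-sided convergence factor: at the interface between `Ω_j` and `Ω_{j+1}` one of the two
pairs `(p₁, q₁)`, `(p₂, q₂)` is used for `(p_j^+, q_j^+)` and the other one for
`(p_{j+1}^-, q_{j+1}^-)`; `σ j` says which. -/
def rho₂ (σ : ℕ → Bool) (kmax δ p₁ q₁ p₂ q₂ : ℝ) : ℝ :=
  D.convFactor kmax δ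
    { pp := fun j => if σ j then p₁ else p₂
      qp := fun j => if σ j then q₁ else q₂
      pm := fun j => if σ (j - 1) then p₂ else p₁
      qm := fun j => if σ (j - 1) then q₂ else q₁ }

/-- The optimal one-sided convergence factor. -/
def opt₁ (kmax δ : ℝ) : ℝ :=
  sInf {r | ∃ p q : ℝ, 0 < p ∧ 0 < q ∧ r = D.rho₁ kmax δ p q}

/-- The optimal two-sided convergence factor. -/
def opt₂ (σ : ℕ → Bool) (kmax δ : ℝ) : ℝ :=
  sInf {r | ∃ p₁ q₁ p₂ q₂ : ℝ, 0 < p₁ ∧ 0 < q₁ ∧ 0 < p₂ ∧ 0 < q₂ ∧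
    r = D.rho₂ σ kmax δ p₁ q₁ p₂ q₂}

/-- `s = λ(kmin)`. -/
def s : ℂ := D.lam D.kmin

/-- `Re (s (e^{2sL} + 1 - 2 c e^{sL}) / (e^{2sL} - 1))`. -/
def modeConst (c : ℝ) : ℝ :=
  (D.s * (Complex.exp (2 * D.s * D.L) + 1 - 2 * (c : ℂ) * Complex.exp (D.s * D.L))
    / (Complex.exp (2 * D.s * D.L) - 1)).re

/-- The closed form constant
`K_J = Re (s (e^{2sL} + 1 - 2 cos (π / J) e^{sL}) / (e^{2sL} - 1))`. -/
def KJ : ℝ := D.modeConst (Real.cos (Real.pi / D.J))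

/-- The minimum of `Re (s (e^{2sL} + 1 - 2 cos (m π / J) e^{sL}) / (e^{2sL} - 1))` over the modes
`m = 1, …, J - 1`; it is attained at `m = 1` or at `m = J - 1`. -/
def Kmode : ℝ :=
  min (D.modeConst (Real.cos (Real.pi / D.J))) (D.modeConst (-Real.cos (Real.pi / D.J)))

end Problem

end OSM

end

/-! ### Perturbation of the extreme eigenvalue of a Hermitian matrix -/

namespace OSM

section Spectral

variable {n : Type*} [Fintype n] [DecidableEq n]

/-! Put `E = e^{-λL}`, `F = e^{-λδ}`, and let `G` be the product of the two reflection coefficients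
`(λ - P) / (λ + P)` met at an interface. This product is symmetric in the two pairs of parameters,
so it is the same at every interface, whatever the arrangement. After rescaling each trace by its
own factor `λ + P` (`T_mul_diagonal`), the iteration matrix becomes an isolated-interface part with
square `G F²` plus `1 - G F²` times an interaction. Hence its square is `(1 - Γ) + Γ Θ` with `Γ = 1
- G F²`, where the coupling matrix `Θ` has size `O(E)` (`iterMat_sq`, `exists_rate_eq`). Everything
follows from this identity in two regimes.

High frequencies: `Θ` is exponentially small, so the squared spectral radius is nearly `|G| e^{-2 δ
Re λ}` (`rate_sq_approx`). Each symbol contributes to the gain `1 - ρ` about `min (P/k, k/P)`. As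
`P/k = p/k + kq`, this is small away from the "zero" `p` and the "pole" `1/q`, and it is essentially
the sum of the multiplicative distances `min (z/k, k/z)` to these two points when they are well
separated. The overlap adds `kδ`.

Low frequencies: the relevant `P` are large, so all reflection coefficients are near `-1`, like the
outer Dirichlet ones. Then `Γ ≈ 2λω` with `ω = 1/P₁ + 1/P₂`, and `Θ` tends to a complex affine
function of two coupled copies of a path, a real symmetric matrix whose extreme eigenvalues are `±2
cos(π/J)`. This makes the gain `K ω` to first order. The upper bound of the spectral radius uses
Rayleigh quotients and the monotonicity of the decay rate in `k`; the lower bound uses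
`exists_eigenvalue_near_top`, since the true matrix is not normal. The monotonicity reduces to
inequalities for `Re (z tanh (z/2))` and `Re (z coth (z/2))` along a hyperbola.

The rest is an equioscillation problem for the sorted zeros and poles `Z 0 ≤ … ≤ Z (n-1)`, with
multiplicity `w`: `(n, w) = (2, 2)` in the one-sided and `(4, 1)` in the two-sided case. To leading
order the gain is at most `wK / Z 0`, at most `2w √(Z i / Z (i+1))` (test the geometric mean), and
at most `2 √(w δ Z (n-1))` (last zero against overlap). Equality throughout gives `T^(2n+1) = 4^n
w^(2n) K δ` and the positions `optZero`. In both cases the constant is `256 K δ`, and `τ =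
δ^{1/(2n+1)}` is the natural small parameter. `ZeroChain` records the upper bounds;
`eventually_sharp` shows that a nearly optimal gain forces every zero near its optimal place.
Conversely `rate_le_of_profile` shows that zeros near these places achieve the gain.

It remains to see which zero is which parameter. Some `p` must be the smallest zero, otherwise the
low-frequency gain is lost. In the two-sided case the order `p₁, 1/q₂, …` is excluded by a test
between the second and third zero. Minimizers exist by compactness and lower semicontinuity of the
spectral radius. -/

theorem mem_spectrum_iff_eigenvector {A : Matrix n n ℂ} {z : ℂ} :
    z ∈ spectrum ℂ A ↔ ∃ v : n → ℂ, v ≠ 0 ∧ A.mulVec v = z • v := by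
  rw [Matrix.mem_spectrum_iff_isRoot_charpoly, Polynomial.IsRoot.def, Matrix.eval_charpoly,
    ← Matrix.exists_mulVec_eq_zero_iff]
  refine exists_congr fun v => and_congr_right fun _ => ?_
  rw [Matrix.sub_mulVec, sub_eq_zero, Matrix.scalar_apply, ← Matrix.smul_one_eq_diagonal,
    Matrix.smul_mulVec, Matrix.one_mulVec, eq_comm]

/-- Converts distances to the spectrum into determinants, which are easy to follow under
perturbations even of non-normal matrices. -/
theorem norm_det_sub_eq_prod (A : Matrix n n ℂ) (z : ℂ) :
    ‖(z • (1 : Matrix n n ℂ) - A).det‖ = (A.charpoly.roots.map fun μ => ‖z - μ‖).prod := by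
  have h := (IsAlgClosed.splits A.charpoly).eval_eq_prod_roots_of_monic A.charpoly_monic z
  rw [Matrix.eval_charpoly, Matrix.scalar_apply, ← Matrix.smul_one_eq_diagonal] at h
  rw [h, show ‖(A.charpoly.roots.map (z - ·)).prod‖ = normHom (A.charpoly.roots.map (z - ·)).prod
    from rfl, map_multiset_prod, Multiset.map_map]
  rfl

theorem mem_charpoly_roots_iff {A : Matrix n n ℂ} {z : ℂ} :
    z ∈ A.charpoly.roots ↔ z ∈ spectrum ℂ A := by
  rw [Polynomial.mem_roots A.charpoly_monic.ne_zero, Matrix.mem_spectrum_iff_isRoot_charpoly]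

theorem card_charpoly_roots (A : Matrix n n ℂ) :
    Multiset.card A.charpoly.roots = Fintype.card n := by
  rw [← A.charpoly_natDegree_eq_dim]
  exact ((IsAlgClosed.splits A.charpoly).natDegree_eq_card_roots).symm

theorem multiset_prod_map_le {α : Type*} (s : Multiset α) (f g : α → ℝ) (c : ℝ) (hc : 0 ≤ c)
    (h : ∀ a ∈ s, 0 ≤ f a ∧ 0 ≤ g a ∧ f a ≤ c * g a) :
    0 ≤ (s.map f).prod ∧ (s.map f).prod ≤ c ^ (Multiset.card s) * (s.map g).prod := by
  induction s using Multiset.induction_on with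
  | empty => simp
  | cons a s ih =>
    have h1 := h a (Multiset.mem_cons_self a s)
    have h2 := ih fun b hb => h b (Multiset.mem_cons_of_mem hb)
    rw [Multiset.map_cons, Multiset.prod_cons, Multiset.map_cons, Multiset.prod_cons,
      Multiset.card_cons, pow_succ]
    refine ⟨mul_nonneg h1.1 h2.1, ?_⟩
    calc f a * (s.map f).prod
        ≤ (c * g a) * (c ^ (Multiset.card s) * (s.map g).prod) :=
          mul_le_mul h1.2.2 h2.2 h2.1 (mul_nonneg hc h1.2.1)
      _ = _ := by ring

/-- The squared Euclidean norm. -/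
noncomputable def nsq (v : n → ℂ) : ℝ := ∑ i, ‖v i‖ ^ 2

omit [DecidableEq n] in
theorem nsq_pos {v : n → ℂ} (hv : v ≠ 0) : 0 < nsq v := by
  obtain ⟨i, hi⟩ := Function.ne_iff.1 hv
  exact Finset.sum_pos' (fun _ _ => by positivity) ⟨i, Finset.mem_univ i, by
    have : 0 < ‖v i‖ := norm_pos_iff.2 hi
    positivity⟩

omit [DecidableEq n] in
theorem star_dotProduct_self (v : n → ℂ) : star v ⬝ᵥ v = (nsq v : ℂ) := by
  simp [nsq, dotProduct, ← Complex.conj_mul']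

omit [DecidableEq n] in
theorem norm_star_dotProduct_mulVec_le {E : Matrix n n ℂ} {ε : ℝ} (hε : 0 ≤ ε)
    (hE : ∀ i j, ‖E i j‖ ≤ ε) (v : n → ℂ) :
    ‖star v ⬝ᵥ E.mulVec v‖ ≤ Fintype.card n * ε * nsq v := by
  have h1 : ‖star v ⬝ᵥ E.mulVec v‖ ≤ ∑ i, ∑ j, ε * (‖v i‖ * ‖v j‖) := by
    refine (norm_sum_le _ _).trans (Finset.sum_le_sum fun i _ => ?_)
    rw [norm_mul, Pi.star_apply, norm_star, Matrix.mulVec, dotProduct]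
    calc ‖v i‖ * ‖∑ j, E i j * v j‖ ≤ ‖v i‖ * ∑ j, ‖E i j * v j‖ := by
          gcongr; exact norm_sum_le _ _
      _ = ∑ j, ‖v i‖ * ‖E i j * v j‖ := Finset.mul_sum _ _ _
      _ ≤ _ := Finset.sum_le_sum fun j _ => by
          rw [norm_mul]
          calc ‖v i‖ * (‖E i j‖ * ‖v j‖) ≤ ‖v i‖ * (ε * ‖v j‖) := by gcongr; exact hE i j
            _ = _ := by ring
  have h2 : ∑ i, ∑ j, ε * (‖v i‖ * ‖v j‖) = ε * (∑ i, ‖v i‖) ^ 2 := by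
    rw [sq, Finset.sum_mul_sum, Finset.mul_sum]
    exact Finset.sum_congr rfl fun i _ => (Finset.mul_sum _ _ _).symm
  have h3 : (∑ i, ‖v i‖) ^ 2 ≤ Fintype.card n * nsq v := by
    simpa [nsq] using sq_sum_le_card_mul_sum_sq (s := (Finset.univ : Finset n)) (f := fun i => ‖v i‖)
  calc _ ≤ ε * (∑ i, ‖v i‖) ^ 2 := h1.trans h2.le
    _ ≤ ε * (Fintype.card n * nsq v) := by gcongr
    _ = _ := by ring

/-- The numerical range of `R` is real and bounded above by `ν`. -/
def RayleighLE (R : Matrix n n ℂ) (ν : ℝ) : Prop :=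
  ∀ v : n → ℂ, ∃ r : ℝ, star v ⬝ᵥ R.mulVec v = r ∧ r ≤ ν * nsq v

theorem RayleighLE.le_norm {R : Matrix n n ℂ} {ν : ℝ} (hR : RayleighLE R ν) {z : ℝ}
    (v : n → ℂ) :
    z * nsq v ≤ ‖star v ⬝ᵥ (((ν + z : ℝ) : ℂ) • (1 : Matrix n n ℂ) - R).mulVec v‖ := by
  obtain ⟨r, hr, hle⟩ := hR v
  rw [Matrix.sub_mulVec, dotProduct_sub, Matrix.smul_mulVec, Matrix.one_mulVec, dotProduct_smul,
    star_dotProduct_self, hr, smul_eq_mul, ← Complex.ofReal_mul, ← Complex.ofReal_sub,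
    Complex.norm_real]
  refine le_trans ?_ (le_abs_self _)
  linarith

theorem RayleighLE.mem_spectrum {R : Matrix n n ℂ} {ν : ℝ} (hR : RayleighLE R ν) {μ : ℂ}
    (h : μ ∈ spectrum ℂ R) : ∃ r : ℝ, μ = r ∧ r ≤ ν := by
  obtain ⟨v, hv, h⟩ := mem_spectrum_iff_eigenvector.1 h
  obtain ⟨r, hr, hle⟩ := hR v
  have hp := nsq_pos hv
  rw [h, dotProduct_smul, star_dotProduct_self, smul_eq_mul] at hr
  refine ⟨r / nsq v, ?_, (div_le_iff₀ hp).2 hle⟩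
  rw [Complex.ofReal_div, ← hr, mul_div_cancel_right₀]
  exact_mod_cast hp.ne'

/-- Write `B - E = B (1 - B⁻¹E)`. For an eigenpair `(x, w)` of `B⁻¹E`, pairing `E w = x B w` with
`w` gives `|x| z ‖w‖² ≤ n ε ‖w‖²`, because the numerical range of `B` lies to the right of `z`. So
every factor of `det (1 - B⁻¹E)` is within `n ε / z` of `1`. -/
theorem RayleighLE.det_perturb {R E : Matrix n n ℂ} {ν ε z : ℝ} (hR : RayleighLE R ν)
    (hε : 0 ≤ ε) (hE : ∀ i j, ‖E i j‖ ≤ ε) (hz : 0 < z) :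
    let B := ((ν + z : ℝ) : ℂ) • (1 : Matrix n n ℂ) - R
    ‖(B - E).det‖ ≤ ‖B.det‖ * (1 + Fintype.card n * ε / z) ^ Fintype.card n ∧
      (Fintype.card n * ε / z ≤ 1 →
        ‖B.det‖ * (1 - Fintype.card n * ε / z) ^ Fintype.card n ≤ ‖(B - E).det‖) := by
  intro B
  set e : ℝ := Fintype.card n * ε / z with he
  have he0 : 0 ≤ e := by positivity
  have hBdet : IsUnit B.det := by
    rw [isUnit_iff_ne_zero]
    intro h0
    obtain ⟨w, hw, h⟩ := Matrix.exists_mulVec_eq_zero_iff.2 h0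
    have h1 := hR.le_norm (z := z) w
    rw [show (((ν + z : ℝ) : ℂ) • (1 : Matrix n n ℂ) - R).mulVec w = 0 from h] at h1
    simp only [dotProduct_zero, norm_zero] at h1
    nlinarith [nsq_pos hw]
  set X := B⁻¹ * E with hX
  have hBX : B - E = B * (1 - X) := by
    rw [mul_sub, mul_one, hX, ← mul_assoc, Matrix.mul_nonsing_inv B hBdet, one_mul]
  have hev : ∀ x ∈ X.charpoly.roots, ‖x‖ ≤ e := by
    intro x hx
    obtain ⟨w, hw, h⟩ := mem_spectrum_iff_eigenvector.1 (mem_charpoly_roots_iff.1 hx)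
    have h1 : E.mulVec w = x • B.mulVec w := by
      rw [← Matrix.mulVec_smul, ← h, Matrix.mulVec_mulVec, hX, ← mul_assoc,
        Matrix.mul_nonsing_inv B hBdet, one_mul]
    have h2 := norm_star_dotProduct_mulVec_le hε hE w
    have h3 := hR.le_norm (z := z) w
    rw [h1, dotProduct_smul, norm_smul] at h2
    have hp := nsq_pos hw
    have h4 : ‖x‖ * (z * nsq w) ≤ Fintype.card n * ε * nsq w :=
      (mul_le_mul_of_nonneg_left h3 (norm_nonneg x)).trans h2
    rw [he, le_div_iff₀ hz]
    nlinarith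
  have hdet : ‖(1 - X).det‖ = (X.charpoly.roots.map fun μ => ‖(1 : ℂ) - μ‖).prod := by
    simpa using norm_det_sub_eq_prod X 1
  rw [hBX, Matrix.det_mul, norm_mul, hdet]
  constructor
  · refine mul_le_mul_of_nonneg_left ?_ (norm_nonneg _)
    have h := (multiset_prod_map_le X.charpoly.roots (fun μ => ‖(1 : ℂ) - μ‖) (fun _ => 1) (1 + e)
      (by positivity) fun x hx => ⟨norm_nonneg _, zero_le_one, by
        refine (norm_sub_le _ _).trans ?_
        simpa using hev x hx⟩).2
    simpa [card_charpoly_roots] using h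
  · intro he1
    refine mul_le_mul_of_nonneg_left ?_ (norm_nonneg _)
    have h := (multiset_prod_map_le X.charpoly.roots (fun _ => 1 - e) (fun μ => ‖(1 : ℂ) - μ‖) 1
      zero_le_one fun x hx => ⟨by linarith, norm_nonneg _, by
        have := norm_sub_norm_le (1 : ℂ) x
        have := hev x hx
        simp only [norm_one] at *
        linarith⟩).2
    simpa [card_charpoly_roots] using h

/-- Moving from `ν + h` to `ν + 2h` doubles the factor of the eigenvalue `ν` itself, and increases
every other factor since the remaining eigenvalues lie to the left of `ν`. -/
theorem RayleighLE.two_mul_det_le {R : Matrix n n ℂ} {ν h : ℝ} (hR : RayleighLE R ν) (hh : 0 < h)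
    (hν : (ν : ℂ) ∈ spectrum ℂ R) :
    2 * ‖(((ν + h : ℝ) : ℂ) • (1 : Matrix n n ℂ) - R).det‖ ≤
      ‖(((ν + 2 * h : ℝ) : ℂ) • (1 : Matrix n n ℂ) - R).det‖ := by
  rw [norm_det_sub_eq_prod, norm_det_sub_eq_prod]
  obtain ⟨s, hs⟩ := Multiset.exists_cons_of_mem (mem_charpoly_roots_iff.2 hν)
  have hle : ∀ μ ∈ s, ∃ r : ℝ, μ = r ∧ r ≤ ν := fun μ hμ =>
    hR.mem_spectrum (mem_charpoly_roots_iff.1 (hs ▸ Multiset.mem_cons_of_mem hμ))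
  have h1 := multiset_prod_map_le s (fun μ => ‖((ν + h : ℝ) : ℂ) - μ‖)
    (fun μ => ‖((ν + 2 * h : ℝ) : ℂ) - μ‖) 1 zero_le_one fun μ hμ => by
      refine ⟨norm_nonneg _, norm_nonneg _, ?_⟩
      obtain ⟨r, rfl, hr⟩ := hle μ hμ
      rw [← Complex.ofReal_sub, ← Complex.ofReal_sub, Complex.norm_real, Complex.norm_real,
        Real.norm_of_nonneg (by linarith), Real.norm_of_nonneg (by linarith)]
      linarith
  rw [hs]
  simp only [Multiset.map_cons, Multiset.prod_cons]
  have h2 : ‖((ν + h : ℝ) : ℂ) - ν‖ = h := by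
    rw [← Complex.ofReal_sub, Complex.norm_real, Real.norm_of_nonneg (by linarith)]; ring
  have h3 : ‖((ν + 2 * h : ℝ) : ℂ) - ν‖ = 2 * h := by
    rw [← Complex.ofReal_sub, Complex.norm_real, Real.norm_of_nonneg (by linarith)]; ring
  rw [h2, h3]
  have h4 := h1.2
  rw [one_pow, one_mul] at h4
  nlinarith

/-- Supplies the ratio of scales for the contradiction in `exists_eigenvalue_near_top`: as `A → ∞`
the left side tends to `1` and the right side to `2`. -/
theorem exists_ratio_const (m : ℕ) : ∃ A : ℝ, 2 ≤ A ∧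
    (1 + 3 / (A - 1)) ^ m * (1 + 1 / A) ^ m < 2 * (1 - 1 / (2 * A)) ^ m := by
  have hA : Tendsto (fun A : ℝ => A) atTop atTop := tendsto_id
  have h1 : Tendsto (fun A : ℝ => (1 + 3 / (A - 1)) ^ m * (1 + 1 / A) ^ m) atTop
      (𝓝 ((1 + 0) ^ m * (1 + 0) ^ m)) :=
    ((tendsto_const_nhds.add (tendsto_const_nhds.div_atTop
      (tendsto_atTop_add_const_right _ (-1) hA))).pow m).mul
      ((tendsto_const_nhds.add (tendsto_const_nhds.div_atTop hA)).pow m)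
  have h2 : Tendsto (fun A : ℝ => 2 * (1 - 1 / (2 * A)) ^ m) atTop (𝓝 (2 * (1 - 0) ^ m)) :=
    tendsto_const_nhds.mul ((tendsto_const_nhds.sub (tendsto_const_nhds.div_atTop
      (hA.const_mul_atTop two_pos))).pow m)
  obtain ⟨A, h, h'⟩ := ((h1.eventually_lt h2 (by norm_num)).and (eventually_ge_atTop 2)).exists
  exact ⟨A, h', h⟩

variable (n) in
/-- The largest eigenvalue of a Hermitian matrix is stable to first order under arbitrary
perturbations. -/
theorem exists_eigenvalue_near_top : ∃ C : ℝ, 0 < C ∧ ∀ (R E : Matrix n n ℂ) (ν ε : ℝ),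
    RayleighLE R ν → (ν : ℂ) ∈ spectrum ℂ R → 0 < ε → (∀ i j, ‖E i j‖ ≤ ε) →
      ∃ μ ∈ spectrum ℂ (R + E), ‖μ - ν‖ ≤ C * ε := by
  obtain ⟨A, hA, hlt⟩ := exists_ratio_const (Fintype.card n)
  refine ⟨A ^ 2 * (Fintype.card n + 1), by positivity, fun R E ν ε hR hν hε hE => ?_⟩
  have hcard : 0 < Fintype.card n := by
    obtain ⟨v, hv, -⟩ := mem_spectrum_iff_eigenvector.1 hν
    obtain ⟨i, -⟩ := Function.ne_iff.1 hv
    exact Fintype.card_pos_iff.2 ⟨i⟩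
  set e : ℝ := Fintype.card n * ε with he
  have he0 : 0 < e := by positivity
  by_contra! hcon
  have hfar : ∀ μ ∈ (R + E).charpoly.roots, A ^ 2 * e < ‖(ν : ℂ) - μ‖ := fun μ hμ => by
    have h := hcon μ (mem_charpoly_roots_iff.1 hμ)
    rw [norm_sub_rev]
    refine lt_of_le_of_lt ?_ h
    rw [he]
    have : (0 : ℝ) < A ^ 2 * ε := by positivity
    nlinarith
  -- The step `h` lies between the size `e` of the perturbation and the assumed distance `A² e` to
  -- the spectrum of `R + E`. Each scale is negligible against the next by a factor `1/A`. The
  -- determinant of `R + E` is thus almost unchanged from `ν + h` to `ν + 2h`, while that of `R` at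
  -- least doubles.
  set h : ℝ := A * e with hh
  have hh0 : 0 < h := by positivity
  have hE1 := (hR.det_perturb hε.le hE hh0).1
  have hE2 := (hR.det_perturb hε.le hE (mul_pos two_pos hh0)).2
  have hR2 := hR.two_mul_det_le hh0 hν
  have hA0 : (0 : ℝ) < A := by linarith
  have e1 : e / h = 1 / A := by rw [hh]; field_simp
  have e2 : e / (2 * h) = 1 / (2 * A) := by rw [hh]; field_simp
  rw [← he, e1, sub_sub] at hE1
  rw [← he, e2, sub_sub] at hE2
  have hE2' := hE2 (by rw [div_le_one (by positivity)]; linarith)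
  have hratio : ‖(((ν + 2 * h : ℝ) : ℂ) • (1 : Matrix n n ℂ) - (R + E)).det‖ ≤
      (1 + 3 / (A - 1)) ^ Fintype.card n *
        ‖(((ν + h : ℝ) : ℂ) • (1 : Matrix n n ℂ) - (R + E)).det‖ := by
    rw [norm_det_sub_eq_prod, norm_det_sub_eq_prod]
    rw [← card_charpoly_roots (R + E)]
    have hA1 : 0 < A - 1 := by linarith
    refine (multiset_prod_map_le _ _ _ _ (by positivity) fun μ hμ =>
      ⟨norm_nonneg _, norm_nonneg _, ?_⟩).2
    have hμ' := hfar μ hμ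
    have a1 : ‖((ν + 2 * h : ℝ) : ℂ) - μ‖ ≤ ‖(ν : ℂ) - μ‖ + 2 * h := by
      have := norm_add_le ((ν : ℂ) - μ) ((2 * h : ℝ) : ℂ)
      rw [Complex.norm_real, Real.norm_of_nonneg (by positivity)] at this
      refine le_trans (le_of_eq ?_) this
      push_cast; ring_nf
    have a2 : ‖(ν : ℂ) - μ‖ - h ≤ ‖((ν + h : ℝ) : ℂ) - μ‖ := by
      have := norm_sub_le (((ν + h : ℝ) : ℂ) - μ) ((h : ℝ) : ℂ)
      rw [Complex.norm_real, Real.norm_of_nonneg (by positivity)] at this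
      have h' : ((ν + h : ℝ) : ℂ) - μ - (h : ℂ) = ν - μ := by push_cast; ring
      rw [h'] at this
      linarith
    have a3 : ‖(ν : ℂ) - μ‖ + 2 * h ≤ (1 + 3 / (A - 1)) * (‖(ν : ℂ) - μ‖ - h) := by
      have hd : (A - 1) * h ≤ ‖(ν : ℂ) - μ‖ - h := by rw [hh]; rw [hh] at *; nlinarith
      have : 3 * h ≤ 3 / (A - 1) * (‖(ν : ℂ) - μ‖ - h) := by
        rw [div_mul_eq_mul_div, le_div_iff₀ hA1]
        nlinarith
      linarith
    refine a1.trans (a3.trans ?_)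
    have : 0 ≤ 1 + 3 / (A - 1) := by positivity
    gcongr
  set d := ‖(((ν + h : ℝ) : ℂ) • (1 : Matrix n n ℂ) - R).det‖
  have hA1 : 0 < A - 1 := by linarith
  have hd0 : 0 < d := by
    refine norm_pos_iff.2 fun h0 => ?_
    obtain ⟨w, hw, h'⟩ := Matrix.exists_mulVec_eq_zero_iff.2 h0
    have h1 := hR.le_norm (z := h) w
    rw [h'] at h1
    simp only [dotProduct_zero, norm_zero] at h1
    nlinarith [nsq_pos hw]
  have hs : 0 ≤ 1 - 1 / (2 * A) := by
    rw [sub_nonneg, div_le_one (by positivity)]; linarith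
  have c1 : d * (2 * (1 - 1 / (2 * A)) ^ Fintype.card n) ≤
      d * ((1 + 3 / (A - 1)) ^ Fintype.card n * (1 + 1 / A) ^ Fintype.card n) := by
    calc d * (2 * (1 - 1 / (2 * A)) ^ Fintype.card n)
        = (2 * d) * (1 - 1 / (2 * A)) ^ Fintype.card n := by ring
      _ ≤ _ := mul_le_mul_of_nonneg_right hR2 (pow_nonneg hs _)
      _ ≤ _ := hE2'
      _ ≤ _ := hratio
      _ ≤ (1 + 3 / (A - 1)) ^ Fintype.card n * (d * (1 + 1 / A) ^ Fintype.card n) := by gcongr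
      _ = _ := by ring
  exact absurd (le_of_mul_le_mul_left c1 hd0) (not_le.2 hlt)

end Spectral

end OSM

/-! ### Spectral radius, Perron bound and the path matrix -/

namespace OSM

section SpectralRadius

variable {n : Type*} [Fintype n] [DecidableEq n]

/-- The spectral radius of a complex matrix as a real number. -/
noncomputable def specRad (A : Matrix n n ℂ) : ℝ := (spectralRadius ℂ A).toReal

theorem specRad_nonneg (A : Matrix n n ℂ) : 0 ≤ specRad A := ENNReal.toReal_nonneg

theorem spectralRadius_ne_top (A : Matrix n n ℂ) : spectralRadius ℂ A ≠ ⊤ := by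
  have hfin : (spectrum ℂ A).Finite :=
    (A.charpoly.roots.toFinset.finite_toSet).subset fun z hz =>
      Multiset.mem_toFinset.2 (mem_charpoly_roots_iff.2 hz)
  obtain ⟨C, hC⟩ := (hfin.image (fun z => ‖z‖₊)).bddAbove
  refine ne_top_of_le_ne_top (ENNReal.coe_ne_top (r := C)) (iSup₂_le fun z hz => ?_)
  exact_mod_cast hC ⟨z, hz, rfl⟩

theorem norm_le_specRad {A : Matrix n n ℂ} {z : ℂ} (hz : z ∈ spectrum ℂ A) :
    ‖z‖ ≤ specRad A := by
  have h : (‖z‖₊ : ENNReal) ≤ spectralRadius ℂ A := le_iSup₂ (f := fun k _ => (‖k‖₊ : ENNReal)) z hz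
  simpa [specRad] using (ENNReal.toReal_le_toReal ENNReal.coe_ne_top (spectralRadius_ne_top A)).2 h

theorem specRad_le {A : Matrix n n ℂ} {r : ℝ} (hr : 0 ≤ r)
    (h : ∀ z ∈ spectrum ℂ A, ‖z‖ ≤ r) : specRad A ≤ r := by
  refine ENNReal.toReal_le_of_le_ofReal hr (iSup₂_le fun z hz => ?_)
  rw [← ENNReal.ofReal_coe_nnreal]
  exact ENNReal.ofReal_le_ofReal (h z hz)

theorem specRad_le_of_sq {A : Matrix n n ℂ} {r : ℝ} (hr : 0 ≤ r)
    (h : ∀ z ∈ spectrum ℂ (A ^ 2), ‖z‖ ≤ r ^ 2) : specRad A ≤ r := by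
  refine specRad_le hr fun z hz => ?_
  have := h _ (spectrum.pow_mem_pow A 2 hz)
  rw [norm_pow] at this
  exact (sq_le_sq₀ (norm_nonneg _) hr).1 this

theorem norm_le_specRad_sq {A : Matrix n n ℂ} {z : ℂ} (hz : z ∈ spectrum ℂ (A ^ 2)) :
    ‖z‖ ≤ specRad A ^ 2 := by
  rw [spectrum.map_pow_of_pos A two_pos] at hz
  obtain ⟨w, hw, rfl⟩ := hz
  simp only [norm_pow]
  exact pow_le_pow_left₀ (norm_nonneg _) (norm_le_specRad hw) 2

theorem specRad_eq_of_mul_eq {A B D : Matrix n n ℂ} (hD : IsUnit D) (h : A * D = D * B) :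
    specRad A = specRad B := by
  obtain ⟨u, rfl⟩ := hD
  have hA : A = u * B * (↑u⁻¹ : Matrix n n ℂ) := by rw [← h, Units.mul_inv_cancel_right]
  rw [specRad, specRad, spectralRadius, spectralRadius, hA, spectrum.units_conjugate]

/-- Take an eigenvalue `z` of the limit with `|z| > y`. Then `det (z - A x)` tends to zero, whereas
it would be at least `(|z| - y)^n` in modulus if all eigenvalues of `A x` had modulus at most `y`.
-/
theorem eventually_lt_specRad {X : Type*} {l : Filter X} {A : X → Matrix n n ℂ}
    {A₀ : Matrix n n ℂ} (hA : Tendsto A l (𝓝 A₀)) {y : ℝ} (hy : y < specRad A₀) :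
    ∀ᶠ x in l, y < specRad (A x) := by
  rcases lt_or_ge y 0 with hy0 | hy0
  · exact Eventually.of_forall fun x => hy0.trans_le (specRad_nonneg _)
  obtain ⟨z, hz, hyz⟩ : ∃ z ∈ spectrum ℂ A₀, y < ‖z‖ := by
    by_contra! hcon
    exact absurd (specRad_le hy0 hcon) (not_le.2 hy)
  have h0 : ‖(z • (1 : Matrix n n ℂ) - A₀).det‖ = 0 := by
    rw [norm_det_sub_eq_prod]
    refine Multiset.prod_eq_zero (Multiset.mem_map.2 ⟨z, mem_charpoly_roots_iff.2 hz, ?_⟩)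
    simp
  have ht : Tendsto (fun x => ‖(z • (1 : Matrix n n ℂ) - A x).det‖) l (𝓝 0) := by
    rw [← h0]
    have hc : Continuous fun B : Matrix n n ℂ => ‖(z • (1 : Matrix n n ℂ) - B).det‖ := by
      fun_prop
    exact (hc.tendsto A₀).comp hA
  filter_upwards [ht.eventually_lt_const (pow_pos (sub_pos.2 hyz) (Fintype.card n))] with x hx
  by_contra! hcon
  refine absurd hx (not_lt.2 ?_)
  rw [norm_det_sub_eq_prod, ← card_charpoly_roots (A x)]
  have h := (multiset_prod_map_le (A x).charpoly.roots (fun _ => ‖z‖ - y) (fun μ => ‖z - μ‖) 1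
    zero_le_one fun μ hμ => ⟨by linarith, norm_nonneg _, by
      have h1 := norm_le_specRad (mem_charpoly_roots_iff.1 hμ)
      have h2 := norm_sub_norm_le z μ
      linarith⟩).2
  simpa using h

-- Schur test with the positive eigenvector as weight: bound `|v i| |v j|` by the
-- arithmetic-geometric mean with weights `s j / s i` and `s i / s j`, then sum using `M s = ν s`.
omit [DecidableEq n] in
theorem norm_star_dotProduct_le_of_nonneg_eigenvector {M : Matrix n n ℝ} {s : n → ℝ} {ν : ℝ}
    (hM : ∀ i j, 0 ≤ M i j) (hsymm : M.IsSymm) (hs : ∀ i, 0 < s i) (h : M.mulVec s = ν • s)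
    (v : n → ℂ) :
    ‖star v ⬝ᵥ (M.map (fun x : ℝ => (x : ℂ))).mulVec v‖ ≤ ν * nsq v := by
  have h1 : ‖star v ⬝ᵥ (M.map (fun x : ℝ => (x : ℂ))).mulVec v‖ ≤
      ∑ i, ∑ j, M i j * (‖v i‖ * ‖v j‖) := by
    refine (norm_sum_le _ _).trans (Finset.sum_le_sum fun i _ => ?_)
    rw [norm_mul, Pi.star_apply, norm_star, Matrix.mulVec, dotProduct]
    calc _ ≤ ‖v i‖ * ∑ j, ‖(M.map (fun x : ℝ => (x : ℂ))) i j * v j‖ := by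
          gcongr; exact norm_sum_le _ _
      _ = ∑ j, ‖v i‖ * ‖(M.map (fun x : ℝ => (x : ℂ))) i j * v j‖ := Finset.mul_sum _ _ _
      _ ≤ _ := Finset.sum_le_sum fun j _ => by
          rw [norm_mul, Matrix.map_apply, Complex.norm_real, Real.norm_of_nonneg (hM i j)]
          exact le_of_eq (by ring)
  have h2 : ∀ i j, M i j * (‖v i‖ * ‖v j‖) ≤
      1 / 2 * (M i j * s j * (‖v i‖ ^ 2 / s i)) + 1 / 2 * (M j i * s i * (‖v j‖ ^ 2 / s j)) := by
    intro i j
    rw [hsymm.apply i j]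
    have hi := hs i
    have hj := hs j
    have h3 : ‖v i‖ * ‖v j‖ ≤ 1 / 2 * (s j * (‖v i‖ ^ 2 / s i)) +
        1 / 2 * (s i * (‖v j‖ ^ 2 / s j)) := by
      have : 1 / 2 * (s j * (‖v i‖ ^ 2 / s i)) + 1 / 2 * (s i * (‖v j‖ ^ 2 / s j)) -
          ‖v i‖ * ‖v j‖ = 1 / 2 * (s j * ‖v i‖ - s i * ‖v j‖) ^ 2 / (s i * s j) := by
        field_simp; ring
      have h4 : 0 ≤ 1 / 2 * (s j * ‖v i‖ - s i * ‖v j‖) ^ 2 / (s i * s j) := by positivity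
      linarith
    calc _ ≤ M i j * (1 / 2 * (s j * (‖v i‖ ^ 2 / s i)) + 1 / 2 * (s i * (‖v j‖ ^ 2 / s j))) :=
          mul_le_mul_of_nonneg_left h3 (hM i j)
      _ = _ := by ring
  have h5 : ∑ i, ∑ j, M i j * s j * (‖v i‖ ^ 2 / s i) = ν * nsq v := by
    rw [nsq, Finset.mul_sum]
    refine Finset.sum_congr rfl fun i _ => ?_
    rw [← Finset.sum_mul]
    have h6 : ∑ j, M i j * s j = ν * s i := congrFun h i
    rw [h6]
    have hi := (hs i).ne'
    field_simp
  refine h1.trans ((Finset.sum_le_sum fun i _ => Finset.sum_le_sum fun j _ => h2 i j).trans ?_)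
  simp only [Finset.sum_add_distrib, ← Finset.mul_sum]
  rw [Finset.sum_comm (f := fun i j => M j i * s i * (‖v j‖ ^ 2 / s j)), h5]
  linarith

omit [DecidableEq n] in
theorem exists_real_star_dotProduct {M : Matrix n n ℝ} (hsymm : M.IsSymm) (v : n → ℂ) :
    ∃ r : ℝ, star v ⬝ᵥ (M.map (fun x : ℝ => (x : ℂ))).mulVec v = r := by
  have : (M.map (fun x : ℝ => (x : ℂ))).IsHermitian := by
    ext i j
    simp [hsymm.apply i j]
  refine ⟨_, (Complex.conj_eq_iff_re.1 ?_).symm⟩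
  rw [starRingEnd_apply, ← Matrix.star_dotProduct_star, star_star, Matrix.star_mulVec, this.eq,
    ← Matrix.dotProduct_mulVec]

end SpectralRadius

/-! ### Eigenvectors and numerical range of the doubled path -/

section PathGraph

variable (N : ℕ)

/-- The upper shift matrix. -/
def shiftU (R : Type*) [Zero R] [One R] : Matrix (Fin N) (Fin N) R :=
  Matrix.of fun i i' => if i'.val = i.val + 1 then 1 else 0

/-- The lower shift matrix. -/
def shiftL (R : Type*) [Zero R] [One R] : Matrix (Fin N) (Fin N) R :=
  Matrix.of fun i i' => if i'.val + 1 = i.val then 1 else 0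

/-- Two copies of the path on `N` vertices, coupled bipartitely. -/
def pathMat (R : Type*) [AddMonoidWithOne R] : Matrix (Fin N ⊕ Fin N) (Fin N ⊕ Fin N) R :=
  Matrix.fromBlocks 0 (shiftU N R + shiftL N R) (shiftU N R + shiftL N R) 0

theorem sum_fin_ite_eq (m : ℕ) (f : ℕ → ℝ) :
    ∑ j : Fin N, (if j.val = m then f j.val else 0) = if m < N then f m else 0 := by
  rw [Fin.sum_univ_eq_sum_range (fun j => if j = m then f j else 0) N, Finset.sum_ite_eq']
  simp

/-- The sine vanishes at the two ghost sites `0` and `N + 1`, so the addition formula holds at the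
end vertices as well. -/
theorem shift_mulVec_sin (i : Fin N) :
    ((shiftU N ℝ + shiftL N ℝ).mulVec
      fun j => Real.sin ((j.val + 1) * (Real.pi / (N + 1 : ℕ)))) i =
      2 * Real.cos (Real.pi / (N + 1 : ℕ)) * Real.sin ((i.val + 1) * (Real.pi / (N + 1 : ℕ))) := by
  set θ := Real.pi / (N + 1 : ℕ) with hθ
  have hN : Real.sin ((N + 1 : ℕ) * θ) = 0 := by
    rw [hθ, mul_div_cancel₀ _ (by positivity), Real.sin_pi]
  have h1 : (shiftU N ℝ).mulVec (fun j => Real.sin ((j.val + 1) * θ)) i =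
      Real.sin ((i.val + 2) * θ) := by
    have : (shiftU N ℝ).mulVec (fun j => Real.sin ((j.val + 1) * θ)) i =
        ∑ j : Fin N, (if j.val = i.val + 1 then Real.sin (((j.val : ℕ) + 1) * θ) else 0) := by
      simp [Matrix.mulVec, dotProduct, shiftU]
    rw [this, sum_fin_ite_eq N (i.val + 1) fun j => Real.sin ((j + 1) * θ)]
    split_ifs with h
    · push_cast; ring_nf
    · have h' : i.val + 1 = N := by omega
      have : ((i.val : ℝ) + 2) = (N + 1 : ℕ) := by
        exact_mod_cast (by omega : i.val + 2 = N + 1)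
      rw [this, hN]
  have h2 : (shiftL N ℝ).mulVec (fun j => Real.sin ((j.val + 1) * θ)) i =
      Real.sin (i.val * θ) := by
    rcases Nat.eq_zero_or_pos i.val with h0 | h0
    · simp [Matrix.mulVec, dotProduct, shiftL, h0]
    have : (shiftL N ℝ).mulVec (fun j => Real.sin ((j.val + 1) * θ)) i =
        ∑ j : Fin N, (if j.val = i.val - 1 then Real.sin (((j.val : ℕ) + 1) * θ) else 0) := by
      simp only [Matrix.mulVec, dotProduct, shiftL, Matrix.of_apply, ite_mul, one_mul, zero_mul]
      refine Finset.sum_congr rfl fun j _ => ?_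
      congr 1
      exact propext (by omega)
    rw [this, sum_fin_ite_eq N (i.val - 1) fun j => Real.sin ((j + 1) * θ), if_pos (by omega)]
    congr 2
    rw [Nat.cast_sub h0]; push_cast; ring
  rw [Matrix.add_mulVec, Pi.add_apply, h1, h2]
  have e1 : ((i.val : ℝ) + 2) * θ = (i.val + 1) * θ + θ := by ring
  have e2 : (i.val : ℝ) * θ = (i.val + 1) * θ - θ := by ring
  rw [e1, e2, Real.sin_add, Real.sin_sub]
  ring

theorem shift_isSymm : (shiftU N ℝ + shiftL N ℝ).IsSymm := by
  ext i j
  simp only [shiftU, shiftL, Matrix.transpose_apply, Matrix.add_apply, Matrix.of_apply]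
  rw [add_comm]
  congr 2 <;> exact propext (by omega)

theorem pathMat_isSymm : (pathMat N ℝ).IsSymm := by
  rw [pathMat]
  exact Matrix.isSymm_fromBlocks_iff.2
    ⟨Matrix.isSymm_zero, shift_isSymm N, shift_isSymm N, Matrix.isSymm_zero⟩

theorem pathMat_nonneg (i j) : 0 ≤ pathMat N ℝ i j := by
  have h : ∀ i j, 0 ≤ (shiftU N ℝ + shiftL N ℝ) i j := fun i j => by
    simp only [shiftU, shiftL, Matrix.add_apply, Matrix.of_apply]
    positivity
  rcases i with i | i <;> rcases j with j | j <;> simp [pathMat] <;> exact h i j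

theorem pathMat_map : (pathMat N ℝ).map (fun x : ℝ => (x : ℂ)) = pathMat N ℂ := by
  ext i j
  rcases i with i | i <;> rcases j with j | j <;>
    simp [pathMat, shiftU, shiftL, apply_ite (fun x : ℝ => (x : ℂ))]

/-- The Perron vector of the path. -/
noncomputable def pathVec (j : Fin N) : ℝ := Real.sin ((j.val + 1) * (Real.pi / (N + 1 : ℕ)))

theorem pathVec_pos (j : Fin N) : 0 < pathVec N j := by
  refine Real.sin_pos_of_pos_of_lt_pi (by positivity) ?_
  have hj : ((j.val : ℝ) + 1) < (N + 1 : ℕ) := by exact_mod_cast (by omega : j.val + 1 < N + 1)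
  rw [← mul_div_assoc, div_lt_iff₀ (by positivity), mul_comm]
  exact mul_lt_mul_of_pos_left hj Real.pi_pos

theorem shift_mulVec_pathVec : (shiftU N ℝ + shiftL N ℝ).mulVec (pathVec N) =
    (2 * Real.cos (Real.pi / (N + 1 : ℕ))) • pathVec N :=
  funext fun i => shift_mulVec_sin N i

theorem pathMat_norm_le (v : Fin N ⊕ Fin N → ℂ) :
    ‖star v ⬝ᵥ (pathMat N ℂ).mulVec v‖ ≤ 2 * Real.cos (Real.pi / (N + 1 : ℕ)) * nsq v := by
  rw [← pathMat_map]
  refine norm_star_dotProduct_le_of_nonneg_eigenvector (s := Sum.elim (pathVec N) (pathVec N))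
    (pathMat_nonneg N) (pathMat_isSymm N) ?_ ?_ v
  · rintro (i | i) <;> exact pathVec_pos N i
  · rw [pathMat, Matrix.fromBlocks_mulVec]
    simp only [Sum.elim_comp_inl, Sum.elim_comp_inr, Matrix.zero_mulVec, zero_add, add_zero,
      shift_mulVec_pathVec]
    ext (i | i) <;> simp

theorem pathMat_real (v : Fin N ⊕ Fin N → ℂ) :
    ∃ r : ℝ, star v ⬝ᵥ (pathMat N ℂ).mulVec v = r := by
  rw [← pathMat_map]
  exact exists_real_star_dotProduct (pathMat_isSymm N) v

theorem pathMat_rayleigh : RayleighLE (pathMat N ℂ) (2 * Real.cos (Real.pi / (N + 1 : ℕ))) := by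
  intro v
  obtain ⟨r, hr⟩ := pathMat_real N v
  have h := pathMat_norm_le N v
  rw [hr, Complex.norm_real] at h
  exact ⟨r, hr, (le_abs_self r).trans h⟩

/-- The lower end of the spectrum matters as much as the upper one: the two ends correspond to `±cos
(π/J)`, and which of these modes decays more slowly depends on the sign of `Re (s / sinh (sL))`. -/
theorem neg_pathMat_rayleigh :
    RayleighLE (-pathMat N ℂ) (2 * Real.cos (Real.pi / (N + 1 : ℕ))) := by
  intro v
  obtain ⟨r, hr⟩ := pathMat_real N v
  have h := pathMat_norm_le N v
  rw [hr, Complex.norm_real] at h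
  refine ⟨-r, ?_, (neg_le_abs r).trans h⟩
  rw [Matrix.neg_mulVec, dotProduct_neg, hr, Complex.ofReal_neg]

theorem shift_mulVec_pathVec_complex :
    (shiftU N ℂ + shiftL N ℂ).mulVec (fun i => (pathVec N i : ℂ)) =
    ((2 * Real.cos (Real.pi / (N + 1 : ℕ)) : ℝ) : ℂ) • fun i => (pathVec N i : ℂ) := by
  ext i
  have h := congrArg (fun x : ℝ => (x : ℂ)) (congrFun (shift_mulVec_pathVec N) i)
  simp only [Matrix.mulVec, dotProduct, Pi.smul_apply, smul_eq_mul] at h ⊢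
  rw [Complex.ofReal_mul] at h
  rw [← h, Complex.ofReal_sum]
  refine Finset.sum_congr rfl fun j _ => ?_
  simp [shiftU, shiftL, apply_ite (fun x : ℝ => (x : ℂ))]

theorem mem_spectrum_pathMat (hN : 1 ≤ N) :
    ((2 * Real.cos (Real.pi / (N + 1 : ℕ)) : ℝ) : ℂ) ∈ spectrum ℂ (pathMat N ℂ) ∧
    ((2 * Real.cos (Real.pi / (N + 1 : ℕ)) : ℝ) : ℂ) ∈ spectrum ℂ (-pathMat N ℂ) := by
  have hne : ∀ w : Fin N → ℂ, (Sum.elim (fun i => (pathVec N i : ℂ)) w) ≠ 0 := fun w h => by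
    have := congrFun h (Sum.inl ⟨0, hN⟩)
    simp only [Sum.elim_inl, Pi.zero_apply, Complex.ofReal_eq_zero] at this
    exact (pathVec_pos N _).ne' this
  constructor
  · refine mem_spectrum_iff_eigenvector.2
      ⟨Sum.elim (fun i => (pathVec N i : ℂ)) (fun i => (pathVec N i : ℂ)), hne _, ?_⟩
    rw [pathMat, Matrix.fromBlocks_mulVec]
    simp only [Sum.elim_comp_inl, Sum.elim_comp_inr, Matrix.zero_mulVec, zero_add, add_zero,
      shift_mulVec_pathVec_complex]
    ext (i | i) <;> simp
  · refine mem_spectrum_iff_eigenvector.2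
      ⟨Sum.elim (fun i => (pathVec N i : ℂ)) (-fun i => (pathVec N i : ℂ)), hne _, ?_⟩
    rw [Matrix.neg_mulVec, pathMat, Matrix.fromBlocks_mulVec]
    simp only [Sum.elim_comp_inl, Sum.elim_comp_inr, Matrix.zero_mulVec, zero_add,
      Matrix.mulVec_neg, shift_mulVec_pathVec_complex]
    ext (i | i) <;> simp

end PathGraph

end OSM

/-! ### Real inequalities for `Re (z tanh (z/2))` and `Re (z coth (z/2))` -/

namespace OSM

section RealInequalities

theorem nonneg_of_deriv_nonneg {f f' : ℝ → ℝ} (h0 : f 0 = 0) (hf : ∀ x, HasDerivAt f (f' x) x)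
    (hf' : ∀ x, 0 ≤ x → 0 ≤ f' x) {x : ℝ} (hx : 0 ≤ x) : 0 ≤ f x := by
  have hmono : MonotoneOn f (Set.Ici 0) := by
    refine monotoneOn_of_deriv_nonneg (convex_Ici 0) (fun y _ => (hf y).continuousAt.continuousWithinAt)
      (fun y _ => (hf y).differentiableAt.differentiableWithinAt) fun y hy => ?_
    rw [(hf y).deriv]
    rw [interior_Ici] at hy
    exact hf' y (le_of_lt hy)
  rw [← h0]
  exact hmono Set.self_mem_Ici hx hx

theorem cos_le_taylor {x : ℝ} (hx : 0 ≤ x) : Real.cos x ≤ 1 - x ^ 2 / 2 + x ^ 4 / 24 := by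
  have := nonneg_of_deriv_nonneg (f := fun x => 1 - x ^ 2 / 2 + x ^ 4 / 24 - Real.cos x)
    (f' := fun x => Real.sin x - (x - x ^ 3 / 6)) (by simp)
    (fun y => by
      have h := (((hasDerivAt_const y (1 : ℝ)).sub ((hasDerivAt_pow 2 y).div_const 2)).add
        ((hasDerivAt_pow 4 y).div_const 24)).sub (Real.hasDerivAt_cos y)
      refine h.congr_deriv ?_
      norm_num; ring)
    (fun y hy => sub_nonneg.2 (Real.sin_ge_sub_cube hy)) hx
  linarith

theorem one_add_sq_le_cosh {x : ℝ} (hx : 0 ≤ x) : 1 + x ^ 2 / 2 ≤ Real.cosh x := by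
  have := nonneg_of_deriv_nonneg (f := fun x => Real.cosh x - (1 + x ^ 2 / 2))
    (f' := fun x => Real.sinh x - x) (by simp)
    (fun y => by
      have h := (Real.hasDerivAt_cosh y).sub
        ((hasDerivAt_const y (1 : ℝ)).add ((hasDerivAt_pow 2 y).div_const 2))
      refine h.congr_deriv ?_
      norm_num)
    (fun y hy => sub_nonneg.2 (Real.self_le_sinh_iff.2 hy)) hx
  linarith

theorem add_cube_le_sinh {x : ℝ} (hx : 0 ≤ x) : x + x ^ 3 / 6 ≤ Real.sinh x := by
  have := nonneg_of_deriv_nonneg (f := fun x => Real.sinh x - (x + x ^ 3 / 6))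
    (f' := fun x => Real.cosh x - (1 + x ^ 2 / 2)) (by simp)
    (fun y => by
      have h := (Real.hasDerivAt_sinh y).sub
        ((hasDerivAt_id y).add ((hasDerivAt_pow 3 y).div_const 6))
      refine h.congr_deriv ?_
      norm_num; ring)
    (fun y hy => sub_nonneg.2 (one_add_sq_le_cosh hy)) hx
  linarith

theorem sinh_le_mul_cosh {x : ℝ} (hx : 0 ≤ x) : Real.sinh x ≤ x * Real.cosh x := by
  have := nonneg_of_deriv_nonneg (f := fun x => x * Real.cosh x - Real.sinh x)
    (f' := fun x => x * Real.sinh x) (by simp)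
    (fun y => by
      have h := ((hasDerivAt_id y).mul (Real.hasDerivAt_cosh y)).sub (Real.hasDerivAt_sinh y)
      refine h.congr_deriv ?_
      simp)
    (fun y hy => mul_nonneg hy (Real.sinh_nonneg_iff.2 hy)) hx
  linarith

/-- This is `tanh (x/2) ≤ x/2`, squared and written with the double angle. -/
theorem four_mul_cosh_sub_one_le {x : ℝ} (hx : 0 ≤ x) :
    4 * (Real.cosh x - 1) ≤ x ^ 2 * (Real.cosh x + 1) := by
  have h1 := sinh_le_mul_cosh (x := x / 2) (by positivity)
  have h2 := Real.cosh_two_mul (x / 2)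
  have h3 := Real.cosh_sq (x / 2)
  have h4 : 0 ≤ Real.sinh (x / 2) := Real.sinh_nonneg_iff.2 (by positivity)
  rw [mul_div_cancel₀ _ (two_ne_zero' ℝ)] at h2
  have h5 := mul_self_le_mul_self h4 h1
  rw [h2]
  nlinarith

/-- Up to a positive factor this is the derivative of `cothRe` along a hyperbola `XY = e`. With `u =
cosh X - 1` and `v = 1 - cos Y`, both nonnegative, the terms in `u`, in `v` and in `uv` are
controlled by Taylor bounds and `Y ≤ X`. -/
theorem coth_deriv_nonneg {X Y : ℝ} (hY : 0 ≤ Y) (hYX : Y ≤ X) :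
    0 ≤ (X ^ 2 + Y ^ 2) * (1 - Real.cosh X * Real.cos Y) +
      (X * Real.sinh X - Y * Real.sin Y) * (Real.cosh X - Real.cos Y) := by
  have hX : 0 ≤ X := hY.trans hYX
  have h1 := add_cube_le_sinh hX
  have h2 := cos_le_taylor hY
  have h3 := four_mul_cosh_sub_one_le hX
  have h4 := Real.sin_le hY
  have hu : 0 ≤ Real.cosh X - 1 := by linarith [Real.one_le_cosh X]
  have hv : 0 ≤ 1 - Real.cos Y := by linarith [Real.cos_le_one Y]
  set u := Real.cosh X - 1 with hu'
  set v := 1 - Real.cos Y with hv'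
  have hc : Real.cosh X = 1 + u := by rw [hu']; ring
  have hcos : Real.cos Y = 1 - v := by rw [hv']; ring
  rw [hc] at h3
  rw [hc, hcos]
  have hS : X ^ 2 + X ^ 4 / 6 ≤ X * Real.sinh X := by nlinarith
  have hs : Y * Real.sin Y ≤ Y ^ 2 := by nlinarith
  have h6 : (X ^ 2 + X ^ 4 / 6 - Y ^ 2) * (u + v) ≤ (X * Real.sinh X - Y * Real.sin Y) * (u + v) :=
    mul_le_mul_of_nonneg_right (by linarith) (by positivity)
  have h7 : 0 ≤ u * (4 * v + X ^ 4 / 6 - 2 * Y ^ 2) := by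
    refine mul_nonneg hu ?_
    have : Y ^ 4 ≤ X ^ 4 := pow_le_pow_left₀ hY hYX 4
    rw [hcos] at h2
    linarith
  have h8 : 4 * u * v ≤ X ^ 2 * (2 + u) * v := mul_le_mul_of_nonneg_right (by linarith) hv
  have h9 : 0 ≤ X ^ 4 / 6 * v := by positivity
  have h10 : 0 ≤ Y ^ 2 * (u * v) := by positivity
  have e : 1 + u - (1 - v) = u + v := by ring
  rw [e]
  nlinarith

/-- The counterpart for `tanhRe`, with `u = cosh X - 1` and `w = 1 + cos Y`. The coefficient of `u`
contains the negative term `-Y²`, and only `X⁴/6`, `Y sin Y` and `(X² + Y²) w` can compensate it. -/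
theorem tanh_deriv_nonneg {X Y : ℝ} (hY : 0 ≤ Y) (hYX : Y ≤ X) :
    0 ≤ (X ^ 2 + Y ^ 2) * (1 + Real.cosh X * Real.cos Y) +
      (X * Real.sinh X + Y * Real.sin Y) * (Real.cosh X + Real.cos Y) := by
  have hX : 0 ≤ X := hY.trans hYX
  have h1 := add_cube_le_sinh hX
  have hu : 0 ≤ Real.cosh X - 1 := by linarith [Real.one_le_cosh X]
  have hw : 0 ≤ 1 + Real.cos Y := by linarith [Real.neg_one_le_cos Y]
  have hXY : Y ^ 2 ≤ X ^ 2 := pow_le_pow_left₀ hY hYX 2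
  have hXY4 : Y ^ 4 ≤ X ^ 4 := pow_le_pow_left₀ hY hYX 4
  have hS : X ^ 2 + X ^ 4 / 6 ≤ X * Real.sinh X := by nlinarith
  -- `s` is a convenient lower bound of `Y sin Y`: it is `0` up to `π`, and `-Y` beyond, where
  -- `X⁴/6` dominates. For `Y ≤ π` the quartic term suffices once `Y² ≥ 6`; below that the
  -- half-angle bound keeps `1 + cos Y` away from zero.
  have key : ∃ s : ℝ, s ≤ Y * Real.sin Y ∧ 0 ≤ X ^ 2 + X ^ 4 / 6 + s ∧
      0 ≤ X ^ 4 / 6 - Y ^ 2 + s + (X ^ 2 + Y ^ 2) * (1 + Real.cos Y) := by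
    rcases le_or_gt Y Real.pi with hpi | hpi
    · refine ⟨0, mul_nonneg hY (Real.sin_nonneg_of_nonneg_of_le_pi hY hpi), by positivity, ?_⟩
      have h2 : 2 * Y ^ 2 * (1 + Real.cos Y) ≤ (X ^ 2 + Y ^ 2) * (1 + Real.cos Y) :=
        mul_le_mul_of_nonneg_right (by linarith) hw
      rcases le_or_gt 6 (Y ^ 2) with h6 | h6
      · nlinarith
      have h3 := Real.one_sub_sq_div_two_le_cos (x := Y / 2)
      have h4 : Real.cos Y = 2 * Real.cos (Y / 2) ^ 2 - 1 := by
        rw [← Real.cos_two_mul]; ring_nf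
      have h5 : (1 - (Y / 2) ^ 2 / 2) ^ 2 ≤ Real.cos (Y / 2) ^ 2 :=
        pow_le_pow_left₀ (by nlinarith) h3 2
      have h7 : 1 - Y ^ 2 / 6 ≤ 2 * (1 + Real.cos Y) := by
        nlinarith [sq_nonneg (Y ^ 2 / 4 - 5 / 3)]
      nlinarith
    · have hY3 : 3 ≤ Y := by linarith [Real.pi_gt_three]
      have h2 : 0 ≤ X ^ 4 / 6 - Y ^ 2 - Y := by
        have h31 : 3.14 ≤ Y := by linarith [Real.pi_gt_d2]
        have : 6 * (Y ^ 2 + Y) ≤ Y ^ 4 := by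
          have : 0 ≤ Y * (Y ^ 3 - 6 * Y - 6) := mul_nonneg hY (by nlinarith [sq_nonneg (Y - 3.14)])
          nlinarith
        linarith
      refine ⟨-Y, by nlinarith [Real.neg_one_le_sin Y], by nlinarith, ?_⟩
      have : 0 ≤ (X ^ 2 + Y ^ 2) * (1 + Real.cos Y) := by positivity
      linarith
  obtain ⟨s, hs, hk1, hk2⟩ := key
  set u := Real.cosh X - 1 with hu'
  set w := 1 + Real.cos Y with hw'
  have hc : Real.cosh X = 1 + u := by rw [hu']; ring
  have hcos : Real.cos Y = w - 1 := by rw [hw']; ring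
  rw [hc, hcos]
  have h6 : (X ^ 2 + X ^ 4 / 6 + s) * (u + w) ≤ (X * Real.sinh X + Y * Real.sin Y) * (u + w) :=
    mul_le_mul_of_nonneg_right (by linarith) (by positivity)
  have h7 := mul_nonneg hu hk2
  have h8 := mul_nonneg hw hk1
  have h9 : 0 ≤ (X ^ 2 + Y ^ 2) * w := by positivity
  have e : 1 + u + (w - 1) = u + w := by ring
  rw [e]
  nlinarith

/-- `Re (z tanh (z / 2))` for `z = X - iY`. -/
noncomputable def tanhRe (X Y : ℝ) : ℝ :=
  (X * Real.sinh X - Y * Real.sin Y) / (Real.cosh X + Real.cos Y)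

/-- `Re (z coth (z / 2))` for `z = X - iY`. -/
noncomputable def cothRe (X Y : ℝ) : ℝ :=
  (X * Real.sinh X + Y * Real.sin Y) / (Real.cosh X - Real.cos Y)

theorem cosh_add_cos_pos {X : ℝ} (hX : 0 < X) (Y : ℝ) : 0 < Real.cosh X + Real.cos Y := by
  linarith [Real.one_lt_cosh.2 hX.ne', Real.neg_one_le_cos Y]

theorem cosh_sub_cos_pos {X : ℝ} (hX : 0 < X) (Y : ℝ) : 0 < Real.cosh X - Real.cos Y := by
  linarith [Real.one_lt_cosh.2 hX.ne', Real.cos_le_one Y]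

theorem mul_sinh_sub_pos {X Y : ℝ} (hX : 0 < X) (hY : 0 ≤ Y) (hYX : Y ≤ X) :
    0 < X * Real.sinh X - Y * Real.sin Y := by
  have h1 := add_cube_le_sinh hX.le
  have h2 := Real.sin_le hY
  have h3 : Y ^ 2 ≤ X ^ 2 := pow_le_pow_left₀ hY hYX 2
  have h4 : 0 < X ^ 4 := by positivity
  nlinarith

theorem mul_sinh_add_pos {X Y : ℝ} (hX : 0 < X) (hY : 0 ≤ Y) (hYX : Y ≤ X) :
    0 < X * Real.sinh X + Y * Real.sin Y := by
  have h1 := add_cube_le_sinh hX.le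
  have h2 : -Y ≤ Real.sin Y := by
    have := Real.abs_sin_le_abs (x := Y)
    rw [abs_of_nonneg hY] at this
    exact (abs_le.1 this).1
  have h3 : Y ^ 2 ≤ X ^ 2 := pow_le_pow_left₀ hY hYX 2
  have h4 : 0 < X ^ 4 := by positivity
  nlinarith

theorem tanhRe_pos {X Y : ℝ} (hX : 0 < X) (hY : 0 ≤ Y) (hYX : Y ≤ X) : 0 < tanhRe X Y :=
  div_pos (mul_sinh_sub_pos hX hY hYX) (cosh_add_cos_pos hX Y)

theorem cothRe_pos {X Y : ℝ} (hX : 0 < X) (hY : 0 ≤ Y) (hYX : Y ≤ X) : 0 < cothRe X Y :=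
  div_pos (mul_sinh_add_pos hX hY hYX) (cosh_sub_cos_pos hX Y)

theorem hasDerivAt_hyperbola (e : ℝ) {X : ℝ} (hX : X ≠ 0) :
    HasDerivAt (fun X => e / X) (-(e / X) / X) X := by
  have := (hasDerivAt_const X e).div (hasDerivAt_id X) hX
  refine this.congr_deriv ?_
  simp only [id]
  field_simp
  ring

/-- Along `XY = e` the condition `Y ≤ X`, once true at `X₁`, stays true to the right, so the sign of
the derivative is needed only in that sector. -/
theorem monotone_along_hyperbola {G G' : ℝ → ℝ} {e X₁ X₂ : ℝ} (hX₁ : 0 < X₁) (he : 0 ≤ e)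
    (heX : e ≤ X₁ ^ 2) (hX : X₁ ≤ X₂)
    (hG : ∀ X, 0 < X → HasDerivAt G (G' X) X)
    (hG' : ∀ X, 0 < X → 0 ≤ e / X → e / X ≤ X → 0 ≤ G' X) : G X₁ ≤ G X₂ := by
  have hpos : ∀ X ∈ Set.Icc X₁ X₂, 0 < X := fun X h => hX₁.trans_le h.1
  refine monotoneOn_of_deriv_nonneg (convex_Icc X₁ X₂)
    (fun y hy => (hG y (hpos y hy)).continuousAt.continuousWithinAt)
    (fun y hy => (hG y (hpos y (interior_subset hy))).differentiableAt.differentiableWithinAt)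
    (fun y hy => ?_) (Set.left_mem_Icc.2 hX) (Set.right_mem_Icc.2 hX) hX
  have hy' := interior_subset hy
  have hy0 := hpos y hy'
  rw [(hG y hy0).deriv]
  refine hG' y hy0 (by positivity) ?_
  rw [div_le_iff₀ hy0]
  nlinarith [hy'.1]

theorem tanhRe_mono {e X₁ X₂ : ℝ} (hX₁ : 0 < X₁) (he : 0 ≤ e)
    (heX : e ≤ X₁ ^ 2) (hX : X₁ ≤ X₂) : tanhRe X₁ (e / X₁) ≤ tanhRe X₂ (e / X₂) := by
  refine monotone_along_hyperbola (G := fun X => tanhRe X (e / X))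
    (G' := fun X => ((X ^ 2 + (e / X) ^ 2) * (1 + Real.cosh X * Real.cos (e / X)) +
      (X * Real.sinh X + (e / X) * Real.sin (e / X)) * (Real.cosh X + Real.cos (e / X))) / X /
      (Real.cosh X + Real.cos (e / X)) ^ 2) hX₁ he heX hX ?_ ?_
  · intro X hX0
    have hY := hasDerivAt_hyperbola e hX0.ne'
    have h1 := (((hasDerivAt_id X).mul (Real.hasDerivAt_sinh X)).sub (hY.mul hY.sin)).div
      ((Real.hasDerivAt_cosh X).add hY.cos) (cosh_add_cos_pos hX0 (e / X)).ne'
    refine h1.congr_deriv ?_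
    simp only [id, Pi.mul_apply, Pi.sub_apply, Pi.add_apply]
    have hD := (cosh_add_cos_pos hX0 (e / X)).ne'
    have hs := Real.sin_sq (e / X)
    have hc := Real.cosh_sq X
    set Y := e / X
    rw [← sub_eq_zero]
    rw [← sub_div, div_eq_zero_iff]
    left
    field_simp
    linear_combination (X ^ 2) * hc + (Y ^ 2) * hs
  · intro X hX0 h0 h1
    have := tanh_deriv_nonneg h0 h1
    positivity

theorem cothRe_mono {e X₁ X₂ : ℝ} (hX₁ : 0 < X₁) (he : 0 ≤ e)
    (heX : e ≤ X₁ ^ 2) (hX : X₁ ≤ X₂) : cothRe X₁ (e / X₁) ≤ cothRe X₂ (e / X₂) := by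
  refine monotone_along_hyperbola (G := fun X => cothRe X (e / X))
    (G' := fun X => ((X ^ 2 + (e / X) ^ 2) * (1 - Real.cosh X * Real.cos (e / X)) +
      (X * Real.sinh X - (e / X) * Real.sin (e / X)) * (Real.cosh X - Real.cos (e / X))) / X /
      (Real.cosh X - Real.cos (e / X)) ^ 2) hX₁ he heX hX ?_ ?_
  · intro X hX0
    have hY := hasDerivAt_hyperbola e hX0.ne'
    have h1 := (((hasDerivAt_id X).mul (Real.hasDerivAt_sinh X)).add (hY.mul hY.sin)).div
      ((Real.hasDerivAt_cosh X).sub hY.cos) (cosh_sub_cos_pos hX0 (e / X)).ne'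
    refine h1.congr_deriv ?_
    simp only [id, Pi.mul_apply, Pi.sub_apply, Pi.add_apply]
    have hs := Real.sin_sq (e / X)
    have hc := Real.cosh_sq X
    set Y := e / X
    rw [← sub_eq_zero]
    rw [← sub_div, div_eq_zero_iff]
    left
    field_simp
    linear_combination (X ^ 2) * hc + (Y ^ 2) * hs
  · intro X hX0 h0 h1
    have := coth_deriv_nonneg h0 h1
    positivity

end RealInequalities

end OSM

/-! ### The root `λ(k)` and the decay rate of the modes -/

namespace OSM

namespace Problem

variable (D : Problem)

theorem lam_sq (k : ℝ) : D.lam k ^ 2 = (k : ℂ) ^ 2 + (D.η : ℂ) - Complex.I * (D.ε : ℂ) := by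
  have := Complex.cpow_ofNat_inv_pow ((k : ℂ) ^ 2 + (D.η : ℂ) - Complex.I * (D.ε : ℂ)) 2
  rw [lam, one_div]
  exact this

variable {D}

theorem lam_re_pos (hη : 0 ≤ D.η) {k : ℝ} (hk : 0 < k) : 0 < (D.lam k).re := by
  have hre : 0 < ((k : ℂ) ^ 2 + (D.η : ℂ) - Complex.I * (D.ε : ℂ)).re := by
    have : ((k : ℂ) ^ 2 + (D.η : ℂ) - Complex.I * (D.ε : ℂ)).re = k ^ 2 + D.η := by
      simp [← Complex.ofReal_pow]
    rw [this]; positivity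
  have hne : ((k : ℂ) ^ 2 + (D.η : ℂ) - Complex.I * (D.ε : ℂ)) ≠ 0 := fun h => by
    rw [h] at hre; simp at hre
  rw [lam, Complex.cpow_def_of_ne_zero hne, Complex.exp_re]
  refine mul_pos (Real.exp_pos _) ?_
  have harg := Complex.abs_arg_lt_pi_div_two_iff.2 (Or.inl hre)
  have him : (Complex.log ((k : ℂ) ^ 2 + (D.η : ℂ) - Complex.I * (D.ε : ℂ)) * (1 / 2 : ℂ)).im =
      Complex.arg ((k : ℂ) ^ 2 + (D.η : ℂ) - Complex.I * (D.ε : ℂ)) / 2 := by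
    have : (1 / 2 : ℂ) = ((1 / 2 : ℝ) : ℂ) := by push_cast; rfl
    rw [this, Complex.im_mul_ofReal, Complex.log_im]; ring
  rw [him]
  rw [abs_lt] at harg
  exact Real.cos_pos_of_mem_Ioo ⟨by linarith [Real.pi_pos], by linarith [Real.pi_pos]⟩

theorem lam_re_sq_sub (k : ℝ) : (D.lam k).re ^ 2 - (D.lam k).im ^ 2 = k ^ 2 + D.η := by
  have h := congrArg Complex.re (D.lam_sq k)
  have e : ((k : ℂ) ^ 2 + (D.η : ℂ) - Complex.I * (D.ε : ℂ)).re = k ^ 2 + D.η := by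
    simp [← Complex.ofReal_pow]
  rw [e, sq, Complex.mul_re] at h
  linarith

theorem two_mul_lam_re_mul_im (k : ℝ) : 2 * (D.lam k).re * -(D.lam k).im = D.ε := by
  have h := congrArg Complex.im (D.lam_sq k)
  have e : ((k : ℂ) ^ 2 + (D.η : ℂ) - Complex.I * (D.ε : ℂ)).im = -D.ε := by
    simp [← Complex.ofReal_pow]
  rw [e, sq, Complex.mul_im] at h
  linarith

theorem neg_lam_im_nonneg (hη : 0 ≤ D.η) (hε : 0 ≤ D.ε) {k : ℝ} (hk : 0 < k) :
    0 ≤ -(D.lam k).im := by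
  have h1 := lam_re_pos hη hk
  have h2 := two_mul_lam_re_mul_im (D := D) k
  by_contra! h
  nlinarith

theorem neg_lam_im_le_re (hη : 0 ≤ D.η) {k : ℝ} (hk : 0 < k) : -(D.lam k).im ≤ (D.lam k).re := by
  have h1 := lam_re_pos hη hk
  have h2 := lam_re_sq_sub (D := D) k
  nlinarith

theorem le_lam_re (hη : 0 ≤ D.η) {k : ℝ} (hk : 0 < k) : k ≤ (D.lam k).re := by
  have h1 := lam_re_pos hη hk
  have h2 := lam_re_sq_sub (D := D) k
  nlinarith [sq_nonneg (D.lam k).im]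

theorem norm_lam_le (hη : 0 ≤ D.η) (hε : 0 ≤ D.ε) {k : ℝ} (hk : 0 < k) : ‖D.lam k‖ ≤ k + (D.η + D.ε) / k := by
  have h : ‖D.lam k‖ ^ 2 ≤ k ^ 2 + D.η + D.ε := by
    rw [← norm_pow, lam_sq]
    refine (norm_sub_le _ _).trans ?_
    refine add_le_add ?_ ?_
    · rw [← Complex.ofReal_pow, ← Complex.ofReal_add, Complex.norm_real,
        Real.norm_of_nonneg (by positivity)]
    · simp [abs_of_nonneg hε]
  refine (sq_le_sq₀ (norm_nonneg _) (by positivity)).1 (h.trans ?_)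
  have e : (k + (D.η + D.ε) / k) ^ 2 = k ^ 2 + 2 * (D.η + D.ε) + ((D.η + D.ε) / k) ^ 2 := by
    field_simp
    ring
  rw [e]
  nlinarith [sq_nonneg ((D.η + D.ε) / k)]

theorem lam_re_mono (hη : 0 ≤ D.η) (hε : 0 ≤ D.ε) {k₁ k₂ : ℝ} (hk₁ : 0 < k₁) (hk : k₁ ≤ k₂) :
    (D.lam k₁).re ≤ (D.lam k₂).re := by
  have hk₂ := hk₁.trans_le hk
  have a1 := lam_re_pos hη hk₁
  have a2 := lam_re_pos hη hk₂
  have b1 := two_mul_lam_re_mul_im (D := D) k₁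
  have b2 := two_mul_lam_re_mul_im (D := D) k₂
  have c1 := lam_re_sq_sub (D := D) k₁
  have c2 := lam_re_sq_sub (D := D) k₂
  have d1 := neg_lam_im_nonneg hη hε hk₁
  have d2 := neg_lam_im_nonneg hη hε hk₂
  by_contra! h
  have h3 : -(D.lam k₁).im ≤ -(D.lam k₂).im := by
    by_contra! h'
    nlinarith
  have h4 : (D.lam k₂).re ^ 2 < (D.lam k₁).re ^ 2 := by nlinarith
  have h5 : (D.lam k₁).im ^ 2 ≤ (D.lam k₂).im ^ 2 := by nlinarith
  have h6 : k₁ ^ 2 ≤ k₂ ^ 2 := by nlinarith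
  linarith

variable (D)

/-- The decay rate `Re (λ (1 + E² - 2 c E) / (1 - E²))`, `E = e^{-λ L}`, of the mode with
`cos (m π / J) = c` at frequency `k`. -/
noncomputable def modeRate (k c : ℝ) : ℝ :=
  (D.lam k * (1 + Complex.exp (-(D.lam k * D.L)) ^ 2 - 2 * c * Complex.exp (-(D.lam k * D.L)))
    / (1 - Complex.exp (-(D.lam k * D.L)) ^ 2)).re

variable {D}

theorem norm_exp_neg_lam_mul (k a : ℝ) :
    ‖Complex.exp (-(D.lam k * a))‖ = Real.exp (-((D.lam k).re * a)) := by
  rw [Complex.norm_exp, Complex.neg_re, Complex.re_mul_ofReal]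

theorem exp_neg_lam_mul_eq (k : ℝ) :
    Complex.exp (-(D.lam k * D.L)) = Real.exp (-((D.lam k).re * D.L)) *
      (Real.cos (-(D.lam k).im * D.L) + Real.sin (-(D.lam k).im * D.L) * Complex.I) := by
  rw [Complex.exp_eq_exp_re_mul_sin_add_cos, Complex.neg_re, Complex.re_mul_ofReal,
    Complex.neg_im, Complex.im_mul_ofReal, Complex.ofReal_exp, Complex.ofReal_cos,
    Complex.ofReal_sin]
  ring_nf

/-- With `z = λL`, the fraction `(1 + E² - 2cE) / (1 - E²)` is the combination with weights `(1 ±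
c)/2` of `(1 - E)/(1 + E) = tanh (z/2)` and `(1 + E)/(1 - E) = coth (z/2)`. -/
theorem modeRate_eq (hL : 0 < D.L) (hη : 0 ≤ D.η) {k : ℝ} (hk : 0 < k) (c : ℝ) :
    modeRate D k c = ((1 + c) / 2 * tanhRe ((D.lam k).re * D.L) (-(D.lam k).im * D.L) +
      (1 - c) / 2 * cothRe ((D.lam k).re * D.L) (-(D.lam k).im * D.L)) / D.L := by
  have hx := lam_re_pos hη hk
  set x := (D.lam k).re with hx'
  set y := -(D.lam k).im with hy'
  have hX : 0 < x * D.L := by positivity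
  have hlam : D.lam k = x - y * Complex.I := by
    apply Complex.ext <;> simp [hx', hy']
  have hE := exp_neg_lam_mul_eq (D := D) k
  rw [← hx', ← hy'] at hE
  set r := Real.exp (-(x * D.L)) with hr
  have hr0 : 0 < r := Real.exp_pos _
  have hr1 : r < 1 := by rw [hr, Real.exp_lt_one_iff]; linarith
  have hch : Real.cosh (x * D.L) = (r⁻¹ + r) / 2 := by
    rw [Real.cosh_eq, hr, Real.exp_neg, inv_inv]
  have hsh : Real.sinh (x * D.L) = (r⁻¹ - r) / 2 := by
    rw [Real.sinh_eq, hr, Real.exp_neg, inv_inv]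
  have hp := cosh_add_cos_pos hX (y * D.L)
  have hm := cosh_sub_cos_pos hX (y * D.L)
  have hcs := Real.sin_sq_add_cos_sq (y * D.L)
  set cY := Real.cos (y * D.L)
  set sY := Real.sin (y * D.L)
  have hEn : ‖Complex.exp (-(D.lam k * D.L))‖ < 1 := by rw [norm_exp_neg_lam_mul]; exact hr1
  set E := Complex.exp (-(D.lam k * D.L)) with hEdef
  have h1p : 1 + E ≠ 0 := fun h => by
    have : ‖E‖ = 1 := by rw [eq_neg_of_add_eq_zero_right h]; simp
    linarith
  have h1m : 1 - E ≠ 0 := fun h => by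
    have : ‖E‖ = 1 := by rw [← sub_eq_zero.1 h]; simp
    linarith
  have hI := Complex.I_sq
  have hcsC : (sY : ℂ) ^ 2 + (cY : ℂ) ^ 2 = 1 := by exact_mod_cast hcs
  have hrC : (r : ℂ) * (r : ℂ)⁻¹ = 1 := by
    rw [mul_inv_cancel₀]; exact_mod_cast hr0.ne'
  have hpC : ((Real.cosh (x * D.L) + cY : ℝ) : ℂ) ≠ 0 := by exact_mod_cast hp.ne'
  have hmC : ((Real.cosh (x * D.L) - cY : ℝ) : ℂ) ≠ 0 := by exact_mod_cast hm.ne'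
  have ht : (1 - E) / (1 + E) = ((Real.sinh (x * D.L) : ℝ) - sY * Complex.I) /
      ((Real.cosh (x * D.L) + cY : ℝ) : ℂ) := by
    rw [div_eq_div_iff h1p hpC, hch, hsh, hE]
    push_cast
    have hrC' : (r : ℂ) ≠ 0 := by exact_mod_cast hr0.ne'
    field_simp
    ring_nf
    rw [hI]
    linear_combination (-2 * (r : ℂ) ^ 2) * hcsC
  have hc : (1 + E) / (1 - E) = ((Real.sinh (x * D.L) : ℝ) + sY * Complex.I) /
      ((Real.cosh (x * D.L) - cY : ℝ) : ℂ) := by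
    rw [div_eq_div_iff h1m hmC, hch, hsh, hE]
    push_cast
    have hrC' : (r : ℂ) ≠ 0 := by exact_mod_cast hr0.ne'
    field_simp
    ring_nf
    rw [hI]
    linear_combination (-2 * (r : ℂ) ^ 2) * hcsC
  have hsplit : D.lam k * (1 + E ^ 2 - 2 * c * E) / (1 - E ^ 2) =
      ((1 + c) / 2 : ℝ) * (D.lam k * ((1 - E) / (1 + E))) +
        ((1 - c) / 2 : ℝ) * (D.lam k * ((1 + E) / (1 - E))) := by
    have : 1 - E ^ 2 = (1 - E) * (1 + E) := by ring
    rw [this]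
    push_cast
    field_simp
    ring
  have ht' : (D.lam k * ((1 - E) / (1 + E))).re = tanhRe (x * D.L) (y * D.L) / D.L := by
    rw [ht, ← mul_div_assoc, Complex.div_ofReal_re, hlam]
    have : ∀ a b : ℝ, (((x : ℂ) - y * Complex.I) * (a - b * Complex.I)).re =
        x * a - y * b := fun a b => by simp
    rw [this]
    change _ = (x * D.L * Real.sinh (x * D.L) - y * D.L * sY) /
      (Real.cosh (x * D.L) + cY) / D.L
    rw [div_right_comm]
    congr 1
    field_simp
  have hc' : (D.lam k * ((1 + E) / (1 - E))).re = cothRe (x * D.L) (y * D.L) / D.L := by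
    rw [hc, ← mul_div_assoc, Complex.div_ofReal_re, hlam]
    have : ∀ a b : ℝ, (((x : ℂ) - y * Complex.I) * (a + b * Complex.I)).re =
        x * a + y * b := fun a b => by simp
    rw [this]
    change _ = (x * D.L * Real.sinh (x * D.L) + y * D.L * sY) /
      (Real.cosh (x * D.L) - cY) / D.L
    rw [div_right_comm]
    congr 1
    field_simp
  rw [modeRate, ← hEdef, hsplit, Complex.add_re, Complex.re_ofReal_mul, Complex.re_ofReal_mul, ht',
    hc']
  ring

theorem modeRate_pos (hL : 0 < D.L) (hη : 0 ≤ D.η) (hε : 0 ≤ D.ε) {k : ℝ} (hk : 0 < k) {c : ℝ}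
    (hc : |c| ≤ 1) : 0 < modeRate D k c := by
  rw [modeRate_eq hL hη hk]
  have hx := lam_re_pos hη hk
  have h1 : 0 < (D.lam k).re * D.L := by positivity
  have h2 : 0 ≤ -(D.lam k).im * D.L := mul_nonneg (neg_lam_im_nonneg hη hε hk) hL.le
  have h3 : -(D.lam k).im * D.L ≤ (D.lam k).re * D.L :=
    mul_le_mul_of_nonneg_right (neg_lam_im_le_re hη hk) hL.le
  have h4 := tanhRe_pos h1 h2 h3
  have h5 := cothRe_pos h1 h2 h3
  rw [abs_le] at hc
  refine div_pos ?_ hL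
  rcases lt_or_ge c 1 with h | h
  · have : 0 ≤ (1 + c) / 2 * tanhRe ((D.lam k).re * D.L) (-(D.lam k).im * D.L) :=
      mul_nonneg (by linarith) h4.le
    have : 0 < (1 - c) / 2 * cothRe ((D.lam k).re * D.L) (-(D.lam k).im * D.L) :=
      mul_pos (by linarith) h5
    linarith
  · have : c = 1 := le_antisymm hc.2 h
    rw [this, add_self_div_two, sub_self, zero_div, zero_mul, one_mul, add_zero]
    exact h4

/-- The product of `Re λ` and `-Im λ` equals `ε/2` for every `k`, so `λL` moves along a fixed
hyperbola as `k` grows, inside the sector where both parts are increasing. -/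
theorem modeRate_mono (hL : 0 < D.L) (hη : 0 ≤ D.η) (hε : 0 ≤ D.ε) {k₁ k₂ : ℝ} (hk₁ : 0 < k₁)
    (hk : k₁ ≤ k₂) {c : ℝ} (hc : |c| ≤ 1) : modeRate D k₁ c ≤ modeRate D k₂ c := by
  have hk₂ := hk₁.trans_le hk
  rw [modeRate_eq hL hη hk₁, modeRate_eq hL hη hk₂]
  have hY : ∀ k, 0 < k → -(D.lam k).im * D.L = (D.ε * D.L ^ 2 / 2) / ((D.lam k).re * D.L) := by
    intro k hk
    have hx := lam_re_pos hη hk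
    rw [eq_div_iff (by positivity), ← two_mul_lam_re_mul_im (D := D) k]
    ring
  rw [hY k₁ hk₁, hY k₂ hk₂]
  have hx₁ := lam_re_pos hη hk₁
  have h1 : 0 < (D.lam k₁).re * D.L := by positivity
  have h2 : (D.lam k₁).re * D.L ≤ (D.lam k₂).re * D.L :=
    mul_le_mul_of_nonneg_right (lam_re_mono hη hε hk₁ hk) hL.le
  have h3 : D.ε * D.L ^ 2 / 2 ≤ ((D.lam k₁).re * D.L) ^ 2 := by
    have := neg_lam_im_le_re hη hk₁
    have h4 : (D.lam k₁).re * -(D.lam k₁).im ≤ (D.lam k₁).re ^ 2 := by nlinarith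
    rw [← two_mul_lam_re_mul_im (D := D) k₁]
    have : 0 ≤ D.L ^ 2 := by positivity
    nlinarith
  have he : 0 ≤ D.ε * D.L ^ 2 / 2 := by positivity
  rw [abs_le] at hc
  refine div_le_div_of_nonneg_right (add_le_add ?_ ?_) hL.le
  · exact mul_le_mul_of_nonneg_left (tanhRe_mono h1 he h3 h2) (by linarith)
  · exact mul_le_mul_of_nonneg_left (cothRe_mono h1 he h3 h2) (by linarith)

/-- The rate is affine in `c`, so on a symmetric interval its minimum sits at an endpoint. This is
why only the modes `1` and `J - 1` matter. -/
theorem modeRate_convex (hL : 0 < D.L) (hη : 0 ≤ D.η) {k : ℝ} (hk : 0 < k) {c d : ℝ}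
    (hd : |d| ≤ c) : min (modeRate D k c) (modeRate D k (-c)) ≤ modeRate D k d := by
  rw [modeRate_eq hL hη hk, modeRate_eq hL hη hk, modeRate_eq hL hη hk, min_div_div_right hL.le]
  refine div_le_div_of_nonneg_right ?_ hL.le
  rw [abs_le] at hd
  set a := tanhRe ((D.lam k).re * D.L) (-(D.lam k).im * D.L)
  set b := cothRe ((D.lam k).re * D.L) (-(D.lam k).im * D.L)
  rcases le_total a b with h | h
  · exact (min_le_left _ _).trans (by nlinarith)
  · exact (min_le_right _ _).trans (by nlinarith)

theorem kmin_pos (hLhat : 0 < D.Lhat) : 0 < D.kmin := div_pos Real.pi_pos hLhat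

theorem modeConst_eq (c : ℝ) : D.modeConst c = modeRate D D.kmin c := by
  rw [modeConst, modeRate, s]
  congr 1
  set z := D.lam D.kmin * D.L with hz
  have e1 : Complex.exp (2 * D.lam D.kmin * D.L) = Complex.exp z ^ 2 := by
    rw [← Complex.exp_nat_mul, hz]; push_cast; ring_nf
  have e2 : Complex.exp (-z) = (Complex.exp z)⁻¹ := Complex.exp_neg z
  rw [e1, e2]
  have h0 : Complex.exp z ≠ 0 := Complex.exp_ne_zero z
  set w := Complex.exp z
  rcases eq_or_ne (w ^ 2 - 1) 0 with h | h
  · have h' : 1 - w⁻¹ ^ 2 = 0 := by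
      rw [inv_pow, sub_eq_zero.1 h]; simp
    rw [h, h', div_zero, div_zero]
  · have h' : 1 - w⁻¹ ^ 2 = (w ^ 2 - 1) / w ^ 2 := by field_simp
    rw [h']
    field_simp

theorem Kmode_pos (hL : 0 < D.L) (hLhat : 0 < D.Lhat) (hη : 0 ≤ D.η) (hε : 0 ≤ D.ε) :
    0 < D.Kmode := by
  rw [Kmode, modeConst_eq, modeConst_eq, lt_min_iff]
  exact ⟨modeRate_pos hL hη hε (kmin_pos hLhat) (Real.abs_cos_le_one _),
    modeRate_pos hL hη hε (kmin_pos hLhat) (by rw [abs_neg]; exact Real.abs_cos_le_one _)⟩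

theorem Kmode_le_modeRate (hL : 0 < D.L) (hLhat : 0 < D.Lhat) (hη : 0 ≤ D.η) (hε : 0 ≤ D.ε)
    {k d : ℝ} (hk : D.kmin ≤ k) (hd : |d| ≤ Real.cos (Real.pi / D.J)) :
    D.Kmode ≤ modeRate D k d := by
  have h0 := kmin_pos hLhat
  refine le_trans ?_ (modeRate_convex hL hη (h0.trans_le hk) hd)
  rw [Kmode, modeConst_eq, modeConst_eq]
  exact min_le_min (modeRate_mono hL hη hε h0 hk (Real.abs_cos_le_one _))
    (modeRate_mono hL hη hε h0 hk (by rw [abs_neg]; exact Real.abs_cos_le_one _))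

/-- The constants for `-c` and `c` differ by `2c Re (s / sinh (sL))`, and `c = cos (π/J)` is
nonnegative, with value zero for `J = 2`. -/
theorem Kmode_eq_KJ (hJ : 2 ≤ D.J) (hL : 0 < D.L) (hLhat : 0 < D.Lhat) (hη : 0 ≤ D.η)
    (h : D.J = 2 ∨ 0 ≤ (D.s / Complex.sinh (D.s * D.L)).re) : D.Kmode = D.KJ := by
  rw [Kmode, KJ, min_eq_left]
  rcases h with h | h
  · rw [h]; simp
  have hc : 0 ≤ Real.cos (Real.pi / D.J) := by
    have hJ' : (2 : ℝ) ≤ D.J := by exact_mod_cast hJ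
    refine Real.cos_nonneg_of_neg_pi_div_two_le_of_le ?_ ?_
    · have : 0 < Real.pi / D.J := div_pos Real.pi_pos (by linarith)
      linarith [Real.pi_pos]
    · exact div_le_div_of_nonneg_left Real.pi_pos.le two_pos hJ'
  set c := Real.cos (Real.pi / D.J)
  have hkey : D.modeConst (-c) - D.modeConst c =
      2 * c * (D.s / Complex.sinh (D.s * D.L)).re := by
    rw [modeConst, modeConst, ← Complex.sub_re, ← sub_div, ← Complex.re_ofReal_mul]
    congr 1
    have e1 : Complex.exp (2 * D.s * D.L) = Complex.exp (D.s * D.L) ^ 2 := by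
      rw [← Complex.exp_nat_mul]; push_cast; ring_nf
    rw [e1, Complex.sinh, Complex.exp_neg]
    have h0 : Complex.exp (D.s * D.L) ≠ 0 := Complex.exp_ne_zero _
    have hx := lam_re_pos hη (kmin_pos hLhat)
    have hn : ‖Complex.exp (D.s * D.L)‖ ≠ 1 := by
      rw [Complex.norm_exp, Complex.re_mul_ofReal]
      refine (Real.one_lt_exp_iff.2 ?_).ne'
      exact mul_pos hx hL
    set w := Complex.exp (D.s * D.L)
    have h1 : w ^ 2 - 1 ≠ 0 := fun h => hn (by
      have : ‖w‖ ^ 2 = 1 := by rw [← norm_pow, sub_eq_zero.1 h, norm_one]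
      exact (pow_eq_one_iff_of_nonneg (norm_nonneg w) two_ne_zero).1 this)
    have h2 : (w - w⁻¹) / 2 = (w ^ 2 - 1) / (2 * w) := by field_simp
    rw [h2]
    push_cast
    field_simp
    ring
  have : 0 ≤ 2 * c * (D.s / Complex.sinh (D.s * D.L)).re := by positivity
  linarith

end Problem

end OSM

/-! ### The normalized iteration matrix and its coupling matrix -/

namespace OSM

section Abstract

variable (N : ℕ) (E F : ℂ) (gp gm : ℕ → ℂ)

/-- The denominator `1 - g⁺ g⁻ (E F)²` of the normalized local problem. -/
noncomputable def locDet (j : ℕ) : ℂ := 1 - gp j * gm j * (E * F) ^ 2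

/-- The part of the normalized iteration matrix in which each interface is isolated. -/
noncomputable def isoMat : Matrix (Fin N ⊕ Fin N) (Fin N ⊕ Fin N) ℂ :=
  Matrix.fromBlocks 0 (Matrix.diagonal fun i => -(gp (i.val + 1) * F))
    (Matrix.diagonal fun i => -(gm (i.val + 2) * F)) 0

/-- The interaction of the interfaces in the normalized iteration matrix. -/
noncomputable def intMat : Matrix (Fin N ⊕ Fin N) (Fin N ⊕ Fin N) ℂ :=
  Matrix.fromBlocks
    (Matrix.of fun i i' => if i'.val = i.val + 1 then E / locDet E F gp gm (i.val + 2) else 0)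
    (Matrix.diagonal fun i => F * E ^ 2 * gp (i.val + 2) / locDet E F gp gm (i.val + 2))
    (Matrix.diagonal fun i => F * E ^ 2 * gm (i.val + 1) / locDet E F gp gm (i.val + 1))
    (Matrix.of fun i i' => if i'.val + 1 = i.val then E / locDet E F gp gm (i.val + 1) else 0)

/-- `T² = (1 - Γ) + Γ Θ` for the normalized iteration matrix `T`, where `Θ` is this matrix. -/
noncomputable def couplingMat (Γ : ℂ) : Matrix (Fin N ⊕ Fin N) (Fin N ⊕ Fin N) ℂ :=
  isoMat N F gp gm * intMat N E F gp gm + intMat N E F gp gm * isoMat N F gp gm +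
    Γ • (intMat N E F gp gm * intMat N E F gp gm)

variable {N E F gp gm}

/-- The isolated part swaps the two traces of an interface, so two steps meet both reflection
coefficients of that interface and the overlap twice. The common value `G` makes the square scalar.
-/
theorem isoMat_mul_self {G : ℂ} (hG : ∀ i < N, gp (i + 1) * gm (i + 2) = G) :
    isoMat N F gp gm * isoMat N F gp gm = (G * F ^ 2) • 1 := by
  have h : ∀ i : Fin N, gp (i.val + 1) * gm (i.val + 2) = G := fun i => hG i i.2
  rw [isoMat, Matrix.fromBlocks_multiply]
  simp only [Matrix.zero_mul, Matrix.mul_zero, zero_add, add_zero, Matrix.diagonal_mul_diagonal]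
  rw [← Matrix.fromBlocks_one, Matrix.fromBlocks_smul, smul_zero]
  congr 1
  · rw [Matrix.smul_one_eq_diagonal]
    congr 1; ext i; rw [← h i]; ring
  · rw [Matrix.smul_one_eq_diagonal]
    congr 1; ext i; rw [← h i]; ring

theorem iterMat_sq {G : ℂ} (hG : ∀ i < N, gp (i + 1) * gm (i + 2) = G) :
    (isoMat N F gp gm + (1 - G * F ^ 2) • intMat N E F gp gm) ^ 2 =
      (G * F ^ 2) • 1 + (1 - G * F ^ 2) • couplingMat N E F gp gm (1 - G * F ^ 2) := by
  rw [sq, add_mul, mul_add, mul_add, isoMat_mul_self hG, couplingMat]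
  simp only [Matrix.mul_smul, Matrix.smul_mul, smul_add, smul_smul]
  abel

/-- Entrywise bound. -/
def MatBound {n : Type*} (A : Matrix n n ℂ) (c : ℝ) : Prop := ∀ i j, ‖A i j‖ ≤ c

section

variable {n : Type*} [Fintype n] {A B : Matrix n n ℂ} {a b : ℝ}

omit [Fintype n] in
theorem MatBound.add (hA : MatBound A a) (hB : MatBound B b) : MatBound (A + B) (a + b) :=
  fun i j => (norm_add_le _ _).trans (add_le_add (hA i j) (hB i j))

omit [Fintype n] in
theorem MatBound.smul (hA : MatBound A a) (z : ℂ) : MatBound (z • A) (‖z‖ * a) := fun i j => by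
  rw [Matrix.smul_apply, norm_smul]
  exact mul_le_mul_of_nonneg_left (hA i j) (norm_nonneg z)

omit [Fintype n] in
theorem MatBound.mono (hA : MatBound A a) (h : a ≤ b) : MatBound A b :=
  fun i j => (hA i j).trans h

theorem MatBound.mul (hA : MatBound A a) (hB : MatBound B b) (ha : 0 ≤ a) :
    MatBound (A * B) (Fintype.card n * (a * b)) := fun i j => by
  rw [Matrix.mul_apply]
  refine (norm_sum_le _ _).trans ?_
  have : ∀ x ∈ Finset.univ, ‖A i x * B x j‖ ≤ a * b := fun x _ => by
    rw [norm_mul]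
    exact mul_le_mul (hA i x) (hB x j) (norm_nonneg _) ha
  simpa using Finset.sum_le_card_nsmul _ _ _ this

end

theorem matBound_fromBlocks {A B C D : Matrix (Fin N) (Fin N) ℂ} {c : ℝ} (hA : MatBound A c)
    (hB : MatBound B c) (hC : MatBound C c) (hD : MatBound D c) :
    MatBound (Matrix.fromBlocks A B C D) c := by
  rintro (i | i) (j | j)
  · exact hA i j
  · exact hB i j
  · exact hC i j
  · exact hD i j

theorem matBound_diagonal {d : Fin N → ℂ} {c : ℝ} (hc : 0 ≤ c) (h : ∀ i, ‖d i‖ ≤ c) :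
    MatBound (Matrix.diagonal d) c := fun i j => by
  rw [Matrix.diagonal_apply]
  split_ifs
  · exact h i
  · simpa using hc

theorem matBound_of_ite {P : Fin N → Fin N → Prop} [∀ i j, Decidable (P i j)] {d : Fin N → ℂ}
    {c : ℝ} (hc : 0 ≤ c) (h : ∀ i, ‖d i‖ ≤ c) :
    MatBound (Matrix.of fun i j => if P i j then d i else 0) c := fun i j => by
  rw [Matrix.of_apply]
  split_ifs
  · exact h i
  · simpa using hc

theorem matBound_zero {n : Type*} {c : ℝ} (hc : 0 ≤ c) : MatBound (0 : Matrix n n ℂ) c :=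
  fun _ _ => by simpa using hc

variable {e : ℝ}

theorem norm_locDet_ge (hF : ‖F‖ ≤ 1) (hp : ∀ j, ‖gp j‖ ≤ 1) (hm : ∀ j, ‖gm j‖ ≤ 1)
    (hE : ‖E‖ ≤ e) (j : ℕ) : 1 - e ^ 2 ≤ ‖locDet E F gp gm j‖ := by
  have h1 : ‖gp j * gm j * (E * F) ^ 2‖ ≤ e ^ 2 := by
    rw [norm_mul, norm_mul, norm_pow, norm_mul]
    have h2 : ‖gp j‖ * ‖gm j‖ ≤ 1 := mul_le_one₀ (hp j) (norm_nonneg _) (hm j)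
    have h3 : (‖E‖ * ‖F‖) ^ 2 ≤ e ^ 2 := by
      refine pow_le_pow_left₀ (by positivity) ?_ 2
      calc ‖E‖ * ‖F‖ ≤ e * 1 := mul_le_mul hE hF (norm_nonneg _) ((norm_nonneg _).trans hE)
        _ = e := mul_one e
    calc _ ≤ 1 * e ^ 2 := mul_le_mul h2 h3 (by positivity) zero_le_one
      _ = _ := one_mul _
  have h2 := norm_sub_norm_le (1 : ℂ) (gp j * gm j * (E * F) ^ 2)
  rw [norm_one] at h2
  rw [locDet]
  linarith

theorem matBound_isoMat (hF : ‖F‖ ≤ 1) (hp : ∀ j, ‖gp j‖ ≤ 1) (hm : ∀ j, ‖gm j‖ ≤ 1) :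
    MatBound (isoMat N F gp gm) 1 := by
  refine matBound_fromBlocks (matBound_zero zero_le_one) (matBound_diagonal zero_le_one fun i => ?_)
    (matBound_diagonal zero_le_one fun i => ?_) (matBound_zero zero_le_one)
  · rw [norm_neg, norm_mul]; exact mul_le_one₀ (hp _) (norm_nonneg _) hF
  · rw [norm_neg, norm_mul]; exact mul_le_one₀ (hm _) (norm_nonneg _) hF

theorem matBound_intMat (hF : ‖F‖ ≤ 1) (hp : ∀ j, ‖gp j‖ ≤ 1) (hm : ∀ j, ‖gm j‖ ≤ 1)
    (hE : ‖E‖ ≤ e) (he : e < 1) : MatBound (intMat N E F gp gm) (‖E‖ / (1 - e ^ 2)) := by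
  have he0 : 0 ≤ e := (norm_nonneg _).trans hE
  have hd : 0 < 1 - e ^ 2 := by nlinarith
  have h0 : 0 ≤ ‖E‖ / (1 - e ^ 2) := by positivity
  have h1 : ∀ j, ‖E / locDet E F gp gm j‖ ≤ ‖E‖ / (1 - e ^ 2) := fun j => by
    rw [norm_div]
    exact div_le_div_of_nonneg_left (norm_nonneg _) hd (norm_locDet_ge hF hp hm hE j)
  have h2 : ∀ (g : ℂ) (j : ℕ), ‖g‖ ≤ 1 → ‖F * E ^ 2 * g / locDet E F gp gm j‖ ≤ ‖E‖ / (1 - e ^ 2) :=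
    fun g j hg => by
      rw [norm_div, norm_mul, norm_mul, norm_pow]
      refine div_le_div₀ (norm_nonneg _) ?_ hd (norm_locDet_ge hF hp hm hE j)
      calc ‖F‖ * ‖E‖ ^ 2 * ‖g‖ ≤ 1 * ‖E‖ ^ 2 * 1 := by gcongr
        _ = ‖E‖ * ‖E‖ := by ring
        _ ≤ ‖E‖ * 1 := by gcongr; linarith
        _ = ‖E‖ := mul_one _
  exact matBound_fromBlocks (matBound_of_ite h0 fun i => h1 _)
    (matBound_diagonal h0 fun i => h2 _ _ (hp _)) (matBound_diagonal h0 fun i => h2 _ _ (hm _))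
    (matBound_of_ite h0 fun i => h1 _)

/-- The coupling matrix is of the size of `E = e^{-λ L}`. -/
theorem matBound_couplingMat {Γ : ℂ} (hF : ‖F‖ ≤ 1) (hp : ∀ j, ‖gp j‖ ≤ 1) (hm : ∀ j, ‖gm j‖ ≤ 1)
    (hE : ‖E‖ ≤ e) (he : e < 1) (hΓ : ‖Γ‖ ≤ 2) :
    MatBound (couplingMat N E F gp gm Γ)
      (Fintype.card (Fin N ⊕ Fin N) * (2 / (1 - e ^ 2) + 2 / (1 - e ^ 2) ^ 2) * ‖E‖) := by
  have he0 : 0 ≤ e := (norm_nonneg _).trans hE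
  have hd : 0 < 1 - e ^ 2 := by nlinarith
  have h0 := matBound_isoMat (N := N) hF hp hm
  have h1 := matBound_intMat (N := N) hF hp hm hE he
  refine (((h0.mul h1 zero_le_one).add (h1.mul h0 (by positivity))).add
    ((h1.mul h1 (by positivity)).smul Γ)).mono ?_
  set c : ℝ := (Fintype.card (Fin N ⊕ Fin N) : ℝ)
  have hc : 0 ≤ c := Nat.cast_nonneg _
  have hE1 : ‖E‖ ≤ 1 := by linarith
  have h2 : ‖Γ‖ * (c * (‖E‖ / (1 - e ^ 2) * (‖E‖ / (1 - e ^ 2)))) ≤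
      2 * (c * (‖E‖ / (1 - e ^ 2) * (1 / (1 - e ^ 2)))) := by
    gcongr
  refine (add_le_add_right h2 _).trans (le_of_eq ?_)
  field_simp
  ring

/-- The limit of `isoMat` for `g → -1`, `F → 1`. -/
def swapMat (N : ℕ) : Matrix (Fin N ⊕ Fin N) (Fin N ⊕ Fin N) ℂ := Matrix.fromBlocks 0 1 1 0

/-- The limit of `intMat` for `g → -1`, `F → 1`. -/
noncomputable def intMatLim (N : ℕ) (E : ℂ) : Matrix (Fin N ⊕ Fin N) (Fin N ⊕ Fin N) ℂ :=
  (E / (1 - E ^ 2)) • Matrix.fromBlocks (shiftU N ℂ) 0 0 (shiftL N ℂ) -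
    (E ^ 2 / (1 - E ^ 2)) • swapMat N

/-- Multiplying by the swap from either side turns the diagonal blocks `U` and `L` into off-diagonal
ones. The sum of the two products puts `U + L` into both off-diagonal blocks, which is the doubled
path. -/
theorem couplingMat_lim (E : ℂ) :
    swapMat N * intMatLim N E + intMatLim N E * swapMat N =
      (E / (1 - E ^ 2)) • pathMat N ℂ - (2 * E ^ 2 / (1 - E ^ 2)) • 1 := by
  have h1 : swapMat N * swapMat N = 1 := by
    rw [swapMat, Matrix.fromBlocks_multiply]
    simp
  have h2 : swapMat N * Matrix.fromBlocks (shiftU N ℂ) 0 0 (shiftL N ℂ) +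
      Matrix.fromBlocks (shiftU N ℂ) 0 0 (shiftL N ℂ) * swapMat N = pathMat N ℂ := by
    rw [swapMat, pathMat, Matrix.fromBlocks_multiply, Matrix.fromBlocks_multiply,
      Matrix.fromBlocks_add]
    simp [add_comm]
  rw [intMatLim, mul_sub, sub_mul, Matrix.mul_smul, Matrix.mul_smul, Matrix.smul_mul,
    Matrix.smul_mul, h1, ← h2, smul_add]
  have h3 : (2 * E ^ 2 / (1 - E ^ 2)) • (1 : Matrix (Fin N ⊕ Fin N) (Fin N ⊕ Fin N) ℂ) =
      (E ^ 2 / (1 - E ^ 2)) • 1 + (E ^ 2 / (1 - E ^ 2)) • 1 := by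
    rw [← add_smul]; congr 1; ring
  rw [h3]
  abel

theorem matBound_swapMat : MatBound (swapMat N) 1 := by
  rw [swapMat, ← Matrix.diagonal_one]
  exact matBound_fromBlocks (matBound_zero zero_le_one)
    (matBound_diagonal zero_le_one fun i => by simp)
    (matBound_diagonal zero_le_one fun i => by simp) (matBound_zero zero_le_one)

variable {h : ℝ}

theorem matBound_isoMat_sub (hF : ‖F‖ ≤ 1) (hF1 : ‖F - 1‖ ≤ h) (hp1 : ∀ i < N, ‖gp (i + 1) + 1‖ ≤ h)
    (hm1 : ∀ i < N, ‖gm (i + 2) + 1‖ ≤ h) : MatBound (isoMat N F gp gm - swapMat N) (2 * h) := by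
  have h0 : 0 ≤ h := (norm_nonneg _).trans hF1
  have key : ∀ g : ℂ, ‖g + 1‖ ≤ h → ‖-(g * F) - 1‖ ≤ 2 * h := fun g hg => by
    have : -(g * F) - 1 = -((g + 1) * F) + (F - 1) := by ring
    rw [this]
    refine (norm_add_le _ _).trans ?_
    rw [norm_neg, norm_mul]
    have : ‖g + 1‖ * ‖F‖ ≤ h * 1 := mul_le_mul hg hF (norm_nonneg _) h0
    linarith
  have e : isoMat N F gp gm - swapMat N = Matrix.fromBlocks 0
      (Matrix.diagonal fun i => -(gp (i.val + 1) * F) - 1)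
      (Matrix.diagonal fun i => -(gm (i.val + 2) * F) - 1) 0 := by
    rw [isoMat, swapMat, ← Matrix.diagonal_one, sub_eq_add_neg, Matrix.fromBlocks_neg,
      Matrix.fromBlocks_add, neg_zero, add_zero, ← sub_eq_add_neg, ← sub_eq_add_neg,
      Matrix.diagonal_sub, Matrix.diagonal_sub]
  rw [e]
  exact matBound_fromBlocks (matBound_zero (by positivity))
    (matBound_diagonal (by positivity) fun i => key _ (hp1 _ i.2))
    (matBound_diagonal (by positivity) fun i => key _ (hm1 _ i.2)) (matBound_zero (by positivity))

/-- The numerator of the difference vanishes when both reflection coefficients equal `-1` and `F =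
1`; it is split into the three deviations from this state. -/
theorem norm_inv_locDet_sub (hF : ‖F‖ ≤ 1) (hp : ∀ j, ‖gp j‖ ≤ 1) (hm : ∀ j, ‖gm j‖ ≤ 1)
    (hE : ‖E‖ ≤ e) (he : e < 1) (hF1 : ‖F - 1‖ ≤ h) {j : ℕ} (hp1 : ‖gp j + 1‖ ≤ h)
    (hm1 : ‖gm j + 1‖ ≤ h) :
    ‖1 / locDet E F gp gm j - 1 / (1 - E ^ 2)‖ ≤ 4 * h / (1 - e ^ 2) ^ 2 := by
  have he0 : 0 ≤ e := (norm_nonneg _).trans hE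
  have h0 : 0 ≤ h := (norm_nonneg _).trans hF1
  have hd : 0 < 1 - e ^ 2 := by nlinarith
  have h1 := norm_locDet_ge hF hp hm hE j
  have h2 : 1 - e ^ 2 ≤ ‖1 - E ^ 2‖ := by
    have := norm_locDet_ge (E := E) (F := 1) (gp := fun _ => 1) (gm := fun _ => 1) (by simp)
      (by simp) (by simp) hE 0
    simpa [locDet] using this
  have hne1 : locDet E F gp gm j ≠ 0 := fun hz => by rw [hz, norm_zero] at h1; linarith
  have hne2 : 1 - E ^ 2 ≠ 0 := fun hz => by rw [hz, norm_zero] at h2; linarith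
  have e1 : 1 / locDet E F gp gm j - 1 / (1 - E ^ 2) =
      E ^ 2 * ((gp j + 1) * (gm j * F ^ 2) - (gm j + 1) * F ^ 2 + (F - 1) * (F + 1)) /
        (locDet E F gp gm j * (1 - E ^ 2)) := by
    rw [div_sub_div _ _ hne1 hne2]
    congr 1
    rw [locDet]; ring
  rw [e1, norm_div, norm_mul, norm_mul]
  have hnum : ‖(gp j + 1) * (gm j * F ^ 2) - (gm j + 1) * F ^ 2 + (F - 1) * (F + 1)‖ ≤ 4 * h := by
    have hF2 : ‖F ^ 2‖ ≤ 1 := by rw [norm_pow]; exact pow_le_one₀ (norm_nonneg _) hF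
    have a1 : ‖(gp j + 1) * (gm j * F ^ 2)‖ ≤ h * 1 := by
      rw [norm_mul, norm_mul]
      exact mul_le_mul hp1 (mul_le_one₀ (hm j) (norm_nonneg _) hF2) (by positivity) h0
    have a2 : ‖(gm j + 1) * F ^ 2‖ ≤ h * 1 := by
      rw [norm_mul]; exact mul_le_mul hm1 hF2 (norm_nonneg _) h0
    have a3 : ‖(F - 1) * (F + 1)‖ ≤ h * 2 := by
      rw [norm_mul]
      refine mul_le_mul hF1 ((norm_add_le _ _).trans ?_) (norm_nonneg _) h0
      rw [norm_one]; linarith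
    have a4 := norm_add_le ((gp j + 1) * (gm j * F ^ 2) - (gm j + 1) * F ^ 2) ((F - 1) * (F + 1))
    have a5 := norm_sub_le ((gp j + 1) * (gm j * F ^ 2)) ((gm j + 1) * F ^ 2)
    linarith
  have hE2 : ‖E ^ 2‖ ≤ 1 := by
    rw [norm_pow]; exact pow_le_one₀ (norm_nonneg _) (by linarith)
  refine div_le_div₀ (by positivity) ?_ (by positivity) ?_
  · calc ‖E ^ 2‖ * _ ≤ 1 * (4 * h) := mul_le_mul hE2 hnum (norm_nonneg _) zero_le_one
      _ = 4 * h := one_mul _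
  · rw [sq]; exact mul_le_mul h1 h2 hd.le (norm_nonneg _)

/-- Closeness to `-1` is required for all subdomains, including the first and the last one. Since
the outer Dirichlet coefficient is exactly `-1`, the limit has no special end entries and is a
uniform path. -/
theorem matBound_intMat_sub (hF : ‖F‖ ≤ 1) (hp : ∀ j, ‖gp j‖ ≤ 1) (hm : ∀ j, ‖gm j‖ ≤ 1)
    (hE : ‖E‖ ≤ e) (he : e < 1) (hF1 : ‖F - 1‖ ≤ h)
    (hp1 : ∀ j, 1 ≤ j → j ≤ N + 1 → ‖gp j + 1‖ ≤ h)
    (hm1 : ∀ j, 1 ≤ j → j ≤ N + 1 → ‖gm j + 1‖ ≤ h) :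
    MatBound (intMat N E F gp gm - intMatLim N E) (6 * h / (1 - e ^ 2) ^ 2) := by
  have he0 : 0 ≤ e := (norm_nonneg _).trans hE
  have h0 : 0 ≤ h := (norm_nonneg _).trans hF1
  have hd : 0 < 1 - e ^ 2 := by nlinarith
  have hd1 : 1 - e ^ 2 ≤ 1 := by nlinarith
  have hE1 : ‖E‖ ≤ 1 := by linarith
  have hE2 : ‖E ^ 2‖ ≤ 1 := by
    rw [norm_pow]; exact pow_le_one₀ (norm_nonneg _) hE1
  have hc : 0 ≤ 6 * h / (1 - e ^ 2) ^ 2 := by positivity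
  have hdet := fun (j : ℕ) (h1 : 1 ≤ j) (h2 : j ≤ N + 1) =>
    norm_inv_locDet_sub hF hp hm hE he hF1 (hp1 j h1 h2) (hm1 j h1 h2)
  have k1 : ∀ j, 1 ≤ j → j ≤ N + 1 →
      ‖E / locDet E F gp gm j - E / (1 - E ^ 2)‖ ≤ 6 * h / (1 - e ^ 2) ^ 2 := fun j h1 h2 => by
    have : E / locDet E F gp gm j - E / (1 - E ^ 2) =
        E * (1 / locDet E F gp gm j - 1 / (1 - E ^ 2)) := by ring
    rw [this, norm_mul]
    calc _ ≤ 1 * (4 * h / (1 - e ^ 2) ^ 2) := mul_le_mul hE1 (hdet j h1 h2) (norm_nonneg _)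
          zero_le_one
      _ ≤ 6 * h / (1 - e ^ 2) ^ 2 := by rw [one_mul]; gcongr; norm_num
  have k2 : ∀ (g : ℂ) (j : ℕ), ‖g + 1‖ ≤ h → 1 ≤ j → j ≤ N + 1 →
      ‖F * E ^ 2 * g / locDet E F gp gm j + E ^ 2 / (1 - E ^ 2)‖ ≤ 6 * h / (1 - e ^ 2) ^ 2 :=
    fun g j hg h1 h2 => by
      have : F * E ^ 2 * g / locDet E F gp gm j + E ^ 2 / (1 - E ^ 2) =
          E ^ 2 * (((g + 1) * F - (F - 1)) / locDet E F gp gm j -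
            (1 / locDet E F gp gm j - 1 / (1 - E ^ 2))) := by ring
      rw [this, norm_mul]
      have b1 : ‖((g + 1) * F - (F - 1)) / locDet E F gp gm j‖ ≤ 2 * h / (1 - e ^ 2) ^ 2 := by
        rw [norm_div]
        refine div_le_div₀ (by positivity) ?_ (by positivity)
          (le_trans ?_ (norm_locDet_ge hF hp hm hE j))
        · refine (norm_sub_le _ _).trans ?_
          rw [norm_mul]
          have : ‖g + 1‖ * ‖F‖ ≤ h * 1 := mul_le_mul hg hF (norm_nonneg _) h0
          linarith
        · nlinarith
      have b2 := norm_sub_le (((g + 1) * F - (F - 1)) / locDet E F gp gm j)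
        (1 / locDet E F gp gm j - 1 / (1 - E ^ 2))
      have b3 := hdet j h1 h2
      have b4 : 2 * h / (1 - e ^ 2) ^ 2 + 4 * h / (1 - e ^ 2) ^ 2 = 6 * h / (1 - e ^ 2) ^ 2 := by
        ring
      calc _ ≤ 1 * (6 * h / (1 - e ^ 2) ^ 2) := mul_le_mul hE2 (by linarith) (norm_nonneg _)
            zero_le_one
        _ = _ := one_mul _
  have e : intMat N E F gp gm - intMatLim N E = Matrix.fromBlocks
      (Matrix.of fun i i' => if i'.val = i.val + 1 then
        E / locDet E F gp gm (i.val + 2) - E / (1 - E ^ 2) else 0)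
      (Matrix.diagonal fun i => F * E ^ 2 * gp (i.val + 2) / locDet E F gp gm (i.val + 2) +
        E ^ 2 / (1 - E ^ 2))
      (Matrix.diagonal fun i => F * E ^ 2 * gm (i.val + 1) / locDet E F gp gm (i.val + 1) +
        E ^ 2 / (1 - E ^ 2))
      (Matrix.of fun i i' => if i'.val + 1 = i.val then
        E / locDet E F gp gm (i.val + 1) - E / (1 - E ^ 2) else 0) := by
    ext (i | i) (j | j)
    · simp only [intMat, intMatLim, swapMat, shiftU, Matrix.sub_apply, Matrix.smul_apply,
        Matrix.fromBlocks_apply₁₁, Matrix.of_apply, Matrix.zero_apply, smul_eq_mul]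
      split_ifs <;> ring
    · simp only [intMat, intMatLim, swapMat, Matrix.sub_apply, Matrix.smul_apply,
        Matrix.fromBlocks_apply₁₂, Matrix.diagonal_apply, Matrix.one_apply, Matrix.zero_apply,
        smul_eq_mul]
      split_ifs <;> ring
    · simp only [intMat, intMatLim, swapMat, Matrix.sub_apply, Matrix.smul_apply,
        Matrix.fromBlocks_apply₂₁, Matrix.diagonal_apply, Matrix.one_apply, Matrix.zero_apply,
        smul_eq_mul]
      split_ifs <;> ring
    · simp only [intMat, intMatLim, swapMat, shiftL, Matrix.sub_apply, Matrix.smul_apply,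
        Matrix.fromBlocks_apply₂₂, Matrix.of_apply, Matrix.zero_apply, smul_eq_mul]
      split_ifs <;> ring
  rw [e]
  refine matBound_fromBlocks ?_ (matBound_diagonal hc fun i => k2 _ _ (hp1 _ ?_ ?_) ?_ ?_)
    (matBound_diagonal hc fun i => k2 _ _ (hm1 _ ?_ ?_) ?_ ?_) ?_
  · exact matBound_of_ite (P := fun i j : Fin N => j.val = i.val + 1)
      (d := fun i => E / locDet E F gp gm (i.val + 2) - E / (1 - E ^ 2)) hc
      fun i => k1 _ (by omega) (by omega)
  iterate 8 omega
  · exact matBound_of_ite (P := fun i j : Fin N => j.val + 1 = i.val)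
      (d := fun i => E / locDet E F gp gm (i.val + 1) - E / (1 - E ^ 2)) hc
      fun i => k1 _ (by omega) (by omega)

/-- For reflection coefficients close to `-1` the coupling matrix is close to a function of the
path matrix. -/
theorem matBound_couplingMat_sub {Γ : ℂ} (hF : ‖F‖ ≤ 1) (hp : ∀ j, ‖gp j‖ ≤ 1)
    (hm : ∀ j, ‖gm j‖ ≤ 1) (hE : ‖E‖ ≤ e) (he : e < 1) (hF1 : ‖F - 1‖ ≤ h)
    (hp1 : ∀ j, 1 ≤ j → j ≤ N + 1 → ‖gp j + 1‖ ≤ h)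
    (hm1 : ∀ j, 1 ≤ j → j ≤ N + 1 → ‖gm j + 1‖ ≤ h) :
    MatBound (couplingMat N E F gp gm Γ -
        ((E / (1 - E ^ 2)) • pathMat N ℂ - (2 * E ^ 2 / (1 - E ^ 2)) • 1))
      (Fintype.card (Fin N ⊕ Fin N) * (16 * h + ‖Γ‖) / (1 - e ^ 2) ^ 2) := by
  have he0 : 0 ≤ e := (norm_nonneg _).trans hE
  have h0 : 0 ≤ h := (norm_nonneg _).trans hF1
  have hd : 0 < 1 - e ^ 2 := by nlinarith
  have hd1 : 1 - e ^ 2 ≤ 1 := by nlinarith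
  have a0 := matBound_isoMat_sub hF hF1 (N := N) (gp := gp) (gm := gm)
    (fun i hi => hp1 _ (by omega) (by omega)) (fun i hi => hm1 _ (by omega) (by omega))
  have a1 := matBound_intMat_sub (N := N) hF hp hm hE he hF1 hp1 hm1
  have b1 := (matBound_intMat (N := N) hF hp hm hE he).mono (b := 1 / (1 - e ^ 2))
    (by gcongr; linarith)
  have b0 := matBound_swapMat (N := N)
  rw [← couplingMat_lim, couplingMat]
  have e1 : isoMat N F gp gm * intMat N E F gp gm + intMat N E F gp gm * isoMat N F gp gm +
      Γ • (intMat N E F gp gm * intMat N E F gp gm) -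
      (swapMat N * intMatLim N E + intMatLim N E * swapMat N) =
      (isoMat N F gp gm - swapMat N) * intMat N E F gp gm +
      swapMat N * (intMat N E F gp gm - intMatLim N E) +
      (intMat N E F gp gm * (isoMat N F gp gm - swapMat N) +
      (intMat N E F gp gm - intMatLim N E) * swapMat N) +
      Γ • (intMat N E F gp gm * intMat N E F gp gm) := by
    simp only [sub_mul, mul_sub]
    abel
  rw [e1]
  have p1 : 0 ≤ 1 / (1 - e ^ 2) := by positivity
  have p2 : 0 ≤ 2 * h := by positivity
  have p3 : 0 ≤ 6 * h / (1 - e ^ 2) ^ 2 := by positivity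
  refine ((((a0.mul b1 p2).add (b0.mul a1 zero_le_one)).add
    ((b1.mul a0 p1).add (a1.mul b0 p3))).add ((b1.mul b1 p1).smul Γ)).mono ?_
  set c : ℝ := (Fintype.card (Fin N ⊕ Fin N) : ℝ)
  have hc : 0 ≤ c := Nat.cast_nonneg _
  have q : 2 * h * (1 / (1 - e ^ 2)) ≤ 2 * h / (1 - e ^ 2) ^ 2 := by
    rw [mul_one_div]
    gcongr
    nlinarith
  have : c * (2 * h * (1 / (1 - e ^ 2))) ≤ c * (2 * h / (1 - e ^ 2) ^ 2) := by gcongr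
  have e2 : c * (16 * h + ‖Γ‖) / (1 - e ^ 2) ^ 2 = c * (2 * h / (1 - e ^ 2) ^ 2) +
      c * (1 * (6 * h / (1 - e ^ 2) ^ 2)) + (c * (2 * h / (1 - e ^ 2) ^ 2) +
      c * (6 * h / (1 - e ^ 2) ^ 2 * 1)) + ‖Γ‖ * (c * (1 / (1 - e ^ 2) * (1 / (1 - e ^ 2)))) := by
    field_simp
    ring
  rw [e2]
  have e3 : 1 / (1 - e ^ 2) * (2 * h) = 2 * h * (1 / (1 - e ^ 2)) := by ring
  rw [e3]
  linarith

end Abstract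

end OSM

/-! ### Reflection coefficients and the similarity to the normalized form -/

namespace OSM

/-- The reflection coefficient `(z - P) / (z + P)`. -/
noncomputable def refl (z : ℂ) (P : ℝ) : ℂ := (z - P) / (z + P)

section Refl

variable {z : ℂ} {P : ℝ}

theorem add_ofReal_ne_zero (hz : 0 < z.re) (hP : 0 < P) : z + P ≠ 0 := fun h => by
  have := congrArg Complex.re h
  simp only [Complex.add_re, Complex.ofReal_re, Complex.zero_re] at this
  linarith

theorem norm_add_ofReal_sq (z : ℂ) (P : ℝ) : ‖z + P‖ ^ 2 = ‖z‖ ^ 2 + 2 * z.re * P + P ^ 2 := by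
  rw [Complex.sq_norm, Complex.sq_norm, Complex.normSq_apply, Complex.normSq_apply]
  simp only [Complex.add_re, Complex.ofReal_re, Complex.add_im, Complex.ofReal_im]
  ring

theorem norm_sub_ofReal_sq (z : ℂ) (P : ℝ) : ‖z - P‖ ^ 2 = ‖z‖ ^ 2 - 2 * z.re * P + P ^ 2 := by
  have := norm_add_ofReal_sq z (-P)
  push_cast at this
  rw [← sub_eq_add_neg] at this
  rw [this]; ring

theorem le_norm_add_ofReal (hz : 0 < z.re) (hP : 0 < P) : P ≤ ‖z + P‖ ∧ ‖z‖ ≤ ‖z + P‖ := by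
  have h := norm_add_ofReal_sq z P
  have h1 : 0 < z.re * P := mul_pos hz hP
  constructor
  · refine (sq_le_sq₀ hP.le (norm_nonneg _)).1 ?_
    nlinarith [sq_nonneg ‖z‖]
  · refine (sq_le_sq₀ (norm_nonneg _) (norm_nonneg _)).1 ?_
    nlinarith [sq_nonneg P]

/-- The numerator of the defect is `|z + P|² - |z - P|² = 4 P Re z`. -/
theorem norm_refl_sq (hz : 0 < z.re) (hP : 0 < P) :
    ‖refl z P‖ ^ 2 = 1 - 4 * z.re * P / (‖z‖ ^ 2 + 2 * z.re * P + P ^ 2) := by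
  have h : 0 < ‖z‖ ^ 2 + 2 * z.re * P + P ^ 2 := by
    have : 0 < z.re * P := mul_pos hz hP
    positivity
  rw [refl, norm_div, div_pow, norm_add_ofReal_sq, norm_sub_ofReal_sq, eq_sub_iff_add_eq,
    ← add_div, div_eq_one_iff_eq h.ne']
  ring

theorem norm_refl_le_one (hz : 0 < z.re) (hP : 0 < P) : ‖refl z P‖ ≤ 1 := by
  have h := norm_refl_sq hz hP
  have h1 : 0 ≤ 4 * z.re * P / (‖z‖ ^ 2 + 2 * z.re * P + P ^ 2) := by
    have : 0 < z.re * P := mul_pos hz hP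
    positivity
  exact (sq_le_one_iff₀ (norm_nonneg _)).1 (by linarith)

theorem refl_add_one (hz : 0 < z.re) (hP : 0 < P) : refl z P + 1 = 2 * z / (z + P) := by
  have := add_ofReal_ne_zero hz hP
  rw [refl]; field_simp; ring

theorem norm_refl_add_one_le (hz : 0 < z.re) (hP : 0 < P) : ‖refl z P + 1‖ ≤ 2 * ‖z‖ / P := by
  rw [refl_add_one hz hP, norm_div, norm_mul]
  simp only [Complex.norm_ofNat]
  exact div_le_div_of_nonneg_left (by positivity) hP (le_norm_add_ofReal hz hP).1

theorem norm_refl_add_one_sub_le (hz : 0 < z.re) (hP : 0 < P) :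
    ‖refl z P + 1 - 2 * z / P‖ ≤ 2 * ‖z‖ ^ 2 / P ^ 2 := by
  have h1 := add_ofReal_ne_zero hz hP
  have hP' : (P : ℂ) ≠ 0 := by exact_mod_cast hP.ne'
  have e : refl z P + 1 - 2 * z / P = -(2 * z ^ 2 / ((z + P) * P)) := by
    rw [refl_add_one hz hP]
    field_simp
    ring
  rw [e, norm_neg, norm_div, norm_mul, norm_mul, norm_pow, Complex.norm_real,
    Real.norm_of_nonneg hP.le]
  simp only [Complex.norm_ofNat]
  refine div_le_div_of_nonneg_left (by positivity) (by positivity) ?_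
  rw [sq]
  exact mul_le_mul_of_nonneg_right (le_norm_add_ofReal hz hP).1 hP.le

theorem one_sub_le_norm_refl (hz : 0 < z.re) (hP : 0 < P) :
    1 - 2 * (P / ‖z‖) ≤ ‖refl z P‖ ∧ 1 - 2 * (‖z‖ / P) ≤ ‖refl z P‖ := by
  have hz0 : 0 < ‖z‖ := norm_pos_iff.2 fun h => by rw [h] at hz; simp at hz
  obtain ⟨h1, h2⟩ := le_norm_add_ofReal hz hP
  have h3 : 0 < ‖z + P‖ := hP.trans_le h1
  have hPn : ‖(P : ℂ)‖ = P := by rw [Complex.norm_real, Real.norm_of_nonneg hP.le]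
  rw [refl, norm_div, le_div_iff₀ h3, le_div_iff₀ h3]
  constructor
  · have h4 := norm_sub_norm_le (z + P) (2 * P)
    have e : z + P - 2 * P = z - P := by ring
    rw [e, norm_mul, hPn, Complex.norm_ofNat] at h4
    have : P ≤ P / ‖z‖ * ‖z + P‖ := by
      rw [div_mul_eq_mul_div, le_div_iff₀ hz0]; gcongr
    nlinarith
  · have h4 := norm_sub_norm_le (z + P) (2 * z)
    have e : z + P - 2 * z = -(z - P) := by ring
    rw [e, norm_neg, norm_mul, Complex.norm_ofNat] at h4
    have : ‖z‖ ≤ ‖z‖ / P * ‖z + P‖ := by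
      rw [div_mul_eq_mul_div, le_div_iff₀ hP]; gcongr
    nlinarith

end Refl

/-- The transmission parameters of the two-sided method. -/
def twoParams (σ : ℕ → Bool) (p₁ q₁ p₂ q₂ : ℝ) : Params :=
  { pp := fun j => if σ j then p₁ else p₂
    qp := fun j => if σ j then q₁ else q₂
    pm := fun j => if σ (j - 1) then p₂ else p₁
    qm := fun j => if σ (j - 1) then q₂ else q₁ }

/-- Here `r` and `l` stand for the factors `λ + P`, and `g`, `h`, `g'` for the reflection
coefficients that replace `λ - P`. After normalization `α` is pure interaction: it carries a factor
`E`. -/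
theorem alpha_identity {r₁ l₂ r₂ g h g' E F : ℂ} (hr₂ : r₂ ≠ 0) (hl₂ : l₂ ≠ 0)
    (hE : E ≠ 0) (hF : F ≠ 0) (_ : 1 - g' * h * (E * F) ^ 2 ≠ 0) :
    (l₂ * r₁ * F⁻¹ - h * l₂ * (g * r₁) * F) /
      (r₂ * l₂ * (E * F)⁻¹ - g' * r₂ * (h * l₂) * (E * F)) * r₂ =
    r₁ * ((1 - g * h * F ^ 2) * (E / (1 - g' * h * (E * F) ^ 2))) := by
  have e : r₂ * l₂ * (E * F)⁻¹ - g' * r₂ * (h * l₂) * (E * F) =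
      r₂ * l₂ * (1 - g' * h * (E * F) ^ 2) / (E * F) := by
    field_simp
  rw [e]
  field_simp

/-- In contrast to `α`, the coefficient `β` keeps the part `-gF` as `E → 0`: this is what remains of
the method when the interface is isolated. -/
theorem beta_identity {r₁ l₂ r₂ g h g' E F : ℂ} (hr₂ : r₂ ≠ 0) (hl₂ : l₂ ≠ 0)
    (hE : E ≠ 0) (hF : F ≠ 0) (hd : 1 - g' * h * (E * F) ^ 2 ≠ 0) :
    (r₁ * (g' * r₂) * E - g * r₁ * r₂ * E⁻¹) /
      (r₂ * l₂ * (E * F)⁻¹ - g' * r₂ * (h * l₂) * (E * F)) * l₂ =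
    r₁ * (-(g * F) + (1 - g * h * F ^ 2) * (F * E ^ 2 * g' / (1 - g' * h * (E * F) ^ 2))) := by
  have e : r₂ * l₂ * (E * F)⁻¹ - g' * r₂ * (h * l₂) * (E * F) =
      r₂ * l₂ * (1 - g' * h * (E * F) ^ 2) / (E * F) := by
    field_simp
  rw [e]
  generalize hD : 1 - g' * h * (E * F) ^ 2 = d at hd
  field_simp
  linear_combination (-(r₁ * g)) * hD

namespace Problem

variable (D : Problem)

/-- The reflection coefficient at the right boundary of `Ω_j`. -/
noncomputable def gPlus (v : Params) (k : ℝ) (j : ℕ) : ℂ := D.rightMinus v k j / D.rightPlus v k j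

/-- The reflection coefficient at the left boundary of `Ω_j`. -/
noncomputable def gMinus (v : Params) (k : ℝ) (j : ℕ) : ℂ := D.leftMinus v k j / D.leftPlus v k j

variable {D}

theorem gPlus_eq (v : Params) (k : ℝ) (j : ℕ) : D.gPlus v k j =
    if j = D.J then -1 else refl (D.lam k) (v.pp j + k ^ 2 * v.qp j) := by
  rw [gPlus, rightMinus, rightPlus]
  split_ifs
  · simp
  · rfl

theorem gMinus_eq (v : Params) (k : ℝ) (j : ℕ) : D.gMinus v k j =
    if j = 1 then -1 else refl (D.lam k) (v.pm j + k ^ 2 * v.qm j) := by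
  rw [gMinus, leftMinus, leftPlus]
  split_ifs
  · simp
  · rfl

variable {σ : ℕ → Bool} {p₁ q₁ p₂ q₂ : ℝ}

theorem gPlus_twoParams (k : ℝ) (j : ℕ) : D.gPlus (twoParams σ p₁ q₁ p₂ q₂) k j =
    if j = D.J then -1 else
      if σ j then refl (D.lam k) (p₁ + k ^ 2 * q₁) else refl (D.lam k) (p₂ + k ^ 2 * q₂) := by
  rw [gPlus_eq]
  simp only [twoParams]
  split_ifs <;> rfl

theorem gMinus_twoParams (k : ℝ) (j : ℕ) : D.gMinus (twoParams σ p₁ q₁ p₂ q₂) k j =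
    if j = 1 then -1 else
      if σ (j - 1) then refl (D.lam k) (p₂ + k ^ 2 * q₂) else refl (D.lam k) (p₁ + k ^ 2 * q₁) := by
  rw [gMinus_eq]
  simp only [twoParams]
  split_ifs <;> rfl

/-- Each interface uses both pairs, one on either side, and the product does not see on which side.
From here on the arrangement `σ` enters only the coupling matrix. -/
theorem gPlus_mul_gMinus (k : ℝ) {i : ℕ} (hi : i < D.J - 1) :
    D.gPlus (twoParams σ p₁ q₁ p₂ q₂) k (i + 1) * D.gMinus (twoParams σ p₁ q₁ p₂ q₂) k (i + 2) =
      refl (D.lam k) (p₁ + k ^ 2 * q₁) * refl (D.lam k) (p₂ + k ^ 2 * q₂) := by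
  have h1 : i + 1 ≠ D.J := by omega
  have h2 : i + 2 ≠ 1 := by omega
  have h3 : i + 2 - 1 = i + 1 := by omega
  rw [gPlus_twoParams, gMinus_twoParams, if_neg h1, if_neg h2, h3]
  split_ifs
  · rfl
  · exact mul_comm _ _

theorem rightPlus_ne_zero {k : ℝ} (hz : 0 < (D.lam k).re) {v : Params}
    (hv : ∀ j, 0 < v.pp j + k ^ 2 * v.qp j) (j : ℕ) : D.rightPlus v k j ≠ 0 := by
  rw [rightPlus]
  split_ifs
  · exact one_ne_zero
  · exact add_ofReal_ne_zero hz (hv j)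

theorem leftPlus_ne_zero {k : ℝ} (hz : 0 < (D.lam k).re) {v : Params}
    (hv : ∀ j, 0 < v.pm j + k ^ 2 * v.qm j) (j : ℕ) : D.leftPlus v k j ≠ 0 := by
  rw [leftPlus]
  split_ifs
  · exact one_ne_zero
  · exact add_ofReal_ne_zero hz (hv j)

theorem norm_gPlus_le {k : ℝ} (hz : 0 < (D.lam k).re) {v : Params}
    (hv : ∀ j, 0 < v.pp j + k ^ 2 * v.qp j) (j : ℕ) : ‖D.gPlus v k j‖ ≤ 1 := by
  rw [gPlus_eq]
  split_ifs
  · simp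
  · exact norm_refl_le_one hz (hv j)

theorem norm_gMinus_le {k : ℝ} (hz : 0 < (D.lam k).re) {v : Params}
    (hv : ∀ j, 0 < v.pm j + k ^ 2 * v.qm j) (j : ℕ) : ‖D.gMinus v k j‖ ≤ 1 := by
  rw [gMinus_eq]
  split_ifs
  · simp
  · exact norm_refl_le_one hz (hv j)

/-- Rescaling every trace by the factor `λ + P` of the operator that defines it leaves the spectrum
unchanged and removes the symbols in favour of reflection coefficients. The result is the isolated
part plus `1 - GF²` times the interaction. -/
theorem T_mul_diagonal {δ k : ℝ} (hL : 0 < D.L) (hδ : 0 ≤ δ) (hz : 0 < (D.lam k).re) {v : Params}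
    (hvp : ∀ j, 0 < v.pp j + k ^ 2 * v.qp j) (hvm : ∀ j, 0 < v.pm j + k ^ 2 * v.qm j) {G : ℂ}
    (hG : ∀ i < D.J - 1, D.gPlus v k (i + 1) * D.gMinus v k (i + 2) = G) :
    D.T δ v k * Matrix.diagonal (Sum.elim (fun i => D.rightPlus v k (i.val + 1))
        fun i => D.leftPlus v k (i.val + 2)) =
      Matrix.diagonal (Sum.elim (fun i => D.rightPlus v k (i.val + 1))
        fun i => D.leftPlus v k (i.val + 2)) *
      (isoMat (D.J - 1) (Complex.exp (-(D.lam k * δ))) (D.gPlus v k) (D.gMinus v k) +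
        (1 - G * Complex.exp (-(D.lam k * δ)) ^ 2) • intMat (D.J - 1)
          (Complex.exp (-(D.lam k * D.L))) (Complex.exp (-(D.lam k * δ))) (D.gPlus v k)
          (D.gMinus v k)) := by
  have hE0 : Complex.exp (-(D.lam k * D.L)) ≠ 0 := Complex.exp_ne_zero _
  have hF0 : Complex.exp (-(D.lam k * δ)) ≠ 0 := Complex.exp_ne_zero _
  have hEn : ‖Complex.exp (-(D.lam k * D.L))‖ < 1 := by
    rw [norm_exp_neg_lam_mul, Real.exp_lt_one_iff]
    have := mul_pos hz hL
    linarith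
  have hFn : ‖Complex.exp (-(D.lam k * δ))‖ ≤ 1 := by
    rw [norm_exp_neg_lam_mul, Real.exp_le_one_iff]
    have := mul_nonneg hz.le hδ
    linarith
  have eF : Complex.exp (D.lam k * δ) = (Complex.exp (-(D.lam k * δ)))⁻¹ := by
    rw [Complex.exp_neg, inv_inv]
  have eE : Complex.exp (D.lam k * D.L) = (Complex.exp (-(D.lam k * D.L)))⁻¹ := by
    rw [Complex.exp_neg, inv_inv]
  have eEF : Complex.exp (-(D.lam k * (D.L + δ))) =
      Complex.exp (-(D.lam k * D.L)) * Complex.exp (-(D.lam k * δ)) := by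
    rw [← Complex.exp_add]; ring_nf
  have eEF' : Complex.exp (D.lam k * (D.L + δ)) =
      (Complex.exp (-(D.lam k * D.L)) * Complex.exp (-(D.lam k * δ)))⁻¹ := by
    rw [← eEF, Complex.exp_neg, inv_inv]
  have hd := fun j => norm_locDet_ge (E := Complex.exp (-(D.lam k * D.L)))
    (F := Complex.exp (-(D.lam k * δ))) (gp := D.gPlus v k) (gm := D.gMinus v k) hFn
    (norm_gPlus_le hz hvp) (norm_gMinus_le hz hvm) le_rfl j
  have hd0 : ∀ j, locDet (Complex.exp (-(D.lam k * D.L))) (Complex.exp (-(D.lam k * δ)))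
      (D.gPlus v k) (D.gMinus v k) j ≠ 0 := fun j h0 => by
    have := hd j
    rw [h0, norm_zero] at this
    nlinarith [norm_nonneg (Complex.exp (-(D.lam k * D.L)))]
  have hrp := rightPlus_ne_zero hz hvp (D := D)
  have hlp := leftPlus_ne_zero hz hvm (D := D)
  have hrm : ∀ j, D.rightMinus v k j = D.gPlus v k j * D.rightPlus v k j := fun j => by
    rw [gPlus, div_mul_cancel₀ _ (hrp j)]
  have hlm : ∀ j, D.leftMinus v k j = D.gMinus v k j * D.leftPlus v k j := fun j => by
    rw [gMinus, div_mul_cancel₀ _ (hlp j)]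
  set E := Complex.exp (-(D.lam k * D.L))
  set F := Complex.exp (-(D.lam k * δ))
  have hG' : ∀ i : Fin (D.J - 1), D.gPlus v k (i.val + 1) * D.gMinus v k (i.val + 2) = G :=
    fun i => hG i i.2
  ext (i | i) (j | j)
  · rw [Matrix.mul_diagonal, Matrix.diagonal_mul]
    simp only [T, isoMat, intMat, Matrix.add_apply, Matrix.smul_apply, Matrix.fromBlocks_apply₁₁,
      Matrix.of_apply, Matrix.zero_apply, Sum.elim_inl, smul_eq_mul, zero_add]
    split_ifs with hij
    · rw [hij, alphaPlus, det, eEF, eEF', eF, hlm, hrm, hrm, ← hG' i]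
      exact alpha_identity (hrp _) (hlp _) hE0 hF0 (hd0 _)
    · simp
  · rw [Matrix.mul_diagonal, Matrix.diagonal_mul]
    simp only [T, isoMat, intMat, Matrix.add_apply, Matrix.smul_apply, Matrix.fromBlocks_apply₁₂,
      Matrix.diagonal_apply, Sum.elim_inl, Sum.elim_inr, smul_eq_mul]
    split_ifs with hij
    · rw [← hij, betaPlus, det, eEF, eEF', eE, hlm, hrm, hrm, ← hG' i]
      exact beta_identity (hrp _) (hlp _) hE0 hF0 (hd0 _)
    · simp
  · rw [Matrix.mul_diagonal, Matrix.diagonal_mul]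
    simp only [T, isoMat, intMat, Matrix.add_apply, Matrix.smul_apply, Matrix.fromBlocks_apply₂₁,
      Matrix.diagonal_apply, Sum.elim_inl, Sum.elim_inr, smul_eq_mul]
    split_ifs with hij
    · have e2 : i.val + 2 - 1 = i.val + 1 := by omega
      rw [← hij, betaMinus, e2, det, eEF, eEF', eE, hlm, hlm, hrm, ← hG' i]
      -- The row of a left trace is the mirror image: left and right factors, and the two reflection
      -- coefficients, exchange their roles.
      have h := beta_identity (r₁ := D.leftPlus v k (i.val + 2)) (g := D.gMinus v k (i.val + 2))
        (h := D.gPlus v k (i.val + 1)) (g' := D.gMinus v k (i.val + 1)) (hlp (i.val + 1))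
        (hrp (i.val + 1)) hE0 hF0
        (by have := hd0 (i.val + 1); rwa [locDet, mul_comm (D.gPlus v k _)] at this)
      rw [locDet, mul_comm (D.gPlus v k (i.val + 1)) (D.gMinus v k (i.val + 1)),
        mul_comm (D.gPlus v k (i.val + 1)) (D.gMinus v k (i.val + 2)), ← h]
      congr 2
      ring
    · simp
  · rw [Matrix.mul_diagonal, Matrix.diagonal_mul]
    simp only [T, isoMat, intMat, Matrix.add_apply, Matrix.smul_apply, Matrix.fromBlocks_apply₂₂,
      Matrix.of_apply, Matrix.zero_apply, Sum.elim_inr, smul_eq_mul, zero_add]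
    split_ifs with hij
    · have e2 : i.val + 2 - 1 = i.val + 1 := by omega
      have e3 : j.val + 2 = i.val + 1 := by omega
      rw [alphaMinus, e2, e3, det, eEF, eEF', eF, hlm, hlm, hrm, ← hG' i]
      have h := alpha_identity (r₁ := D.leftPlus v k (i.val + 2)) (g := D.gMinus v k (i.val + 2))
        (h := D.gPlus v k (i.val + 1)) (g' := D.gMinus v k (i.val + 1)) (hlp (i.val + 1))
        (hrp (i.val + 1)) hE0 hF0
        (by have := hd0 (i.val + 1); rwa [locDet, mul_comm (D.gPlus v k _)] at this)
      rw [locDet, mul_comm (D.gPlus v k (i.val + 1)) (D.gMinus v k (i.val + 1)),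
        mul_comm (D.gPlus v k (i.val + 1)) (D.gMinus v k (i.val + 2)), ← h]
      congr 2
      ring
    · simp

/-- The spectral radius of the iteration matrix at frequency `k`. -/
noncomputable def rate (D : Problem) (σ : ℕ → Bool) (δ p₁ q₁ p₂ q₂ k : ℝ) : ℝ :=
  specRad (D.T δ (twoParams σ p₁ q₁ p₂ q₂) k)

/-- The product of the two reflection coefficients of an interface. -/
noncomputable def reflProd (D : Problem) (p₁ q₁ p₂ q₂ k : ℝ) : ℂ :=
  refl (D.lam k) (p₁ + k ^ 2 * q₁) * refl (D.lam k) (p₂ + k ^ 2 * q₂)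

/-- The matrix `Θ` in `T² = (1 - Γ) + Γ Θ`. -/
noncomputable def coupling (D : Problem) (σ : ℕ → Bool) (δ p₁ q₁ p₂ q₂ k : ℝ) :
    Matrix (Fin (D.J - 1) ⊕ Fin (D.J - 1)) (Fin (D.J - 1) ⊕ Fin (D.J - 1)) ℂ :=
  couplingMat (D.J - 1) (Complex.exp (-(D.lam k * D.L))) (Complex.exp (-(D.lam k * δ)))
    (D.gPlus (twoParams σ p₁ q₁ p₂ q₂) k) (D.gMinus (twoParams σ p₁ q₁ p₂ q₂) k)
    (1 - D.reflProd p₁ q₁ p₂ q₂ k * Complex.exp (-(D.lam k * δ)) ^ 2)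

theorem twoParams_pos {k : ℝ} (h₁ : 0 < p₁ + k ^ 2 * q₁) (h₂ : 0 < p₂ + k ^ 2 * q₂) :
    (∀ j, 0 < (twoParams σ p₁ q₁ p₂ q₂).pp j + k ^ 2 * (twoParams σ p₁ q₁ p₂ q₂).qp j) ∧
    (∀ j, 0 < (twoParams σ p₁ q₁ p₂ q₂).pm j + k ^ 2 * (twoParams σ p₁ q₁ p₂ q₂).qm j) := by
  constructor <;> intro j <;> simp only [twoParams] <;> split_ifs <;> assumption

/-- The iteration matrix has the spectral radius of a matrix whose square is `(1 - Γ) + Γ Θ`. -/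
theorem exists_rate_eq {δ k : ℝ} (hL : 0 < D.L) (hδ : 0 ≤ δ) (hz : 0 < (D.lam k).re)
    (h₁ : 0 < p₁ + k ^ 2 * q₁) (h₂ : 0 < p₂ + k ^ 2 * q₂) :
    ∃ A : Matrix (Fin (D.J - 1) ⊕ Fin (D.J - 1)) (Fin (D.J - 1) ⊕ Fin (D.J - 1)) ℂ,
      D.rate σ δ p₁ q₁ p₂ q₂ k = specRad A ∧
      A ^ 2 = (D.reflProd p₁ q₁ p₂ q₂ k * Complex.exp (-(D.lam k * δ)) ^ 2) • 1 +
        (1 - D.reflProd p₁ q₁ p₂ q₂ k * Complex.exp (-(D.lam k * δ)) ^ 2) •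
          D.coupling σ δ p₁ q₁ p₂ q₂ k := by
  obtain ⟨hvp, hvm⟩ := twoParams_pos (σ := σ) h₁ h₂
  refine ⟨_, specRad_eq_of_mul_eq ?_ (T_mul_diagonal hL hδ hz hvp hvm
    fun i hi => gPlus_mul_gMinus k hi), iterMat_sq fun i hi => gPlus_mul_gMinus k hi⟩
  rw [Matrix.isUnit_iff_isUnit_det, Matrix.det_diagonal, isUnit_iff_ne_zero, Finset.prod_ne_zero_iff]
  rintro (i | i) -
  · exact rightPlus_ne_zero hz hvp _
  · exact leftPlus_ne_zero hz hvm _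

end Problem

end OSM

/-! ### The spectral radius at a single frequency -/

namespace OSM

section Affine

variable {n : Type*} [Fintype n] [DecidableEq n]

/-- Eigenvalues are located through the quadratic form at an eigenvector, so no normality of `M` is
needed. -/
theorem exists_vector_of_mem_spectrum_affine {M : Matrix n n ℂ} {a b z : ℂ}
    (hz : z ∈ spectrum ℂ (a • (1 : Matrix n n ℂ) + b • M)) :
    ∃ v : n → ℂ, v ≠ 0 ∧ z * nsq v = a * nsq v + b * (star v ⬝ᵥ M.mulVec v) := by
  obtain ⟨v, hv, h⟩ := mem_spectrum_iff_eigenvector.1 hz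
  refine ⟨v, hv, ?_⟩
  have := congrArg (fun w => star v ⬝ᵥ w) h
  simp only [Matrix.add_mulVec, Matrix.smul_mulVec, Matrix.one_mulVec, dotProduct_add,
    dotProduct_smul, star_dotProduct_self, smul_eq_mul] at this
  exact this.symm

theorem mem_spectrum_affine {M : Matrix n n ℂ} {y : ℂ} (hy : y ∈ spectrum ℂ M) (a b : ℂ) :
    a + b * y ∈ spectrum ℂ (a • (1 : Matrix n n ℂ) + b • M) := by
  obtain ⟨v, hv, h⟩ := mem_spectrum_iff_eigenvector.1 hy
  refine mem_spectrum_iff_eigenvector.2 ⟨v, hv, ?_⟩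
  rw [Matrix.add_mulVec, Matrix.smul_mulVec, Matrix.smul_mulVec, Matrix.one_mulVec, h, smul_smul,
    ← add_smul]

theorem abs_norm_sub_le_of_mem_spectrum_affine {M : Matrix n n ℂ} {a b z : ℂ} {c : ℝ} (hc : 0 ≤ c)
    (hM : MatBound M c) (hz : z ∈ spectrum ℂ (a • (1 : Matrix n n ℂ) + b • M)) :
    |‖z‖ - ‖a‖| ≤ ‖b‖ * (Fintype.card n * c) := by
  obtain ⟨v, hv, h⟩ := exists_vector_of_mem_spectrum_affine hz
  have hp := nsq_pos hv
  have h1 := norm_star_dotProduct_mulVec_le hc hM v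
  have h2 : ‖z - a‖ * nsq v ≤ ‖b‖ * (Fintype.card n * c) * nsq v := by
    have e : ‖z - a‖ * nsq v = ‖(z - a) * nsq v‖ := by
      rw [norm_mul, Complex.norm_real, Real.norm_of_nonneg hp.le]
    rw [e, sub_mul, h, add_sub_cancel_left, norm_mul, mul_assoc]
    exact mul_le_mul_of_nonneg_left h1 (norm_nonneg _)
  exact (abs_norm_sub_norm_le z a).trans (le_of_mul_le_mul_right h2 hp)

end Affine

section RealLemmas

/-- A square-root bound: all estimates are obtained for the squared spectral radius, and a
second-order loss is affordable. -/
theorem one_sub_le_of_sq {r x : ℝ} (hr : 0 ≤ r) (hx : 0 ≤ x) (h : 1 - x ≤ r ^ 2) :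
    1 - x / 2 - x ^ 2 / 2 ≤ r := by
  rcases le_or_gt (1 - x / 2 - x ^ 2 / 2) 0 with h0 | h0
  · linarith
  have hx1 : x < 1 := by nlinarith
  refine (sq_le_sq₀ h0.le hr).1 (le_trans ?_ h)
  have h1 : x / 2 + x ^ 2 / 2 ≤ x := by nlinarith
  have h2 : (x / 2 + x ^ 2 / 2) ^ 2 ≤ x ^ 2 := pow_le_pow_left₀ (by positivity) h1 2
  nlinarith

theorem one_sub_sum_le_mul {a b c α β γ : ℝ} (ha1 : a ≤ 1) (hb1 : b ≤ 1)
    (hc1 : c ≤ 1) (ha0 : 0 ≤ a) (ha : 1 - α ≤ a) (hb : 1 - β ≤ b)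
    (hc : 1 - γ ≤ c) : 1 - α - β - γ ≤ a * b * c := by
  have hab : a * b ≤ 1 := by nlinarith
  nlinarith [mul_nonneg (sub_nonneg.2 ha1) (sub_nonneg.2 hb1),
    mul_nonneg (sub_nonneg.2 hab) (sub_nonneg.2 hc1)]

theorem exp_neg_le_two_div_sq {x : ℝ} (hx : 0 < x) : Real.exp (-x) ≤ 2 / x ^ 2 := by
  have h := Real.quadratic_le_exp_of_nonneg hx.le
  rw [Real.exp_neg, inv_le_comm₀ (Real.exp_pos x) (by positivity), inv_div]
  linarith

theorem norm_exp_neg_sub_one_le {w : ℂ} (hw : 0 ≤ w.re) : ‖Complex.exp (-w) - 1‖ ≤ 2 * ‖w‖ := by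
  rcases le_or_gt ‖w‖ 1 with h | h
  · simpa using Complex.norm_exp_sub_one_le (x := -w) (by simpa using h)
  · refine (norm_sub_le _ _).trans ?_
    have : ‖Complex.exp (-w)‖ ≤ 1 := by
      rw [Complex.norm_exp, Real.exp_le_one_iff, Complex.neg_re]; linarith
    rw [norm_one]; linarith

/-- Only the real part of `w` counts to first order; the imaginary part costs `|w|²/2`. -/
theorem norm_one_sub_le (w : ℂ) : ‖1 - w‖ ≤ 1 - w.re + ‖w‖ ^ 2 / 2 := by
  have h1 : ‖1 - w‖ ^ 2 = 1 - 2 * w.re + ‖w‖ ^ 2 := by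
    rw [Complex.sq_norm, Complex.sq_norm, Complex.normSq_apply, Complex.normSq_apply]
    simp only [Complex.sub_re, Complex.one_re, Complex.sub_im, Complex.one_im]
    ring
  have h2 := Complex.re_le_norm w
  have h3 : 0 ≤ 1 - w.re + ‖w‖ ^ 2 / 2 := by nlinarith [sq_nonneg (‖w‖ - 1)]
  refine (sq_le_sq₀ (norm_nonneg _) h3).1 ?_
  rw [h1]
  nlinarith [sq_nonneg (w.re - ‖w‖ ^ 2 / 2)]

end RealLemmas

namespace Problem

/-- The standing assumptions. -/
structure Admissible (D : Problem) : Prop where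
  two_le_J : 2 ≤ D.J
  L_pos : 0 < D.L
  Lhat_pos : 0 < D.Lhat
  eta_nonneg : 0 ≤ D.η
  eps_nonneg : 0 ≤ D.ε

variable {D : Problem}

theorem Admissible.kmin_pos (hD : D.Admissible) : 0 < D.kmin := Problem.kmin_pos hD.Lhat_pos

theorem Admissible.lam_re_pos (hD : D.Admissible) {k : ℝ} (hk : D.kmin ≤ k) : 0 < (D.lam k).re :=
  Problem.lam_re_pos hD.eta_nonneg (hD.kmin_pos.trans_le hk)

theorem Admissible.le_lam_re (hD : D.Admissible) {k : ℝ} (hk : D.kmin ≤ k) : k ≤ (D.lam k).re :=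
  Problem.le_lam_re hD.eta_nonneg (hD.kmin_pos.trans_le hk)

theorem Admissible.norm_lam_le (hD : D.Admissible) {k : ℝ} (hk : D.kmin ≤ k) :
    ‖D.lam k‖ ≤ k + (D.η + D.ε) / k :=
  Problem.norm_lam_le hD.eta_nonneg hD.eps_nonneg (hD.kmin_pos.trans_le hk)

theorem Admissible.nonempty (hD : D.Admissible) : Nonempty (Fin (D.J - 1) ⊕ Fin (D.J - 1)) :=
  ⟨Sum.inl ⟨0, by have := hD.two_le_J; omega⟩⟩

theorem Admissible.exp_kmin_lt_one (hD : D.Admissible) : Real.exp (-(D.kmin * D.L)) < 1 := by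
  rw [Real.exp_lt_one_iff]
  have := mul_pos hD.kmin_pos hD.L_pos
  linarith

theorem Admissible.norm_exp_le (hD : D.Admissible) {k : ℝ} (hk : D.kmin ≤ k) :
    ‖Complex.exp (-(D.lam k * D.L))‖ ≤ Real.exp (-(k * D.L)) := by
  rw [norm_exp_neg_lam_mul, Real.exp_le_exp, neg_le_neg_iff]
  exact mul_le_mul_of_nonneg_right (hD.le_lam_re hk) hD.L_pos.le

theorem Admissible.norm_exp_le_kmin (hD : D.Admissible) {k : ℝ} (hk : D.kmin ≤ k) :
    ‖Complex.exp (-(D.lam k * D.L))‖ ≤ Real.exp (-(D.kmin * D.L)) := by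
  refine (hD.norm_exp_le hk).trans ?_
  rw [Real.exp_le_exp, neg_le_neg_iff]
  exact mul_le_mul_of_nonneg_right hk hD.L_pos.le

theorem Admissible.norm_exp_delta_le (hD : D.Admissible) {k δ : ℝ} (hk : D.kmin ≤ k)
    (hδ : 0 ≤ δ) : ‖Complex.exp (-(D.lam k * δ))‖ ≤ 1 := by
  rw [norm_exp_neg_lam_mul, Real.exp_le_one_iff]
  have := mul_nonneg (hD.lam_re_pos hk).le hδ
  linarith

variable {σ : ℕ → Bool} {p₁ q₁ p₂ q₂ : ℝ}

theorem Admissible.norm_reflProd_le (hD : D.Admissible) {k : ℝ} (hk : D.kmin ≤ k)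
    (h₁ : 0 < p₁ + k ^ 2 * q₁) (h₂ : 0 < p₂ + k ^ 2 * q₂) : ‖D.reflProd p₁ q₁ p₂ q₂ k‖ ≤ 1 := by
  rw [reflProd, norm_mul]
  exact mul_le_one₀ (norm_refl_le_one (hD.lam_re_pos hk) h₁) (norm_nonneg _)
    (norm_refl_le_one (hD.lam_re_pos hk) h₂)

theorem Admissible.norm_reflProd_mul (k δ : ℝ) :
    ‖D.reflProd p₁ q₁ p₂ q₂ k * Complex.exp (-(D.lam k * δ)) ^ 2‖ =
      ‖D.reflProd p₁ q₁ p₂ q₂ k‖ * Real.exp (-(2 * ((D.lam k).re * δ))) := by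
  rw [norm_mul, norm_pow, norm_exp_neg_lam_mul, ← Real.exp_nat_mul]
  congr 2
  push_cast; ring

theorem Admissible.norm_reflProd_mul_le (hD : D.Admissible) {k δ : ℝ} (hk : D.kmin ≤ k)
    (hδ : 0 ≤ δ) (h₁ : 0 < p₁ + k ^ 2 * q₁) (h₂ : 0 < p₂ + k ^ 2 * q₂) :
    ‖D.reflProd p₁ q₁ p₂ q₂ k * Complex.exp (-(D.lam k * δ)) ^ 2‖ ≤ 1 := by
  rw [norm_mul, norm_pow]
  exact mul_le_one₀ (hD.norm_reflProd_le hk h₁ h₂) (by positivity)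
    (pow_le_one₀ (norm_nonneg _) (hD.norm_exp_delta_le hk hδ))

theorem Admissible.norm_gap_le (hD : D.Admissible) {k δ : ℝ} (hk : D.kmin ≤ k)
    (hδ : 0 ≤ δ) (h₁ : 0 < p₁ + k ^ 2 * q₁) (h₂ : 0 < p₂ + k ^ 2 * q₂) :
    ‖1 - D.reflProd p₁ q₁ p₂ q₂ k * Complex.exp (-(D.lam k * δ)) ^ 2‖ ≤ 2 := by
  refine (norm_sub_le _ _).trans ?_
  rw [norm_one]
  linarith [hD.norm_reflProd_mul_le hk hδ h₁ h₂]

/-- Up to the exponentially small coupling, the squared spectral radius is the product of the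
reflection coefficients, damped by the overlap. -/
theorem Admissible.rate_sq_approx (hD : D.Admissible) : ∃ C : ℝ, 0 < C ∧
    ∀ (σ : ℕ → Bool) (δ p₁ q₁ p₂ q₂ k : ℝ), 0 ≤ δ → D.kmin ≤ k → 0 < p₁ + k ^ 2 * q₁ →
      0 < p₂ + k ^ 2 * q₂ →
      |D.rate σ δ p₁ q₁ p₂ q₂ k ^ 2 -
        ‖D.reflProd p₁ q₁ p₂ q₂ k‖ * Real.exp (-(2 * ((D.lam k).re * δ)))| ≤
      C * (‖1 - D.reflProd p₁ q₁ p₂ q₂ k * Complex.exp (-(D.lam k * δ)) ^ 2‖ *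
        Real.exp (-(k * D.L))) := by
  have := hD.nonempty
  set e := Real.exp (-(D.kmin * D.L)) with he
  have he1 : e < 1 := hD.exp_kmin_lt_one
  have he0 : 0 < e := Real.exp_pos _
  have hd : 0 < 1 - e ^ 2 := by nlinarith
  set c : ℝ := (Fintype.card (Fin (D.J - 1) ⊕ Fin (D.J - 1)) : ℝ) with hc
  have hc0 : 0 < c := by rw [hc]; exact_mod_cast Fintype.card_pos
  set B : ℝ := c * (2 / (1 - e ^ 2) + 2 / (1 - e ^ 2) ^ 2) with hB
  have hB0 : 0 < B := by positivity
  refine ⟨c * B, by positivity, fun σ δ p₁ q₁ p₂ q₂ k hδ hk h₁ h₂ => ?_⟩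
  obtain ⟨A, hA, hA2⟩ := exists_rate_eq (σ := σ) hD.L_pos hδ (hD.lam_re_pos hk) h₁ h₂
  obtain ⟨hvp, hvm⟩ := twoParams_pos (σ := σ) h₁ h₂
  have hz := hD.lam_re_pos hk
  have hΓ := hD.norm_gap_le hk hδ h₁ h₂
  have hM := matBound_couplingMat (N := D.J - 1) (hD.norm_exp_delta_le hk hδ)
    (norm_gPlus_le hz hvp) (norm_gMinus_le hz hvm) (hD.norm_exp_le_kmin hk) he1 hΓ
  have hM' : MatBound (D.coupling σ δ p₁ q₁ p₂ q₂ k) (B * Real.exp (-(k * D.L))) :=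
    hM.mono (mul_le_mul_of_nonneg_left (hD.norm_exp_le hk) hB0.le)
  have hspec : ∀ z ∈ spectrum ℂ (A ^ 2), _ := fun z hz' => by
    rw [hA2] at hz'
    exact abs_norm_sub_le_of_mem_spectrum_affine (by positivity) hM' hz'
  rw [norm_reflProd_mul] at hspec
  set a := ‖D.reflProd p₁ q₁ p₂ q₂ k‖ * Real.exp (-(2 * ((D.lam k).re * δ)))
  have ha : 0 ≤ a := by positivity
  set Γn := ‖1 - D.reflProd p₁ q₁ p₂ q₂ k * Complex.exp (-(D.lam k * δ)) ^ 2‖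
  have hr : Γn * (c * (B * Real.exp (-(k * D.L)))) = c * B * (Γn * Real.exp (-(k * D.L))) := by ring
  rw [← hc, hr] at hspec
  set err := c * B * (Γn * Real.exp (-(k * D.L))) with herr
  have herr0 : 0 ≤ err := by positivity
  rw [hA, abs_le]
  constructor
  -- Every eigenvalue of the square has modulus within `err` of `a`. Any single one gives the lower
  -- bound and all together give the upper bound.
  · obtain ⟨z, hz'⟩ := spectrum.nonempty_of_isAlgClosed_of_finiteDimensional ℂ (A ^ 2)
    have h3 := (abs_le.1 (hspec z hz')).1
    have h4 := norm_le_specRad_sq hz'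
    linarith
  · have h3 : specRad A ≤ Real.sqrt (a + err) := by
      refine specRad_le_of_sq (Real.sqrt_nonneg _) fun z hz' => ?_
      rw [Real.sq_sqrt (by positivity)]
      linarith [(abs_le.1 (hspec z hz')).2]
    have h4 := pow_le_pow_left₀ (specRad_nonneg A) h3 2
    rw [Real.sq_sqrt (by positivity)] at h4
    linarith

theorem rate_nonneg (δ k : ℝ) : 0 ≤ D.rate σ δ p₁ q₁ p₂ q₂ k := specRad_nonneg _

/-- A symbol much smaller or much larger than `λ` reflects almost completely. The term in `1/k²`
pays for replacing `|λ|` by `k`. -/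
theorem Admissible.le_norm_refl (hD : D.Admissible) {k P m : ℝ} (hk : D.kmin ≤ k) (hP : 0 < P)
    (hm : P / k ≤ m ∨ k / P ≤ m) :
    1 - (2 * m + 2 * (D.η + D.ε) / k ^ 2) ≤ ‖refl (D.lam k) P‖ := by
  have hk0 := hD.kmin_pos.trans_le hk
  have hz := hD.lam_re_pos hk
  have hΛ : 0 ≤ D.η + D.ε := add_nonneg hD.eta_nonneg hD.eps_nonneg
  have h1 := one_sub_le_norm_refl hz hP
  have hn : k ≤ ‖D.lam k‖ := (hD.le_lam_re hk).trans (Complex.re_le_norm _)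
  have h0 : 0 ≤ 2 * (D.η + D.ε) / k ^ 2 := by positivity
  rcases hm with hm | hm
  · have : P / ‖D.lam k‖ ≤ P / k := div_le_div_of_nonneg_left hP.le hk0 hn
    linarith [h1.1]
  -- For `m > 1` the claimed lower bound is negative.
  · rcases le_or_gt m 1 with hm1 | hm1
    · have h2 : ‖D.lam k‖ / P ≤ m + (D.η + D.ε) / k ^ 2 := by
        calc ‖D.lam k‖ / P ≤ (k + (D.η + D.ε) / k) / P := by
              gcongr; exact hD.norm_lam_le hk
          _ = k / P + k / P * ((D.η + D.ε) / k ^ 2) := by field_simp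
          _ ≤ m + 1 * ((D.η + D.ε) / k ^ 2) := by
              gcongr; exact hm.trans hm1
          _ = _ := by ring
      have e : 2 * (D.η + D.ε) / k ^ 2 = 2 * ((D.η + D.ε) / k ^ 2) := by ring
      rw [e]
      linarith [h1.2]
    · linarith [norm_nonneg (refl (D.lam k) P)]

/-- Upper bound for the contraction at a single frequency. -/
theorem Admissible.one_sub_rate_le (hD : D.Admissible) : ∃ C : ℝ, 0 < C ∧
    ∀ (σ : ℕ → Bool) (δ p₁ q₁ p₂ q₂ k m₁ m₂ : ℝ), 0 ≤ δ → D.kmin ≤ k → 0 < p₁ + k ^ 2 * q₁ →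
      0 < p₂ + k ^ 2 * q₂ → 0 ≤ m₁ → 0 ≤ m₂ →
      ((p₁ + k ^ 2 * q₁) / k ≤ m₁ ∨ k / (p₁ + k ^ 2 * q₁) ≤ m₁) →
      ((p₂ + k ^ 2 * q₂) / k ≤ m₂ ∨ k / (p₂ + k ^ 2 * q₂) ≤ m₂) →
      1 - D.rate σ δ p₁ q₁ p₂ q₂ k ≤
        (m₁ + m₂ + k * δ) + 4 * (m₁ + m₂ + k * δ) ^ 2 + C / k ^ 2 := by
  obtain ⟨C₀, hC₀, hrate⟩ := hD.rate_sq_approx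
  have hΛ : 0 ≤ D.η + D.ε := add_nonneg hD.eta_nonneg hD.eps_nonneg
  have hLp := hD.L_pos
  have hkm := hD.kmin_pos
  set Λ := D.η + D.ε with hΛ'
  set C₁ : ℝ := 6 * Λ + 4 * C₀ / D.L ^ 2 with hC₁
  have hC₁0 : 0 < C₁ := by positivity
  refine ⟨C₁ / 2 + C₁ ^ 2 / D.kmin ^ 2, by positivity,
    fun σ δ p₁ q₁ p₂ q₂ k m₁ m₂ hδ hk h₁ h₂ hm₁ hm₂ hc₁ hc₂ => ?_⟩
  have hk0 := hkm.trans_le hk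
  have hρ := rate_nonneg (D := D) (σ := σ) (p₁ := p₁) (q₁ := q₁) (p₂ := p₂) (q₂ := q₂) δ k
  set s := m₁ + m₂ + k * δ with hs
  have hkδ : 0 ≤ k * δ := by positivity
  have hs0 : 0 ≤ s := by positivity
  -- For `kδ > 1` the right-hand side already exceeds `1`; otherwise `δ Re λ` may be replaced by
  -- `kδ` at the cost of a term `1/k²`.
  rcases lt_or_ge 1 (k * δ) with hbig | hsmall
  · have : 0 ≤ (C₁ / 2 + C₁ ^ 2 / D.kmin ^ 2) / k ^ 2 := by positivity
    nlinarith [sq_nonneg s]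
  have a1 := hD.le_norm_refl hk h₁ hc₁
  have a2 := hD.le_norm_refl hk h₂ hc₂
  have hz := hD.lam_re_pos hk
  have hx : (D.lam k).re * δ ≤ k * δ + Λ / k ^ 2 := by
    have h3 := (Complex.re_le_norm _).trans (hD.norm_lam_le hk)
    calc (D.lam k).re * δ ≤ (k + Λ / k) * δ := mul_le_mul_of_nonneg_right h3 hδ
      _ = k * δ + Λ / k ^ 2 * (k * δ) := by field_simp
      _ ≤ k * δ + Λ / k ^ 2 * 1 := by gcongr
      _ = _ := by ring
  have a3 : 1 - (2 * (k * δ) + 2 * Λ / k ^ 2) ≤ Real.exp (-(2 * ((D.lam k).re * δ))) := by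
    have h4 := Real.add_one_le_exp (-(2 * ((D.lam k).re * δ)))
    have e : 2 * Λ / k ^ 2 = 2 * (Λ / k ^ 2) := by ring
    rw [e]; linarith
  have a3' : Real.exp (-(2 * ((D.lam k).re * δ))) ≤ 1 := by
    rw [Real.exp_le_one_iff]
    have := mul_nonneg hz.le hδ
    linarith
  have h5 := one_sub_sum_le_mul (norm_refl_le_one hz h₁) (norm_refl_le_one hz h₂) a3'
    (norm_nonneg _) a1 a2 a3
  rw [← norm_mul] at h5
  have h6 := (abs_le.1 (hrate σ δ p₁ q₁ p₂ q₂ k hδ hk h₁ h₂)).1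
  have h7 : C₀ * (‖1 - D.reflProd p₁ q₁ p₂ q₂ k * Complex.exp (-(D.lam k * δ)) ^ 2‖ *
      Real.exp (-(k * D.L))) ≤ 4 * C₀ / D.L ^ 2 / k ^ 2 := by
    calc _ ≤ C₀ * (2 * (2 / (k * D.L) ^ 2)) := by
          gcongr
          · exact hD.norm_gap_le hk hδ h₁ h₂
          · exact exp_neg_le_two_div_sq (by positivity)
      _ = _ := by field_simp; ring
  have h8 : 1 - (2 * s + C₁ / k ^ 2) ≤ D.rate σ δ p₁ q₁ p₂ q₂ k ^ 2 := by
    have e : C₁ / k ^ 2 = 3 * (2 * Λ / k ^ 2) + 4 * C₀ / D.L ^ 2 / k ^ 2 := by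
      rw [hC₁]; field_simp; ring
    rw [e, hs]
    rw [reflProd] at h6 h7
    linarith
  have h9 := one_sub_le_of_sq hρ (by positivity) h8
  have h10 : (2 * s + C₁ / k ^ 2) ^ 2 ≤ 8 * s ^ 2 + 2 * (C₁ / k ^ 2) ^ 2 := by
    nlinarith [sq_nonneg (2 * s - C₁ / k ^ 2)]
  have h11 : (C₁ / k ^ 2) ^ 2 ≤ C₁ ^ 2 / D.kmin ^ 2 / k ^ 2 := by
    have : (C₁ / k ^ 2) ^ 2 = C₁ ^ 2 / k ^ 2 / k ^ 2 := by field_simp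
    rw [this]
    gcongr
  have e2 : (C₁ / 2 + C₁ ^ 2 / D.kmin ^ 2) / k ^ 2 =
      C₁ / k ^ 2 / 2 + C₁ ^ 2 / D.kmin ^ 2 / k ^ 2 := by ring
  rw [e2]
  linarith

end Problem

end OSM

/-! ### Low frequencies: reduction to the path matrix -/

namespace OSM

namespace Problem

variable {D : Problem} {σ : ℕ → Bool} {p₁ q₁ p₂ q₂ : ℝ}

/-- The coefficients of the low-frequency limit `θ R - θ'` of the coupling matrix. -/
noncomputable def offCoef (D : Problem) (k : ℝ) : ℂ :=
  Complex.exp (-(D.lam k * D.L)) / (1 - Complex.exp (-(D.lam k * D.L)) ^ 2)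

/-- The diagonal coefficient of the low-frequency limit. -/
noncomputable def diagCoef (D : Problem) (k : ℝ) : ℂ :=
  2 * Complex.exp (-(D.lam k * D.L)) ^ 2 / (1 - Complex.exp (-(D.lam k * D.L)) ^ 2)

theorem Admissible.le_norm_one_sub (hD : D.Admissible) {k : ℝ} (hk : D.kmin ≤ k) :
    1 - Real.exp (-(D.kmin * D.L)) ^ 2 ≤ ‖1 - Complex.exp (-(D.lam k * D.L)) ^ 2‖ := by
  have h1 := norm_sub_norm_le (1 : ℂ) (Complex.exp (-(D.lam k * D.L)) ^ 2)
  rw [norm_one, norm_pow] at h1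
  have h2 := pow_le_pow_left₀ (norm_nonneg _) (hD.norm_exp_le_kmin hk) 2
  linarith

theorem Admissible.one_sub_exp_pos (hD : D.Admissible) :
    0 < 1 - Real.exp (-(D.kmin * D.L)) ^ 2 := by
  have h1 := hD.exp_kmin_lt_one
  have h0 := Real.exp_pos (-(D.kmin * D.L))
  nlinarith

theorem Admissible.norm_coef_le (hD : D.Admissible) {k : ℝ} (hk : D.kmin ≤ k) :
    ‖D.offCoef k‖ ≤ 2 / (1 - Real.exp (-(D.kmin * D.L)) ^ 2) ∧
    ‖D.diagCoef k‖ ≤ 2 / (1 - Real.exp (-(D.kmin * D.L)) ^ 2) := by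
  have h1 := hD.le_norm_one_sub hk
  have h0 := hD.one_sub_exp_pos
  have h2 : ‖Complex.exp (-(D.lam k * D.L))‖ ≤ 1 :=
    (hD.norm_exp_le_kmin hk).trans hD.exp_kmin_lt_one.le
  constructor
  · rw [offCoef, norm_div]
    exact div_le_div₀ (by norm_num) (by linarith) h0 h1
  · rw [diagCoef, norm_div, norm_mul, norm_pow, Complex.norm_ofNat]
    refine div_le_div₀ (by norm_num) ?_ h0 h1
    have := pow_le_one₀ (n := 2) (norm_nonneg _) h2
    linarith

theorem Admissible.offCoef_ne_zero (hD : D.Admissible) {k : ℝ} (hk : D.kmin ≤ k) :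
    D.offCoef k ≠ 0 := by
  refine div_ne_zero (Complex.exp_ne_zero _) fun h => ?_
  have h1 := hD.le_norm_one_sub hk
  rw [h, norm_zero] at h1
  linarith [hD.one_sub_exp_pos]

/-- Identifies the first-order decay of the Rayleigh quotient `2r` of the path matrix with the mode
rate at cosine `r`. -/
theorem Admissible.re_lam_mul (hD : D.Admissible) {k : ℝ} (hk : D.kmin ≤ k) (r : ℝ) :
    (D.lam k * (1 + D.diagCoef k - D.offCoef k * (2 * r : ℝ))).re = D.modeRate k r := by
  rw [modeRate]
  congr 1
  have h0 : 1 - Complex.exp (-(D.lam k * D.L)) ^ 2 ≠ 0 := fun h => by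
    have h1 := hD.le_norm_one_sub hk
    rw [h, norm_zero] at h1
    linarith [hD.one_sub_exp_pos]
  rw [diagCoef, offCoef]
  push_cast
  field_simp
  ring

set_option maxHeartbeats 1600000 in
/-- First-order expansion of the gap and of the coupling matrix for large transmission
parameters. -/
theorem Admissible.lowFreq_expansion (hD : D.Admissible) (k₀ : ℝ) : ∃ C : ℝ, 0 < C ∧
    ∀ (σ : ℕ → Bool) (δ p₁ q₁ p₂ q₂ k : ℝ), 0 ≤ δ → δ ≤ 1 → D.kmin ≤ k → k ≤ k₀ →
      0 < p₁ + k ^ 2 * q₁ → 0 < p₂ + k ^ 2 * q₂ →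
      ∀ ω : ℝ, ω = 1 / (p₁ + k ^ 2 * q₁) + 1 / (p₂ + k ^ 2 * q₂) → ω ≤ 1 →
      ‖D.lam k‖ ≤ C ∧
      ‖1 - D.reflProd p₁ q₁ p₂ q₂ k * Complex.exp (-(D.lam k * δ)) ^ 2 - 2 * D.lam k * ω‖ ≤
        C * (ω ^ 2 + δ) ∧
      ‖1 - D.reflProd p₁ q₁ p₂ q₂ k * Complex.exp (-(D.lam k * δ)) ^ 2‖ ≤ C * (ω + δ) ∧
      MatBound (D.coupling σ δ p₁ q₁ p₂ q₂ k -
        (D.offCoef k • pathMat (D.J - 1) ℂ - D.diagCoef k • 1)) (C * (ω + δ)) := by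
  have hΛ0 : 0 ≤ D.η + D.ε := add_nonneg hD.eta_nonneg hD.eps_nonneg
  have hkm := hD.kmin_pos
  set Λ : ℝ := |k₀| + (D.η + D.ε) / D.kmin + 1 with hΛ
  have hΛp : 1 ≤ Λ := by
    have := abs_nonneg k₀
    have : 0 ≤ (D.η + D.ε) / D.kmin := by positivity
    linarith
  have hd := hD.one_sub_exp_pos
  set d := 1 - Real.exp (-(D.kmin * D.L)) ^ 2 with hd'
  set c : ℝ := (Fintype.card (Fin (D.J - 1) ⊕ Fin (D.J - 1)) : ℝ) with hc
  have hc0 : 0 ≤ c := Nat.cast_nonneg _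
  set C₁ : ℝ := 4 * Λ + 3 * Λ ^ 2 with hC₁
  set C₂ : ℝ := 2 * Λ + C₁ with hC₂
  have hC₁0 : 0 < C₁ := by positivity
  refine ⟨C₂ + c * (32 * Λ + C₂) / d ^ 2, by positivity, ?_⟩
  intro σ δ p₁ q₁ p₂ q₂ k hδ hδ1 hk hk₀ h₁ h₂ ω hω hω1
  have hk0 := hkm.trans_le hk
  have hz := hD.lam_re_pos hk
  have hn : ‖D.lam k‖ ≤ Λ := by
    refine (hD.norm_lam_le hk).trans ?_
    have : (D.η + D.ε) / k ≤ (D.η + D.ε) / D.kmin := by gcongr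
    have := le_abs_self k₀
    linarith
  set P₁ := p₁ + k ^ 2 * q₁ with hP₁
  set P₂ := p₂ + k ^ 2 * q₂ with hP₂
  have i1 : 0 < 1 / P₁ := by positivity
  have i2 : 0 < 1 / P₂ := by positivity
  have hω0 : 0 < ω := by rw [hω]; positivity
  have hF := hD.norm_exp_delta_le hk hδ
  have hF1 : ‖Complex.exp (-(D.lam k * δ)) - 1‖ ≤ 2 * Λ * δ := by
    refine (norm_exp_neg_sub_one_le ?_).trans ?_
    · rw [Complex.re_mul_ofReal]; positivity
    · rw [norm_mul, Complex.norm_real, Real.norm_of_nonneg hδ, mul_assoc]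
      gcongr
  set F := Complex.exp (-(D.lam k * δ)) with hFdef
  set u₁ := refl (D.lam k) P₁ + 1 with hu₁
  set u₂ := refl (D.lam k) P₂ + 1 with hu₂
  have b1 : ‖u₁‖ ≤ 2 * Λ * (1 / P₁) := by
    refine (norm_refl_add_one_le hz h₁).trans ?_
    rw [mul_one_div]; gcongr
  have b2 : ‖u₂‖ ≤ 2 * Λ * (1 / P₂) := by
    refine (norm_refl_add_one_le hz h₂).trans ?_
    rw [mul_one_div]; gcongr
  have hsq : ∀ P : ℝ, 2 * ‖D.lam k‖ ^ 2 / P ^ 2 ≤ 2 * Λ ^ 2 * (1 / P) ^ 2 := fun P => by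
    rw [one_div, inv_pow, ← div_eq_mul_inv]; gcongr
  have c1 := (norm_refl_add_one_sub_le hz h₁).trans (hsq P₁)
  have c2 := (norm_refl_add_one_sub_le hz h₂).trans (hsq P₂)
  have hG := hD.norm_reflProd_le hk h₁ h₂
  have hGeq : D.reflProd p₁ q₁ p₂ q₂ k = (u₁ - 1) * (u₂ - 1) := by
    rw [reflProd, hu₁, hu₂]; ring
  have hF2 : ‖1 - F ^ 2‖ ≤ 4 * Λ * δ := by
    have : 1 - F ^ 2 = -((F - 1) * (F + 1)) := by ring
    rw [this, norm_neg, norm_mul]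
    have h3 : ‖F + 1‖ ≤ 2 := (norm_add_le _ _).trans (by rw [norm_one]; linarith)
    calc _ ≤ 2 * Λ * δ * 2 := mul_le_mul hF1 h3 (norm_nonneg _) (by positivity)
      _ = _ := by ring
  have hgap : ‖1 - D.reflProd p₁ q₁ p₂ q₂ k * F ^ 2 - 2 * D.lam k * ω‖ ≤ C₁ * (ω ^ 2 + δ) := by
    -- With `G = (u₁ - 1)(u₂ - 1)` one has `1 - G = u₁ + u₂ - u₁u₂`. The linear terms give `2λω`;
    -- the product and the expansion errors are `O(ω²)`, and the overlap is `O(δ)`.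
    have e : 1 - D.reflProd p₁ q₁ p₂ q₂ k * F ^ 2 - 2 * D.lam k * ω =
        D.reflProd p₁ q₁ p₂ q₂ k * (1 - F ^ 2) + (u₁ - 2 * D.lam k / P₁) +
          (u₂ - 2 * D.lam k / P₂) - u₁ * u₂ := by
      rw [hω, hGeq]; push_cast; ring
    rw [e]
    refine (norm_sub_le _ _).trans ?_
    have t1 := norm_add_le (D.reflProd p₁ q₁ p₂ q₂ k * (1 - F ^ 2) + (u₁ - 2 * D.lam k / P₁))
      (u₂ - 2 * D.lam k / P₂)
    have t2 := norm_add_le (D.reflProd p₁ q₁ p₂ q₂ k * (1 - F ^ 2)) (u₁ - 2 * D.lam k / P₁)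
    have t3 : ‖D.reflProd p₁ q₁ p₂ q₂ k * (1 - F ^ 2)‖ ≤ 1 * (4 * Λ * δ) := by
      rw [norm_mul]; exact mul_le_mul hG hF2 (norm_nonneg _) zero_le_one
    have t4 : ‖u₁ * u₂‖ ≤ 2 * Λ * (1 / P₁) * (2 * Λ * (1 / P₂)) := by
      rw [norm_mul]; exact mul_le_mul b1 b2 (norm_nonneg _) (by positivity)
    have hid : ω ^ 2 = (1 / P₁) ^ 2 + 2 * (1 / P₁ * (1 / P₂)) + (1 / P₂) ^ 2 := by rw [hω]; ring
    have hab : 4 * (1 / P₁ * (1 / P₂)) ≤ ω ^ 2 := by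
      rw [hid]; nlinarith only [sq_nonneg (1 / P₁ - 1 / P₂)]
    have hcd : (1 / P₁) ^ 2 + (1 / P₂) ^ 2 ≤ ω ^ 2 := by
      rw [hid]; nlinarith only [mul_pos i1 i2]
    have hΛ2 : 0 ≤ Λ ^ 2 := by positivity
    have k1 : 2 * Λ * (1 / P₁) * (2 * Λ * (1 / P₂)) ≤ Λ ^ 2 * ω ^ 2 := by
      calc _ = Λ ^ 2 * (4 * (1 / P₁ * (1 / P₂))) := by ring
        _ ≤ _ := mul_le_mul_of_nonneg_left hab hΛ2
    have k2 : 2 * Λ ^ 2 * (1 / P₁) ^ 2 + 2 * Λ ^ 2 * (1 / P₂) ^ 2 ≤ 2 * (Λ ^ 2 * ω ^ 2) := by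
      calc _ = 2 * (Λ ^ 2 * ((1 / P₁) ^ 2 + (1 / P₂) ^ 2)) := by ring
        _ ≤ _ := by gcongr
    have k3 : C₁ * (ω ^ 2 + δ) = 4 * Λ * δ + 3 * (Λ ^ 2 * ω ^ 2) + 4 * Λ * ω ^ 2 + 3 * Λ ^ 2 * δ := by
      rw [hC₁]; ring
    have k4 : 0 ≤ 4 * Λ * ω ^ 2 + 3 * Λ ^ 2 * δ := by positivity
    rw [k3]
    linarith
  have hgap2 : ‖1 - D.reflProd p₁ q₁ p₂ q₂ k * F ^ 2‖ ≤ C₂ * (ω + δ) := by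
    have t1 := norm_add_le (1 - D.reflProd p₁ q₁ p₂ q₂ k * F ^ 2 - 2 * D.lam k * ω)
      (2 * D.lam k * ω)
    rw [sub_add_cancel] at t1
    have t2 : ‖2 * D.lam k * ω‖ ≤ 2 * Λ * ω := by
      rw [norm_mul, norm_mul, Complex.norm_ofNat, Complex.norm_real, Real.norm_of_nonneg hω0.le]
      gcongr
    have t3 : C₁ * (ω ^ 2 + δ) ≤ C₁ * (ω + δ) := by
      have : ω ^ 2 ≤ ω := by nlinarith only [hω0, hω1]
      gcongr
    have t4 : 0 ≤ 2 * Λ * δ := by positivity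
    rw [hC₂]
    linarith
  have hCle : C₂ ≤ C₂ + c * (32 * Λ + C₂) / d ^ 2 := by
    have : 0 ≤ c * (32 * Λ + C₂) / d ^ 2 := by positivity
    linarith
  have hC12 : C₁ ≤ C₂ + c * (32 * Λ + C₂) / d ^ 2 := by linarith
  refine ⟨by linarith, hgap.trans (by gcongr), hgap2.trans (by gcongr), ?_⟩
  obtain ⟨hvp, hvm⟩ := twoParams_pos (σ := σ) h₁ h₂
  have hh : 0 ≤ 2 * Λ * (ω + δ) := by positivity
  have g1 : ‖u₁‖ ≤ 2 * Λ * (ω + δ) := by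
    refine b1.trans ?_
    gcongr
    rw [hω]; linarith
  have g2 : ‖u₂‖ ≤ 2 * Λ * (ω + δ) := by
    refine b2.trans ?_
    gcongr
    rw [hω]; linarith
  have hM := matBound_couplingMat_sub (N := D.J - 1) (E := Complex.exp (-(D.lam k * D.L)))
    (h := 2 * Λ * (ω + δ)) (Γ := 1 - D.reflProd p₁ q₁ p₂ q₂ k * F ^ 2) hF
    (norm_gPlus_le hz hvp) (norm_gMinus_le hz hvm) (hD.norm_exp_le_kmin hk) hD.exp_kmin_lt_one
    (hF1.trans (by gcongr; linarith))
    (fun j _ _ => by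
      rw [gPlus_twoParams]
      split_ifs
      -- On the outer boundary the reflection coefficient is exactly `-1`.
      · simpa using hh
      · exact g1
      · exact g2)
    (fun j _ _ => by
      rw [gMinus_twoParams]
      split_ifs
      · simpa using hh
      · exact g2
      · exact g1)
  refine hM.mono ?_
  rw [← hc, ← hd']
  calc c * (16 * (2 * Λ * (ω + δ)) + ‖1 - D.reflProd p₁ q₁ p₂ q₂ k * F ^ 2‖) / d ^ 2
      ≤ c * (16 * (2 * Λ * (ω + δ)) + C₂ * (ω + δ)) / d ^ 2 := by gcongr
    _ = c * (32 * Λ + C₂) / d ^ 2 * (ω + δ) := by ring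
    _ ≤ _ := by
        have : 0 ≤ C₂ * (ω + δ) := by positivity
        linarith

theorem Admissible.cast_J (hD : D.Admissible) : D.J - 1 + 1 = D.J := by
  have := hD.two_le_J
  omega

theorem sq_add_le {ω δ : ℝ} (hδ : 0 ≤ δ) (hδ1 : δ ≤ 1) : (ω + δ) * (ω + δ) ≤ 2 * (ω ^ 2 + δ) := by
  nlinarith [sq_nonneg (ω - δ)]

set_option maxHeartbeats 1600000 in
/-- At low frequencies the spectral radius is at most `1 - K ω` up to second order. -/
theorem Admissible.rate_le_lowFreq (hD : D.Admissible) (k₀ : ℝ) : ∃ C : ℝ, 0 < C ∧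
    ∀ (σ : ℕ → Bool) (δ p₁ q₁ p₂ q₂ k : ℝ), 0 ≤ δ → δ ≤ 1 → D.kmin ≤ k → k ≤ k₀ →
      0 < p₁ + k ^ 2 * q₁ → 0 < p₂ + k ^ 2 * q₂ →
      ∀ ω : ℝ, ω = 1 / (p₁ + k ^ 2 * q₁) + 1 / (p₂ + k ^ 2 * q₂) → ω ≤ 1 →
      D.rate σ δ p₁ q₁ p₂ q₂ k ≤ 1 - D.Kmode * ω + C * (ω ^ 2 + δ) := by
  have := hD.nonempty
  obtain ⟨C, hC, hexp⟩ := hD.lowFreq_expansion k₀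
  have hd := hD.one_sub_exp_pos
  set Θ := 2 / (1 - Real.exp (-(D.kmin * D.L)) ^ 2) with hΘ
  have hΘ0 : 0 < Θ := by positivity
  set n : ℝ := (Fintype.card (Fin (D.J - 1) ⊕ Fin (D.J - 1)) : ℝ) with hn
  have hn0 : 0 ≤ n := Nat.cast_nonneg _
  set M := 1 + 3 * Θ with hM
  refine ⟨C ^ 2 * M ^ 2 + C * M + C ^ 2 * n, by positivity, ?_⟩
  intro σ δ p₁ q₁ p₂ q₂ k hδ hδ1 hk hk₀ h₁ h₂ ω hω hω1
  obtain ⟨hlam, hgap, hgap2, hmat⟩ := hexp σ δ p₁ q₁ p₂ q₂ k hδ hδ1 hk hk₀ h₁ h₂ ω hω hω1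
  have hω0 : 0 < ω := by rw [hω]; positivity
  obtain ⟨A, hA, hA2⟩ := exists_rate_eq (σ := σ) hD.L_pos hδ (hD.lam_re_pos hk) h₁ h₂
  obtain ⟨ho, hdg⟩ := hD.norm_coef_le hk
  have hcos : Real.cos (Real.pi / (D.J - 1 + 1 : ℕ)) = Real.cos (Real.pi / D.J) := by
    rw [hD.cast_J]
  have hcos1 := Real.cos_le_one (Real.pi / D.J)
  have key : ∀ z ∈ spectrum ℂ (A ^ 2), ‖z‖ ≤ 1 - 2 * (D.Kmode * ω -
      (C ^ 2 * M ^ 2 + C * M + C ^ 2 * n) * (ω ^ 2 + δ)) := by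
    intro z hz
    rw [hA2] at hz
    obtain ⟨v, hv, h⟩ := exists_vector_of_mem_spectrum_affine hz
    have hp := nsq_pos hv
    have hpC : (nsq v : ℂ) ≠ 0 := by exact_mod_cast hp.ne'
    set Γ := 1 - D.reflProd p₁ q₁ p₂ q₂ k * Complex.exp (-(D.lam k * δ)) ^ 2 with hΓ
    have hGΓ : D.reflProd p₁ q₁ p₂ q₂ k * Complex.exp (-(D.lam k * δ)) ^ 2 = 1 - Γ := by
      rw [hΓ]; ring
    rw [hGΓ] at h
    set Er := D.coupling σ δ p₁ q₁ p₂ q₂ k -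
        (D.offCoef k • pathMat (D.J - 1) ℂ - D.diagCoef k • 1) with hEr
    have hsplit : D.coupling σ δ p₁ q₁ p₂ q₂ k =
        D.offCoef k • pathMat (D.J - 1) ℂ - D.diagCoef k • 1 + Er := by rw [hEr]; abel
    obtain ⟨r', hr'⟩ := pathMat_real (D.J - 1) v
    have hr'le := pathMat_norm_le (D.J - 1) v
    rw [hcos, hr', Complex.norm_real] at hr'le
    -- An eigenvector of the true matrix is used only as a test vector for the path matrix. Its
    -- quotient `2r` need not be an eigenvalue, but `|r| ≤ cos (π/J)` is enough because the mode
    -- rate is affine in `r`.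
    set r := r' / (2 * nsq v) with hr
    have hrle : |r| ≤ Real.cos (Real.pi / D.J) := by
      rw [hr, abs_div, abs_of_pos (by positivity : 0 < 2 * nsq v), div_le_iff₀ (by positivity)]
      rw [Real.norm_eq_abs] at hr'le
      linarith
    have hr'eq : r' = 2 * r * nsq v := by rw [hr]; field_simp
    set ev := (star v ⬝ᵥ Er.mulVec v) / nsq v with hev
    have hevle : ‖ev‖ ≤ n * (C * (ω + δ)) := by
      have := norm_star_dotProduct_mulVec_le (by positivity) hmat v
      rw [hev, norm_div, Complex.norm_real, Real.norm_of_nonneg hp.le, div_le_iff₀ hp]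
      exact this
    have heveq : star v ⬝ᵥ Er.mulVec v = ev * nsq v := by rw [hev]; field_simp
    have hz' : z = 1 - Γ * (1 + D.diagCoef k - D.offCoef k * (2 * r : ℝ)) + Γ * ev := by
      have h3 : star v ⬝ᵥ (D.coupling σ δ p₁ q₁ p₂ q₂ k).mulVec v =
          (D.offCoef k * (2 * r : ℝ) - D.diagCoef k + ev) * nsq v := by
        rw [hsplit, Matrix.add_mulVec, Matrix.sub_mulVec, Matrix.smul_mulVec, Matrix.smul_mulVec,
          Matrix.one_mulVec, dotProduct_add, dotProduct_sub, dotProduct_smul, dotProduct_smul,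
          star_dotProduct_self, hr', heveq, hr'eq]
        simp only [smul_eq_mul]
        push_cast; ring
      rw [h3] at h
      have h4 : z * nsq v = (1 - Γ * (1 + D.diagCoef k - D.offCoef k * (2 * r : ℝ)) + Γ * ev) *
          nsq v := by rw [h]; ring
      exact mul_right_cancel₀ hpC h4
    set Y := 1 + D.diagCoef k - D.offCoef k * (2 * r : ℝ) with hY
    have hYle : ‖Y‖ ≤ M := by
      have hr1 : ‖((2 * r : ℝ) : ℂ)‖ ≤ 2 := by
        rw [Complex.norm_real, Real.norm_eq_abs, abs_mul, abs_two]; linarith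
      have t1 : ‖D.offCoef k * (2 * r : ℝ)‖ ≤ Θ * 2 := by
        rw [norm_mul]; exact mul_le_mul ho hr1 (norm_nonneg _) hΘ0.le
      have t2 := norm_sub_le (1 + D.diagCoef k) (D.offCoef k * (2 * r : ℝ))
      have t3 := norm_add_le (1 : ℂ) (D.diagCoef k)
      rw [norm_one] at t3
      rw [hY, hM]; linarith
    have hre := hD.re_lam_mul hk r
    rw [← hY] at hre
    have hK := Kmode_le_modeRate hD.L_pos hD.Lhat_pos hD.eta_nonneg hD.eps_nonneg hk hrle
    -- The main term `w` has real part `2ω` times the mode rate, so the modulus of the eigenvalue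
    -- drops by at least `2Kω`. What is left is a first-order error times a first-order factor.
    set w := 2 * D.lam k * ω * Y with hw
    have hwre : w.re = 2 * ω * D.modeRate k r := by
      rw [← hre, hw]
      have : 2 * D.lam k * ω * Y = ((2 * ω : ℝ) : ℂ) * (D.lam k * Y) := by push_cast; ring
      rw [this, Complex.re_ofReal_mul]
    have hwn : ‖w‖ ≤ 2 * C * ω * M := by
      rw [hw, norm_mul, norm_mul, norm_mul, Complex.norm_ofNat, Complex.norm_real,
        Real.norm_of_nonneg hω0.le]
      gcongr
    have h1w := norm_one_sub_le w
    have hzz : z = (1 - w) - (Γ - 2 * D.lam k * ω) * Y + Γ * ev := by rw [hz', hw]; ring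
    have s1 := norm_add_le ((1 - w) - (Γ - 2 * D.lam k * ω) * Y) (Γ * ev)
    have s2 := norm_sub_le (1 - w) ((Γ - 2 * D.lam k * ω) * Y)
    have s3 : ‖(Γ - 2 * D.lam k * ω) * Y‖ ≤ C * (ω ^ 2 + δ) * M := by
      rw [norm_mul]; exact mul_le_mul hgap hYle (norm_nonneg _) (by positivity)
    have s4 : ‖Γ * ev‖ ≤ C * (ω + δ) * (n * (C * (ω + δ))) := by
      rw [norm_mul]; exact mul_le_mul hgap2 hevle (norm_nonneg _) (by positivity)
    have s5 : C * (ω + δ) * (n * (C * (ω + δ))) ≤ 2 * (C ^ 2 * n * (ω ^ 2 + δ)) := by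
      calc _ = C ^ 2 * n * ((ω + δ) * (ω + δ)) := by ring
        _ ≤ C ^ 2 * n * (2 * (ω ^ 2 + δ)) :=
          mul_le_mul_of_nonneg_left (sq_add_le hδ hδ1) (by positivity)
        _ = _ := by ring
    have s6 : ‖w‖ ^ 2 / 2 ≤ 2 * (C ^ 2 * M ^ 2 * (ω ^ 2 + δ)) := by
      have := pow_le_pow_left₀ (norm_nonneg _) hwn 2
      have h0 : 0 ≤ C ^ 2 * M ^ 2 * δ := by positivity
      have e : (2 * C * ω * M) ^ 2 = 4 * (C ^ 2 * M ^ 2 * ω ^ 2) := by ring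
      rw [e] at this
      have e2 : C ^ 2 * M ^ 2 * (ω ^ 2 + δ) = C ^ 2 * M ^ 2 * ω ^ 2 + C ^ 2 * M ^ 2 * δ := by ring
      rw [e2]; linarith
    have s7 : ω * D.Kmode ≤ ω * D.modeRate k r := mul_le_mul_of_nonneg_left hK hω0.le
    have s8 : 0 ≤ C * (ω ^ 2 + δ) * M := by positivity
    rw [hwre] at h1w
    rw [hzz]
    have e3 : (C ^ 2 * M ^ 2 + C * M + C ^ 2 * n) * (ω ^ 2 + δ) = C ^ 2 * M ^ 2 * (ω ^ 2 + δ) +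
      C * (ω ^ 2 + δ) * M + C ^ 2 * n * (ω ^ 2 + δ) := by ring
    rw [e3]
    linarith
  set a := D.Kmode * ω - (C ^ 2 * M ^ 2 + C * M + C ^ 2 * n) * (ω ^ 2 + δ) with ha
  obtain ⟨z, hz⟩ := spectrum.nonempty_of_isAlgClosed_of_finiteDimensional ℂ (A ^ 2)
  have h2a : 0 ≤ 1 - 2 * a := (norm_nonneg z).trans (key z hz)
  have hrate : specRad A ≤ 1 - a := by
    refine specRad_le_of_sq (by linarith) fun z hz => (key z hz).trans ?_
    nlinarith only [sq_nonneg a]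
  rw [hA]
  linarith

/-- Eigenvalue of the coupling matrix near an end of the limiting spectrum. -/
theorem Admissible.exists_eigenvalue_coupling (hD : D.Admissible) : ∃ C : ℝ, 0 < C ∧
    ∀ (Θ : Matrix (Fin (D.J - 1) ⊕ Fin (D.J - 1)) (Fin (D.J - 1) ⊕ Fin (D.J - 1)) ℂ) (b : ℝ),
      0 < b → MatBound (Θ - (D.offCoef D.kmin • pathMat (D.J - 1) ℂ - D.diagCoef D.kmin • 1)) b →
      ∀ r : ℝ, (r = Real.cos (Real.pi / D.J) ∨ r = -Real.cos (Real.pi / D.J)) →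
      ∃ y ∈ spectrum ℂ Θ, ‖y - (D.offCoef D.kmin * (2 * r : ℝ) - D.diagCoef D.kmin)‖ ≤ C * b := by
  obtain ⟨C, hC, h⟩ := exists_eigenvalue_near_top (Fin (D.J - 1) ⊕ Fin (D.J - 1))
  refine ⟨C, hC, fun Θ b hb hΘ r hr => ?_⟩
  have ho := hD.offCoef_ne_zero le_rfl
  set o := D.offCoef D.kmin
  set dg := D.diagCoef D.kmin
  set E := Θ - (o • pathMat (D.J - 1) ℂ - dg • 1) with hE
  have hJ1 : 1 ≤ D.J - 1 := by have := hD.two_le_J; omega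
  have hspec := mem_spectrum_pathMat (D.J - 1) hJ1
  have hcos : Real.cos (Real.pi / (D.J - 1 + 1 : ℕ)) = Real.cos (Real.pi / D.J) := by
    rw [hD.cast_J]
  have hR := pathMat_rayleigh (D.J - 1)
  have hR' := neg_pathMat_rayleigh (D.J - 1)
  rw [hcos] at hspec hR hR'
  have hon : 0 < ‖o‖ := norm_pos_iff.2 ho
  -- The coefficient of the path matrix is complex, so the limit itself is not Hermitian. The
  -- coefficient `t` is factored out, leaving a Hermitian matrix with perturbation `t⁻¹E`; the two
  -- factors of modulus `‖t‖` cancel in the final bound. The two ends of the spectrum are the tops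
  -- of the path matrix and of its negative.
  have gen : ∀ (R : Matrix (Fin (D.J - 1) ⊕ Fin (D.J - 1)) (Fin (D.J - 1) ⊕ Fin (D.J - 1)) ℂ)
      (t : ℂ), t ≠ 0 → ‖t‖ = ‖o‖ → t • R = o • pathMat (D.J - 1) ℂ →
      RayleighLE R (2 * Real.cos (Real.pi / D.J)) →
      ((2 * Real.cos (Real.pi / D.J) : ℝ) : ℂ) ∈ spectrum ℂ R →
      ∃ y ∈ spectrum ℂ Θ, ‖y - (t * (2 * Real.cos (Real.pi / D.J) : ℝ) - dg)‖ ≤ C * b := by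
    intro R t ht htn hRe hRay hmem
    obtain ⟨μ, hμ, hle⟩ := h R (t⁻¹ • E) _ (b / ‖o‖) hRay hmem (by positivity) fun i j => by
      rw [Matrix.smul_apply, norm_smul, norm_inv, htn, div_eq_inv_mul]
      exact mul_le_mul_of_nonneg_left (hΘ i j) (by positivity)
    have hΘeq : Θ = (-dg) • 1 + t • (R + t⁻¹ • E) := by
      rw [smul_add, smul_smul, mul_inv_cancel₀ ht, one_smul, hRe, hE, neg_smul]
      abel
    refine ⟨-dg + t * μ, ?_, ?_⟩
    · rw [hΘeq]; exact mem_spectrum_affine hμ _ _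
    · have e : -dg + t * μ - (t * (2 * Real.cos (Real.pi / D.J) : ℝ) - dg) =
          t * (μ - (2 * Real.cos (Real.pi / D.J) : ℝ)) := by ring
      rw [e, norm_mul, htn]
      calc ‖o‖ * ‖μ - (2 * Real.cos (Real.pi / D.J) : ℝ)‖ ≤ ‖o‖ * (C * (b / ‖o‖)) := by gcongr
        _ = C * b := by field_simp
  rcases hr with rfl | rfl
  · exact gen _ o ho rfl rfl hR hspec.1
  · obtain ⟨y, hy, hle⟩ := gen (-pathMat (D.J - 1) ℂ) (-o) (neg_ne_zero.2 ho) (norm_neg _)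
      (by rw [smul_neg, neg_smul, neg_neg]) hR' hspec.2
    refine ⟨y, hy, ?_⟩
    have e : o * ((2 * -Real.cos (Real.pi / D.J) : ℝ) : ℂ) - dg =
        -o * ((2 * Real.cos (Real.pi / D.J) : ℝ) : ℂ) - dg := by push_cast; ring
    rw [e]
    exact hle

set_option maxHeartbeats 1600000 in
/-- At the lowest frequency the spectral radius is at least `1 - K ω` up to second order. -/
theorem Admissible.one_sub_rate_kmin_le (hD : D.Admissible) : ∃ C : ℝ, 0 < C ∧
    ∀ (σ : ℕ → Bool) (δ p₁ q₁ p₂ q₂ : ℝ), 0 < δ → δ ≤ 1 →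
      0 < p₁ + D.kmin ^ 2 * q₁ → 0 < p₂ + D.kmin ^ 2 * q₂ →
      ∀ ω : ℝ, ω = 1 / (p₁ + D.kmin ^ 2 * q₁) + 1 / (p₂ + D.kmin ^ 2 * q₂) →
      1 - D.rate σ δ p₁ q₁ p₂ q₂ D.kmin ≤ D.Kmode * ω + C * (ω ^ 2 + δ) := by
  obtain ⟨C, hC, hexp⟩ := hD.lowFreq_expansion D.kmin
  obtain ⟨C', hC', heig⟩ := hD.exists_eigenvalue_coupling
  have hd := hD.one_sub_exp_pos
  set Θ := 2 / (1 - Real.exp (-(D.kmin * D.L)) ^ 2) with hΘ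
  have hΘ0 : 0 < Θ := by positivity
  set M := 1 + 3 * Θ with hM
  have hKpos := Kmode_pos hD.L_pos hD.Lhat_pos hD.eta_nonneg hD.eps_nonneg
  set B := C * M + 2 * (C ^ 2 * C') with hB
  have hB0 : 0 < B := by positivity
  refine ⟨1 + B + (2 * D.Kmode + B) ^ 2, by positivity, ?_⟩
  intro σ δ p₁ q₁ p₂ q₂ hδ hδ1 h₁ h₂ ω hω
  have hω0 : 0 < ω := by rw [hω]; positivity
  have hρ := rate_nonneg (D := D) (σ := σ) (p₁ := p₁) (q₁ := q₁) (p₂ := p₂) (q₂ := q₂) δ D.kmin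
  -- For `ω > 1` the expansion is not available, but the right-hand side is at least `1`.
  rcases lt_or_ge 1 ω with hω1 | hω1
  · have h1 : 1 ≤ ω ^ 2 + δ := by nlinarith only [hω1, hδ]
    have h2 : 1 ≤ 1 + B + (2 * D.Kmode + B) ^ 2 := by
      have : 0 ≤ (2 * D.Kmode + B) ^ 2 := sq_nonneg _
      linarith
    have h3 : 0 < D.Kmode * ω := by positivity
    nlinarith only [mul_le_mul h1 h2 zero_le_one (zero_le_one.trans h1), h3, hρ]
  obtain ⟨hlam, hgap, hgap2, hmat⟩ := hexp σ δ p₁ q₁ p₂ q₂ D.kmin hδ.le hδ1 le_rfl le_rfl h₁ h₂ ω hω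
    hω1
  obtain ⟨A, hA, hA2⟩ := exists_rate_eq (σ := σ) hD.L_pos hδ.le (hD.lam_re_pos le_rfl) h₁ h₂
  obtain ⟨ho, hdg⟩ := hD.norm_coef_le (le_refl D.kmin)
  have hcos1 := Real.abs_cos_le_one (Real.pi / D.J)
  -- The end of the spectrum belonging to the slowest mode, where an actual eigenvalue is required.
  obtain ⟨r, hr, hrK⟩ : ∃ r : ℝ, (r = Real.cos (Real.pi / D.J) ∨ r = -Real.cos (Real.pi / D.J)) ∧
      D.Kmode = D.modeRate D.kmin r := by
    rw [Kmode, modeConst_eq, modeConst_eq]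
    rcases min_choice (D.modeRate D.kmin (Real.cos (Real.pi / D.J)))
      (D.modeRate D.kmin (-Real.cos (Real.pi / D.J))) with h | h
    · exact ⟨_, Or.inl rfl, h⟩
    · exact ⟨_, Or.inr rfl, h⟩
  have hr1 : |r| ≤ 1 := by
    rcases hr with rfl | rfl
    · exact hcos1
    · rwa [abs_neg]
  obtain ⟨y, hy, hyle⟩ := heig _ (C * (ω + δ)) (by positivity) hmat r hr
  set Γ := 1 - D.reflProd p₁ q₁ p₂ q₂ D.kmin * Complex.exp (-(D.lam D.kmin * δ)) ^ 2 with hΓ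
  have hGΓ : D.reflProd p₁ q₁ p₂ q₂ D.kmin * Complex.exp (-(D.lam D.kmin * δ)) ^ 2 = 1 - Γ := by
    rw [hΓ]; ring
  rw [hGΓ] at hA2
  have hz := mem_spectrum_affine hy (1 - Γ) Γ
  rw [← hA2] at hz
  have hzle := norm_le_specRad_sq hz
  rw [← hA] at hzle
  set Y := 1 + D.diagCoef D.kmin - D.offCoef D.kmin * (2 * r : ℝ) with hY
  have hYle : ‖Y‖ ≤ M := by
    have hr1 : ‖((2 * r : ℝ) : ℂ)‖ ≤ 2 := by
      rw [Complex.norm_real, Real.norm_eq_abs, abs_mul, abs_two]; linarith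
    have t1 : ‖D.offCoef D.kmin * (2 * r : ℝ)‖ ≤ Θ * 2 := by
      rw [norm_mul]; exact mul_le_mul ho hr1 (norm_nonneg _) hΘ0.le
    have t2 := norm_sub_le (1 + D.diagCoef D.kmin) (D.offCoef D.kmin * (2 * r : ℝ))
    have t3 := norm_add_le (1 : ℂ) (D.diagCoef D.kmin)
    rw [norm_one] at t3
    rw [hY, hM]; linarith
  set ev := y - (D.offCoef D.kmin * (2 * r : ℝ) - D.diagCoef D.kmin) with hev
  set w := 2 * D.lam D.kmin * ω * Y with hw
  have hwre : w.re = 2 * ω * D.Kmode := by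
    rw [hrK, ← hD.re_lam_mul le_rfl r, ← hY, hw]
    have : 2 * D.lam D.kmin * ω * Y = ((2 * ω : ℝ) : ℂ) * (D.lam D.kmin * Y) := by push_cast; ring
    rw [this, Complex.re_ofReal_mul]
  have hzz : 1 - w = (1 - Γ + Γ * y) + ((Γ - 2 * D.lam D.kmin * ω) * Y - Γ * ev) := by
    rw [hw, hev, hY]; ring
  have s0 : 1 - 2 * ω * D.Kmode ≤ ‖1 - w‖ := by
    have := Complex.re_le_norm (1 - w)
    rwa [Complex.sub_re, Complex.one_re, hwre] at this
  have s1 := norm_add_le (1 - Γ + Γ * y) ((Γ - 2 * D.lam D.kmin * ω) * Y - Γ * ev)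
  have s2 := norm_sub_le ((Γ - 2 * D.lam D.kmin * ω) * Y) (Γ * ev)
  have s3 : ‖(Γ - 2 * D.lam D.kmin * ω) * Y‖ ≤ C * (ω ^ 2 + δ) * M := by
    rw [norm_mul]; exact mul_le_mul hgap hYle (norm_nonneg _) (by positivity)
  have s4 : ‖Γ * ev‖ ≤ C * (ω + δ) * (C' * (C * (ω + δ))) := by
    rw [norm_mul]; exact mul_le_mul hgap2 hyle (norm_nonneg _) (by positivity)
  have s5 : C * (ω + δ) * (C' * (C * (ω + δ))) ≤ 2 * (C ^ 2 * C') * (ω ^ 2 + δ) := by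
    calc _ = C ^ 2 * C' * ((ω + δ) * (ω + δ)) := by ring
      _ ≤ C ^ 2 * C' * (2 * (ω ^ 2 + δ)) :=
        mul_le_mul_of_nonneg_left (sq_add_le hδ.le hδ1) (by positivity)
      _ = _ := by ring
  have s6 : B * (ω ^ 2 + δ) = C * (ω ^ 2 + δ) * M + 2 * (C ^ 2 * C') * (ω ^ 2 + δ) := by
    rw [hB]; ring
  have s7 : 1 - (2 * D.Kmode * ω + B * (ω ^ 2 + δ)) ≤ D.rate σ δ p₁ q₁ p₂ q₂ D.kmin ^ 2 := by
    rw [hzz] at s0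
    rw [s6]
    linarith
  have s8 := one_sub_le_of_sq hρ (by positivity) s7
  have hx2 : (2 * D.Kmode * ω + B * (ω ^ 2 + δ)) ^ 2 ≤ 2 * ((2 * D.Kmode + B) ^ 2 * (ω ^ 2 + δ)) := by
    have h1 : 2 * D.Kmode * ω + B * (ω ^ 2 + δ) ≤ (2 * D.Kmode + B) * (ω + δ) := by
      have : ω ^ 2 ≤ ω := by nlinarith only [hω0, hω1]
      have h2 : B * (ω ^ 2 + δ) ≤ B * (ω + δ) := by gcongr
      have h3 : 0 ≤ 2 * D.Kmode * δ := by positivity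
      linarith
    calc _ ≤ ((2 * D.Kmode + B) * (ω + δ)) ^ 2 := pow_le_pow_left₀ (by positivity) h1 2
      _ = (2 * D.Kmode + B) ^ 2 * ((ω + δ) * (ω + δ)) := by ring
      _ ≤ (2 * D.Kmode + B) ^ 2 * (2 * (ω ^ 2 + δ)) :=
        mul_le_mul_of_nonneg_left (sq_add_le hδ.le hδ1) (sq_nonneg _)
      _ = _ := by ring
  have s9 : 0 ≤ (1 + B / 2) * (ω ^ 2 + δ) := by positivity
  linarith

end Problem

end OSM

/-! ### Zero chains: the scales of the zeros -/

namespace OSM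

theorem eventually_mul_lt (A : ℝ) {b : ℝ} (hb : 0 < b) : ∀ᶠ τ in 𝓝[>] (0 : ℝ), A * τ < b := by
  have h : Tendsto (fun τ : ℝ => A * τ) (𝓝[>] 0) (𝓝 0) := by
    have : Tendsto (fun τ : ℝ => A * τ) (𝓝 0) (𝓝 (A * 0)) := tendsto_id.const_mul A
    rw [mul_zero] at this
    exact this.mono_left nhdsWithin_le_nhds
  exact h.eventually_lt_const hb

/-- The information on the gain `E = 1 - ρ` of a transmission condition whose symbol has the zeros
and poles `Z 0 ≤ … ≤ Z (n - 1)`, each with multiplicity `w`, for the overlap `τ ^ (2 n + 1)`. -/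
structure ZeroChain (n : ℕ) (w K C c k₁ c₀ τ : ℝ) (Z : ℕ → ℝ) (E : ℝ) : Prop where
  pos : ∀ j, 0 < Z j
  mono : ∀ i j, i ≤ j → j < n → Z i ≤ Z j
  low : E ≤ w * K * ∑ j ∈ Finset.range n, 1 / Z j +
    C * ((∑ j ∈ Finset.range n, 1 / Z j) ^ 2 + τ ^ (2 * n + 1))
  test : ∀ k, k₁ ≤ k → k * τ ^ (2 * n + 1) ≤ c → ∀ m : ℕ → ℝ, (∀ j < n, 0 ≤ m j) →
    (∀ j < n, Z j ≤ m j * k ∨ k ≤ m j * Z j) → ∀ s : ℝ,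
      s = w * ∑ j ∈ Finset.range n, m j + k * τ ^ (2 * n + 1) → E ≤ s + 4 * s ^ 2 + C / k ^ 2
  gain : c₀ * τ ≤ E

namespace ZeroChain

variable {n : ℕ} {w K C c k₁ c₀ : ℝ}

theorem freq_mul {κ τ : ℝ} (hτ : 0 < τ) {i : ℕ} (hi : i ≤ n) :
    κ / τ ^ (2 * i) * τ ^ (2 * n + 1) = κ * τ * (τ ^ 2) ^ (n - i) := by
  obtain ⟨d, rfl⟩ := Nat.exists_eq_add_of_le hi
  rw [Nat.add_sub_cancel_left, div_mul_eq_mul_div, div_eq_iff (by positivity), ← pow_mul]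
  ring

theorem le_freq {κ τ : ℝ} (hκ : 0 < κ) (hτ : 0 < τ) (hτ1 : τ ≤ 1) {i : ℕ} (hi : 1 ≤ i) :
    κ / τ ^ 2 ≤ κ / τ ^ (2 * i) :=
  div_le_div_of_nonneg_left hκ.le (by positivity) (pow_le_pow_of_le_one hτ.le hτ1 (by omega))

theorem freq_mul_le {κ τ : ℝ} (hκ : 0 < κ) (hτ : 0 < τ) (hτ1 : τ ≤ 1) {i : ℕ} (hi : i < n) :
    κ / τ ^ (2 * i) * τ ^ (2 * n + 1) ≤ κ * τ * τ ^ 2 := by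
  rw [freq_mul hτ hi.le, ← pow_mul]
  exact mul_le_mul_of_nonneg_left (pow_le_pow_of_le_one hτ.le hτ1 (by omega)) (by positivity)

/-- At the frequency `κ / τ^(2i)` the overlap contributes at most `c₀τ/8`. If all zeros were further
than a factor `aτ` away, with `a = c₀/(8wn)`, they would contribute at most another `c₀τ/8`, and the
gain `c₀τ` could not be reached. For `i = n` the overlap itself is of order `τ`, hence the smallness
of `κ`. -/
theorem exists_zero_near (hw : 0 < w) (hC : 0 ≤ C) (hc : 0 < c) (hc₀ : 0 < c₀) {κ : ℝ}
    (hκ : 0 < κ) : ∀ᶠ τ in 𝓝[>] (0 : ℝ), ∀ Z E, ZeroChain n w K C c k₁ c₀ τ Z E →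
      ∀ i, 1 ≤ i → i ≤ n → (i = n → κ ≤ c₀ / 8) →
      ∃ j < n, c₀ / (8 * w * n) * τ * (κ / τ ^ (2 * i)) < Z j ∧
        c₀ / (8 * w * n) * τ * Z j < κ / τ ^ (2 * i) := by
  filter_upwards [self_mem_nhdsWithin, eventually_mul_lt 1 one_pos, eventually_mul_lt k₁ hκ,
    eventually_mul_lt κ hc, eventually_mul_lt κ (by positivity : 0 < c₀ / 8),
    eventually_mul_lt c₀ one_pos, eventually_mul_lt (C / κ ^ 2) (by positivity : 0 < c₀ / 4)]
    with τ hτ e1 e2 e3 e4 e5 e6 Z E h i hi hin hilast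
  have hτ : 0 < τ := hτ
  rw [one_mul] at e1
  have hτ2 : τ ^ 2 ≤ τ := by nlinarith only [hτ, e1]
  have hn : 0 < (n : ℝ) := by exact_mod_cast hi.trans hin
  by_contra! hcon
  have hk : k₁ ≤ κ / τ ^ (2 * i) := by
    refine le_trans ?_ (le_freq hκ hτ e1.le hi)
    rw [le_div_iff₀ (by positivity)]
    rcases le_or_gt k₁ 0 with h0 | h0
    · exact (mul_nonpos_of_nonpos_of_nonneg h0 (sq_nonneg τ)).trans hκ.le
    · nlinarith
  have hkd : κ / τ ^ (2 * i) * τ ^ (2 * n + 1) ≤ c ∧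
      κ / τ ^ (2 * i) * τ ^ (2 * n + 1) ≤ c₀ / 8 * τ := by
    rcases eq_or_lt_of_le hin with rfl | hlt
    · rw [freq_mul hτ le_rfl, Nat.sub_self, pow_zero, mul_one]
      exact ⟨e3.le, mul_le_mul_of_nonneg_right (hilast rfl) hτ.le⟩
    · have hle := freq_mul_le hκ hτ e1.le hlt
      have h1 : κ * τ * τ ^ 2 ≤ κ * τ * τ := by gcongr
      constructor <;> nlinarith [mul_pos hκ hτ]
  set k := κ / τ ^ (2 * i) with hkdef
  have hk0 : 0 < k := by positivity
  have hE := h.test k hk hkd.1 (fun _ => c₀ / (8 * w * n) * τ) (fun j _ => by positivity)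
    (fun j hj => by
      rcases le_or_gt (Z j) (c₀ / (8 * w * n) * τ * k) with h1 | h1
      · exact Or.inl h1
      · exact Or.inr (hcon j hj h1)) _ rfl
  rw [Finset.sum_const, Finset.card_range, nsmul_eq_mul] at hE
  have hs : w * (n * (c₀ / (8 * w * n) * τ)) = c₀ / 8 * τ := by field_simp
  rw [hs] at hE
  have hCk : C / k ^ 2 ≤ C / κ ^ 2 * τ * τ := by
    have h2 : C / k ^ 2 ≤ C / (κ / τ ^ 2) ^ 2 := by
      have := le_freq hκ hτ e1.le hi
      gcongr
    refine h2.trans ?_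
    have h3 : C / (κ / τ ^ 2) ^ 2 = C / κ ^ 2 * (τ ^ 2 * τ ^ 2) := by field_simp
    rw [h3, mul_assoc]
    exact mul_le_mul_of_nonneg_left (by nlinarith) (by positivity)
  have hg := h.gain
  set s := c₀ / 8 * τ + k * τ ^ (2 * n + 1) with hsdef
  have hs0 : 0 ≤ s := by positivity
  have hs1 : s ≤ c₀ / 4 * τ := by linarith [hkd.2]
  have hs2 : 4 * s ^ 2 ≤ 1 / 4 * (c₀ * τ) * (c₀ * τ) := by
    calc 4 * s ^ 2 ≤ 4 * (c₀ / 4 * τ) ^ 2 := by gcongr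
      _ = _ := by ring
  have h4 : C / κ ^ 2 * τ * τ < c₀ / 4 * τ := mul_lt_mul_of_pos_right e6 hτ
  have h5 : c₀ * τ * (c₀ * τ) ≤ c₀ * τ * 1 := by gcongr
  linarith

/-- Induction upwards. The low-frequency bound keeps `Z 0` below the scale `1/τ`. Then a frequency
is placed so far above the bound for `Z i` that the zero which must be near it has a larger index.
-/
theorem eventually_upper (hn : 1 ≤ n) (hw : 0 < w) (hK : 0 < K) (hC : 0 ≤ C) (hc : 0 < c)
    (hc₀ : 0 < c₀) (i : ℕ) (hi : i < n) : ∃ hi' : ℝ, 0 < hi' ∧ ∀ᶠ τ in 𝓝[>] (0 : ℝ), ∀ Z E,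
      ZeroChain n w K C c k₁ c₀ τ Z E → Z i ≤ hi' / τ ^ (2 * i + 1) := by
  have hn0 : 0 < (n : ℝ) := by exact_mod_cast hn
  induction i with
  | zero =>
    -- If `Z 0 > H/τ`, all `n` reciprocals are below `τ/H`. The two summands of `H` make their sum
    -- at most `τ` and its contribution to the gain at most `c₀τ/4`.
    set H : ℝ := n + 4 * w * K * n / c₀ with hH
    have hH0 : 0 < H := by positivity
    refine ⟨H, hH0, ?_⟩
    filter_upwards [self_mem_nhdsWithin, eventually_mul_lt 1 one_pos,
      eventually_mul_lt C (by positivity : 0 < c₀ / 4)] with τ hτ e1 e2 Z E h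
    have hτ : 0 < τ := hτ
    rw [one_mul] at e1
    by_contra! hcon
    rw [mul_zero, zero_add, pow_one, div_lt_iff₀ hτ] at hcon
    have hsum : ∑ j ∈ Finset.range n, 1 / Z j ≤ n * (τ / H) := by
      have : ∀ j ∈ Finset.range n, 1 / Z j ≤ τ / H := fun j hj => by
        rw [div_le_div_iff₀ (h.pos j) hH0]
        have := h.mono 0 j (Nat.zero_le _) (Finset.mem_range.1 hj)
        nlinarith
      refine (Finset.sum_le_sum this).trans ?_
      rw [Finset.sum_const, Finset.card_range, nsmul_eq_mul]
    have hlow := h.low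
    set u := ∑ j ∈ Finset.range n, 1 / Z j with hu
    have hu0 : 0 ≤ u := Finset.sum_nonneg fun j _ => by have := h.pos j; positivity
    have hu1 : u ≤ τ := by
      refine hsum.trans ?_
      rw [mul_div_assoc', div_le_iff₀ hH0, mul_comm]
      have : 0 ≤ 4 * w * K * n / c₀ := by positivity
      gcongr
      linarith
    have hu2 : w * K * u ≤ c₀ / 4 * τ := by
      calc w * K * u ≤ w * K * (n * (τ / H)) := by gcongr
        _ = (w * K * n / H) * τ := by ring
        _ ≤ c₀ / 4 * τ := by
          refine mul_le_mul_of_nonneg_right ?_ hτ.le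
          rw [div_le_iff₀ hH0, hH]
          have : c₀ / 4 * (n + 4 * w * K * n / c₀) = c₀ / 4 * n + w * K * n := by field_simp
          rw [this]
          have : 0 ≤ c₀ / 4 * n := by positivity
          linarith
    have hu3 : C * u ^ 2 ≤ C * τ * τ := by
      rw [mul_assoc, ← pow_two]; gcongr
    have hd : C * τ ^ (2 * n + 1) ≤ C * τ * τ := by
      rw [mul_assoc]
      gcongr
      rw [← pow_two]
      exact pow_le_pow_of_le_one hτ.le e1.le (by omega)
    have hg := h.gain
    have : C * τ * τ < c₀ / 4 * τ := mul_lt_mul_of_pos_right e2 hτ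
    nlinarith only [hlow, hu2, hu3, hd, hg, this, mul_pos hc₀ hτ]
  | succ i ih =>
    obtain ⟨B, hB, hev⟩ := ih (by omega)
    set a := c₀ / (8 * w * n) with ha
    have ha0 : 0 < a := by positivity
    have hnear := exists_zero_near (n := n) (K := K) (k₁ := k₁) hw hC hc hc₀
      (κ := B / a) (by positivity)
    refine ⟨B / a / a, by positivity, ?_⟩
    filter_upwards [self_mem_nhdsWithin, hev, hnear] with τ hτ h1 h2 Z E h
    have hτ : 0 < τ := hτ
    obtain ⟨j, hj, hja, hjb⟩ := h2 Z E h (i + 1) (by omega) hi.le (fun h => absurd h hi.ne)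
    have hZi := h1 Z E h
    rw [← ha] at hja hjb
    have hij : i < j := by
      by_contra! hle
      have h3 := h.mono j i hle (by omega)
      have h4 : a * τ * (B / a / τ ^ (2 * (i + 1))) = B / τ ^ (2 * i + 1) := by
        rw [show 2 * (i + 1) = 2 * i + 1 + 1 by ring, pow_succ τ (2 * i + 1)]
        field_simp
      rw [h4] at hja
      linarith
    refine (h.mono (i + 1) j hij hj).trans ?_
    rw [le_div_iff₀ (by positivity), le_div_iff₀ ha0]
    rw [lt_div_iff₀ (by positivity)] at hjb
    calc Z j * τ ^ (2 * (i + 1) + 1) * a = a * τ * Z j * τ ^ (2 * (i + 1)) := by ring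
      _ ≤ _ := hjb.le

/-- Induction downwards, starting from the largest zero at the frequency where the overlap is about
to take over. A frequency placed far enough below the bound for `Z (i+1)` needs a zero of index at
most `i`. -/
theorem eventually_lower (hw : 0 < w) (hC : 0 ≤ C) (hc : 0 < c) (hc₀ : 0 < c₀) (d i : ℕ)
    (hi : i + d + 1 = n) : ∃ lo : ℝ, 0 < lo ∧ ∀ᶠ τ in 𝓝[>] (0 : ℝ), ∀ Z E,
      ZeroChain n w K C c k₁ c₀ τ Z E → lo / τ ^ (2 * i + 1) ≤ Z i := by
  have hn0 : 0 < (n : ℝ) := by exact_mod_cast (by omega : 0 < n)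
  set a := c₀ / (8 * w * n) with ha
  have ha0 : 0 < a := by positivity
  have key : ∀ κ τ : ℝ, 0 < τ → a * τ * (κ / τ ^ (2 * (i + 1))) = a * κ / τ ^ (2 * i + 1) := by
    intro κ τ hτ
    rw [show 2 * (i + 1) = 2 * i + 1 + 1 by ring, pow_succ τ (2 * i + 1)]
    field_simp
  induction d generalizing i with
  | zero =>
    set κ := c₀ / 8 with hκ
    have hκ0 : 0 < κ := by positivity
    have hnear := exists_zero_near (n := n) (K := K) (k₁ := k₁) hw hC hc hc₀ hκ0
    refine ⟨a * κ, by positivity, ?_⟩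
    filter_upwards [self_mem_nhdsWithin, hnear] with τ hτ h2 Z E h
    obtain ⟨j, hj, hja, hjb⟩ := h2 Z E h (i + 1) (by omega) (by omega)
      fun _ => le_rfl
    rw [← ha, key κ τ hτ] at hja
    exact hja.le.trans (h.mono j i (by omega) (by omega))
  | succ d ih =>
    obtain ⟨B, hB, hev⟩ := ih (i + 1) (by omega) (fun κ τ hτ => by
      rw [show 2 * (i + 1 + 1) = 2 * (i + 1) + 1 + 1 by ring, pow_succ τ (2 * (i + 1) + 1)]
      field_simp)
    have hnear := exists_zero_near (n := n) (K := K) (k₁ := k₁) hw hC hc hc₀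
      (κ := a * B) (by positivity)
    refine ⟨a * (a * B), by positivity, ?_⟩
    filter_upwards [self_mem_nhdsWithin, hev, hnear] with τ hτ h1 h2 Z E h
    have hτ' : 0 < τ := hτ
    obtain ⟨j, hj, hja, hjb⟩ := h2 Z E h (i + 1) (by omega) (by omega)
      (fun h => by omega)
    rw [← ha] at hja hjb
    have hji : j ≤ i := by
      by_contra! hlt
      have h3 := h.mono (i + 1) j hlt hj
      have h4 := (h1 Z E h).trans h3
      rw [div_le_iff₀ (by positivity)] at h4
      rw [lt_div_iff₀ (by positivity)] at hjb
      have : a * B ≤ a * (Z j * τ ^ (2 * (i + 1) + 1)) := by gcongr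
      have e : a * (Z j * τ ^ (2 * (i + 1) + 1)) = a * τ * Z j * τ ^ (2 * (i + 1)) := by ring
      linarith
    rw [key _ τ hτ] at hja
    exact hja.le.trans (h.mono j i hji (by omega))

/-- The zeros are located at the scales `τ ^ (-(2 j + 1))`. -/
theorem eventually_scaled (hn : 1 ≤ n) (hw : 0 < w) (hK : 0 < K) (hC : 0 ≤ C) (hc : 0 < c)
    (hc₀ : 0 < c₀) : ∃ lo B : ℝ, 0 < lo ∧ 0 < B ∧ ∀ᶠ τ in 𝓝[>] (0 : ℝ), ∀ Z E,
      ZeroChain n w K C c k₁ c₀ τ Z E →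
      ∀ i < n, lo / τ ^ (2 * i + 1) ≤ Z i ∧ Z i ≤ B / τ ^ (2 * i + 1) := by
  choose! B hB hBev using fun i hi =>
    eventually_upper (n := n) (k₁ := k₁) hn hw hK hC hc hc₀ i hi
  have hlow : ∀ i < n, ∃ lo : ℝ, 0 < lo ∧ ∀ᶠ τ in 𝓝[>] (0 : ℝ), ∀ Z E,
      ZeroChain n w K C c k₁ c₀ τ Z E → lo / τ ^ (2 * i + 1) ≤ Z i := fun i hi =>
    eventually_lower hw hC hc hc₀ (n - 1 - i) i (by omega)
  choose! lo hlo hloev using hlow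
  have hne : (Finset.range n).Nonempty := ⟨0, Finset.mem_range.2 hn⟩
  obtain ⟨i₀, hi₀, hmin⟩ := (Finset.range n).exists_min_image lo hne
  obtain ⟨i₁, hi₁, hmax⟩ := (Finset.range n).exists_max_image B hne
  refine ⟨lo i₀, B i₁, hlo _ (Finset.mem_range.1 hi₀), hB _ (Finset.mem_range.1 hi₁), ?_⟩
  have hall : ∀ᶠ τ in 𝓝[>] (0 : ℝ), ∀ i ∈ Finset.range n, (∀ Z E,
      ZeroChain n w K C c k₁ c₀ τ Z E → Z i ≤ B i / τ ^ (2 * i + 1)) ∧ (∀ Z E,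
      ZeroChain n w K C c k₁ c₀ τ Z E → lo i / τ ^ (2 * i + 1) ≤ Z i) := by
    rw [Filter.eventually_all_finset]
    exact fun i hi => (hBev i (Finset.mem_range.1 hi)).and (hloev i (Finset.mem_range.1 hi))
  filter_upwards [self_mem_nhdsWithin, hall] with τ hτ h Z E hZ i hi
  have hτ : 0 < τ := hτ
  obtain ⟨h1, h2⟩ := h i (Finset.mem_range.2 hi)
  constructor
  · refine le_trans ?_ (h2 Z E hZ)
    gcongr
    exact hmin i (Finset.mem_range.2 hi)
  · refine (h1 Z E hZ).trans ?_
    gcongr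
    exact hmax i (Finset.mem_range.2 hi)

set_option maxHeartbeats 400000 in
/-- The value of the test at a frequency between two neighbouring zeros, or (`i = n`) beyond the
last one. -/
theorem le_of_scaled {lo B κ₀ κ₁ A : ℝ} (hn : 1 ≤ n) (hw : 0 < w) (hC : 0 ≤ C) (hlo : 0 < lo)
    (hB : 0 < B) (hκ₀ : 0 < κ₀) (hA : 0 < A) (hκ₁ : 0 < κ₁) (hc : 0 < c) :
    ∃ C' : ℝ, 0 < C' ∧ ∀ᶠ τ in 𝓝[>] (0 : ℝ), ∀ Z E, ZeroChain n w K C c k₁ c₀ τ Z E →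
      (∀ i < n, lo / τ ^ (2 * i + 1) ≤ Z i ∧ Z i ≤ B / τ ^ (2 * i + 1)) →
      ∀ i, 1 ≤ i → i ≤ n → ∀ κ, κ₀ ≤ κ → κ ≤ κ₁ → ∀ μ ν : ℝ, 0 ≤ μ → 0 ≤ ν →
      Z (i - 1) ≤ μ * (κ / τ ^ (2 * i)) → (i < n → κ / τ ^ (2 * i) ≤ ν * Z i) →
      (i = n → w * ν = κ * τ) → w * μ + w * ν ≤ A * τ → E ≤ w * μ + w * ν + C' * τ ^ 2 := by
  set F : ℝ := B / κ₀ + κ₁ / lo with hF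
  have hF0 : 0 < F := by positivity
  set G : ℝ := w * n * F + κ₁ with hG
  have hG0 : 0 < G := by positivity
  refine ⟨G + 4 * (A + G) ^ 2 + C / κ₀ ^ 2, by positivity, ?_⟩
  filter_upwards [self_mem_nhdsWithin, eventually_mul_lt 1 one_pos, eventually_mul_lt k₁ hκ₀,
    eventually_mul_lt κ₁ hc] with τ hτ e1 e2 e3 Z E h hsc i hi hin κ hκl hκu μ ν hμ hν h₁ h₂ h₃
    hA'
  have hτ : 0 < τ := hτ
  rw [one_mul] at e1
  have hκ : 0 < κ := hκ₀.trans_le hκl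
  have hτ2 : τ ^ 2 ≤ τ := by nlinarith only [hτ, e1]
  have hk : k₁ ≤ κ / τ ^ (2 * i) := by
    refine le_trans ?_ (le_freq hκ hτ e1.le hi)
    rw [le_div_iff₀ (by positivity)]
    rcases le_or_gt k₁ 0 with h0 | h0
    · exact (mul_nonpos_of_nonpos_of_nonneg h0 (sq_nonneg τ)).trans hκ.le
    · nlinarith
  have hkd : κ / τ ^ (2 * i) * τ ^ (2 * n + 1) ≤ c ∧
      κ / τ ^ (2 * i) * τ ^ (2 * n + 1) ≤ (if i = n then w * ν else 0) + κ₁ * τ ^ 3 := by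
    have hp : 0 ≤ κ₁ * τ ^ 3 := by positivity
    rcases eq_or_lt_of_le hin with rfl | hlt
    · rw [freq_mul hτ le_rfl, Nat.sub_self, pow_zero, mul_one, if_pos rfl, h₃ rfl]
      have : κ * τ ≤ κ₁ * τ := by gcongr
      exact ⟨by linarith, by linarith⟩
    · have hle := freq_mul_le hκ hτ e1.le hlt
      have h1 : κ * τ * τ ^ 2 ≤ κ₁ * τ * τ ^ 2 := by gcongr
      have h2 : κ₁ * τ * τ ^ 2 ≤ κ₁ * τ * 1 := by gcongr; nlinarith
      have h3 : κ₁ * τ * τ ^ 2 = κ₁ * τ ^ 3 := by ring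
      rw [if_neg hlt.ne]
      constructor <;> linarith
  have hfreq : κ / τ ^ (2 * i) * τ ^ (2 * i + 1) = κ * τ := by
    rw [pow_succ]; field_simp
  set k := κ / τ ^ (2 * i) with hkdef
  have hk0 : 0 < k := by positivity
  -- Only the two neighbouring zeros are tested exactly, with weights `μ` and `ν`. Every other zero
  -- is at least two scales further, so `Fτ³` covers it. For `i = n` there is no right neighbour and
  -- the overlap term `kδ = wν` takes its place.
  have hE := h.test k hk hkd.1 (fun j => (if j = i - 1 then μ else 0) +
    (if j = i then ν else 0) + F * τ ^ 3) (fun j _ => by positivity) (fun j hj => by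
      have n1 : 0 ≤ (if j = i - 1 then μ else 0) := by positivity
      have n2 : 0 ≤ (if j = i then ν else 0) := by positivity
      have n3 : 0 ≤ F * τ ^ 3 := by positivity
      have hzj := h.pos j
      rcases lt_trichotomy j (i - 1) with hlt | heq | hgt
      · left
        rw [if_neg hlt.ne, if_neg (by omega), zero_add, zero_add]
        refine (hsc j hj).2.trans ?_
        rw [div_le_iff₀ (by positivity)]
        have e : F * τ ^ 3 * k * τ ^ (2 * j + 1) = F * κ * (τ ^ (2 * j + 4) / τ ^ (2 * i)) := by
          rw [hkdef]; ring
        rw [e]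
        have h5 : 1 ≤ τ ^ (2 * j + 4) / τ ^ (2 * i) := by
          rw [le_div_iff₀ (by positivity), one_mul]
          exact pow_le_pow_of_le_one hτ.le e1.le (by omega)
        have h6 : B ≤ F * κ := by
          calc B = B / κ₀ * κ₀ := by field_simp
            _ ≤ F * κ := by
              have : 0 ≤ κ₁ / lo := by positivity
              gcongr
              linarith
        calc B ≤ F * κ := h6
          _ = F * κ * 1 := by ring
          _ ≤ _ := by gcongr
      · left
        rw [heq, if_pos rfl]
        refine h₁.trans ?_
        gcongr
        have n2' : 0 ≤ (if i - 1 = i then ν else 0) := by positivity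
        linarith
      · rcases (by omega : j = i ∨ i < j) with heq | hgt'
        · right
          rw [heq, if_pos rfl]
          refine (h₂ (by omega)).trans ?_
          have := h.pos i
          gcongr
          have n1' : 0 ≤ (if i = i - 1 then μ else 0) := by positivity
          linarith
        · right
          rw [if_neg (by omega), if_neg (by omega), zero_add, zero_add]
          refine le_trans ?_ (mul_le_mul_of_nonneg_left (hsc j hj).1 n3)
          rw [hkdef, mul_div_assoc', div_le_div_iff₀ (by positivity) (by positivity)]
          have h6 : κ ≤ F * lo := by
            calc κ ≤ κ₁ / lo * lo := by rw [div_mul_cancel₀ _ hlo.ne']; exact hκu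
              _ ≤ F * lo := by
                have : 0 ≤ B / κ₀ := by positivity
                gcongr
                linarith
          have h5 : τ ^ (2 * j + 1) ≤ τ ^ (2 * i + 3) :=
            pow_le_pow_of_le_one hτ.le e1.le (by omega)
          calc κ * τ ^ (2 * j + 1) ≤ F * lo * τ ^ (2 * i + 3) := by gcongr
            _ = _ := by ring) _ rfl
  rw [Finset.sum_add_distrib, Finset.sum_add_distrib, Finset.sum_ite_eq', Finset.sum_ite_eq',
    Finset.sum_const, Finset.card_range, nsmul_eq_mul, if_pos (Finset.mem_range.2 (by omega))] at hE
  have hs0 : 0 ≤ w * (μ + (if i ∈ Finset.range n then ν else 0) + n * (F * τ ^ 3)) +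
      k * τ ^ (2 * n + 1) := by positivity
  have hs1 : w * (μ + (if i ∈ Finset.range n then ν else 0) + n * (F * τ ^ 3)) +
      k * τ ^ (2 * n + 1) ≤ w * μ + w * ν + G * τ ^ 3 := by
    have e : G * τ ^ 3 = w * (n * (F * τ ^ 3)) + κ₁ * τ ^ 3 := by rw [hG]; ring
    rw [e]
    have hk2 := hkd.2
    rcases eq_or_lt_of_le hin with heq | hlt
    · rw [if_pos heq] at hk2
      rw [if_neg (by rw [heq]; simp)]
      linarith only [hk2, mul_nonneg hw.le hν]
    · rw [if_neg hlt.ne] at hk2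
      rw [if_pos (Finset.mem_range.2 hlt)]
      linarith only [hk2]
  set s := w * (μ + (if i ∈ Finset.range n then ν else 0) + n * (F * τ ^ 3)) +
      k * τ ^ (2 * n + 1) with hs
  have hτ3 : G * τ ^ 3 ≤ G * τ ^ 2 := by
    gcongr ?_ * ?_
    exact pow_le_pow_of_le_one hτ.le e1.le (by norm_num)
  have hs2 : s ≤ (A + G) * τ := by
    have : G * τ ^ 2 ≤ G * τ := by gcongr
    linarith only [this, hs1, hτ3, hA']
  have hs3 : 4 * s ^ 2 ≤ 4 * (A + G) ^ 2 * τ ^ 2 := by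
    have := pow_le_pow_left₀ hs0 hs2 2
    rw [mul_pow] at this
    linarith only [this]
  have hCk : C / k ^ 2 ≤ C / κ₀ ^ 2 * τ ^ 2 := by
    have h2 : C / k ^ 2 ≤ C / (κ₀ / τ ^ 2) ^ 2 := by
      have : κ₀ / τ ^ 2 ≤ k := by
        refine le_trans ?_ (le_freq hκ hτ e1.le hi)
        gcongr
      gcongr
    refine h2.trans ?_
    have h3 : C / (κ₀ / τ ^ 2) ^ 2 = C / κ₀ ^ 2 * (τ ^ 2 * τ ^ 2) := by field_simp
    rw [h3]
    gcongr ?_ * ?_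
    exact mul_le_of_le_one_left (sq_nonneg τ) (pow_le_one₀ hτ.le e1.le)
  have e : (G + 4 * (A + G) ^ 2 + C / κ₀ ^ 2) * τ ^ 2 = G * τ ^ 2 + 4 * (A + G) ^ 2 * τ ^ 2 +
    C / κ₀ ^ 2 * τ ^ 2 := by ring
  rw [e]
  linarith only [hE, hs1, hτ3, hs3, hCk]

end ZeroChain

end OSM

/-! ### Zero chains: sharp relations and localization -/

namespace OSM

namespace ZeroChain

variable {n : ℕ} {w K C c k₁ c₀ : ℝ}

/-- All zeros beyond the first have reciprocals `O(τ³)`, so only `Z 0` enters the low-frequency gain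
to first order. -/
theorem scaled_low {lo B : ℝ} (hn : 1 ≤ n) (hw : 0 < w) (hK : 0 < K) (hC : 0 ≤ C) (hlo : 0 < lo) :
    ∃ C' : ℝ, 0 < C' ∧ ∀ᶠ τ in 𝓝[>] (0 : ℝ), ∀ Z E, ZeroChain n w K C c k₁ c₀ τ Z E →
      (∀ i < n, lo / τ ^ (2 * i + 1) ≤ Z i ∧ Z i ≤ B / τ ^ (2 * i + 1)) →
      E ≤ w * K / Z 0 + C' * τ ^ 2 := by
  refine ⟨w * K * (n / lo) + C * ((1 / lo + n / lo) ^ 2 + 1), by positivity, ?_⟩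
  filter_upwards [self_mem_nhdsWithin, eventually_mul_lt 1 one_pos] with τ hτ e1 Z E h hsc
  have hτ : 0 < τ := hτ
  rw [one_mul] at e1
  have h0 := h.pos 0
  have hsum : ∑ j ∈ Finset.range n, 1 / Z j ≤ 1 / Z 0 + n * (τ ^ 3 / lo) := by
    have hle : ∀ j ∈ Finset.range n, 1 / Z j ≤ (if j = 0 then 1 / Z 0 else 0) + τ ^ 3 / lo := by
      intro j hj
      rcases Nat.eq_zero_or_pos j with rfl | hpos
      · rw [if_pos rfl]
        have : 0 ≤ τ ^ 3 / lo := by positivity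
        linarith
      · rw [if_neg hpos.ne', zero_add]
        have h1 := (hsc j (Finset.mem_range.1 hj)).1
        have h2 : 0 < lo / τ ^ (2 * j + 1) := by positivity
        calc 1 / Z j ≤ 1 / (lo / τ ^ (2 * j + 1)) := one_div_le_one_div_of_le h2 h1
          _ = τ ^ (2 * j + 1) / lo := one_div_div _ _
          _ ≤ _ := by
            gcongr ?_ / _
            exact pow_le_pow_of_le_one hτ.le e1.le (by omega)
    refine (Finset.sum_le_sum hle).trans ?_
    rw [Finset.sum_add_distrib, Finset.sum_ite_eq', Finset.sum_const, Finset.card_range,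
      nsmul_eq_mul, if_pos (Finset.mem_range.2 hn)]
  have hlow := h.low
  have hu0 : 0 ≤ ∑ j ∈ Finset.range n, 1 / Z j :=
    Finset.sum_nonneg fun j _ => by have := h.pos j; positivity
  set u := ∑ j ∈ Finset.range n, 1 / Z j with hu
  have hτ32 : τ ^ 3 ≤ τ ^ 2 := pow_le_pow_of_le_one hτ.le e1.le (by norm_num)
  have hτ31 : τ ^ 3 ≤ τ := by
    have := pow_le_pow_of_le_one hτ.le e1.le (show 1 ≤ 3 by norm_num)
    rwa [pow_one] at this
  have hδ : τ ^ (2 * n + 1) ≤ τ ^ 2 := pow_le_pow_of_le_one hτ.le e1.le (by omega)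
  have hZ0 : 1 / Z 0 ≤ τ / lo := by
    have h1 := (hsc 0 hn).1
    rw [mul_zero, zero_add, pow_one] at h1
    calc 1 / Z 0 ≤ 1 / (lo / τ) := one_div_le_one_div_of_le (by positivity) h1
      _ = _ := one_div_div _ _
  have hu1 : u ≤ (1 / lo + n / lo) * τ := by
    have : n * (τ ^ 3 / lo) ≤ n * (τ / lo) := by gcongr
    have e : (1 / lo + n / lo) * τ = τ / lo + n * (τ / lo) := by ring
    rw [e]
    linarith
  have hu2 : u ^ 2 ≤ (1 / lo + n / lo) ^ 2 * τ ^ 2 := by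
    have := pow_le_pow_left₀ hu0 hu1 2
    rwa [mul_pow] at this
  calc E ≤ w * K * u + C * (u ^ 2 + τ ^ (2 * n + 1)) := hlow
    _ ≤ w * K * (1 / Z 0 + n * (τ ^ 2 / lo)) +
        C * ((1 / lo + n / lo) ^ 2 * τ ^ 2 + 1 * τ ^ 2) := by
      gcongr
      · refine hsum.trans ?_
        gcongr
      · linarith
    _ = _ := by ring

/-- Quantitative relations between consecutive zeros and the gain. -/
theorem eventually_relations (hn : 1 ≤ n) (hw : 0 < w) (hK : 0 < K) (hC : 0 ≤ C) (hc : 0 < c)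
    (hc₀ : 0 < c₀) : ∃ C' : ℝ, 0 < C' ∧ ∀ᶠ τ in 𝓝[>] (0 : ℝ), ∀ Z E,
      ZeroChain n w K C c k₁ c₀ τ Z E → ∀ e, e = E - C' * τ ^ 2 → 0 < e →
      e * Z 0 ≤ w * K ∧ (∀ i, i + 1 < n → e ^ 2 * Z (i + 1) ≤ 4 * w ^ 2 * Z i) ∧
      e ^ 2 ≤ 4 * w * (Z (n - 1) * τ ^ (2 * n + 1)) := by
  obtain ⟨lo, B, hlo, hB, hev⟩ := eventually_scaled (n := n) (k₁ := k₁) hn hw hK hC hc hc₀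
  obtain ⟨C₁, hC₁, hev₁⟩ := scaled_low (c := c) (k₁ := k₁) (c₀ := c₀) (B := B) hn hw hK hC hlo
  obtain ⟨C₂, hC₂, hev₂⟩ := le_of_scaled (n := n) (K := K) (k₁ := k₁) (c₀ := c₀) (c := c)
    (κ₀ := lo) (κ₁ := B) (A := 2 * w * (B / lo)) hn hw hC hlo hB hlo (by positivity) hB hc
  obtain ⟨C₃, hC₃, hev₃⟩ := le_of_scaled (n := n) (K := K) (k₁ := k₁) (c₀ := c₀) (c := c)
    (κ₀ := √(w * lo)) (κ₁ := √(w * B)) (A := 2 * √(w * B)) hn hw hC hlo hB (by positivity)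
    (by positivity) (by positivity) hc
  refine ⟨C₁ + C₂ + C₃, by positivity, ?_⟩
  filter_upwards [self_mem_nhdsWithin, hev, hev₁, hev₂, hev₃] with τ hτ h h₁ h₂ h₃ Z E hZ e he he0
  have hτ : 0 < τ := hτ
  have hsc := h Z E hZ
  have p1 : 0 ≤ C₁ * τ ^ 2 := by positivity
  have p2 : 0 ≤ C₂ * τ ^ 2 := by positivity
  have p3 : 0 ≤ C₃ * τ ^ 2 := by positivity
  rw [add_mul, add_mul] at he
  refine ⟨?_, fun i hi => ?_, ?_⟩
  · have := h₁ Z E hZ hsc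
    rw [← le_div_iff₀ (hZ.pos 0)]
    linarith
  · have hz0 := hZ.pos i
    have hz1 := hZ.pos (i + 1)
    obtain ⟨l0, u0⟩ := hsc i (by omega)
    obtain ⟨l1, u1⟩ := hsc (i + 1) hi
    rw [div_le_iff₀ (by positivity)] at l0 l1
    rw [le_div_iff₀ (by positivity)] at u0 u1
    -- The geometric mean balances the distances to both zeros: `Z i / k = k / Z (i+1)`. This gives
    -- the smallest value of their sum.
    set k := √(Z i * Z (i + 1)) with hk
    have hk0 : 0 < k := by positivity
    have hk2 : k * k = Z i * Z (i + 1) := Real.mul_self_sqrt (by positivity)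
    have hκ2 : (k * τ ^ (2 * (i + 1))) ^ 2 =
        Z i * τ ^ (2 * i + 1) * (Z (i + 1) * τ ^ (2 * (i + 1) + 1)) := by
      calc _ = k * k * (τ ^ (2 * (i + 1)) * τ ^ (2 * (i + 1))) := by ring
        _ = _ := by rw [hk2]; ring
    have hl : lo ≤ k * τ ^ (2 * (i + 1)) := by
      refine (sq_le_sq₀ hlo.le (by positivity)).1 ?_
      rw [hκ2, pow_two]
      gcongr
    have hu : k * τ ^ (2 * (i + 1)) ≤ B := by
      refine (sq_le_sq₀ (by positivity) hB.le).1 ?_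
      rw [hκ2, pow_two]
      gcongr
    have hkk : k * τ ^ (2 * (i + 1)) / τ ^ (2 * (i + 1)) = k := by field_simp
    have hμν : k / Z (i + 1) = Z i / k := by
      rw [div_eq_div_iff hz1.ne' hk0.ne', hk2]
    have hμ : Z i / k ≤ B / lo * τ := by
      rw [div_mul_eq_mul_div, div_le_div_iff₀ hk0 hlo]
      have e3 : (Z i * lo) * τ ^ (2 * i + 1) ≤ (B * τ * k) * τ ^ (2 * i + 1) := by
        calc (Z i * lo) * τ ^ (2 * i + 1) = Z i * τ ^ (2 * i + 1) * lo := by ring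
          _ ≤ B * (k * τ ^ (2 * (i + 1))) := by gcongr
          _ = _ := by ring
      exact le_of_mul_le_mul_right e3 (by positivity)
    have := h₂ Z E hZ hsc (i + 1) (by omega) hi.le (k * τ ^ (2 * (i + 1))) hl hu (Z i / k) (Z i / k)
      (by positivity) (by positivity) (by rw [hkk, Nat.add_sub_cancel]; field_simp; rfl)
      (fun _ => by rw [hkk, ← hμν]; field_simp; rfl) (fun h => absurd h hi.ne)
      (by
        calc w * (Z i / k) + w * (Z i / k) = 2 * w * (Z i / k) := by ring
          _ ≤ 2 * w * (B / lo * τ) := by gcongr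
          _ = _ := by ring)
    have hle : e ≤ 2 * w * (Z i / k) := by linarith
    have hsq := pow_le_pow_left₀ he0.le hle 2
    calc e ^ 2 * Z (i + 1) ≤ (2 * w * (Z i / k)) ^ 2 * Z (i + 1) := by gcongr
      _ = 4 * w ^ 2 * Z i * (Z i * Z (i + 1)) / (k * k) := by field_simp; ring
      _ = _ := by rw [hk2]; field_simp
  · obtain ⟨m, rfl⟩ : ∃ m, n = m + 1 := ⟨n - 1, by omega⟩
    rw [Nat.add_sub_cancel]
    have hz := hZ.pos m
    obtain ⟨l0, u0⟩ := hsc m (by omega)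
    rw [div_le_iff₀ (by positivity)] at l0
    rw [le_div_iff₀ (by positivity)] at u0
    -- Beyond the last zero the balance is between `w Z m / k` and the overlap `kδ`; both equal `κτ`
    -- at this frequency.
    set κ := √(w * (Z m * τ ^ (2 * m + 1))) with hκ
    have hκ0 : 0 < κ := by positivity
    have hκ2 : κ * κ = w * (Z m * τ ^ (2 * m + 1)) := Real.mul_self_sqrt (by positivity)
    have hμ : w * (κ * τ / w) = κ * τ := by field_simp
    have hu : κ ≤ √(w * B) := Real.sqrt_le_sqrt (by gcongr)
    have := h₃ Z E hZ hsc (m + 1) (by omega) le_rfl κ (Real.sqrt_le_sqrt (by gcongr)) hu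
      (κ * τ / w) (κ * τ / w) (by positivity) (by positivity)
      (by
        rw [Nat.add_sub_cancel, div_mul_div_comm, le_div_iff₀ (by positivity)]
        refine le_of_eq ?_
        calc Z m * (w * τ ^ (2 * (m + 1))) = w * (Z m * τ ^ (2 * m + 1)) * τ := by ring
          _ = _ := by rw [← hκ2]; ring)
      (fun h => absurd h (lt_irrefl _)) (fun _ => hμ)
      (by
        rw [hμ]
        calc κ * τ + κ * τ = 2 * κ * τ := by ring
          _ ≤ _ := by gcongr)
    rw [hμ] at this
    have hle : e ≤ 2 * κ * τ := by linarith
    have hsq := pow_le_pow_left₀ he0.le hle 2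
    calc e ^ 2 ≤ (2 * κ * τ) ^ 2 := hsq
      _ = 4 * (κ * κ) * τ ^ 2 := by ring
      _ = _ := by rw [hκ2]; ring

end ZeroChain

/-- The optimal position of the `i`-th zero when the gain is `T`. -/
noncomputable def optZero (w K T : ℝ) (i : ℕ) : ℝ := w * K / T * (4 * w ^ 2 / T ^ 2) ^ i

theorem optZero_pos {w K T : ℝ} (hw : 0 < w) (hK : 0 < K) (hT : 0 < T) (i : ℕ) :
    0 < optZero w K T i := by
  unfold optZero; positivity

theorem optZero_succ (w K T : ℝ) (i : ℕ) :
    optZero w K T (i + 1) = optZero w K T i * (4 * w ^ 2 / T ^ 2) := by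
  rw [optZero, optZero, pow_succ]; ring

/-- The value of `T` is chosen so that the chain of optimal zeros also closes with equality at the
overlap. -/
theorem optZero_last {w K T δ : ℝ} {n : ℕ} (hn : 1 ≤ n) (hw : 0 < w) (hT : 0 < T)
    (h : T ^ (2 * n + 1) = 4 ^ n * w ^ (2 * n) * K * δ) :
    4 * w * (optZero w K T (n - 1) * δ) = T ^ 2 := by
  obtain ⟨m, rfl⟩ : ∃ m, n = m + 1 := ⟨n - 1, by omega⟩
  have e : T ^ (2 * (m + 1) + 1) = T ^ 2 * (T * (T ^ 2) ^ m) := by rw [← pow_mul]; ring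
  rw [e] at h
  rw [Nat.add_sub_cancel, optZero, div_pow]
  have h2 : 4 * w * (w * K / T * ((4 * w ^ 2) ^ m / (T ^ 2) ^ m) * δ) =
      4 * w * w * K * (4 * w ^ 2) ^ m * δ / (T * (T ^ 2) ^ m) := by field_simp
  rw [h2, div_eq_iff (by positivity), h, mul_pow, ← pow_mul]
  ring

/-- With `x = e/T`, the relations push `Z i` down from the left end by at most `x^(-(2i+1))` times
its optimal value, and up from the right end by at least `x^(2(n-i))` times it. Both bounds at the
last zero are compatible only if `x ≤ 1`, and then all zeros are squeezed. -/
theorem chain_bounds {n : ℕ} {w K T δ e : ℝ} {Z : ℕ → ℝ} (hn : 1 ≤ n) (hw : 0 < w) (hK : 0 < K)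
    (hT : 0 < T) (hδ : 0 < δ) (hTn : T ^ (2 * n + 1) = 4 ^ n * w ^ (2 * n) * K * δ)
    (he : 0 < e) (h₀ : e * Z 0 ≤ w * K) (h₁ : ∀ i, i + 1 < n → e ^ 2 * Z (i + 1) ≤ 4 * w ^ 2 * Z i)
    (h₂ : e ^ 2 ≤ 4 * w * (Z (n - 1) * δ)) :
    e / T ≤ 1 ∧ ∀ i < n, (e / T) ^ (2 * n) * optZero w K T i ≤ Z i ∧
      Z i * (e / T) ^ (2 * n) ≤ optZero w K T i := by
  have hopt := fun i => optZero_pos hw hK hT i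
  set x := e / T with hx
  have hx0 : 0 < x := by positivity
  have hex : e = x * T := by rw [hx]; field_simp
  have s0 : x * Z 0 ≤ optZero w K T 0 := by
    rw [optZero, pow_zero, mul_one, le_div_iff₀ hT]
    calc x * Z 0 * T = e * Z 0 := by rw [hex]; ring
      _ ≤ _ := h₀
  have s1 : ∀ i, i + 1 < n → x ^ 2 * Z (i + 1) ≤ Z i * (4 * w ^ 2 / T ^ 2) := fun i hi => by
    rw [mul_div_assoc', le_div_iff₀ (by positivity)]
    calc x ^ 2 * Z (i + 1) * T ^ 2 = e ^ 2 * Z (i + 1) := by rw [hex]; ring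
      _ ≤ _ := h₁ i hi
      _ = _ := by ring
  have s2 : x ^ 2 * optZero w K T (n - 1) ≤ Z (n - 1) := by
    have h3 := optZero_last hn hw hT hTn
    have h4 : (x ^ 2 * optZero w K T (n - 1)) * (4 * w * δ) ≤ Z (n - 1) * (4 * w * δ) := by
      calc _ = x ^ 2 * (4 * w * (optZero w K T (n - 1) * δ)) := by ring
        _ = e ^ 2 := by rw [h3, hex]; ring
        _ ≤ _ := h₂
        _ = _ := by ring
    exact le_of_mul_le_mul_right h4 (by positivity)
  have up : ∀ i < n, x ^ (2 * i + 1) * Z i ≤ optZero w K T i := by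
    intro i
    induction i with
    | zero => intro _; simpa using s0
    | succ i ih =>
      intro hi
      rw [optZero_succ]
      calc x ^ (2 * (i + 1) + 1) * Z (i + 1) = x ^ (2 * i + 1) * (x ^ 2 * Z (i + 1)) := by ring
        _ ≤ x ^ (2 * i + 1) * (Z i * (4 * w ^ 2 / T ^ 2)) :=
          mul_le_mul_of_nonneg_left (s1 i hi) (by positivity)
        _ = x ^ (2 * i + 1) * Z i * (4 * w ^ 2 / T ^ 2) := by ring
        _ ≤ _ := by gcongr; exact ih (by omega)
  have low : ∀ d i, i + d + 1 = n → x ^ (2 * (d + 1)) * optZero w K T i ≤ Z i := by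
    intro d
    induction d with
    | zero =>
      intro i hi
      obtain rfl : i = n - 1 := by omega
      simpa using s2
    | succ d ih =>
      intro i hi
      have h3 := ih (i + 1) (by omega)
      rw [optZero_succ] at h3
      have h4 := s1 i (by omega)
      have h5 : (x ^ (2 * (d + 1 + 1)) * optZero w K T i) * (4 * w ^ 2 / T ^ 2) ≤
          Z i * (4 * w ^ 2 / T ^ 2) := by
        refine le_trans ?_ h4
        calc _ = x ^ 2 * (x ^ (2 * (d + 1)) * (optZero w K T i * (4 * w ^ 2 / T ^ 2))) := by ring
          _ ≤ _ := by gcongr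
      exact le_of_mul_le_mul_right h5 (by positivity)
  have hx1 : x ≤ 1 := by
    have h3 := up (n - 1) (by omega)
    have h4 := low 0 (n - 1) (by omega)
    by_contra! hlt
    have h5 : optZero w K T (n - 1) < Z (n - 1) := by
      refine lt_of_lt_of_le ?_ h4
      have := one_lt_pow₀ hlt (show 2 * (0 + 1) ≠ 0 by norm_num)
      nlinarith [hopt (n - 1)]
    have h6 : 1 ≤ x ^ (2 * (n - 1) + 1) := one_le_pow₀ hlt.le
    nlinarith [hopt (n - 1)]
  refine ⟨hx1, fun i hi => ⟨?_, ?_⟩⟩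
  · refine le_trans ?_ (low (n - 1 - i) i (by omega))
    have := hopt i
    gcongr ?_ * _
    exact pow_le_pow_of_le_one hx0.le hx1 (by omega)
  · refine le_trans ?_ (up i hi)
    rw [mul_comm]
    have hz : 0 ≤ Z i := by
      have h3 := low (n - 1 - i) i (by omega)
      have := hopt i
      exact le_trans (by positivity) h3
    gcongr ?_ * _
    exact pow_le_pow_of_le_one hx0.le hx1 (by omega)

/-- Sharp bound of the gain and localization of the zeros of nearly optimal conditions. -/
theorem ZeroChain.eventually_sharp {n : ℕ} {w K C c k₁ c₀ t : ℝ} (hn : 1 ≤ n) (hw : 0 < w)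
    (hK : 0 < K) (hC : 0 ≤ C) (hc : 0 < c) (hc₀ : 0 < c₀) (ht : 0 < t)
    (htn : t ^ (2 * n + 1) = 4 ^ n * w ^ (2 * n) * K) :
    ∃ C' : ℝ, 0 < C' ∧ ∀ᶠ τ in 𝓝[>] (0 : ℝ), ∀ Z E, ZeroChain n w K C c k₁ c₀ τ Z E →
      E ≤ t * τ + C' * τ ^ 2 ∧ ∀ x, x = (E - C' * τ ^ 2) / (t * τ) → 0 < x → x ≤ 1 ∧
        ∀ i < n, x ^ (2 * n) * optZero w K (t * τ) i ≤ Z i ∧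
          Z i * x ^ (2 * n) ≤ optZero w K (t * τ) i := by
  obtain ⟨C', hC', hev⟩ := ZeroChain.eventually_relations (n := n) (k₁ := k₁) hn hw hK hC hc hc₀
  refine ⟨C', hC', ?_⟩
  filter_upwards [self_mem_nhdsWithin, hev] with τ hτ h Z E hZ
  have hτ : 0 < τ := hτ
  have hT : 0 < t * τ := by positivity
  have key : 0 < E - C' * τ ^ 2 → (E - C' * τ ^ 2) / (t * τ) ≤ 1 ∧
        ∀ i < n, ((E - C' * τ ^ 2) / (t * τ)) ^ (2 * n) * optZero w K (t * τ) i ≤ Z i ∧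
          Z i * ((E - C' * τ ^ 2) / (t * τ)) ^ (2 * n) ≤ optZero w K (t * τ) i := fun he => by
    obtain ⟨h0, h1, h2⟩ := h Z E hZ _ rfl he
    exact chain_bounds hn hw hK hT (by positivity) (by rw [mul_pow, htn]) he h0 h1 h2
  refine ⟨?_, fun x hx hx0 => ?_⟩
  · by_contra! hlt
    have h1 := (key (by linarith)).1
    rw [div_le_one hT] at h1
    linarith
  · rw [hx] at hx0 ⊢
    exact key ((div_pos_iff_of_pos_right hT).1 hx0)

end OSM

/-! ### From transmission parameters to zero chains -/

namespace OSM

/-- Indices beyond the range get the default value `1`, which keeps the sequence positive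
everywhere. -/
theorem exists_sorted {n : ℕ} (W : Fin n → ℝ) (hW : ∀ i, 0 < W i) :
    ∃ (π : Equiv.Perm (Fin n)) (Z : ℕ → ℝ), (∀ j, 0 < Z j) ∧ (∀ i j, i ≤ j → j < n → Z i ≤ Z j) ∧
      ∀ j : Fin n, Z j = W (π j) := by
  refine ⟨Tuple.sort W, fun j => if h : j < n then W (Tuple.sort W ⟨j, h⟩) else 1, fun j => ?_,
    fun i j hij hj => ?_, fun j => ?_⟩
  · dsimp only
    split_ifs
    · exact hW _
    · exact one_pos
  · simp only [hj, hij.trans_lt hj, dif_pos]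
    exact Tuple.monotone_sort W (show (⟨i, _⟩ : Fin n) ≤ ⟨j, hj⟩ from hij)
  · simp

theorem sum_range_eq_sum_perm {n : ℕ} (π : Equiv.Perm (Fin n)) (f : ℕ → ℝ) :
    ∑ j ∈ Finset.range n, f j = ∑ i : Fin n, f (π.symm i) := by
  rw [Finset.sum_range]
  exact (Equiv.sum_comp π.symm fun i : Fin n => f i).symm

/-- A test at `k` of the symbol `p + k² q` in terms of its zero and pole. -/
theorem symbol_test {p q k m m' : ℝ} (hp : 0 < p) (hq : 0 < q) (hk : 0 < k) (hm : 0 ≤ m)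
    (hm' : 0 ≤ m') (h : p ≤ m * k ∨ k ≤ m * p) (h' : 1 / q ≤ m' * k ∨ k ≤ m' * (1 / q)) :
    (p + k ^ 2 * q) / k ≤ m + m' ∨ k / (p + k ^ 2 * q) ≤ m + m' := by
  have hP : 0 < p + k ^ 2 * q := by positivity
  rcases h with h | h
  · rcases h' with h' | h'
    · right
      rw [div_le_iff₀ hq] at h'
      rw [div_le_iff₀ hP]
      have h1 : k * 1 ≤ k * (m' * k * q) := by gcongr
      have : 0 ≤ m * (p + k ^ 2 * q) + m' * p := by positivity
      linarith
    · left
      rw [mul_one_div, le_div_iff₀ hq] at h'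
      rw [div_le_iff₀ hk]
      have : k * (k * q) ≤ k * m' := by gcongr
      linarith
  · right
    rw [div_le_iff₀ hP]
    have : 0 ≤ m * (k ^ 2 * q) + m' * (p + k ^ 2 * q) := by positivity
    linarith

namespace Problem

variable {D : Problem} {σ : ℕ → Bool} {p q p₁ q₁ p₂ q₂ kmax δ : ℝ}

theorem rho₁_eq (σ : ℕ → Bool) : D.rho₁ kmax δ p q = D.rho₂ σ kmax δ p q p q := by
  simp only [rho₁, rho₂, ite_self]

/-- Without boundedness the supremum in the convergence factor would be a default value and would
not dominate the rate at each frequency. -/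
theorem Admissible.exists_rate_le (hD : D.Admissible) : ∃ B : ℝ, ∀ (σ : ℕ → Bool)
    (δ p₁ q₁ p₂ q₂ k : ℝ), 0 ≤ δ → D.kmin ≤ k → 0 < p₁ + k ^ 2 * q₁ → 0 < p₂ + k ^ 2 * q₂ →
      D.rate σ δ p₁ q₁ p₂ q₂ k ≤ B := by
  obtain ⟨C, hC, h⟩ := hD.rate_sq_approx
  refine ⟨2 + 2 * C, fun σ δ p₁ q₁ p₂ q₂ k hδ hk h₁ h₂ => ?_⟩
  have h3 := (abs_le.1 (h σ δ p₁ q₁ p₂ q₂ k hδ hk h₁ h₂)).2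
  have h4 := hD.norm_reflProd_mul_le hk hδ h₁ h₂
  rw [norm_reflProd_mul] at h4
  have h5 := hD.norm_gap_le hk hδ h₁ h₂
  have h6 : Real.exp (-(k * D.L)) ≤ 1 := by
    rw [Real.exp_le_one_iff]
    have := mul_pos (hD.kmin_pos.trans_le hk) hD.L_pos
    linarith
  have h7 : C * (‖1 - D.reflProd p₁ q₁ p₂ q₂ k * Complex.exp (-(D.lam k * δ)) ^ 2‖ *
      Real.exp (-(k * D.L))) ≤ C * (2 * 1) := by gcongr
  nlinarith [sq_nonneg (D.rate σ δ p₁ q₁ p₂ q₂ k - 1)]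

theorem Admissible.bddAbove_rate (hD : D.Admissible) (hδ : 0 ≤ δ) (hp₁ : 0 < p₁) (hq₁ : 0 < q₁)
    (hp₂ : 0 < p₂) (hq₂ : 0 < q₂) :
    BddAbove ((fun k => D.rate σ δ p₁ q₁ p₂ q₂ k) '' Set.Icc D.kmin kmax) := by
  obtain ⟨B, hB⟩ := hD.exists_rate_le
  refine ⟨B, ?_⟩
  rintro _ ⟨k, hk, rfl⟩
  exact hB σ δ p₁ q₁ p₂ q₂ k hδ hk.1 (by positivity) (by positivity)

theorem Admissible.rate_le_rho₂ (hD : D.Admissible) (hδ : 0 ≤ δ) (hp₁ : 0 < p₁) (hq₁ : 0 < q₁)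
    (hp₂ : 0 < p₂) (hq₂ : 0 < q₂) {k : ℝ} (hk : D.kmin ≤ k) (hk' : k ≤ kmax) :
    D.rate σ δ p₁ q₁ p₂ q₂ k ≤ D.rho₂ σ kmax δ p₁ q₁ p₂ q₂ :=
  le_csSup (hD.bddAbove_rate hδ hp₁ hq₁ hp₂ hq₂) ⟨k, ⟨hk, hk'⟩, rfl⟩

theorem rho₂_le {b : ℝ} (hk : D.kmin ≤ kmax)
    (h : ∀ k, D.kmin ≤ k → k ≤ kmax → D.rate σ δ p₁ q₁ p₂ q₂ k ≤ b) :
    D.rho₂ σ kmax δ p₁ q₁ p₂ q₂ ≤ b := by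
  refine csSup_le ((Set.nonempty_Icc.2 hk).image _) ?_
  rintro _ ⟨k, hk, rfl⟩
  exact h k hk.1 hk.2

/-- Upper bounds of the gain `1 - ρ`. -/
theorem Admissible.gain_le (hD : D.Admissible) : ∃ C : ℝ, 0 < C ∧
    ∀ (σ : ℕ → Bool) (kmax δ p₁ q₁ p₂ q₂ : ℝ), 0 < δ → δ ≤ 1 → 0 < p₁ → 0 < q₁ → 0 < p₂ → 0 < q₂ →
      D.kmin ≤ kmax →
      (1 - D.rho₂ σ kmax δ p₁ q₁ p₂ q₂ ≤ D.Kmode * (1 / p₁ + 1 / p₂) +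
        C * ((1 / p₁ + 1 / p₂) ^ 2 + δ)) ∧
      ∀ k m₁ m₂ : ℝ, D.kmin ≤ k → k ≤ kmax → 0 ≤ m₁ → 0 ≤ m₂ →
        ((p₁ + k ^ 2 * q₁) / k ≤ m₁ ∨ k / (p₁ + k ^ 2 * q₁) ≤ m₁) →
        ((p₂ + k ^ 2 * q₂) / k ≤ m₂ ∨ k / (p₂ + k ^ 2 * q₂) ≤ m₂) →
        1 - D.rho₂ σ kmax δ p₁ q₁ p₂ q₂ ≤
          (m₁ + m₂ + k * δ) + 4 * (m₁ + m₂ + k * δ) ^ 2 + C / k ^ 2 := by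
  obtain ⟨C₁, hC₁, h₁⟩ := hD.one_sub_rate_kmin_le
  obtain ⟨C₂, hC₂, h₂⟩ := hD.one_sub_rate_le
  have hK := Kmode_pos hD.L_pos hD.Lhat_pos hD.eta_nonneg hD.eps_nonneg
  refine ⟨C₁ + C₂, by positivity, fun σ kmax δ p₁ q₁ p₂ q₂ hδ hδ1 hp₁ hq₁ hp₂ hq₂ hkk => ⟨?_, ?_⟩⟩
  · have h3 := hD.rate_le_rho₂ (σ := σ) hδ.le hp₁ hq₁ hp₂ hq₂ le_rfl hkk
    have h4 := h₁ σ δ p₁ q₁ p₂ q₂ hδ hδ1 (by positivity) (by positivity) _ rfl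
    have h5 : 1 / (p₁ + D.kmin ^ 2 * q₁) + 1 / (p₂ + D.kmin ^ 2 * q₂) ≤ 1 / p₁ + 1 / p₂ := by
      gcongr
      · have : 0 ≤ D.kmin ^ 2 * q₁ := by positivity
        linarith
      · have : 0 ≤ D.kmin ^ 2 * q₂ := by positivity
        linarith
    set ω := 1 / (p₁ + D.kmin ^ 2 * q₁) + 1 / (p₂ + D.kmin ^ 2 * q₂) with hω
    have hω0 : 0 ≤ ω := by positivity
    calc _ ≤ D.Kmode * ω + C₁ * (ω ^ 2 + δ) := by linarith
      _ ≤ _ := by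
        gcongr
        linarith
  · intro k m₁ m₂ hk hk' hm₁ hm₂ hc₁ hc₂
    have h3 := hD.rate_le_rho₂ (σ := σ) hδ.le hp₁ hq₁ hp₂ hq₂ hk hk'
    have h4 := h₂ σ δ p₁ q₁ p₂ q₂ k m₁ m₂ hδ.le hk (by positivity) (by positivity) hm₁ hm₂ hc₁ hc₂
    have h5 : C₂ / k ^ 2 ≤ (C₁ + C₂) / k ^ 2 := by gcongr; linarith
    linarith

/-- The tests treat zeros and poles alike. The low-frequency bound does not, but enlarging `1/p₁ +
1/p₂` by `q₁ + q₂` makes it symmetric too, so the four numbers may be sorted. The information lost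
is recovered later when the order is determined. -/
theorem Admissible.zeroChain_twoSided (hD : D.Admissible) : ∃ C : ℝ, 0 < C ∧
    ∀ (σ : ℕ → Bool) (c₀ c τ kmax p₁ q₁ p₂ q₂ : ℝ), 0 < τ → τ ≤ 1 → 0 < p₁ → 0 < q₁ → 0 < p₂ →
      0 < q₂ → D.kmin ≤ kmax → c / τ ^ 9 ≤ kmax →
      c₀ * τ ≤ 1 - D.rho₂ σ kmax (τ ^ 9) p₁ q₁ p₂ q₂ →
      ∃ (π : Equiv.Perm (Fin 4)) (Z : ℕ → ℝ),
        ZeroChain 4 1 D.Kmode C c D.kmin c₀ τ Z (1 - D.rho₂ σ kmax (τ ^ 9) p₁ q₁ p₂ q₂) ∧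
        ∀ j : Fin 4, Z j = ![p₁, 1 / q₁, p₂, 1 / q₂] (π j) := by
  obtain ⟨C, hC, hgain⟩ := hD.gain_le
  have hK := Kmode_pos hD.L_pos hD.Lhat_pos hD.eta_nonneg hD.eps_nonneg
  refine ⟨C, hC, fun σ c₀ c τ kmax p₁ q₁ p₂ q₂ hτ hτ1 hp₁ hq₁ hp₂ hq₂ hkk hck hE => ?_⟩
  obtain ⟨hlow, htest⟩ := hgain σ kmax (τ ^ 9) p₁ q₁ p₂ q₂ (by positivity)
    (pow_le_one₀ hτ.le hτ1) hp₁ hq₁ hp₂ hq₂ hkk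
  obtain ⟨π, Z, hpos, hmono, hZ⟩ := exists_sorted ![p₁, 1 / q₁, p₂, 1 / q₂] (by
    intro i; fin_cases i <;> simp [hp₁, hq₁, hp₂, hq₂])
  have hZ' : ∀ i : Fin 4, Z (π.symm i) = ![p₁, 1 / q₁, p₂, 1 / q₂] i := fun i => by
    rw [hZ, Equiv.apply_symm_apply]
  refine ⟨π, Z, ⟨hpos, hmono, ?_, ?_, hE⟩, hZ⟩
  · rw [sum_range_eq_sum_perm π]
    simp only [hZ']
    rw [Fin.sum_univ_four]
    have e : (1 / ![p₁, 1 / q₁, p₂, 1 / q₂] 0 + 1 / ![p₁, 1 / q₁, p₂, 1 / q₂] 1 +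
      1 / ![p₁, 1 / q₁, p₂, 1 / q₂] 2 + 1 / ![p₁, 1 / q₁, p₂, 1 / q₂] 3) =
      1 / p₁ + q₁ + 1 / p₂ + q₂ := by simp
    rw [e, one_mul]
    refine hlow.trans ?_
    have hle : 1 / p₁ + 1 / p₂ ≤ 1 / p₁ + q₁ + 1 / p₂ + q₂ := by linarith
    have h0 : 0 ≤ 1 / p₁ + 1 / p₂ := by positivity
    generalize 1 / p₁ + 1 / p₂ = X at hle h0 ⊢
    generalize 1 / p₁ + q₁ + 1 / p₂ + q₂ = Y at hle ⊢
    gcongr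
  · intro k hk hkc m hm hmk s hs
    have hk0 := hD.kmin_pos.trans_le hk
    have hk' : k ≤ kmax := by
      refine le_trans ?_ hck
      rwa [le_div_iff₀ (by positivity)]
    rw [sum_range_eq_sum_perm π, Fin.sum_univ_four, one_mul] at hs
    have t0 := hmk _ (π.symm 0).isLt
    have t1 := hmk _ (π.symm 1).isLt
    have t2 := hmk _ (π.symm 2).isLt
    have t3 := hmk _ (π.symm 3).isLt
    rw [hZ'] at t0 t1 t2 t3
    have n0 := hm _ (π.symm 0).isLt
    have n1 := hm _ (π.symm 1).isLt
    have n2 := hm _ (π.symm 2).isLt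
    have n3 := hm _ (π.symm 3).isLt
    have := htest k _ _ hk hk' (add_nonneg n0 n1) (add_nonneg n2 n3)
      (symbol_test hp₁ hq₁ hk0 n0 n1 t0 t1) (symbol_test hp₂ hq₂ hk0 n2 n3 t2 t3)
    have e : m (π.symm 0) + m (π.symm 1) + (m (π.symm 2) + m (π.symm 3)) + k * τ ^ 9 = s := by
      rw [hs]; ring
    rwa [e] at this

/-- Both sides of an interface use the same symbol, so each of the two zeros counts with
multiplicity `2`. The constant `4C` comes from `(2/p)² ≤ 4 (1/p + q)²`. -/
theorem Admissible.zeroChain_oneSided (hD : D.Admissible) : ∃ C : ℝ, 0 < C ∧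
    ∀ (c₀ c τ kmax p q : ℝ), 0 < τ → τ ≤ 1 → 0 < p → 0 < q →
      D.kmin ≤ kmax → c / τ ^ 5 ≤ kmax → c₀ * τ ≤ 1 - D.rho₁ kmax (τ ^ 5) p q →
      ∃ (π : Equiv.Perm (Fin 2)) (Z : ℕ → ℝ),
        ZeroChain 2 2 D.Kmode C c D.kmin c₀ τ Z (1 - D.rho₁ kmax (τ ^ 5) p q) ∧
        ∀ j : Fin 2, Z j = ![p, 1 / q] (π j) := by
  obtain ⟨C, hC, hgain⟩ := hD.gain_le
  have hK := Kmode_pos hD.L_pos hD.Lhat_pos hD.eta_nonneg hD.eps_nonneg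
  refine ⟨4 * C, by positivity, fun c₀ c τ kmax p q hτ hτ1 hp hq hkk hck hE => ?_⟩
  rw [rho₁_eq fun _ => true] at hE ⊢
  obtain ⟨hlow, htest⟩ := hgain (fun _ => true) kmax (τ ^ 5) p q p q (by positivity)
    (pow_le_one₀ hτ.le hτ1) hp hq hp hq hkk
  obtain ⟨π, Z, hpos, hmono, hZ⟩ := exists_sorted ![p, 1 / q] (by
    intro i; fin_cases i <;> simp [hp, hq])
  have hZ' : ∀ i : Fin 2, Z (π.symm i) = ![p, 1 / q] i := fun i => by
    rw [hZ, Equiv.apply_symm_apply]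
  refine ⟨π, Z, ⟨hpos, hmono, ?_, ?_, hE⟩, hZ⟩
  · rw [sum_range_eq_sum_perm π]
    simp only [hZ']
    rw [Fin.sum_univ_two]
    have e : (1 / ![p, 1 / q] 0 + 1 / ![p, 1 / q] 1) = 1 / p + q := by simp
    rw [e]
    refine hlow.trans ?_
    have h1 : (1 / p + 1 / p) ^ 2 ≤ 4 * (1 / p + q) ^ 2 := by
      have : 0 < 1 / p := by positivity
      nlinarith
    have h2 : 0 ≤ C * τ ^ 5 := by positivity
    have h3 : C * (1 / p + 1 / p) ^ 2 ≤ C * (4 * (1 / p + q) ^ 2) := by gcongr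
    have h4 : 0 ≤ D.Kmode * q := by positivity
    norm_num only
    linarith
  · intro k hk hkc m hm hmk s hs
    have hk0 := hD.kmin_pos.trans_le hk
    have hk' : k ≤ kmax := by
      refine le_trans ?_ hck
      rwa [le_div_iff₀ (by positivity)]
    rw [sum_range_eq_sum_perm π, Fin.sum_univ_two] at hs
    have t0 := hmk _ (π.symm 0).isLt
    have t1 := hmk _ (π.symm 1).isLt
    rw [hZ'] at t0 t1
    have n0 := hm _ (π.symm 0).isLt
    have n1 := hm _ (π.symm 1).isLt
    have hsym := symbol_test hp hq hk0 n0 n1 t0 t1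
    have := htest k _ _ hk hk' (add_nonneg n0 n1) (add_nonneg n0 n1) hsym hsym
    have e : m (π.symm 0) + m (π.symm 1) + (m (π.symm 0) + m (π.symm 1)) + k * τ ^ 5 = s := by
      rw [hs]; ring
    rw [e] at this
    have h5 : C / k ^ 2 ≤ 4 * C / k ^ 2 := by gcongr; linarith
    linarith

theorem eventually_le_div (a : ℝ) {c : ℝ} (hc : 0 < c) (n : ℕ) (hn : 1 ≤ n) :
    ∀ᶠ τ in 𝓝[>] (0 : ℝ), a ≤ c / τ ^ n := by
  filter_upwards [self_mem_nhdsWithin, eventually_mul_lt 1 one_pos, eventually_mul_lt |a| hc]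
    with τ hτ e1 e2
  have hτ : 0 < τ := hτ
  rw [one_mul] at e1
  rw [le_div_iff₀ (by positivity)]
  have h1 : τ ^ n ≤ τ := by
    have := pow_le_pow_of_le_one hτ.le e1.le hn
    rwa [pow_one] at this
  calc a * τ ^ n ≤ |a| * τ ^ n := by gcongr; exact le_abs_self a
    _ ≤ |a| * τ := by gcongr
    _ ≤ c := e2.le

/-- Sharp bound for two-sided conditions with a non-negligible gain. -/
theorem Admissible.sharp_twoSided (hD : D.Admissible) {c c₀ t : ℝ} (hc : 0 < c) (hc₀ : 0 < c₀)
    (ht : 0 < t) (ht9 : t ^ 9 = 256 * D.Kmode) : ∃ C : ℝ, 0 < C ∧ ∀ᶠ τ in 𝓝[>] (0 : ℝ),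
      ∀ (σ : ℕ → Bool) (kmax p₁ q₁ p₂ q₂ : ℝ), 0 < p₁ → 0 < q₁ → 0 < p₂ → 0 < q₂ →
      c / τ ^ 9 ≤ kmax → c₀ * τ ≤ 1 - D.rho₂ σ kmax (τ ^ 9) p₁ q₁ p₂ q₂ →
      1 - D.rho₂ σ kmax (τ ^ 9) p₁ q₁ p₂ q₂ ≤ t * τ + C * τ ^ 2 ∧
      ∃ π : Equiv.Perm (Fin 4), ∀ x,
        x = (1 - D.rho₂ σ kmax (τ ^ 9) p₁ q₁ p₂ q₂ - C * τ ^ 2) / (t * τ) → 0 < x → x ≤ 1 ∧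
        ∀ i : Fin 4, x ^ 8 * optZero 1 D.Kmode (t * τ) i ≤ ![p₁, 1 / q₁, p₂, 1 / q₂] (π i) ∧
          ![p₁, 1 / q₁, p₂, 1 / q₂] (π i) * x ^ 8 ≤ optZero 1 D.Kmode (t * τ) i := by
  have hK := Kmode_pos hD.L_pos hD.Lhat_pos hD.eta_nonneg hD.eps_nonneg
  obtain ⟨C, hC, hchain⟩ := hD.zeroChain_twoSided
  obtain ⟨C', hC', hev⟩ := ZeroChain.eventually_sharp (n := 4) (w := 1) (K := D.Kmode) (C := C)
    (k₁ := D.kmin) (by norm_num) one_pos hK hC.le hc hc₀ ht (by rw [ht9]; norm_num)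
  refine ⟨C', hC', ?_⟩
  filter_upwards [self_mem_nhdsWithin, eventually_mul_lt 1 one_pos, hev,
    eventually_le_div D.kmin hc 9 (by norm_num)]
    with τ hτ e1 h e2 σ kmax p₁ q₁ p₂ q₂ hp₁ hq₁ hp₂ hq₂ hk hE
  rw [one_mul] at e1
  obtain ⟨π, Z, hZ, hZW⟩ := hchain σ c₀ c τ kmax p₁ q₁ p₂ q₂ hτ e1.le hp₁ hq₁ hp₂ hq₂
    (e2.trans hk) hk hE
  obtain ⟨h1, h2⟩ := h Z _ hZ
  refine ⟨h1, π, fun x hx hx0 => ?_⟩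
  obtain ⟨h3, h4⟩ := h2 x hx hx0
  refine ⟨h3, fun i => ?_⟩
  rw [← hZW]
  exact h4 i i.isLt

/-- Sharp bound for one-sided conditions with a non-negligible gain. -/
theorem Admissible.sharp_oneSided (hD : D.Admissible) {c c₀ t : ℝ} (hc : 0 < c) (hc₀ : 0 < c₀)
    (ht : 0 < t) (ht5 : t ^ 5 = 256 * D.Kmode) : ∃ C : ℝ, 0 < C ∧ ∀ᶠ τ in 𝓝[>] (0 : ℝ),
      ∀ kmax p q : ℝ, 0 < p → 0 < q →
      c / τ ^ 5 ≤ kmax → c₀ * τ ≤ 1 - D.rho₁ kmax (τ ^ 5) p q →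
      1 - D.rho₁ kmax (τ ^ 5) p q ≤ t * τ + C * τ ^ 2 ∧
      ∃ π : Equiv.Perm (Fin 2), ∀ x,
        x = (1 - D.rho₁ kmax (τ ^ 5) p q - C * τ ^ 2) / (t * τ) → 0 < x → x ≤ 1 ∧
        ∀ i : Fin 2, x ^ 4 * optZero 2 D.Kmode (t * τ) i ≤ ![p, 1 / q] (π i) ∧
          ![p, 1 / q] (π i) * x ^ 4 ≤ optZero 2 D.Kmode (t * τ) i := by
  have hK := Kmode_pos hD.L_pos hD.Lhat_pos hD.eta_nonneg hD.eps_nonneg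
  obtain ⟨C, hC, hchain⟩ := hD.zeroChain_oneSided
  obtain ⟨C', hC', hev⟩ := ZeroChain.eventually_sharp (n := 2) (w := 2) (K := D.Kmode) (C := C)
    (k₁ := D.kmin) (by norm_num) two_pos hK hC.le hc hc₀ ht (by rw [ht5]; norm_num)
  refine ⟨C', hC', ?_⟩
  filter_upwards [self_mem_nhdsWithin, eventually_mul_lt 1 one_pos, hev,
    eventually_le_div D.kmin hc 5 (by norm_num)] with τ hτ e1 h e2 kmax p q hp hq hk hE
  rw [one_mul] at e1
  obtain ⟨π, Z, hZ, hZW⟩ := hchain c₀ c τ kmax p q hτ e1.le hp hq (e2.trans hk) hk hE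
  obtain ⟨h1, h2⟩ := h Z _ hZ
  refine ⟨h1, π, fun x hx hx0 => ?_⟩
  obtain ⟨h3, h4⟩ := h2 x hx hx0
  refine ⟨h3, fun i => ?_⟩
  rw [← hZW]
  exact h4 i i.isLt

end Problem

end OSM

/-! ### Lower bounds of the gain by the symbol -/

namespace OSM

theorem one_sub_two_mul_mul_sq_le {x : ℝ} (hx : 0 ≤ x) : (1 - 2 * x) * (1 + x) ^ 2 ≤ 1 := by
  nlinarith [pow_nonneg hx 2, pow_nonneg hx 3]

/-- The distance of the frequency `k` to the zero (or pole) `z`, on a multiplicative scale. -/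
noncomputable def zdist (z k : ℝ) : ℝ := min (z / k) (k / z)

theorem zdist_nonneg {z k : ℝ} (hz : 0 < z) (hk : 0 < k) : 0 ≤ zdist z k :=
  le_min (by positivity) (by positivity)

/-- If the zero `p` and the pole `1 / q` of the symbol are well separated, the symbol is small or
large up to the sum of the distances to the zero and to the pole. -/
theorem symbol_profile {p q k m : ℝ} (hp : 0 < p) (hq : 0 < q) (hk : 0 < k) (hpq : p * q ≤ 1 / 2)
    (hm : m ≤ (zdist p k + zdist (1 / q) k) * (1 - 2 * (p * q))) (hm2 : m ≤ 1 / 2) :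
    m ≤ (p + k ^ 2 * q) / k ∧ m * ((p + k ^ 2 * q) / k) ≤ 1 := by
  have hr : (p + k ^ 2 * q) / k = p / k + k * q := by field_simp
  have hα : 0 < p / k := by positivity
  have hβ : 0 < k * q := by positivity
  have hε : p / k * (k * q) = p * q := by field_simp
  have a1 : zdist p k ≤ p / k := min_le_left _ _
  have a2 : zdist p k ≤ 1 / (p / k) := (min_le_right _ _).trans_eq (one_div_div _ _).symm
  have b1 : zdist (1 / q) k ≤ k * q :=
    (min_le_right _ _).trans_eq (by rw [div_div_eq_mul_div, div_one])
  have b2 : zdist (1 / q) k ≤ 1 / (k * q) := (min_le_left _ _).trans_eq (by rw [div_div, mul_comm])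
  have ha := zdist_nonneg hp hk
  have hb := zdist_nonneg (one_div_pos.2 hq) hk
  rw [hr]
  generalize zdist p k = a at *
  generalize zdist (1 / q) k = b at *
  generalize p / k = α at *
  generalize k * q = β at *
  rw [← hε] at hpq hm
  have hε0 : 0 < α * β := by positivity
  rw [le_div_iff₀ (by positivity)] at a2 b2
  -- The case where one of `α = p/k`, `β = kq` exceeds `1`; the other case is symmetric. There `(a +
  -- b)(α + β) ≤ (1 + αβ)²`, and the factor `1 - 2αβ` absorbs the excess.
  have key : ∀ α β a b : ℝ, 0 < α → 0 < β → 0 ≤ a → 0 ≤ b → α * β ≤ 1 / 2 → 1 < α → a * α ≤ 1 →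
      b ≤ β → (a + b) * (1 - 2 * (α * β)) * (α + β) ≤ 1 := by
    intro α β a b hα hβ ha hb hpq h1 h2 h3
    have e0 : 0 < α * β := by positivity
    have e1 : β ≤ α * β := by nlinarith
    have e2 : a ≤ 1 := by nlinarith
    have e3 : (a + b) * (α + β) ≤ 1 + 2 * (α * β) + (α * β) ^ 2 := by
      have f1 : a * β ≤ 1 * (α * β) := mul_le_mul e2 e1 hβ.le zero_le_one
      have f2 : b * α ≤ β * α := by gcongr
      have f3 : b * β ≤ (α * β) * (α * β) := mul_le_mul (h3.trans e1) e1 hβ.le e0.le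
      nlinarith
    calc (a + b) * (1 - 2 * (α * β)) * (α + β) = (1 - 2 * (α * β)) * ((a + b) * (α + β)) := by ring
      _ ≤ (1 - 2 * (α * β)) * (1 + 2 * (α * β) + (α * β) ^ 2) :=
        mul_le_mul_of_nonneg_left e3 (by linarith)
      _ = (1 - 2 * (α * β)) * (1 + α * β) ^ 2 := by ring
      _ ≤ 1 := one_sub_two_mul_mul_sq_le e0.le
  constructor
  · have : (a + b) * (1 - 2 * (α * β)) ≤ (a + b) * 1 := by gcongr; linarith
    linarith
  · have hab : 0 < α + β := by positivity
    rcases lt_or_ge 1 α with h1 | h1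
    · exact (mul_le_mul_of_nonneg_right hm hab.le).trans (key α β a b hα hβ ha hb hpq h1 a2 b1)
    · rcases lt_or_ge 1 β with h2 | h2
      · refine (mul_le_mul_of_nonneg_right hm hab.le).trans ?_
        have := key β α b a hβ hα hb ha (by linarith) h2 b2 a1
        rw [mul_comm β α, add_comm b a, add_comm β α] at this
        exact this
      · nlinarith

namespace Problem

variable {D : Problem}

/-- If `m ≤ P/k ≤ 1/m`, then `kP/(k + P)² ≥ m/(1 + m)²`, so the defect of the squared reflection
coefficient is at least `4m` to first order. The exponential form makes the factors of an interface
and of the overlap multiply conveniently. -/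
theorem Admissible.norm_refl_le_exp (hD : D.Admissible) {k P m : ℝ} (hk : D.kmin ≤ k) (hP : 0 < P)
    (hm : 0 ≤ m) (h1 : m ≤ P / k) (h2 : m * (P / k) ≤ 1) :
    ‖refl (D.lam k) P‖ ≤
      Real.exp (-(2 * (m - 2 * m ^ 2 - 2 * ((D.η + D.ε) / k ^ 2) * m))) := by
  have hk0 := hD.kmin_pos.trans_le hk
  have hz := hD.lam_re_pos hk
  have hx := hD.le_lam_re hk
  have hn := hD.norm_lam_le hk
  have hΛ : 0 ≤ D.η + D.ε := add_nonneg hD.eta_nonneg hD.eps_nonneg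
  have hsq := norm_refl_sq hz hP
  set θ := (D.η + D.ε) / k ^ 2 with hθ
  have hθ0 : 0 ≤ θ := by positivity
  have hn' : ‖D.lam k‖ ≤ k * (1 + θ) := by
    refine hn.trans_eq ?_
    rw [hθ]; field_simp
  set a := m - 2 * m ^ 2 - 2 * θ * m with ha
  have hden : 0 < ‖D.lam k‖ ^ 2 + 2 * (D.lam k).re * P + P ^ 2 := by positivity
  have hfrac : 4 * a ≤ 4 * (D.lam k).re * P / (‖D.lam k‖ ^ 2 + 2 * (D.lam k).re * P + P ^ 2) := by
    rw [le_div_iff₀ hden]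
    rcases le_or_gt a 0 with h | h
    · have : 0 ≤ 4 * (D.lam k).re * P := by positivity
      nlinarith
    have hm0 : 0 < m := by
      rcases hm.eq_or_lt with h0 | h0
      · rw [ha, ← h0] at h; norm_num at h
      · exact h0
    have hfac : 0 < 1 - 2 * m - 2 * θ := by
      have : a = m * (1 - 2 * m - 2 * θ) := by rw [ha]; ring
      rw [this] at h
      exact (mul_pos_iff_of_pos_left hm0).1 h
    have ha2 : a * ((1 + θ) ^ 2 * (1 + m) ^ 2) ≤ m := by
      have i1 := one_sub_two_mul_mul_sq_le hθ0
      have i2 := one_sub_two_mul_mul_sq_le hm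
      have i3 : 1 - 2 * m - 2 * θ ≤ (1 - 2 * m) * (1 - 2 * θ) := by nlinarith
      have i4 : (1 - 2 * m - 2 * θ) * ((1 + θ) ^ 2 * (1 + m) ^ 2) ≤ 1 := by
        calc _ ≤ (1 - 2 * m) * (1 - 2 * θ) * ((1 + θ) ^ 2 * (1 + m) ^ 2) := by gcongr
          _ = ((1 - 2 * θ) * (1 + θ) ^ 2) * ((1 - 2 * m) * (1 + m) ^ 2) := by ring
          _ ≤ 1 := mul_le_one₀ i1 (mul_nonneg (by linarith) (by positivity)) i2
      calc a * ((1 + θ) ^ 2 * (1 + m) ^ 2) =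
          m * ((1 - 2 * m - 2 * θ) * ((1 + θ) ^ 2 * (1 + m) ^ 2)) := by rw [ha]; ring
        _ ≤ m * 1 := by gcongr
        _ = m := mul_one m
    have hmP : m * (k + P) ^ 2 ≤ k * P * (1 + m) ^ 2 := by
      rw [le_div_iff₀ hk0] at h1
      rw [mul_div_assoc', div_le_iff₀ hk0, one_mul] at h2
      have := mul_nonneg (sub_nonneg.2 h1) (sub_nonneg.2 h2)
      nlinarith
    have hN : ‖D.lam k‖ ^ 2 + 2 * k * P + P ^ 2 ≤ (1 + θ) ^ 2 * (k + P) ^ 2 := by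
      have j1 := pow_le_pow_left₀ (norm_nonneg _) hn' 2
      have j2 : 0 ≤ (2 * θ + θ ^ 2) * (2 * k * P + P ^ 2) := by positivity
      nlinarith
    have hmain : a * (‖D.lam k‖ ^ 2 + 2 * k * P + P ^ 2) ≤ k * P := by
      have j3 : a * ((1 + θ) ^ 2 * (k + P) ^ 2) * (1 + m) ^ 2 ≤ k * P * (1 + m) ^ 2 := by
        calc _ = a * ((1 + θ) ^ 2 * (1 + m) ^ 2) * (k + P) ^ 2 := by ring
          _ ≤ m * (k + P) ^ 2 := by gcongr
          _ ≤ _ := hmP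
      exact (mul_le_mul_of_nonneg_left hN h.le).trans (le_of_mul_le_mul_right j3 (by positivity))
    have ha8 : 0 ≤ 1 - 2 * a := by
      have : 0 ≤ 2 * θ * m := by positivity
      nlinarith [sq_nonneg (m - 1 / 4)]
    -- The estimate was made with `k` in place of `Re λ ≥ k`. Increasing the real part only helps,
    -- because `P Re λ` enters with net coefficient `4 (1 - 2a)`.
    have hmono : 0 ≤ ((D.lam k).re - k) * P * (1 - 2 * a) :=
      mul_nonneg (mul_nonneg (sub_nonneg.2 hx) hP.le) ha8
    nlinarith
  have h3 : ‖refl (D.lam k) P‖ ^ 2 ≤ Real.exp (-(2 * a)) ^ 2 := by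
    rw [hsq, ← Real.exp_nat_mul]
    have := Real.add_one_le_exp (-(4 * a))
    have e : ((2 : ℕ) : ℝ) * -(2 * a) = -(4 * a) := by push_cast; ring
    rw [e]
    linarith
  exact (sq_le_sq₀ (norm_nonneg _) (Real.exp_pos _).le).1 h3

/-- Lower bound of the gain at a single frequency. -/
theorem Admissible.rate_le_of_symbol (hD : D.Admissible) : ∃ C b₀ : ℝ, 0 < C ∧ 0 < b₀ ∧
    ∀ (σ : ℕ → Bool) (δ p₁ q₁ p₂ q₂ k m₁ m₂ d b : ℝ), 0 ≤ δ → D.kmin ≤ k → 0 < p₁ + k ^ 2 * q₁ →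
      0 < p₂ + k ^ 2 * q₂ → b ≤ b₀ → 0 ≤ m₁ → m₁ ≤ b → 0 ≤ m₂ → m₂ ≤ b → 0 ≤ d → d ≤ b →
      d ≤ k * δ →
      m₁ ≤ (p₁ + k ^ 2 * q₁) / k → m₁ * ((p₁ + k ^ 2 * q₁) / k) ≤ 1 →
      m₂ ≤ (p₂ + k ^ 2 * q₂) / k → m₂ * ((p₂ + k ^ 2 * q₂) / k) ≤ 1 →
      D.rate σ δ p₁ q₁ p₂ q₂ k ≤ 1 - (m₁ + m₂ + d) + C * (b ^ 2 + b / k ^ 2) +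
        C * (‖1 - D.reflProd p₁ q₁ p₂ q₂ k * Complex.exp (-(D.lam k * δ)) ^ 2‖ *
          Real.exp (-(k * D.L))) := by
  obtain ⟨C₀, hC₀, hrate⟩ := hD.rate_sq_approx
  have hΛ : 0 ≤ D.η + D.ε := add_nonneg hD.eta_nonneg hD.eps_nonneg
  have hkm := hD.kmin_pos
  set Λ := D.η + D.ε with hΛdef
  set G := 7 + 4 * (Λ / D.kmin ^ 2) with hG
  have hG0 : 7 ≤ G := by
    have : 0 ≤ Λ / D.kmin ^ 2 := by positivity
    linarith
  clear_value G Λ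
  -- The threshold `1/(2G)` keeps the exponent below `1` in modulus, so that the exponential may be
  -- expanded to second order.
  refine ⟨4 + 4 * Λ + 2 * G ^ 2 + C₀, 1 / (2 * G), by positivity, by positivity, ?_⟩
  intro σ δ p₁ q₁ p₂ q₂ k m₁ m₂ d b hδ hk hP₁ hP₂ hb hm₁ hm₁b hm₂ hm₂b hd hdb hdk r1 r1' r2 r2'
  have hk0 := hkm.trans_le hk
  have hb0 : 0 ≤ b := hd.trans hdb
  have g1 := hD.norm_refl_le_exp hk hP₁ hm₁ r1 r1'
  have g2 := hD.norm_refl_le_exp hk hP₂ hm₂ r2 r2'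
  have happ := (abs_le.1 (hrate σ δ p₁ q₁ p₂ q₂ k hδ hk hP₁ hP₂)).2
  set e := C₀ * (‖1 - D.reflProd p₁ q₁ p₂ q₂ k * Complex.exp (-(D.lam k * δ)) ^ 2‖ *
          Real.exp (-(k * D.L))) with he
  have he0 : 0 ≤ e := by positivity
  clear_value e
  have hρ := rate_nonneg (D := D) (σ := σ) (p₁ := p₁) (q₁ := q₁) (p₂ := p₂) (q₂ := q₂) δ k
  rw [← hΛdef] at g1 g2
  set θ := Λ / k ^ 2 with hθ
  clear_value θ
  have hθ0 : 0 ≤ θ := by rw [hθ]; positivity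
  have hθ1 : θ ≤ Λ / D.kmin ^ 2 := by rw [hθ]; gcongr
  have hexp : Real.exp (-(2 * ((D.lam k).re * δ))) ≤ Real.exp (-(2 * d)) := by
    rw [Real.exp_le_exp]
    have : k * δ ≤ (D.lam k).re * δ := mul_le_mul_of_nonneg_right (hD.le_lam_re hk) hδ
    linarith
  have hb1 : b ≤ 1 := by
    refine hb.trans ?_
    rw [div_le_one (by positivity)]
    linarith
  have hGb : 2 * (G * b) ≤ 1 := by
    rw [le_div_iff₀ (by positivity)] at hb
    linarith
  set y := (m₁ - 2 * m₁ ^ 2 - 2 * θ * m₁) + (m₂ - 2 * m₂ ^ 2 - 2 * θ * m₂) + d with hy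
  clear_value y
  have hprod : ‖D.reflProd p₁ q₁ p₂ q₂ k‖ * Real.exp (-(2 * ((D.lam k).re * δ))) ≤
      Real.exp (-(2 * y)) := by
    have e1 : Real.exp (-(2 * y)) = Real.exp (-(2 * (m₁ - 2 * m₁ ^ 2 - 2 * θ * m₁))) *
        Real.exp (-(2 * (m₂ - 2 * m₂ ^ 2 - 2 * θ * m₂))) * Real.exp (-(2 * d)) := by
      rw [← Real.exp_add, ← Real.exp_add, hy]
      congr 1; ring
    rw [e1, reflProd, norm_mul]
    gcongr
  have n1 : m₁ ^ 2 ≤ b ^ 2 := by gcongr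
  have n2 : m₂ ^ 2 ≤ b ^ 2 := by gcongr
  have n3 : θ * m₁ ≤ θ * b := by gcongr
  have n4 : θ * m₂ ≤ θ * b := by gcongr
  have n5 : b ^ 2 ≤ b := by nlinarith
  have n6 : θ * b ≤ Λ / D.kmin ^ 2 * b := by gcongr
  have n7 : 0 ≤ θ * b := by positivity
  have hyl : m₁ + m₂ + d - (4 * b ^ 2 + 4 * (θ * b)) ≤ y := by rw [hy]; linarith only [n1, n2, n3, n4]
  have hyabs : |y| ≤ G * b := by
    have e1 : G * b = 7 * b + 4 * (Λ / D.kmin ^ 2 * b) := by rw [hG]; ring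
    rw [e1, abs_le]
    constructor
    · linarith only [hyl, n5, n6, hm₁, hm₂, hd, hb0]
    · have h5 : 0 ≤ θ * m₁ + θ * m₂ := by positivity
      have h6 : 0 ≤ m₁ ^ 2 + m₂ ^ 2 := by positivity
      rw [hy]; linarith only [h5, h6, hm₁b, hm₂b, hdb, n6, n7, hb0]
  have hexp2 : Real.exp (-(2 * y)) ≤ 1 - 2 * y + 4 * (G * b) ^ 2 := by
    have h5 : |-(2 * y)| ≤ 1 := by
      rw [abs_neg, abs_mul, abs_two]; linarith only [hyabs, hGb]
    have h6 := (abs_le.1 (Real.abs_exp_sub_one_sub_id_le h5)).2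
    have h7 := pow_le_pow_left₀ (abs_nonneg y) hyabs 2
    rw [sq_abs] at h7
    linarith only [h6, h7]
  have hsq : D.rate σ δ p₁ q₁ p₂ q₂ k ^ 2 ≤ 1 - 2 * (y - 2 * (G * b) ^ 2 - e / 2) := by
    linarith only [happ, hprod, hexp2]
  have hfin : D.rate σ δ p₁ q₁ p₂ q₂ k ≤ 1 - (y - 2 * (G * b) ^ 2 - e / 2) := by
    set z := y - 2 * (G * b) ^ 2 - e / 2 with hz
    have h8 : 0 ≤ 1 - z := by linarith only [sq_nonneg (D.rate σ δ p₁ q₁ p₂ q₂ k), hsq]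
    refine (sq_le_sq₀ hρ h8).1 ?_
    linarith only [sq_nonneg z, hsq]
  have hbk : θ * b = Λ * (b / k ^ 2) := by rw [hθ]; ring
  rw [hbk] at hyl
  have q0 : 0 ≤ b / k ^ 2 := by positivity
  have q1 : 0 ≤ 4 * Λ * b ^ 2 + C₀ * b ^ 2 := by positivity
  have q2 : 0 ≤ (4 + 2 * G ^ 2 + C₀) * (b / k ^ 2) := by positivity
  have q3 : 0 ≤ (4 + 4 * Λ + 2 * G ^ 2) *
      (‖1 - D.reflProd p₁ q₁ p₂ q₂ k * Complex.exp (-(D.lam k * δ)) ^ 2‖ *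
          Real.exp (-(k * D.L))) := by positivity
  calc _ ≤ 1 - (y - 2 * (G * b) ^ 2 - e / 2) := hfin
    _ ≤ 1 - (m₁ + m₂ + d) + (4 + 2 * G ^ 2) * b ^ 2 + 4 * Λ * (b / k ^ 2) + e := by
      have : 2 * (G * b) ^ 2 = 2 * G ^ 2 * b ^ 2 := by ring
      linarith only [this, hyl, he0]
    _ ≤ _ := by rw [he]; linarith only [q1, q2, q3]

end Problem

end OSM

/-! ### Lower bounds of the gain in the three frequency ranges -/

namespace OSM

namespace Problem

/-- Parameters at the scale `p ≳ 1 / τ`, with well separated zeros and poles `p` and `1 / q`. -/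
structure ScaledBox (lo hi H τ δ p₁ q₁ p₂ q₂ : ℝ) : Prop where
  delta_nonneg : 0 ≤ δ
  delta_le : δ ≤ τ ^ 2
  q₁_pos : 0 < q₁
  q₂_pos : 0 < q₂
  le_p₁ : lo / τ ≤ p₁
  le_p₂ : lo / τ ≤ p₂
  p₁_le : p₁ ≤ hi / τ
  mul_le₁ : p₁ * q₁ ≤ H * τ ^ 2
  mul_le₂ : p₂ * q₂ ≤ H * τ ^ 2

variable {D : Problem} {lo hi H : ℝ}

/-- At bounded frequencies the part `k²q` changes `1/p` by at most `k² (pq)/p³`, which is of order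
`τ² τ³`. -/
theorem one_div_symbol_ge {lo H τ p q k k₀ : ℝ} (hlo : 0 < lo) (hτ : 0 < τ) (hq : 0 < q)
    (hk : 0 < k) (hk₀ : k ≤ k₀) (hp : lo / τ ≤ p) (hpq : p * q ≤ H * τ ^ 2) :
    1 / p - k₀ ^ 2 * H / lo ^ 3 * τ ^ 5 ≤ 1 / (p + k ^ 2 * q) ∧ 1 / (p + k ^ 2 * q) ≤ τ / lo := by
  have hlt : 0 < lo / τ := by positivity
  have hp0 : 0 < p := hlt.trans_le hp
  have hH : 0 ≤ H * τ ^ 2 := le_trans (by positivity) hpq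
  constructor
  · have h1 : 1 / p - 1 / (p + k ^ 2 * q) ≤ k ^ 2 * (p * q) / p ^ 3 := by
      have e : 1 / p - 1 / (p + k ^ 2 * q) = k ^ 2 * q / (p * (p + k ^ 2 * q)) := by
        field_simp; ring
      have e2 : k ^ 2 * (p * q) / p ^ 3 = k ^ 2 * q / (p * p) := by field_simp
      rw [e, e2]
      have : 0 ≤ k ^ 2 * q := by positivity
      gcongr
      linarith
    have h2 : k ^ 2 * (p * q) / p ^ 3 ≤ k₀ ^ 2 * (H * τ ^ 2) / (lo / τ) ^ 3 := by gcongr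
    have e3 : k₀ ^ 2 * (H * τ ^ 2) / (lo / τ) ^ 3 = k₀ ^ 2 * H / lo ^ 3 * τ ^ 5 := by field_simp
    linarith
  · have : τ / lo = 1 / (lo / τ) := (one_div_div _ _).symm
    rw [this]
    apply one_div_le_one_div_of_le hlt
    have : 0 ≤ k ^ 2 * q := by positivity
    linarith

theorem Admissible.rate_le_low (hD : D.Admissible) (hlo : 0 < lo) (k₀ : ℝ) :
    ∃ C : ℝ, 0 < C ∧ ∀ᶠ τ in 𝓝[>] (0 : ℝ), ∀ (σ : ℕ → Bool) (δ p₁ q₁ p₂ q₂ : ℝ),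
      ScaledBox lo hi H τ δ p₁ q₁ p₂ q₂ → ∀ k, D.kmin ≤ k → k ≤ k₀ →
      D.rate σ δ p₁ q₁ p₂ q₂ k ≤ 1 - D.Kmode * (1 / p₁ + 1 / p₂) + C * τ ^ 2 := by
  obtain ⟨C, hC, h⟩ := hD.rate_le_lowFreq k₀
  have hK := Kmode_pos hD.L_pos hD.Lhat_pos hD.eta_nonneg hD.eps_nonneg
  refine ⟨2 * D.Kmode * (k₀ ^ 2 * |H| / lo ^ 3) + C * ((2 / lo) ^ 2 + 1), by positivity, ?_⟩
  filter_upwards [self_mem_nhdsWithin, eventually_mul_lt 1 one_pos,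
    eventually_mul_lt (2 / lo) one_pos] with τ hτ e1 e2 σ δ p₁ q₁ p₂ q₂ hb k hk hkk
  have hτ : 0 < τ := hτ
  rw [one_mul] at e1
  have hk0 := hD.kmin_pos.trans_le hk
  have hlt : 0 < lo / τ := by positivity
  have hp₁ := hlt.trans_le hb.le_p₁
  have hp₂ := hlt.trans_le hb.le_p₂
  have hq₁ := hb.q₁_pos
  have hq₂ := hb.q₂_pos
  have hH : ∀ {x : ℝ}, x ≤ H * τ ^ 2 → x ≤ |H| * τ ^ 2 := fun hx =>
    hx.trans (by gcongr; exact le_abs_self H)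
  obtain ⟨a1, b1⟩ := one_div_symbol_ge hlo hτ hq₁ hk0 hkk hb.le_p₁ (hH hb.mul_le₁)
  obtain ⟨a2, b2⟩ := one_div_symbol_ge hlo hτ hq₂ hk0 hkk hb.le_p₂ (hH hb.mul_le₂)
  have hω0 : 0 ≤ 1 / (p₁ + k ^ 2 * q₁) + 1 / (p₂ + k ^ 2 * q₂) := by positivity
  have hω : 1 / (p₁ + k ^ 2 * q₁) + 1 / (p₂ + k ^ 2 * q₂) ≤ 2 / lo * τ := by
    have : 2 / lo * τ = τ / lo + τ / lo := by ring
    linarith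
  have hτ1 : τ ^ 2 ≤ 1 := by nlinarith
  have hmain := h σ δ p₁ q₁ p₂ q₂ k hb.delta_nonneg (hb.delta_le.trans hτ1) hk hkk (by positivity)
    (by positivity) _ rfl (hω.trans e2.le)
  generalize 1 / (p₁ + k ^ 2 * q₁) = x₁ at *
  generalize 1 / (p₂ + k ^ 2 * q₂) = x₂ at *
  have hsq := pow_le_pow_left₀ hω0 hω 2
  have h5 : τ ^ 5 ≤ τ ^ 2 := pow_le_pow_of_le_one hτ.le e1.le (by norm_num)
  have h6 : k₀ ^ 2 * |H| / lo ^ 3 * τ ^ 5 ≤ k₀ ^ 2 * |H| / lo ^ 3 * τ ^ 2 := by gcongr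
  have h7 : D.Kmode * (1 / p₁ + 1 / p₂ - 2 * (k₀ ^ 2 * |H| / lo ^ 3 * τ ^ 2)) ≤
      D.Kmode * (x₁ + x₂) := by
    refine mul_le_mul_of_nonneg_left ?_ hK.le
    linarith
  have h8 : C * ((x₁ + x₂) ^ 2 + δ) ≤ C * ((2 / lo * τ) ^ 2 + τ ^ 2) := by
    have := hb.delta_le
    gcongr
  calc _ ≤ 1 - D.Kmode * (x₁ + x₂) + C * ((x₁ + x₂) ^ 2 + δ) := hmain
    _ ≤ 1 - D.Kmode * (1 / p₁ + 1 / p₂ - 2 * (k₀ ^ 2 * |H| / lo ^ 3 * τ ^ 2)) +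
        C * ((2 / lo * τ) ^ 2 + τ ^ 2) := by linarith
    _ = _ := by ring

/-- In the intermediate range the coupling is not yet exponentially small in `τ`. The factor `kτ`
from `Γ` is what makes its contribution a small multiple of `τ`. -/
theorem Admissible.norm_gap_le_mul (hD : D.Admissible) (hlo : 0 < lo) :
    ∃ C : ℝ, 0 < C ∧ ∀ τ δ p₁ q₁ p₂ q₂ : ℝ, 0 < τ → τ ≤ 1 → ScaledBox lo hi H τ δ p₁ q₁ p₂ q₂ →
      ∀ k, D.kmin ≤ k →
      ‖1 - D.reflProd p₁ q₁ p₂ q₂ k * Complex.exp (-(D.lam k * δ)) ^ 2‖ ≤ C * (k * τ) := by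
  have hΛ : 0 ≤ D.η + D.ε := add_nonneg hD.eta_nonneg hD.eps_nonneg
  have hkm := hD.kmin_pos
  set N := 1 + (D.η + D.ε) / D.kmin ^ 2 with hN
  have hN0 : 0 < N := by positivity
  clear_value N
  refine ⟨N * (4 / lo + 4), by positivity, fun τ δ p₁ q₁ p₂ q₂ hτ hτ1 hb k hk => ?_⟩
  have hk0 := hkm.trans_le hk
  have hlt : 0 < lo / τ := by positivity
  have hp₁ := hlt.trans_le hb.le_p₁
  have hp₂ := hlt.trans_le hb.le_p₂
  have hq₁ := hb.q₁_pos
  have hq₂ := hb.q₂_pos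
  have hz := hD.lam_re_pos hk
  have hP₁ : 0 < p₁ + k ^ 2 * q₁ := by positivity
  have hP₂ : 0 < p₂ + k ^ 2 * q₂ := by positivity
  have hn : ‖D.lam k‖ ≤ k * N := by
    refine (hD.norm_lam_le hk).trans ?_
    have : (D.η + D.ε) / k = k * ((D.η + D.ε) / k ^ 2) := by field_simp
    rw [this, hN, mul_add, mul_one]
    gcongr
  have b : ∀ P : ℝ, 0 < P → lo / τ ≤ P → ‖refl (D.lam k) P + 1‖ ≤ 2 * (N / lo * (k * τ)) := by
    intro P hP hle
    refine (norm_refl_add_one_le hz hP).trans ?_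
    calc 2 * ‖D.lam k‖ / P ≤ 2 * (k * N) / (lo / τ) := by gcongr
      _ = _ := by field_simp
  have b1 := b _ hP₁ (hb.le_p₁.trans (le_add_of_nonneg_right (by positivity)))
  have b2 := b _ hP₂ (hb.le_p₂.trans (le_add_of_nonneg_right (by positivity)))
  have hF := hD.norm_exp_delta_le hk hb.delta_nonneg
  have hF1 : ‖Complex.exp (-(D.lam k * δ)) - 1‖ ≤ 2 * (N * (k * τ)) := by
    refine (norm_exp_neg_sub_one_le ?_).trans ?_
    · rw [Complex.re_mul_ofReal]; exact mul_nonneg hz.le hb.delta_nonneg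
    · rw [norm_mul, Complex.norm_real, Real.norm_of_nonneg hb.delta_nonneg]
      have : δ ≤ τ := hb.delta_le.trans (by nlinarith)
      have h0 := hb.delta_nonneg
      calc 2 * (‖D.lam k‖ * δ) ≤ 2 * (k * N * τ) := by gcongr
        _ = _ := by ring
  have g1 := norm_refl_le_one hz hP₁
  have g2 := norm_refl_le_one hz hP₂
  rw [reflProd]
  generalize Complex.exp (-(D.lam k * δ)) = F at *
  generalize refl (D.lam k) (p₁ + k ^ 2 * q₁) = u at *
  generalize refl (D.lam k) (p₂ + k ^ 2 * q₂) = v at *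
  have e : 1 - u * v * F ^ 2 = (u + 1) - u * (v + 1) - u * v * ((F - 1) * (F + 1)) := by ring
  rw [e]
  have t1 := norm_sub_le ((u + 1) - u * (v + 1)) (u * v * ((F - 1) * (F + 1)))
  have t2 := norm_sub_le (u + 1) (u * (v + 1))
  have t3 : ‖u * (v + 1)‖ ≤ 1 * (2 * (N / lo * (k * τ))) := by
    rw [norm_mul]; exact mul_le_mul g1 b2 (norm_nonneg _) zero_le_one
  have t4 : ‖u * v * ((F - 1) * (F + 1))‖ ≤ 1 * (2 * (N * (k * τ)) * 2) := by
    rw [norm_mul, norm_mul, norm_mul]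
    have h3 : ‖F + 1‖ ≤ 2 := (norm_add_le _ _).trans (by rw [norm_one]; linarith)
    exact mul_le_mul (mul_le_one₀ g1 (norm_nonneg _) g2)
      (mul_le_mul hF1 h3 (norm_nonneg _) (by positivity)) (by positivity) zero_le_one
  calc _ ≤ 2 * (N / lo * (k * τ)) + 1 * (2 * (N / lo * (k * τ))) + 1 * (2 * (N * (k * τ)) * 2) := by
        linarith
    _ = _ := by ring

/-- For `k₀ ≤ k ≤ lo/τ` the first symbol alone gives a gain of order `kτ/hi`, which exceeds any
prescribed `Bτ` once `k₀` is large. The coupling error is `O(τ/k)` and is absorbed in the same way.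
-/
theorem Admissible.rate_le_mid (hD : D.Admissible) {B : ℝ} (hlo : 0 < lo) (hhi : 0 < hi)
    (hB : 0 < B) : ∃ k₀ C : ℝ, 0 < C ∧ ∀ᶠ τ in 𝓝[>] (0 : ℝ), ∀ (σ : ℕ → Bool)
      (δ p₁ q₁ p₂ q₂ : ℝ), ScaledBox lo hi H τ δ p₁ q₁ p₂ q₂ → ∀ k, D.kmin ≤ k → k₀ ≤ k →
      k ≤ lo / τ → D.rate σ δ p₁ q₁ p₂ q₂ k ≤ 1 - B * τ + C * τ ^ 2 := by
  obtain ⟨C₁, b₀, hC₁, hb₀, hrate⟩ := hD.rate_le_of_symbol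
  obtain ⟨C₂, hC₂, hgap⟩ := hD.norm_gap_le_mul (lo := lo) (hi := hi) (H := H) hlo
  have hL := hD.L_pos
  -- One summand for each requirement: `k ≥ 1`, a gain `2Bτ` from the first symbol, and the two
  -- error terms at most `Bτ/2` each.
  set k₀ := 1 + 4 * hi * B + 4 * C₁ + 4 * C₁ * C₂ / (B * D.L ^ 2) with hk₀
  have hk₀1 : 1 ≤ k₀ := by
    have : 0 ≤ 4 * hi * B + 4 * C₁ + 4 * C₁ * C₂ / (B * D.L ^ 2) := by positivity
    linarith
  have hk₀2 : 4 * hi * B ≤ k₀ := by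
    have : 0 ≤ 1 + 4 * C₁ + 4 * C₁ * C₂ / (B * D.L ^ 2) := by positivity
    linarith
  have hk₀3 : 4 * C₁ ≤ k₀ := by
    have : 0 ≤ 1 + 4 * hi * B + 4 * C₁ * C₂ / (B * D.L ^ 2) := by positivity
    linarith
  have hk₀4 : 4 * C₁ * C₂ / (B * D.L ^ 2) ≤ k₀ := by
    have : 0 ≤ 1 + 4 * hi * B + 4 * C₁ := by positivity
    linarith
  clear_value k₀
  refine ⟨k₀, C₁ * (4 * B ^ 2), by positivity, ?_⟩
  filter_upwards [self_mem_nhdsWithin, eventually_mul_lt 1 one_pos, eventually_mul_lt (2 * B) hb₀,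
    eventually_mul_lt (2 * B) one_pos, eventually_mul_lt |H| one_pos]
    with τ hτ e1 e2 e3 e4 σ δ p₁ q₁ p₂ q₂ hb k hk hkk hkl
  have hτ : 0 < τ := hτ
  rw [one_mul] at e1
  have hk0 := hD.kmin_pos.trans_le hk
  have hk1 : 1 ≤ k := hk₀1.trans hkk
  have hlt : 0 < lo / τ := by positivity
  have hp₁ := hlt.trans_le hb.le_p₁
  have hp₂ := hlt.trans_le hb.le_p₂
  have hq₁ := hb.q₁_pos
  have hq₂ := hb.q₂_pos
  have hP₁ : 0 < p₁ + k ^ 2 * q₁ := by positivity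
  have hP₂ : 0 < p₂ + k ^ 2 * q₂ := by positivity
  have hkp : k ≤ p₁ := hkl.trans hb.le_p₁
  have r1 : 2 * B * τ ≤ (p₁ + k ^ 2 * q₁) / k := by
    rw [le_div_iff₀ hk0]
    have : 0 ≤ k ^ 2 * q₁ := by positivity
    have : 2 * B * τ * k ≤ 1 * k := by gcongr
    linarith
  have r2 : 2 * B * τ * ((p₁ + k ^ 2 * q₁) / k) ≤ 1 := by
    rw [mul_div_assoc', div_le_iff₀ hk0, one_mul]
    have h1 : k ^ 2 * q₁ ≤ p₁ * 1 := by
      have h2 : p₁ * q₁ ≤ 1 := by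
        refine hb.mul_le₁.trans ?_
        calc H * τ ^ 2 ≤ |H| * τ ^ 2 := by gcongr; exact le_abs_self H
          _ = |H| * τ * τ := by ring
          _ ≤ 1 * 1 := by gcongr
          _ = 1 := one_mul 1
      calc k ^ 2 * q₁ ≤ p₁ ^ 2 * q₁ := by gcongr
        _ = p₁ * (p₁ * q₁) := by ring
        _ ≤ _ := by gcongr
    have h3 := hb.p₁_le
    rw [le_div_iff₀ hτ] at h3
    calc 2 * B * τ * (p₁ + k ^ 2 * q₁) ≤ 2 * B * τ * (p₁ + p₁ * 1) := by gcongr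
      _ = 4 * B * (p₁ * τ) := by ring
      _ ≤ 4 * B * hi := by gcongr
      _ = 4 * hi * B := by ring
      _ ≤ k := hk₀2.trans hkk
  have hmain := hrate σ δ p₁ q₁ p₂ q₂ k (2 * B * τ) 0 0 (2 * B * τ) hb.delta_nonneg hk hP₁ hP₂ e2.le
    (by positivity) le_rfl le_rfl (by positivity) le_rfl (by positivity)
    (mul_nonneg hk0.le hb.delta_nonneg) r1 r2 (by positivity) (by rw [zero_mul]; exact zero_le_one)
  have hg := hgap τ δ p₁ q₁ p₂ q₂ hτ e1.le hb k hk
  have he : C₁ * (‖1 - D.reflProd p₁ q₁ p₂ q₂ k * Complex.exp (-(D.lam k * δ)) ^ 2‖ *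
          Real.exp (-(k * D.L))) ≤ B / 2 * τ := by
    have h1 := exp_neg_le_two_div_sq (by positivity : 0 < k * D.L)
    calc _ ≤ C₁ * (C₂ * (k * τ) * (2 / (k * D.L) ^ 2)) := by gcongr
      _ = 4 * C₁ * C₂ / (B * D.L ^ 2) / k * (B / 2 * τ) := by field_simp; ring
      _ ≤ 1 * (B / 2 * τ) := by
        gcongr
        rw [div_le_one hk0]
        exact hk₀4.trans hkk
      _ = _ := one_mul _
  have hk2 : C₁ * (2 * B * τ / k ^ 2) ≤ B / 2 * τ := by
    have h1 : 4 * C₁ ≤ k ^ 2 := (hk₀3.trans hkk).trans (by nlinarith)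
    rw [mul_div_assoc', div_le_iff₀ (by positivity)]
    calc C₁ * (2 * B * τ) = B / 2 * τ * (4 * C₁) := by ring
      _ ≤ _ := by gcongr
  calc _ ≤ 1 - (2 * B * τ + 0 + 0) + C₁ * ((2 * B * τ) ^ 2 + 2 * B * τ / k ^ 2) + _ := hmain
    _ ≤ 1 - (2 * B * τ + 0 + 0) + C₁ * ((2 * B * τ) ^ 2 + 2 * B * τ / k ^ 2) + B / 2 * τ := by gcongr
    _ ≤ _ := by linarith only [hk2]

/-- Here `k ≥ lo/τ`, so both the coupling and the correction to `|λ| ≈ k` are `O(τ²)`. What remains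
is the sum of the distances to zeros and poles, with relative loss `2pq = O(τ²)`. -/
theorem Admissible.rate_le_high (hD : D.Admissible) {B : ℝ} (hlo : 0 < lo) (hB : 0 < B) :
    ∃ C : ℝ, 0 < C ∧ ∀ᶠ τ in 𝓝[>] (0 : ℝ), ∀ (σ : ℕ → Bool) (δ p₁ q₁ p₂ q₂ M : ℝ),
      ScaledBox lo hi H τ δ p₁ q₁ p₂ q₂ → M ≤ B * τ → ∀ k, D.kmin ≤ k → lo / τ ≤ k →
      M ≤ zdist p₁ k + zdist (1 / q₁) k + (zdist p₂ k + zdist (1 / q₂) k) + k * δ →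
      D.rate σ δ p₁ q₁ p₂ q₂ k ≤ 1 - M + C * τ ^ 2 := by
  obtain ⟨C₁, b₀, hC₁, hb₀, hrate⟩ := hD.rate_le_of_symbol
  have hL := hD.L_pos
  refine ⟨C₁ * (B ^ 2 + B / lo ^ 2) + C₁ * (2 * (2 / (lo * D.L) ^ 2)) + 8 * B * |H|,
    by positivity, ?_⟩
  filter_upwards [self_mem_nhdsWithin, eventually_mul_lt 1 one_pos, eventually_mul_lt B hb₀,
    eventually_mul_lt B (by norm_num : (0 : ℝ) < 1 / 2),
    eventually_mul_lt |H| (by norm_num : (0 : ℝ) < 1 / 4)]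
    with τ hτ e1 e2 e3 e4 σ δ p₁ q₁ p₂ q₂ M hb hMB k hk hkl hM
  have hτ : 0 < τ := hτ
  rw [one_mul] at e1
  have hk0 := hD.kmin_pos.trans_le hk
  have hlt : 0 < lo / τ := by positivity
  have hp₁ := hlt.trans_le hb.le_p₁
  have hp₂ := hlt.trans_le hb.le_p₂
  have hq₁ := hb.q₁_pos
  have hq₂ := hb.q₂_pos
  have hP₁ : 0 < p₁ + k ^ 2 * q₁ := by positivity
  have hP₂ : 0 < p₂ + k ^ 2 * q₂ := by positivity
  have hkδ : 0 ≤ k * δ := mul_nonneg hk0.le hb.delta_nonneg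
  have hBτ : 0 ≤ B * τ := by positivity
  have hH1 : |H| * τ ^ 2 ≤ 1 / 4 := by
    calc |H| * τ ^ 2 = |H| * τ * τ := by ring
      _ ≤ 1 / 4 * 1 := by gcongr
      _ = _ := by norm_num
  have hHa : H * τ ^ 2 ≤ |H| * τ ^ 2 := by gcongr; exact le_abs_self H
  have hε₁ := hb.mul_le₁.trans hHa
  have hε₂ := hb.mul_le₂.trans hHa
  have hs₁ : 0 ≤ zdist p₁ k + zdist (1 / q₁) k :=
    add_nonneg (zdist_nonneg hp₁ hk0) (zdist_nonneg (one_div_pos.2 hq₁) hk0)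
  have hs₂ : 0 ≤ zdist p₂ k + zdist (1 / q₂) k :=
    add_nonneg (zdist_nonneg hp₂ hk0) (zdist_nonneg (one_div_pos.2 hq₂) hk0)
  set μ₁ := (zdist p₁ k + zdist (1 / q₁) k) * (1 - 2 * (p₁ * q₁)) with hμ₁
  set μ₂ := (zdist p₂ k + zdist (1 / q₂) k) * (1 - 2 * (p₂ * q₂)) with hμ₂
  have hμ₁0 : 0 ≤ μ₁ := mul_nonneg hs₁ (by linarith only [hε₁, hH1])
  have hμ₂0 : 0 ≤ μ₂ := mul_nonneg hs₂ (by linarith only [hε₂, hH1])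
  -- The contributions are truncated at `Bτ`, as the expansion needs small quantities. If a
  -- truncation is active, that contribution alone is at least `M`.
  obtain ⟨a1, a2⟩ := symbol_profile (m := min μ₁ (B * τ)) hp₁ hq₁ hk0
    (by linarith only [hε₁, hH1]) (min_le_left _ _) ((min_le_right _ _).trans e3.le)
  obtain ⟨b1, b2⟩ := symbol_profile (m := min μ₂ (B * τ)) hp₂ hq₂ hk0
    (by linarith only [hε₂, hH1]) (min_le_left _ _) ((min_le_right _ _).trans e3.le)
  have hmain := hrate σ δ p₁ q₁ p₂ q₂ k (min μ₁ (B * τ)) (min μ₂ (B * τ)) (min (k * δ) (B * τ))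
    (B * τ) hb.delta_nonneg hk hP₁ hP₂ e2.le (le_min hμ₁0 hBτ) (min_le_right _ _)
    (le_min hμ₂0 hBτ) (min_le_right _ _) (le_min hkδ hBτ) (min_le_right _ _) (min_le_left _ _)
    a1 a2 b1 b2
  have he : C₁ * (‖1 - D.reflProd p₁ q₁ p₂ q₂ k * Complex.exp (-(D.lam k * δ)) ^ 2‖ *
          Real.exp (-(k * D.L))) ≤ C₁ * (2 * (2 / (lo * D.L) ^ 2)) * τ ^ 2 := by
    have h1 := exp_neg_le_two_div_sq (by positivity : 0 < k * D.L)
    have h2 : 2 / (k * D.L) ^ 2 ≤ 2 / (lo / τ * D.L) ^ 2 := by gcongr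
    calc _ ≤ C₁ * (2 * (2 / (lo / τ * D.L) ^ 2)) := by
          gcongr
          · exact hD.norm_gap_le hk hb.delta_nonneg hP₁ hP₂
          · exact h1.trans h2
      _ = _ := by field_simp
  have hk2 : C₁ * ((B * τ) ^ 2 + B * τ / k ^ 2) ≤ C₁ * (B ^ 2 + B / lo ^ 2) * τ ^ 2 := by
    have h1 : B * τ / k ^ 2 ≤ B / lo ^ 2 * τ ^ 2 := by
      calc B * τ / k ^ 2 ≤ B * 1 / (lo / τ) ^ 2 := by gcongr
        _ = _ := by field_simp
    calc _ ≤ C₁ * ((B * τ) ^ 2 + B / lo ^ 2 * τ ^ 2) := by gcongr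
      _ = _ := by ring
  have hsum : M - 8 * B * |H| * τ ^ 2 ≤ min μ₁ (B * τ) + min μ₂ (B * τ) + min (k * δ) (B * τ) := by
    have hX : 0 ≤ 8 * B * |H| * τ ^ 2 := by positivity
    have i1 := le_min hμ₁0 hBτ
    have i2 := le_min hμ₂0 hBτ
    have i3 := le_min hkδ hBτ
    rcases le_total (B * τ) μ₁ with c1 | c1
    · rw [min_eq_right c1] at i1 ⊢
      linarith only [i2, i3, hMB, hX]
    rcases le_total (B * τ) μ₂ with c2 | c2
    · rw [min_eq_right c2] at i2 ⊢
      linarith only [i1, i3, hMB, hX]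
    rcases le_total (B * τ) (k * δ) with c3 | c3
    · rw [min_eq_right c3] at i3 ⊢
      linarith only [i1, i2, hMB, hX]
    rw [min_eq_left c1, min_eq_left c2, min_eq_left c3]
    have key : ∀ s ε : ℝ, 0 ≤ s → ε ≤ |H| * τ ^ 2 → s * (1 - 2 * ε) ≤ B * τ →
        s - 4 * B * |H| * τ ^ 2 ≤ s * (1 - 2 * ε) := by
      intro s ε hs hε hle
      have h1 : s * (1 / 2) ≤ s * (1 - 2 * ε) := by
        gcongr
        linarith only [hε, hH1]
      have h2 : s ≤ 2 * B := by nlinarith only [h1, hle, e1, hB, hτ]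
      have h3 : s * ε ≤ s * (|H| * τ ^ 2) := by gcongr
      have h4 : s * (|H| * τ ^ 2) ≤ 2 * B * (|H| * τ ^ 2) := by gcongr
      linarith only [h3, h4]
    have k1 := key _ _ hs₁ hε₁ c1
    have k2 := key _ _ hs₂ hε₂ c2
    rw [← hμ₁] at k1
    rw [← hμ₂] at k2
    linarith only [k1, k2, hM]
  calc _ ≤ _ := hmain
    _ ≤ 1 - (M - 8 * B * |H| * τ ^ 2) + C₁ * (B ^ 2 + B / lo ^ 2) * τ ^ 2 +
        C₁ * (2 * (2 / (lo * D.L) ^ 2)) * τ ^ 2 := by linarith only [he, hk2, hsum]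
    _ = _ := by ring

/-- The gain is at least `M` if `M` is below the low-frequency gain and below the
high-frequency profile. -/
theorem Admissible.rate_le_of_profile (hD : D.Admissible) {B : ℝ} (hlo : 0 < lo) (hhi : 0 < hi)
    (hB : 0 < B) : ∃ C : ℝ, 0 < C ∧ ∀ᶠ τ in 𝓝[>] (0 : ℝ), ∀ (σ : ℕ → Bool)
      (δ p₁ q₁ p₂ q₂ M : ℝ), ScaledBox lo hi H τ δ p₁ q₁ p₂ q₂ → M ≤ B * τ →
      M ≤ D.Kmode * (1 / p₁ + 1 / p₂) →
      (∀ k, lo / τ ≤ k →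
        M ≤ zdist p₁ k + zdist (1 / q₁) k + (zdist p₂ k + zdist (1 / q₂) k) + k * δ) →
      ∀ k, D.kmin ≤ k → D.rate σ δ p₁ q₁ p₂ q₂ k ≤ 1 - M + C * τ ^ 2 := by
  obtain ⟨k₀, C₂, hC₂, h₂⟩ := hD.rate_le_mid (hi := hi) (H := H) hlo hhi hB
  obtain ⟨C₁, hC₁, h₁⟩ := hD.rate_le_low (hi := hi) (H := H) hlo k₀
  obtain ⟨C₃, hC₃, h₃⟩ := hD.rate_le_high (hi := hi) (H := H) hlo hB
  refine ⟨C₁ + C₂ + C₃, by positivity, ?_⟩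
  filter_upwards [h₁, h₂, h₃] with τ h₁ h₂ h₃ σ δ p₁ q₁ p₂ q₂ M hb hMB hMK hM k hk
  have n1 : 0 ≤ C₁ * τ ^ 2 := by positivity
  have n2 : 0 ≤ C₂ * τ ^ 2 := by positivity
  have n3 : 0 ≤ C₃ * τ ^ 2 := by positivity
  rw [add_mul, add_mul]
  rcases le_total k k₀ with h | h
  · have := h₁ σ δ p₁ q₁ p₂ q₂ hb k hk h
    linarith
  rcases le_total k (lo / τ) with h' | h'
  · have := h₂ σ δ p₁ q₁ p₂ q₂ hb k hk h h'
    linarith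
  · have := h₃ σ δ p₁ q₁ p₂ q₂ M hb hMB k hk h' (hM k h')
    linarith

end Problem

end OSM

/-! ### The optimal zeros attain the gain -/

namespace OSM

theorem le_add_of_sq_le {T a b : ℝ} (ha : 0 ≤ a) (hb : 0 ≤ b) (h : T ^ 2 ≤ 4 * (a * b)) :
    T ≤ a + b := by
  refine le_of_sq_le_sq ?_ (by positivity)
  nlinarith [sq_nonneg (a - b)]

theorem zdist_of_le {z k : ℝ} (hz : 0 < z) (h : z ≤ k) : zdist z k = z / k := by
  have hk := hz.trans_le h
  refine min_eq_left ?_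
  exact ((div_le_one hk).2 h).trans ((one_le_div hz).2 h)

theorem zdist_of_ge {z k : ℝ} (hk : 0 < k) (h : k ≤ z) : zdist z k = k / z := by
  have hz := hk.trans_le h
  refine min_eq_right ?_
  exact ((div_le_one hz).2 h).trans ((one_le_div hk).2 h)

/-- Arithmetic-geometric mean inequality along a chain of zeros. -/
theorem le_profile {n : ℕ} {w T δ k : ℝ} {Z : ℕ → ℝ} (hw : 0 < w) (hδ : 0 ≤ δ) (hk : 0 < k)
    (hZ : ∀ i < n, 0 < Z i) (h₁ : ∀ i, i + 1 < n → T ^ 2 * Z (i + 1) ≤ 4 * w ^ 2 * Z i)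
    (h₂ : T ^ 2 ≤ 4 * w * (Z (n - 1) * δ)) (d m : ℕ) (hm : m + d + 1 = n) (hmk : Z m ≤ k) :
    T ≤ w * ∑ j ∈ Finset.range n, zdist (Z j) k + k * δ := by
  have hnn : ∀ j ∈ Finset.range n, 0 ≤ zdist (Z j) k := fun j hj =>
    zdist_nonneg (hZ j (Finset.mem_range.1 hj)) hk
  have hkδ : 0 ≤ k * δ := by positivity
  induction d generalizing m with
  | zero =>
    have hz := hZ m (by omega)
    obtain rfl : m = n - 1 := by omega
    have h3 := Finset.single_le_sum hnn (Finset.mem_range.2 (by omega : n - 1 < n))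
    rw [zdist_of_le hz hmk] at h3
    have h4 : T ≤ w * (Z (n - 1) / k) + k * δ := by
      refine le_add_of_sq_le (by positivity) hkδ (h₂.trans_eq ?_)
      field_simp
    have h5 := mul_le_mul_of_nonneg_left h3 hw.le
    linarith
  | succ d ih =>
    -- Walk up the chain until `k` lies between two consecutive zeros, or beyond the last one. There
    -- the two relevant distances have a product of at least `T²/4`, and the remaining ones are
    -- nonnegative.
    rcases le_total (Z (m + 1)) k with h | h
    · exact ih (m + 1) (by omega) h
    · have hz := hZ m (by omega)
      have hz' := hZ (m + 1) (by omega)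
      have h3 : zdist (Z m) k + zdist (Z (m + 1)) k ≤ ∑ j ∈ Finset.range n, zdist (Z j) k := by
        rw [← Finset.sum_pair (f := fun j => zdist (Z j) k) (by omega : m ≠ m + 1)]
        refine Finset.sum_le_sum_of_subset_of_nonneg ?_ fun j hj _ => hnn j hj
        intro j hj
        rw [Finset.mem_insert, Finset.mem_singleton] at hj
        exact Finset.mem_range.2 (by omega)
      rw [zdist_of_le hz hmk, zdist_of_ge hk h] at h3
      have h4 : T ≤ w * (Z m / k) + w * (k / Z (m + 1)) := by
        refine le_add_of_sq_le (by positivity) (by positivity) ?_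
        have h5 := h₁ m (by omega)
        rw [← le_div_iff₀ hz'] at h5
        refine h5.trans_eq ?_
        field_simp
      have h5 := mul_le_mul_of_nonneg_left h3 hw.le
      linarith

/-- Zeros near the optimal ones have a profile close to the optimal one. -/
theorem le_profile_of_near {n : ℕ} {w K T δ y k : ℝ} {Z : ℕ → ℝ} (hn : 1 ≤ n) (hw : 0 < w)
    (hK : 0 < K) (hT : 0 < T) (hδ : 0 < δ) (hTn : T ^ (2 * n + 1) = 4 ^ n * w ^ (2 * n) * K * δ)
    (hy : 0 < y) (hy1 : y ≤ 1)
    (hZ : ∀ i < n, y * optZero w K T i ≤ Z i ∧ Z i * y ≤ optZero w K T i) (hk : 0 < k)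
    (hk' : Z 0 ≤ k) : y * T ≤ w * ∑ j ∈ Finset.range n, zdist (Z j) k + k * δ := by
  have hopt := fun i => optZero_pos hw hK hT i
  refine le_profile hw hδ.le hk (fun i hi => ?_) (fun i hi => ?_) ?_ (n - 1) 0 (by omega) hk'
  · have := hopt i
    exact lt_of_lt_of_le (by positivity) (hZ i hi).1
  · have h1 := (hZ (i + 1) hi).2
    have h2 := (hZ i (by omega)).1
    have e : T ^ 2 * optZero w K T (i + 1) = 4 * w ^ 2 * optZero w K T i := by
      rw [optZero_succ]; field_simp
    calc (y * T) ^ 2 * Z (i + 1) = y * (T ^ 2 * (Z (i + 1) * y)) := by ring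
      _ ≤ y * (T ^ 2 * optZero w K T (i + 1)) := by gcongr
      _ = 4 * w ^ 2 * (y * optZero w K T i) := by rw [e]; ring
      _ ≤ _ := by gcongr
  · have h2 := (hZ (n - 1) (by omega)).1
    have h3 := hopt (n - 1)
    calc (y * T) ^ 2 = y * (y * T ^ 2) := by ring
      _ ≤ 1 * (y * T ^ 2) := by gcongr
      _ = 4 * w * (y * optZero w K T (n - 1) * δ) := by
        rw [← optZero_last hn hw hT hTn]; ring
      _ ≤ _ := by gcongr

/-- A lower bound `1 / τ` for the optimal zeros. -/
theorem optZero_ge {w K t τ : ℝ} (hw : 0 < w) (hK : 0 < K) (ht : 0 < t) (hτ : 0 < τ)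
    (h : t * τ ≤ 2 * w) (i : ℕ) : w * K / t / τ ≤ optZero w K (t * τ) i := by
  have h1 : w * K / t / τ = w * K / (t * τ) := by rw [div_div]
  rw [optZero, h1]
  refine le_mul_of_one_le_right (by positivity) (one_le_pow₀ ?_)
  rw [one_le_div (by positivity)]
  nlinarith [mul_pos ht hτ]

theorem optZero_zero (w K T : ℝ) : optZero w K T 0 = w * K / T := by
  rw [optZero, pow_zero, mul_one]

theorem optZero_le_mul {w K t τ : ℝ} (hw : 0 < w) (hK : 0 < K) (ht : 0 < t) (hτ : 0 < τ)
    (h : t * τ ≤ 2 * w) (i d : ℕ) (hd : 1 ≤ d) :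
    optZero w K (t * τ) i ≤ t ^ 2 / (4 * w ^ 2) * τ ^ 2 * optZero w K (t * τ) (i + d) := by
  have hpos := optZero_pos hw hK (mul_pos ht hτ) i
  obtain ⟨e, rfl⟩ := Nat.exists_eq_add_of_le hd
  have h1 : optZero w K (t * τ) (i + (1 + e)) =
      optZero w K (t * τ) i * (4 * w ^ 2 / (t * τ) ^ 2) * (4 * w ^ 2 / (t * τ) ^ 2) ^ e := by
    rw [optZero, optZero]; ring
  have h2 : 1 ≤ (4 * w ^ 2 / (t * τ) ^ 2) ^ e := by
    refine one_le_pow₀ ?_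
    rw [one_le_div (by positivity)]
    nlinarith [mul_pos ht hτ]
  have h3 : t ^ 2 / (4 * w ^ 2) * τ ^ 2 * optZero w K (t * τ) (i + (1 + e)) =
      optZero w K (t * τ) i * (4 * w ^ 2 / (t * τ) ^ 2) ^ e := by
    rw [h1]; field_simp
  rw [h3]
  exact le_mul_of_one_le_right hpos.le h2

namespace Problem

variable {D : Problem}

/-- Consecutive optimal zeros differ by the factor `4w²/T²`, of order `τ^(-2)`. A zero placed below
its own pole is therefore separated from it by at least that factor, up to the tolerance `y ≥ 1/2`.
-/
theorem near_mul_le {w K t τ y z z' q : ℝ} (hw : 0 < w) (hK : 0 < K) (ht : 0 < t) (hτ : 0 < τ)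
    (h : t * τ ≤ 2 * w) (hy : 1 / 2 ≤ y) (hq : 0 < q) (i d : ℕ) (hd : 1 ≤ d)
    (hz : z * y ≤ optZero w K (t * τ) i) (hz' : y * optZero w K (t * τ) (i + d) ≤ z')
    (hqz : z' = 1 / q) : z * q ≤ t ^ 2 / w ^ 2 * τ ^ 2 := by
  have hle := optZero_le_mul hw hK ht hτ h i d hd
  have hpos := optZero_pos hw hK (mul_pos ht hτ) (i + d)
  have hpos0 := optZero_pos hw hK (mul_pos ht hτ) i
  have hy0 : 0 < y := by linarith
  have hq' : y * optZero w K (t * τ) (i + d) * q ≤ 1 := by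
    rw [hqz, le_div_iff₀ hq] at hz'
    exact hz'
  generalize optZero w K (t * τ) (i + d) = X' at *
  generalize optZero w K (t * τ) i = X at *
  have h1 : z ≤ 2 * X := by
    rcases le_or_gt z 0 with h0 | h0
    · linarith
    · nlinarith
  have h2 : X' * q ≤ 2 := by
    have : 0 < X' * q := by positivity
    nlinarith
  calc z * q ≤ 2 * X * q := by gcongr
    _ ≤ 2 * (t ^ 2 / (4 * w ^ 2) * τ ^ 2 * X') * q := by gcongr
    _ = 2 * (t ^ 2 / (4 * w ^ 2) * τ ^ 2) * (X' * q) := by ring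
    _ ≤ 2 * (t ^ 2 / (4 * w ^ 2) * τ ^ 2) * 2 := by gcongr
    _ = _ := by field_simp; ring

/-- The gain for parameters near the optimal two-sided ones. -/
theorem Admissible.rate_le_twoSided (hD : D.Admissible) {t : ℝ} (ht : 0 < t)
    (ht9 : t ^ 9 = 256 * D.Kmode) : ∃ C : ℝ, 0 < C ∧ ∀ᶠ τ in 𝓝[>] (0 : ℝ),
      ∀ (σ : ℕ → Bool) (p₁ q₁ p₂ q₂ y : ℝ), 0 < q₁ → 0 < q₂ → 1 / 2 ≤ y → y ≤ 1 →
      (∀ i : Fin 4, y * optZero 1 D.Kmode (t * τ) i ≤ ![p₁, p₂, 1 / q₂, 1 / q₁] i ∧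
        ![p₁, p₂, 1 / q₂, 1 / q₁] i * y ≤ optZero 1 D.Kmode (t * τ) i) →
      ∀ k, D.kmin ≤ k → D.rate σ (τ ^ 9) p₁ q₁ p₂ q₂ k ≤ 1 - y * (t * τ) + C * τ ^ 2 := by
  have hK := Kmode_pos hD.L_pos hD.Lhat_pos hD.eta_nonneg hD.eps_nonneg
  set K := D.Kmode with hKdef
  -- The optimal smallest zero is `wK/(tτ)`. The tolerance `y ≥ 1/2` allows a factor `2` in either
  -- direction, which gives `lo` and `hi`.
  obtain ⟨C, hC, h⟩ := hD.rate_le_of_profile (lo := 1 * K / t / 2) (hi := 2 * (1 * K / t))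
    (H := t ^ 2 / 1 ^ 2) (B := t) (by positivity) (by positivity) ht
  refine ⟨C, hC, ?_⟩
  filter_upwards [self_mem_nhdsWithin, eventually_mul_lt 1 one_pos, h, eventually_mul_lt t two_pos,
    eventually_mul_lt t (by norm_num : (0 : ℝ) < 1 / 4)] with τ hτ e1 h e2 e3 σ p₁ q₁ p₂ q₂ y hq₁ hq₂
    hy hy1 hZ k hk
  have hτ : 0 < τ := hτ
  rw [one_mul] at e1
  have hy0 : 0 < y := by linarith
  have ht2 : t * τ ≤ 2 * 1 := by linarith
  obtain ⟨a0, b0⟩ := hZ 0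
  obtain ⟨a1, b1⟩ := hZ 1
  obtain ⟨a2, b2⟩ := hZ 2
  obtain ⟨a3, b3⟩ := hZ 3
  replace a0 : y * optZero 1 K (t * τ) 0 ≤ p₁ := a0
  replace b0 : p₁ * y ≤ optZero 1 K (t * τ) 0 := b0
  replace a1 : y * optZero 1 K (t * τ) 1 ≤ p₂ := a1
  replace b1 : p₂ * y ≤ optZero 1 K (t * τ) 1 := b1
  replace a2 : y * optZero 1 K (t * τ) 2 ≤ 1 / q₂ := a2
  replace a3 : y * optZero 1 K (t * τ) 3 ≤ 1 / q₁ := a3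
  have hopt0 := optZero_pos one_pos hK (mul_pos ht hτ) 0
  have lowb : ∀ i (z : ℝ), y * optZero 1 K (t * τ) i ≤ z → 1 * K / t / 2 / τ ≤ z := by
    intro i z hz
    refine le_trans ?_ hz
    have h1 := optZero_ge one_pos hK ht hτ ht2 i
    calc 1 * K / t / 2 / τ = 1 / 2 * (1 * K / t / τ) := by ring
      _ ≤ _ := by gcongr
  have hp₁hi : p₁ ≤ 2 * (1 * K / t) / τ := by
    have h1 : p₁ ≤ 2 * optZero 1 K (t * τ) 0 := by nlinarith
    refine h1.trans_eq ?_
    rw [optZero_zero]; field_simp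
  have hbox : ScaledBox (1 * K / t / 2) (2 * (1 * K / t)) (t ^ 2 / 1 ^ 2) τ (τ ^ 9) p₁ q₁ p₂ q₂ :=
    { delta_nonneg := by positivity
      delta_le := pow_le_pow_of_le_one hτ.le e1.le (by norm_num)
      q₁_pos := hq₁
      q₂_pos := hq₂
      le_p₁ := lowb _ _ a0
      le_p₂ := lowb _ _ a1
      p₁_le := hp₁hi
      mul_le₁ := near_mul_le one_pos hK ht hτ ht2 hy hq₁ 0 3 (by norm_num) b0 a3 rfl
      mul_le₂ := near_mul_le one_pos hK ht hτ ht2 hy hq₂ 1 1 (by norm_num) b1 a2 rfl }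
  have hp₁ : 0 < p₁ := lt_of_lt_of_le (by positivity) hbox.le_p₁
  have hp₂ : 0 < p₂ := lt_of_lt_of_le (by positivity) hbox.le_p₂
  have hyt : y * (t * τ) ≤ t * τ := mul_le_of_le_one_left (by positivity) hy1
  refine h σ (τ ^ 9) p₁ q₁ p₂ q₂ (y * (t * τ)) hbox hyt ?_ (fun k hk => ?_) k hk
  · have h1 : y * (t * τ) ≤ K / p₁ := by
      rw [optZero_zero, le_div_iff₀ (by positivity)] at b0
      rw [le_div_iff₀ hp₁]
      linarith
    have h2 : 0 ≤ K * (1 / p₂) := by positivity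
    rw [mul_add, mul_one_div]
    linarith
  · have hk0 : 0 < k := lt_of_lt_of_le (by positivity) hk
    rcases le_total p₁ k with hpk | hpk
    · have := le_profile_of_near (n := 4) (w := 1) (K := K) (T := t * τ) (δ := τ ^ 9) (y := y)
        (k := k) (Z := fun j => if h : j < 4 then ![p₁, p₂, 1 / q₂, 1 / q₁] ⟨j, h⟩ else 1)
        (by norm_num) one_pos hK (by positivity) (by positivity)
        (by rw [mul_pow, ht9]; norm_num) hy0 hy1 (fun i hi => by simpa [hi] using hZ ⟨i, hi⟩) hk0
        (by simpa using hpk)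
      rw [Finset.sum_range, Fin.sum_univ_four] at this
      simp only [Fin.is_lt, dite_true, Fin.eta, one_mul] at this
      replace this : y * (t * τ) ≤ zdist p₁ k + zdist p₂ k + zdist (1 / q₂) k +
        zdist (1 / q₁) k + k * τ ^ 9 := this
      linarith
    -- Between `lo/τ` and `p₁ ≤ hi/τ` the frequency is within a factor `4` of `p₁`, so this zero
    -- alone contributes a constant, far more than `tτ`.
    · have h1 : 1 / 4 ≤ zdist p₁ k := by
        rw [zdist_of_ge hk0 hpk, le_div_iff₀ hp₁]
        have h2 : 2 * (1 * K / t) / τ = 4 * (1 * K / t / 2 / τ) := by ring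
        rw [h2] at hp₁hi
        linarith
      have n1 := zdist_nonneg (one_div_pos.2 hq₁) hk0
      have n2 := zdist_nonneg (one_div_pos.2 hq₂) hk0
      have n3 := zdist_nonneg hp₂ hk0
      have n4 : 0 ≤ k * τ ^ 9 := by positivity
      linarith

/-- The gain for parameters near the optimal one-sided ones. -/
theorem Admissible.rate_le_oneSided (hD : D.Admissible) {t : ℝ} (ht : 0 < t)
    (ht5 : t ^ 5 = 256 * D.Kmode) : ∃ C : ℝ, 0 < C ∧ ∀ᶠ τ in 𝓝[>] (0 : ℝ),
      ∀ (σ : ℕ → Bool) (p q y : ℝ), 0 < q → 1 / 2 ≤ y → y ≤ 1 →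
      (∀ i : Fin 2, y * optZero 2 D.Kmode (t * τ) i ≤ ![p, 1 / q] i ∧
        ![p, 1 / q] i * y ≤ optZero 2 D.Kmode (t * τ) i) →
      ∀ k, D.kmin ≤ k → D.rate σ (τ ^ 5) p q p q k ≤ 1 - y * (t * τ) + C * τ ^ 2 := by
  have hK := Kmode_pos hD.L_pos hD.Lhat_pos hD.eta_nonneg hD.eps_nonneg
  set K := D.Kmode with hKdef
  obtain ⟨C, hC, h⟩ := hD.rate_le_of_profile (lo := 2 * K / t / 2) (hi := 2 * (2 * K / t))
    (H := t ^ 2 / 2 ^ 2) (B := t) (by positivity) (by positivity) ht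
  refine ⟨C, hC, ?_⟩
  filter_upwards [self_mem_nhdsWithin, eventually_mul_lt 1 one_pos, h, eventually_mul_lt t two_pos,
    eventually_mul_lt t (by norm_num : (0 : ℝ) < 1 / 4)] with τ hτ e1 h e2 e3 σ p q y hq hy hy1 hZ k hk
  have hτ : 0 < τ := hτ
  rw [one_mul] at e1
  have hy0 : 0 < y := by linarith
  have ht2 : t * τ ≤ 2 * 2 := by linarith
  obtain ⟨a0, b0⟩ := hZ 0
  obtain ⟨a1, b1⟩ := hZ 1
  replace a0 : y * optZero 2 K (t * τ) 0 ≤ p := a0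
  replace b0 : p * y ≤ optZero 2 K (t * τ) 0 := b0
  replace a1 : y * optZero 2 K (t * τ) 1 ≤ 1 / q := a1
  have hopt0 := optZero_pos two_pos hK (mul_pos ht hτ) 0
  have hlow : 2 * K / t / 2 / τ ≤ p := by
    refine le_trans ?_ a0
    have h1 := optZero_ge two_pos hK ht hτ ht2 0
    calc 2 * K / t / 2 / τ = 1 / 2 * (2 * K / t / τ) := by ring
      _ ≤ _ := by gcongr
  have hphi : p ≤ 2 * (2 * K / t) / τ := by
    have h1 : p ≤ 2 * optZero 2 K (t * τ) 0 := by nlinarith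
    refine h1.trans_eq ?_
    rw [optZero_zero]; field_simp
  have hpq := near_mul_le two_pos hK ht hτ ht2 hy hq 0 1 le_rfl b0 a1 rfl
  have hbox : ScaledBox (2 * K / t / 2) (2 * (2 * K / t)) (t ^ 2 / 2 ^ 2) τ (τ ^ 5) p q p q :=
    { delta_nonneg := by positivity
      delta_le := pow_le_pow_of_le_one hτ.le e1.le (by norm_num)
      q₁_pos := hq
      q₂_pos := hq
      le_p₁ := hlow
      le_p₂ := hlow
      p₁_le := hphi
      mul_le₁ := hpq
      mul_le₂ := hpq }
  have hp : 0 < p := lt_of_lt_of_le (by positivity) hlow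
  have hyt : y * (t * τ) ≤ t * τ := mul_le_of_le_one_left (by positivity) hy1
  refine h σ (τ ^ 5) p q p q (y * (t * τ)) hbox hyt ?_ (fun k hk => ?_) k hk
  · rw [optZero_zero, le_div_iff₀ (by positivity)] at b0
    have e : K * (1 / p + 1 / p) = 2 * K / p := by ring
    rw [e, le_div_iff₀ hp]
    linarith
  · have hk0 : 0 < k := lt_of_lt_of_le (by positivity) hk
    rcases le_total p k with hpk | hpk
    · have := le_profile_of_near (n := 2) (w := 2) (K := K) (T := t * τ) (δ := τ ^ 5) (y := y)
        (k := k) (Z := fun j => if h : j < 2 then ![p, 1 / q] ⟨j, h⟩ else 1)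
        (by norm_num) two_pos hK (by positivity) (by positivity)
        (by rw [mul_pow, ht5]; norm_num) hy0 hy1 (fun i hi => by simpa [hi] using hZ ⟨i, hi⟩) hk0
        (by simpa using hpk)
      rw [Finset.sum_range, Fin.sum_univ_two] at this
      simp only [Fin.is_lt, dite_true, Fin.eta] at this
      replace this : y * (t * τ) ≤ 2 * (zdist p k + zdist (1 / q) k) + k * τ ^ 5 := this
      linarith
    · have h1 : 1 / 4 ≤ zdist p k := by
        rw [zdist_of_ge hk0 hpk, le_div_iff₀ hp]
        have h2 : 2 * (2 * K / t) / τ = 4 * (2 * K / t / 2 / τ) := by ring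
        rw [h2] at hphi
        linarith
      have n1 := zdist_nonneg (one_div_pos.2 hq) hk0
      have n4 : 0 ≤ k * τ ^ 5 := by positivity
      linarith

end Problem

end OSM

/-! ### Which zero is which parameter -/

namespace OSM

/-- Optimal zeros of different index differ by a factor of at least `4`, which the tolerance `y² ≥
81/100` cannot bridge. -/
theorem optZero_strict {w K T y : ℝ} (hw : 0 < w) (hK : 0 < K) (hT : 0 < T) (hTw : T ≤ w)
    (hy : 9 / 10 ≤ y) {z z' : ℝ} {i j : ℕ} (hz : y * optZero w K T i ≤ z)
    (hz' : z' * y ≤ optZero w K T j) (h : z ≤ z') : i ≤ j := by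
  by_contra! hlt
  obtain ⟨d, rfl⟩ := Nat.exists_eq_add_of_lt hlt
  have hpos := optZero_pos hw hK hT j
  have h1 : optZero w K T (j + d + 1) = optZero w K T j * (4 * w ^ 2 / T ^ 2) ^ (d + 1) := by
    rw [optZero, optZero]; ring
  have h2 : 4 ≤ 4 * w ^ 2 / T ^ 2 := by
    rw [le_div_iff₀ (by positivity)]
    nlinarith
  have h3 : 4 ≤ (4 * w ^ 2 / T ^ 2) ^ (d + 1) :=
    h2.trans (le_self_pow₀ (by linarith) (by omega))
  have h4 : 4 * optZero w K T j ≤ optZero w K T (j + d + 1) := by rw [h1]; nlinarith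
  have hy0 : 0 < y := by linarith
  have h5 : y * (y * (4 * optZero w K T j)) ≤ optZero w K T j := by
    refine le_trans ?_ hz'
    calc y * (y * (4 * optZero w K T j)) ≤ y * (y * optZero w K T (j + d + 1)) := by gcongr
      _ ≤ y * z' := by gcongr; exact hz.trans h
      _ = z' * y := mul_comm _ _
  have h6 : 81 / 100 ≤ y * y := by nlinarith
  nlinarith

theorem optZero_one (w K T : ℝ) : optZero w K T 1 = 4 * w ^ 3 * K / T ^ 3 := by
  rw [optZero]; ring

theorem optZero_mono {w K T : ℝ} (hw : 0 < w) (hK : 0 < K) (hT : 0 < T) (hTw : T ≤ 2 * w)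
    {i j : ℕ} (h : i ≤ j) : optZero w K T i ≤ optZero w K T j := by
  refine monotone_nat_of_le_succ (fun m => ?_) h
  rw [optZero_succ]
  refine le_mul_of_one_le_right (optZero_pos hw hK hT m).le ?_
  rw [one_le_div (by positivity)]
  nlinarith

namespace Problem

variable {D : Problem}

/-- If every `p` is at the scale of the second zero or above, then `1/p₁ + 1/p₂ = O(τ³)`, and the
gain at the lowest frequency is only `O(τ²)`. -/
theorem Admissible.gain_lt_of_large (hD : D.Admissible) {c κ t : ℝ} (hc : 0 < c) (hκ : 0 < κ)
    (ht : 0 < t) (N : ℕ) (hN : 2 ≤ N) : ∀ᶠ τ in 𝓝[>] (0 : ℝ), ∀ (σ : ℕ → Bool)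
      (kmax p₁ q₁ p₂ q₂ : ℝ), 0 < q₁ → 0 < q₂ → c / τ ^ N ≤ kmax → κ / τ ^ 3 ≤ p₁ →
      κ / τ ^ 3 ≤ p₂ → 1 - D.rho₂ σ kmax (τ ^ N) p₁ q₁ p₂ q₂ < t * τ := by
  obtain ⟨C, hC, h⟩ := hD.gain_le
  have hK := Kmode_pos hD.L_pos hD.Lhat_pos hD.eta_nonneg hD.eps_nonneg
  filter_upwards [self_mem_nhdsWithin, eventually_mul_lt 1 one_pos,
    eventually_le_div D.kmin hc N (by omega),
    eventually_mul_lt (D.Kmode * (2 / κ) + C * ((2 / κ) ^ 2 + 1)) ht]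
    with τ hτ e1 e2 e3 σ kmax p₁ q₁ p₂ q₂ hq₁ hq₂ hk h1 h2
  have hτ : 0 < τ := hτ
  rw [one_mul] at e1
  have hκτ : 0 < κ / τ ^ 3 := by positivity
  have hp₁ := hκτ.trans_le h1
  have hp₂ := hκτ.trans_le h2
  have hδ : τ ^ N ≤ τ ^ 2 := pow_le_pow_of_le_one hτ.le e1.le hN
  have hτ3 : τ ^ 3 ≤ τ ^ 2 := pow_le_pow_of_le_one hτ.le e1.le (by norm_num)
  have hτ1 : τ ^ 2 ≤ 1 := by nlinarith
  have h3 := (h σ kmax (τ ^ N) p₁ q₁ p₂ q₂ (by positivity) (hδ.trans hτ1) hp₁ hq₁ hp₂ hq₂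
    (e2.trans hk)).1
  have i1 : 1 / p₁ ≤ τ ^ 3 / κ := (one_div_le_one_div_of_le hκτ h1).trans_eq (one_div_div _ _)
  have i2 : 1 / p₂ ≤ τ ^ 3 / κ := (one_div_le_one_div_of_le hκτ h2).trans_eq (one_div_div _ _)
  have i3 : 1 / p₁ + 1 / p₂ ≤ 2 / κ * τ ^ 2 := by
    calc _ ≤ τ ^ 3 / κ + τ ^ 3 / κ := add_le_add i1 i2
      _ = 2 / κ * τ ^ 3 := by ring
      _ ≤ _ := by gcongr
  have i0 : 0 ≤ 1 / p₁ + 1 / p₂ := by positivity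
  have i4 : (1 / p₁ + 1 / p₂) ^ 2 ≤ (2 / κ) ^ 2 * τ ^ 2 := by
    have := pow_le_pow_left₀ i0 i3 2
    rw [mul_pow] at this
    refine this.trans ?_
    gcongr
    nlinarith [sq_nonneg τ]
  generalize 1 / p₁ + 1 / p₂ = X at *
  calc _ ≤ D.Kmode * X + C * (X ^ 2 + τ ^ N) := h3
    _ ≤ D.Kmode * (2 / κ * τ ^ 2) + C * ((2 / κ) ^ 2 * τ ^ 2 + τ ^ 2) := by gcongr
    _ = (D.Kmode * (2 / κ) + C * ((2 / κ) ^ 2 + 1)) * τ * τ := by ring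
    _ < t * τ := mul_lt_mul_of_pos_right e3 hτ

/-- The order of the zeros of nearly optimal one-sided conditions. -/
theorem Admissible.order_oneSided (hD : D.Admissible) {c t : ℝ} (hc : 0 < c) (ht : 0 < t) :
    ∀ᶠ τ in 𝓝[>] (0 : ℝ), ∀ kmax p q y : ℝ, 0 < q →
      c / τ ^ 5 ≤ kmax → 9 / 10 ≤ y → 9 / 10 * (t * τ) ≤ 1 - D.rho₁ kmax (τ ^ 5) p q →
      ∀ π : Equiv.Perm (Fin 2), (∀ i : Fin 2, y * optZero 2 D.Kmode (t * τ) i ≤ ![p, 1 / q] (π i) ∧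
        ![p, 1 / q] (π i) * y ≤ optZero 2 D.Kmode (t * τ) i) →
      (∀ i : Fin 2, y * optZero 2 D.Kmode (t * τ) i ≤ ![p, 1 / q] i ∧
        ![p, 1 / q] i * y ≤ optZero 2 D.Kmode (t * τ) i) := by
  have hK := Kmode_pos hD.L_pos hD.Lhat_pos hD.eta_nonneg hD.eps_nonneg
  have hlow := hD.gain_lt_of_large (t := 9 / 10 * t) (κ := 9 / 10 * (4 * 2 ^ 3 * D.Kmode / t ^ 3)) hc
    (by positivity) (by positivity) 5 (by norm_num)
  filter_upwards [self_mem_nhdsWithin, hlow] with τ hτ h kmax p q y hq hk hy hE π hZ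
  have hτ : 0 < τ := hτ
  have hpos := optZero_pos two_pos hK (mul_pos ht hτ) 1
  have hfix : π 1 = 1 := by
    by_contra hne
    have h1 : π 1 = 0 := by
      generalize π 1 = a at hne
      fin_cases a
      · rfl
      · exact absurd rfl hne
    have h2 := (hZ 1).1
    rw [h1] at h2
    replace h2 : y * optZero 2 D.Kmode (t * τ) 1 ≤ p := h2
    have h3 : 9 / 10 * (4 * 2 ^ 3 * D.Kmode / t ^ 3) / τ ^ 3 ≤ p := by
      refine le_trans ?_ h2
      calc _ = 9 / 10 * optZero 2 D.Kmode (t * τ) 1 := by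
            rw [optZero_one, mul_pow]; field_simp
        _ ≤ _ := by gcongr
    have h4 := h (fun _ => true) kmax p q p q hq hq hk h3 h3
    rw [← rho₁_eq] at h4
    linarith
  have hπ : ∀ i, π i = i := by
    intro i
    fin_cases i
    · have h5 : π 0 ≠ π 1 := fun h => by simpa using π.injective h
      rw [hfix] at h5
      change π 0 = 0
      generalize π 0 = a at h5
      fin_cases a
      · rfl
      · exact absurd rfl h5
    · exact hfix
  intro i
  have := hZ i
  rwa [hπ i] at this

/-- This excludes the order `p₁, 1/q₂` followed by `p₂` and `1/q₁`. Between `1/q₂` and `p₂` both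
parts `kq₂` and `p₂/k` of the second symbol exceed `1` and add up; its contribution is then at most
`k/p₂`, and the pole `1/q₂` gives nothing. Only about half of `T` is left at the balancing
frequency. -/
theorem Admissible.gain_lt_of_interlaced (hD : D.Admissible) {c t : ℝ} (hc : 0 < c) (ht : 0 < t) :
    ∀ᶠ τ in 𝓝[>] (0 : ℝ), ∀ (σ : ℕ → Bool) (kmax p₁ q₁ p₂ q₂ y : ℝ), 0 < p₁ → 0 < q₁ → 0 < p₂ →
      0 < q₂ → c / τ ^ 9 ≤ kmax → 9 / 10 ≤ y → p₁ * y ≤ optZero 1 D.Kmode (t * τ) 0 →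
      (y * optZero 1 D.Kmode (t * τ) 2 ≤ p₂ ∧ y * optZero 1 D.Kmode (t * τ) 3 ≤ 1 / q₁ ∨
        y * optZero 1 D.Kmode (t * τ) 3 ≤ p₂ ∧ y * optZero 1 D.Kmode (t * τ) 2 ≤ 1 / q₁) →
      1 - D.rho₂ σ kmax (τ ^ 9) p₁ q₁ p₂ q₂ < 9 / 10 * (t * τ) := by
  obtain ⟨C, hC, h⟩ := hD.gain_le
  have hK := Kmode_pos hD.L_pos hD.Lhat_pos hD.eta_nonneg hD.eps_nonneg
  set K := D.Kmode with hKdef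
  clear_value K
  have hkmin : ∀ᶠ τ in 𝓝[>] (0 : ℝ), D.kmin ≤ 8 * K / t ^ 4 / τ ^ 4 :=
    eventually_le_div _ (by positivity) 4 (by norm_num)
  filter_upwards [self_mem_nhdsWithin, eventually_mul_lt 1 one_pos,
    eventually_le_div D.kmin hc 9 (by norm_num), hkmin, eventually_mul_lt (8 * K / t ^ 4) hc,
    eventually_mul_lt t (by norm_num : (0 : ℝ) < 1 / 100),
    eventually_mul_lt (8 * K / t ^ 4) (by positivity : 0 < t / 100),
    eventually_mul_lt (C * t ^ 8 / (64 * K ^ 2)) (by positivity : 0 < t / 100)]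
    with τ hτ e1 e2 e3 e4 e5 e6 e7 σ kmax p₁ q₁ p₂ q₂ y hp₁ hq₁ hp₂ hq₂ hk hy hz0 hz
  have hτ : 0 < τ := hτ
  rw [one_mul] at e1
  have hy0 : 0 < y := by linarith
  have hT : 0 < t * τ := by positivity
  have hT3 : (t * τ) ^ 3 ≤ 1 / 10000 * (t * τ) := by
    have : (t * τ) ^ 2 ≤ (1 / 100) ^ 2 := pow_le_pow_left₀ hT.le e5.le 2
    nlinarith
  have o0 : optZero 1 K (t * τ) 0 = K / (t * τ) := by rw [optZero]; ring
  have o2 : optZero 1 K (t * τ) 2 = 16 * K / (t * τ) ^ 5 := by rw [optZero]; ring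
  have o3 : optZero 1 K (t * τ) 3 = 64 * K / (t * τ) ^ 7 := by rw [optZero]; ring
  rw [o0] at hz0
  rw [o2, o3] at hz
  have hkeq : 8 * K / t ^ 4 / τ ^ 4 = 8 * K / (t * τ) ^ 4 := by rw [mul_pow, div_div]
  rw [hkeq] at e3
  have hkδ : 8 * K / (t * τ) ^ 4 * τ ^ 9 = 8 * K / t ^ 4 * τ * τ ^ 4 := by field_simp
  have hτ4 : τ ^ 4 ≤ τ := by
    have := pow_le_pow_of_le_one hτ.le e1.le (show 1 ≤ 4 by norm_num)
    rwa [pow_one] at this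
  -- The geometric mean of the second and third optimal zeros, `4K/T³` and `16K/T⁵` with `T = tτ`.
  set k := 8 * K / (t * τ) ^ 4 with hkdef
  have hk0 : 0 < k := by positivity
  have hkkmax : k ≤ kmax := by
    refine le_trans ?_ hk
    rw [le_div_iff₀ (by positivity), hkδ]
    calc 8 * K / t ^ 4 * τ * τ ^ 4 ≤ c * 1 := by
          gcongr
          exact hτ4.trans e1.le
      _ = c := mul_one c
  have hkδ' : k * τ ^ 9 ≤ 1 / 100 * (t * τ) := by
    rw [hkδ]
    calc 8 * K / t ^ 4 * τ * τ ^ 4 ≤ t / 100 * τ := by gcongr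
      _ = _ := by ring
  have m0 : p₁ / k ≤ (t * τ) ^ 3 := by
    rw [div_le_iff₀ hk0]
    have h1 : p₁ ≤ 2 * (K / (t * τ)) := by nlinarith
    refine h1.trans ?_
    have h2 : (t * τ) ^ 3 * k = 8 * (K / (t * τ)) := by rw [hkdef]; field_simp
    have : 0 ≤ K / (t * τ) := by positivity
    linarith
  have g2 : ∀ z, y * (16 * K / (t * τ) ^ 5) ≤ z → k / z ≤ 5 / 9 * (t * τ) := by
    intro z hz
    have hz0 : 0 < z := lt_of_lt_of_le (by positivity) hz
    rw [div_le_iff₀ hz0]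
    calc k = 5 / 9 * (t * τ) * (9 / 10 * (16 * K / (t * τ) ^ 5)) := by
          rw [hkdef]; field_simp; norm_num
      _ ≤ 5 / 9 * (t * τ) * (y * (16 * K / (t * τ) ^ 5)) := by gcongr
      _ ≤ _ := by gcongr
  have g3 : ∀ z, y * (64 * K / (t * τ) ^ 7) ≤ z → k / z ≤ (t * τ) ^ 3 := by
    intro z hz
    have hz0 : 0 < z := lt_of_lt_of_le (by positivity) hz
    rw [div_le_iff₀ hz0]
    calc k ≤ (t * τ) ^ 3 * (9 / 10 * (64 * K / (t * τ) ^ 7)) := by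
          have e : (t * τ) ^ 3 * (9 / 10 * (64 * K / (t * τ) ^ 7)) = 36 / 5 * k := by
            rw [hkdef]; field_simp; norm_num
          rw [e]; linarith
      _ ≤ (t * τ) ^ 3 * (y * (64 * K / (t * τ) ^ 7)) := by gcongr
      _ ≤ _ := by gcongr
  have hsum : k / p₂ + k / (1 / q₁) ≤ 5 / 9 * (t * τ) + (t * τ) ^ 3 := by
    rcases hz with ⟨z1, z2⟩ | ⟨z1, z2⟩
    · linarith [g2 _ z1, g3 _ z2]
    · linarith [g3 _ z1, g2 _ z2]
  have hkq : k / (1 / q₁) = k * q₁ := by rw [div_div_eq_mul_div, div_one]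
  rw [hkq] at hsum
  have hδ1 : τ ^ 9 ≤ 1 := pow_le_one₀ hτ.le e1.le
  have hmain := (h σ kmax (τ ^ 9) p₁ q₁ p₂ q₂ (by positivity) hδ1 hp₁ hq₁ hp₂ hq₂
    (e2.trans hk)).2 k (p₁ / k + k * q₁) (k / p₂) e3 hkkmax (by positivity) (by positivity)
    (Or.inl (by
      refine le_of_eq ?_
      field_simp))
    (Or.inr (by
      have : 0 ≤ k ^ 2 * q₂ := by positivity
      gcongr
      linarith))
  have hS : p₁ / k + k * q₁ + k / p₂ + k * τ ^ 9 ≤ 3 / 5 * (t * τ) := by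
    linarith only [hsum, m0, hkδ', hT3, hT]
  have hS0 : 0 ≤ p₁ / k + k * q₁ + k / p₂ + k * τ ^ 9 := by positivity
  have hS2 := pow_le_pow_left₀ hS0 hS 2
  have hCk : C / k ^ 2 ≤ 1 / 100 * (t * τ) := by
    have e : C / k ^ 2 = C * t ^ 8 / (64 * K ^ 2) * τ * τ ^ 7 := by
      rw [hkdef]; field_simp; norm_num
    rw [e]
    have hτ7 : τ ^ 7 ≤ τ := by
      have := pow_le_pow_of_le_one hτ.le e1.le (show 1 ≤ 7 by norm_num)
      rwa [pow_one] at this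
    calc _ ≤ t / 100 * τ := by gcongr
      _ = _ := by ring
  have hT2 : (t * τ) * (t * τ) ≤ 1 / 100 * (t * τ) := by gcongr
  generalize p₁ / k + k * q₁ + k / p₂ + k * τ ^ 9 = S at *
  have e8 : (3 / 5 * (t * τ)) ^ 2 = 9 / 25 * ((t * τ) * (t * τ)) := by ring
  linarith only [hmain, hS, hS2, hCk, hT2, e8, hT]

/-- The order of the zeros of nearly optimal two-sided conditions. -/
theorem Admissible.order_twoSided (hD : D.Admissible) {c t : ℝ} (hc : 0 < c) (ht : 0 < t) :
    ∀ᶠ τ in 𝓝[>] (0 : ℝ), ∀ (σ : ℕ → Bool) (kmax p₁ q₁ p₂ q₂ y : ℝ), 0 < p₁ → 0 < q₁ → 0 < p₂ →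
      0 < q₂ → p₁ ≤ p₂ → q₁ ≤ q₂ → c / τ ^ 9 ≤ kmax → 9 / 10 ≤ y →
      9 / 10 * (t * τ) ≤ 1 - D.rho₂ σ kmax (τ ^ 9) p₁ q₁ p₂ q₂ →
      ∀ π : Equiv.Perm (Fin 4), (∀ i : Fin 4,
        y * optZero 1 D.Kmode (t * τ) i ≤ ![p₁, 1 / q₁, p₂, 1 / q₂] (π i) ∧
        ![p₁, 1 / q₁, p₂, 1 / q₂] (π i) * y ≤ optZero 1 D.Kmode (t * τ) i) →
      (∀ i : Fin 4, y * optZero 1 D.Kmode (t * τ) i ≤ ![p₁, p₂, 1 / q₂, 1 / q₁] i ∧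
        ![p₁, p₂, 1 / q₂, 1 / q₁] i * y ≤ optZero 1 D.Kmode (t * τ) i) := by
  have hK := Kmode_pos hD.L_pos hD.Lhat_pos hD.eta_nonneg hD.eps_nonneg
  have hlow := hD.gain_lt_of_large (t := 9 / 10 * t) (κ := 9 / 10 * (4 * 1 ^ 3 * D.Kmode / t ^ 3)) hc
    (by positivity) (by positivity) 9 (by norm_num)
  filter_upwards [self_mem_nhdsWithin, hlow, hD.gain_lt_of_interlaced hc ht, eventually_mul_lt t one_pos]
    with τ hτ h h' e1 σ kmax p₁ q₁ p₂ q₂ y hp₁ hq₁ hp₂ hq₂ hp hq hk hy hE π hZ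
  have hτ : 0 < τ := hτ
  have hT : 0 < t * τ := by positivity
  have hZ' : ∀ i : Fin 4, y * optZero 1 D.Kmode (t * τ) (π.symm i) ≤ ![p₁, 1 / q₁, p₂, 1 / q₂] i ∧
      ![p₁, 1 / q₁, p₂, 1 / q₂] i * y ≤ optZero 1 D.Kmode (t * τ) (π.symm i) := fun i => by
    have := hZ (π.symm i)
    rwa [Equiv.apply_symm_apply] at this
  have hinj : ∀ i j : Fin 4, i ≠ j → (π.symm i : ℕ) ≠ π.symm j := fun i j hij heq =>
    hij (π.symm.injective (Fin.ext heq))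
  obtain ⟨a1, a2⟩ := hZ' 0
  obtain ⟨b1, b2⟩ := hZ' 1
  obtain ⟨c1, c2⟩ := hZ' 2
  obtain ⟨d1, d2⟩ := hZ' 3
  have ab := hinj 0 1 (by decide)
  have ac := hinj 0 2 (by decide)
  have ad := hinj 0 3 (by decide)
  have bc := hinj 1 2 (by decide)
  have bd := hinj 1 3 (by decide)
  have cd := hinj 2 3 (by decide)
  have la := (π.symm 0).isLt
  have lb := (π.symm 1).isLt
  have lc := (π.symm 2).isLt
  have ld := (π.symm 3).isLt
  generalize (π.symm 0 : ℕ) = a at *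
  generalize (π.symm 1 : ℕ) = b at *
  generalize (π.symm 2 : ℕ) = c' at *
  generalize (π.symm 3 : ℕ) = d at *
  replace a1 : y * optZero 1 D.Kmode (t * τ) a ≤ p₁ := a1
  replace a2 : p₁ * y ≤ optZero 1 D.Kmode (t * τ) a := a2
  replace b1 : y * optZero 1 D.Kmode (t * τ) b ≤ 1 / q₁ := b1
  replace b2 : 1 / q₁ * y ≤ optZero 1 D.Kmode (t * τ) b := b2
  replace c1 : y * optZero 1 D.Kmode (t * τ) c' ≤ p₂ := c1
  replace c2 : p₂ * y ≤ optZero 1 D.Kmode (t * τ) c' := c2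
  replace d1 : y * optZero 1 D.Kmode (t * τ) d ≤ 1 / q₂ := d1
  replace d2 : 1 / q₂ * y ≤ optZero 1 D.Kmode (t * τ) d := d2
  have hac := optZero_strict one_pos hK hT e1.le hy a1 c2 hp
  have hdb := optZero_strict one_pos hK hT e1.le hy d1 b2 (one_div_le_one_div_of_le hq₁ hq)
  have hy0 : 0 < y := by linarith
  -- Otherwise both `p₁` and `p₂`, the larger of the two, sit at the second zero or above.
  have ha : a = 0 := by
    by_contra hne
    have hbig : ∀ j z, 1 ≤ j → y * optZero 1 D.Kmode (t * τ) j ≤ z →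
        9 / 10 * (4 * 1 ^ 3 * D.Kmode / t ^ 3) / τ ^ 3 ≤ z := by
      intro j z hj hz
      refine le_trans ?_ hz
      have hpos := optZero_pos one_pos hK hT 1
      calc _ = 9 / 10 * optZero 1 D.Kmode (t * τ) 1 := by
            rw [optZero_one, mul_pow]; field_simp
        _ ≤ y * optZero 1 D.Kmode (t * τ) 1 := by gcongr
        _ ≤ _ := by
          gcongr
          exact optZero_mono one_pos hK hT (by linarith) hj
    have h4 := h σ kmax p₁ q₁ p₂ q₂ hq₁ hq₂ hk (hbig a _ (by omega) a1) (hbig c' _ (by omega) c1)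
    linarith
  subst ha
  have hc1 : c' = 1 := by
    by_contra hne
    -- Since the pole of the second pair comes before that of the first, it must then occupy the
    -- second place, which is the interlaced configuration.
    have h5 : c' = 2 ∧ b = 3 ∨ c' = 3 ∧ b = 2 := by omega
    have h6 := h' σ kmax p₁ q₁ p₂ q₂ y hp₁ hq₁ hp₂ hq₂ hk hy a2 (by
      rcases h5 with ⟨rfl, rfl⟩ | ⟨rfl, rfl⟩
      · exact Or.inl ⟨c1, b1⟩
      · exact Or.inr ⟨c1, b1⟩)
    linarith
  subst hc1
  obtain rfl : d = 2 := by omega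
  obtain rfl : b = 3 := by omega
  intro i
  fin_cases i
  · exact ⟨a1, a2⟩
  · exact ⟨c1, c2⟩
  · exact ⟨d1, d2⟩
  · exact ⟨b1, b2⟩

end Problem

end OSM

/-! ### Continuity of the iteration matrix and existence of minimizers -/

namespace OSM

namespace Problem

variable {D : Problem}

/-- Since `|λ - P| ≤ |λ + P|` at both boundaries and the second exponential is strictly smaller in
modulus, the two terms cannot cancel. -/
theorem det_ne_zero {δ k : ℝ} (hL : 0 < D.L) (hδ : 0 ≤ δ) (hz : 0 < (D.lam k).re) {v : Params}
    (hvp : ∀ j, 0 < v.pp j + k ^ 2 * v.qp j) (hvm : ∀ j, 0 < v.pm j + k ^ 2 * v.qm j) (j : ℕ) :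
    D.det δ v k j ≠ 0 := by
  have hrp := rightPlus_ne_zero hz hvp (D := D) j
  have hlp := leftPlus_ne_zero hz hvm (D := D) j
  have h1 := norm_gPlus_le hz hvp (D := D) j
  have h2 := norm_gMinus_le hz hvm (D := D) j
  rw [gPlus, norm_div, div_le_one (norm_pos_iff.2 hrp)] at h1
  rw [gMinus, norm_div, div_le_one (norm_pos_iff.2 hlp)] at h2
  have hre : (D.lam k * (D.L + δ)).re = (D.lam k).re * (D.L + δ) := by
    rw [← Complex.ofReal_add, Complex.re_mul_ofReal]
  have hpos : 0 < (D.lam k).re * (D.L + δ) := by positivity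
  intro h
  rw [det, sub_eq_zero] at h
  have h3 := congrArg norm h
  rw [norm_mul, norm_mul, norm_mul, norm_mul, Complex.norm_exp, Complex.norm_exp, Complex.neg_re,
    hre] at h3
  have h4 : ‖D.rightMinus v k j‖ * ‖D.leftMinus v k j‖ ≤ ‖D.rightPlus v k j‖ * ‖D.leftPlus v k j‖ :=
    mul_le_mul h1 h2 (norm_nonneg _) (norm_nonneg _)
  have h5 : 0 < ‖D.rightPlus v k j‖ * ‖D.leftPlus v k j‖ :=
    mul_pos (norm_pos_iff.2 hrp) (norm_pos_iff.2 hlp)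
  have h6 : Real.exp (-((D.lam k).re * (D.L + δ))) < Real.exp ((D.lam k).re * (D.L + δ)) := by
    rw [Real.exp_lt_exp]; linarith
  have h7 := mul_le_mul_of_nonneg_right h4 (Real.exp_pos (-((D.lam k).re * (D.L + δ)))).le
  have h8 := mul_lt_mul_of_pos_left h6 h5
  linarith

theorem tendsto_T {X : Type*} {l : Filter X} {v : X → Params} {v₀ : Params} {δ k : ℝ}
    (hL : 0 < D.L) (hδ : 0 ≤ δ) (hz : 0 < (D.lam k).re)
    (hvp : ∀ j, 0 < v₀.pp j + k ^ 2 * v₀.qp j) (hvm : ∀ j, 0 < v₀.pm j + k ^ 2 * v₀.qm j)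
    (hpp : ∀ j, Tendsto (fun x => (v x).pp j) l (𝓝 (v₀.pp j)))
    (hqp : ∀ j, Tendsto (fun x => (v x).qp j) l (𝓝 (v₀.qp j)))
    (hpm : ∀ j, Tendsto (fun x => (v x).pm j) l (𝓝 (v₀.pm j)))
    (hqm : ∀ j, Tendsto (fun x => (v x).qm j) l (𝓝 (v₀.qm j))) :
    Tendsto (fun x => D.T δ (v x) k) l (𝓝 (D.T δ v₀ k)) := by
  have hP : ∀ j, Tendsto (fun x => (((v x).pp j + k ^ 2 * (v x).qp j : ℝ) : ℂ)) l
      (𝓝 ((v₀.pp j + k ^ 2 * v₀.qp j : ℝ) : ℂ)) := fun j =>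
    (Complex.continuous_ofReal.tendsto _).comp ((hpp j).add ((hqp j).const_mul _))
  have hM : ∀ j, Tendsto (fun x => (((v x).pm j + k ^ 2 * (v x).qm j : ℝ) : ℂ)) l
      (𝓝 ((v₀.pm j + k ^ 2 * v₀.qm j : ℝ) : ℂ)) := fun j =>
    (Complex.continuous_ofReal.tendsto _).comp ((hpm j).add ((hqm j).const_mul _))
  have hlp : ∀ j, Tendsto (fun x => D.leftPlus (v x) k j) l (𝓝 (D.leftPlus v₀ k j)) := fun j => by
    unfold leftPlus
    split_ifs
    · exact tendsto_const_nhds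
    · exact (hM j).const_add _
  have hlm : ∀ j, Tendsto (fun x => D.leftMinus (v x) k j) l (𝓝 (D.leftMinus v₀ k j)) := fun j => by
    unfold leftMinus
    split_ifs
    · exact tendsto_const_nhds
    · exact (hM j).const_sub _
  have hrp : ∀ j, Tendsto (fun x => D.rightPlus (v x) k j) l (𝓝 (D.rightPlus v₀ k j)) := fun j => by
    unfold rightPlus
    split_ifs
    · exact tendsto_const_nhds
    · exact (hP j).const_add _
  have hrm : ∀ j, Tendsto (fun x => D.rightMinus (v x) k j) l (𝓝 (D.rightMinus v₀ k j)) :=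
    fun j => by
      unfold rightMinus
      split_ifs
      · exact tendsto_const_nhds
      · exact (hP j).const_sub _
  have hdet : ∀ j, Tendsto (fun x => D.det δ (v x) k j) l (𝓝 (D.det δ v₀ k j)) := fun j =>
    (((hrp j).mul (hlp j)).mul_const _).sub (((hrm j).mul (hlm j)).mul_const _)
  have hd := det_ne_zero hL hδ hz hvp hvm (D := D)
  refine tendsto_pi_nhds.2 fun i => tendsto_pi_nhds.2 fun j => ?_
  rcases i with i | i <;> rcases j with j | j
  · simp only [T, Matrix.fromBlocks_apply₁₁, Matrix.of_apply]
    split_ifs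
    · exact ((((hlp _).mul (hrp _)).mul_const _).sub (((hlm _).mul (hrm _)).mul_const _)).div
        (hdet _) (hd _)
    · exact tendsto_const_nhds
  · simp only [T, Matrix.fromBlocks_apply₁₂, Matrix.diagonal_apply]
    split_ifs
    · exact ((((hrp _).mul (hrm _)).mul_const _).sub (((hrm _).mul (hrp _)).mul_const _)).div
        (hdet _) (hd _)
    · exact tendsto_const_nhds
  · simp only [T, Matrix.fromBlocks_apply₂₁, Matrix.diagonal_apply]
    split_ifs
    · exact ((((hlp _).mul (hlm _)).mul_const _).sub (((hlm _).mul (hlp _)).mul_const _)).div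
        (hdet _) (hd _)
    · exact tendsto_const_nhds
  · simp only [T, Matrix.fromBlocks_apply₂₂, Matrix.of_apply]
    split_ifs
    · exact ((((hrp _).mul (hlp _)).mul_const _).sub (((hrm _).mul (hlm _)).mul_const _)).div
        (hdet _) (hd _)
    · exact tendsto_const_nhds

/-- The convergence factor attains its minimum on compact sets of parameters. -/
theorem Admissible.exists_isMinOn_rho₂ (hD : D.Admissible) {X : Type*} [TopologicalSpace X]
    {S : Set X} (hS : IsCompact S) (hne : S.Nonempty) {P₁ Q₁ P₂ Q₂ : X → ℝ} (cP₁ : Continuous P₁)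
    (cQ₁ : Continuous Q₁) (cP₂ : Continuous P₂) (cQ₂ : Continuous Q₂)
    (hpos : ∀ x ∈ S, 0 < P₁ x ∧ 0 < Q₁ x ∧ 0 < P₂ x ∧ 0 < Q₂ x) (σ : ℕ → Bool) {kmax δ : ℝ}
    (hδ : 0 ≤ δ) (hk : D.kmin ≤ kmax) :
    ∃ x ∈ S, IsMinOn (fun x => D.rho₂ σ kmax δ (P₁ x) (Q₁ x) (P₂ x) (Q₂ x)) S x := by
  refine LowerSemicontinuousOn.exists_isMinOn hne hS fun x hx y hy => ?_
  obtain ⟨h1, h2, h3, h4⟩ := hpos x hx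
  -- A supremum of lower semicontinuous functions is lower semicontinuous: one frequency exceeding
  -- `y` keeps exceeding it nearby.
  obtain ⟨_, ⟨k, hkI, rfl⟩, hyk⟩ := exists_lt_of_lt_csSup ((Set.nonempty_Icc.2 hk).image _) hy
  have hz := hD.lam_re_pos hkI.1
  have hk2 : 0 ≤ k ^ 2 := sq_nonneg k
  obtain ⟨hvp, hvm⟩ := twoParams_pos (σ := σ) (k := k) (p₁ := P₁ x) (q₁ := Q₁ x) (p₂ := P₂ x)
    (q₂ := Q₂ x) (by positivity) (by positivity)
  have hT := tendsto_T (D := D) (l := 𝓝[S] x) (δ := δ) (k := k)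
    (v := fun x => twoParams σ (P₁ x) (Q₁ x) (P₂ x) (Q₂ x)) hD.L_pos hδ hz hvp hvm
    (fun j => by
      simp only [twoParams]
      split_ifs
      · exact cP₁.continuousWithinAt
      · exact cP₂.continuousWithinAt)
    (fun j => by
      simp only [twoParams]
      split_ifs
      · exact cQ₁.continuousWithinAt
      · exact cQ₂.continuousWithinAt)
    (fun j => by
      simp only [twoParams]
      split_ifs
      · exact cP₂.continuousWithinAt
      · exact cP₁.continuousWithinAt)
    (fun j => by
      simp only [twoParams]
      split_ifs
      · exact cQ₂.continuousWithinAt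
      · exact cQ₁.continuousWithinAt)
  filter_upwards [eventually_lt_specRad hT hyk, self_mem_nhdsWithin] with x' hx' hx'S
  obtain ⟨i1, i2, i3, i4⟩ := hpos x' hx'S
  exact lt_of_lt_of_le hx' (hD.rate_le_rho₂ (σ := σ) hδ i1 i2 i3 i4 hkI.1 hkI.2)

end Problem

end OSM

/-! ### All bounds at a fixed small overlap -/

namespace OSM

/-- The parameter region is open and unbounded. As everything at least as good as a reference value
lies in the box, a minimum over the box is global. -/
theorem isLeast_of_isMinOn {X : Type*} {f : X → ℝ} {Pos Box : Set X} {v : ℝ} (hsub : Box ⊆ Pos)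
    {x₀ : X} (hx₀ : x₀ ∈ Pos) (hv : f x₀ ≤ v) (hbox : ∀ x ∈ Pos, f x ≤ v → x ∈ Box)
    (hmin : Box.Nonempty → ∃ x ∈ Box, IsMinOn f Box x) : ∃ x ∈ Pos, IsLeast (f '' Pos) (f x) := by
  have h0 := hbox x₀ hx₀ hv
  obtain ⟨x, hx, hle⟩ := hmin ⟨x₀, h0⟩
  refine ⟨x, hsub hx, ⟨x, hsub hx, rfl⟩, ?_⟩
  rintro _ ⟨z, hz, rfl⟩
  rcases le_or_gt (f z) v with h | h
  · exact hle (hbox z hz h)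
  · exact (hle h0).trans (hv.trans h.le)

theorem mem_box_of_near {m M z O x : ℝ} {N : ℕ} (hx : 1 / 4 ≤ x) (hO : 0 < O) (hm : m ≤ O)
    (hM : O ≤ M) (h1 : x ^ N * O ≤ z) (h2 : z * x ^ N ≤ O) :
    (1 / 4) ^ N * m ≤ z ∧ z ≤ 4 ^ N * M := by
  have hp : (1 / 4 : ℝ) ^ N ≤ x ^ N := pow_le_pow_left₀ (by norm_num) hx N
  have hq : (0 : ℝ) < (1 / 4) ^ N := by positivity
  have hz : 0 ≤ z := le_trans (mul_nonneg (hq.le.trans hp) hO.le) h1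
  constructor
  · calc (1 / 4) ^ N * m ≤ (1 / 4) ^ N * O := by gcongr
      _ ≤ x ^ N * O := by gcongr
      _ ≤ z := h1
  · have h3 : z * (1 / 4) ^ N ≤ M := by
      calc z * (1 / 4) ^ N ≤ z * x ^ N := by gcongr
        _ ≤ M := h2.trans hM
    rw [one_div, inv_pow, ← div_eq_mul_inv, div_le_iff₀ (by positivity)] at h3
    linarith

theorem mem_Icc_of_pos {m M z : ℝ} (h1 : m ≤ z) (h2 : z ≤ M) :
    min m (1 / M) ≤ z ∧ z ≤ max M (1 / m) :=
  ⟨(min_le_left _ _).trans h1, h2.trans (le_max_left _ _)⟩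

theorem mem_Icc_of_inv {m M q : ℝ} (hm : 0 < m) (hq : 0 < q) (h1 : m ≤ 1 / q) (h2 : 1 / q ≤ M) :
    min m (1 / M) ≤ q ∧ q ≤ max M (1 / m) := by
  have hM : 0 < M := lt_of_lt_of_le (by positivity) h2
  constructor
  · exact (min_le_right _ _).trans ((one_div_le hM hq).2 h2)
  · exact ((le_one_div hq hm).2 h1).trans (le_max_right _ _)

namespace Problem

variable {D : Problem}

/-- Everything about two-sided conditions at a fixed small overlap `τ ^ 9`. -/
theorem Admissible.summary_twoSided (hD : D.Admissible) {c t : ℝ} (hc : 0 < c)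
    (ht : 0 < t) (ht9 : t ^ 9 = 256 * D.Kmode) : ∃ C C' : ℝ, 0 < C ∧ 0 < C' ∧
      ∀ᶠ τ in 𝓝[>] (0 : ℝ), ∀ (σ : ℕ → Bool) (kmax : ℝ), c / τ ^ 9 ≤ kmax →
      (∀ p₁ q₁ p₂ q₂, 0 < p₁ → 0 < q₁ → 0 < p₂ → 0 < q₂ →
        1 - D.rho₂ σ kmax (τ ^ 9) p₁ q₁ p₂ q₂ ≤ t * τ + C * τ ^ 2) ∧
      (∀ p₁ q₁ p₂ q₂ y, 0 < q₁ → 0 < q₂ → 1 / 2 ≤ y → y ≤ 1 →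
        (∀ i : Fin 4, y * optZero 1 D.Kmode (t * τ) i ≤ ![p₁, p₂, 1 / q₂, 1 / q₁] i ∧
          ![p₁, p₂, 1 / q₂, 1 / q₁] i * y ≤ optZero 1 D.Kmode (t * τ) i) →
        y * (t * τ) - C' * τ ^ 2 ≤ 1 - D.rho₂ σ kmax (τ ^ 9) p₁ q₁ p₂ q₂) ∧
      (∀ p₁ q₁ p₂ q₂ x, 0 < p₁ → 0 < q₁ → 0 < p₂ → 0 < q₂ → p₁ ≤ p₂ → q₁ ≤ q₂ →
        x = (1 - D.rho₂ σ kmax (τ ^ 9) p₁ q₁ p₂ q₂ - C * τ ^ 2) / (t * τ) → 0 < x →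
        9 / 10 ≤ x ^ 8 → 9 / 10 * (t * τ) ≤ 1 - D.rho₂ σ kmax (τ ^ 9) p₁ q₁ p₂ q₂ →
        (∀ i : Fin 4, x ^ 8 * optZero 1 D.Kmode (t * τ) i ≤ ![p₁, p₂, 1 / q₂, 1 / q₁] i ∧
          ![p₁, p₂, 1 / q₂, 1 / q₁] i * x ^ 8 ≤ optZero 1 D.Kmode (t * τ) i)) ∧
      (∃ p₁ q₁ p₂ q₂, 0 < p₁ ∧ 0 < q₁ ∧ 0 < p₂ ∧ 0 < q₂ ∧
        D.rho₂ σ kmax (τ ^ 9) p₁ q₁ p₂ q₂ = D.opt₂ σ kmax (τ ^ 9)) ∧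
      1 - D.opt₂ σ kmax (τ ^ 9) ≤ t * τ + C * τ ^ 2 ∧
      t * τ - C' * τ ^ 2 ≤ 1 - D.opt₂ σ kmax (τ ^ 9) := by
  have hK := Kmode_pos hD.L_pos hD.Lhat_pos hD.eta_nonneg hD.eps_nonneg
  obtain ⟨C, hC, h₁⟩ := hD.sharp_twoSided hc (by positivity : 0 < t / 2) ht ht9
  obtain ⟨C', hC', h₂⟩ := hD.rate_le_twoSided ht ht9
  refine ⟨C, C', hC, hC', ?_⟩
  filter_upwards [self_mem_nhdsWithin, h₁, h₂, hD.order_twoSided hc ht,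
    eventually_le_div D.kmin hc 9 (by norm_num), eventually_mul_lt C (by positivity : 0 < t / 4),
    eventually_mul_lt C' (by positivity : 0 < t / 2), eventually_mul_lt t one_pos]
    with τ hτ h₁ h₂ h₃ e1 e2 e3 e4 σ kmax hk
  have hτ : 0 < τ := hτ
  have hT : 0 < t * τ := by positivity
  have hkk : D.kmin ≤ kmax := e1.trans hk
  have hδ : (0 : ℝ) < τ ^ 9 := by positivity
  have upper : ∀ p₁ q₁ p₂ q₂, 0 < p₁ → 0 < q₁ → 0 < p₂ → 0 < q₂ →
        1 - D.rho₂ σ kmax (τ ^ 9) p₁ q₁ p₂ q₂ ≤ t * τ + C * τ ^ 2 := by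
    intro p₁ q₁ p₂ q₂ hp₁ hq₁ hp₂ hq₂
    rcases le_or_gt (t / 2 * τ) (1 - D.rho₂ σ kmax (τ ^ 9) p₁ q₁ p₂ q₂) with h | h
    · exact (h₁ σ kmax p₁ q₁ p₂ q₂ hp₁ hq₁ hp₂ hq₂ hk h).1
    · have : 0 ≤ C * τ ^ 2 := by positivity
      linarith
  have lower : ∀ p₁ q₁ p₂ q₂ y, 0 < q₁ → 0 < q₂ → 1 / 2 ≤ y → y ≤ 1 →
        (∀ i : Fin 4, y * optZero 1 D.Kmode (t * τ) i ≤ ![p₁, p₂, 1 / q₂, 1 / q₁] i ∧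
          ![p₁, p₂, 1 / q₂, 1 / q₁] i * y ≤ optZero 1 D.Kmode (t * τ) i) →
        y * (t * τ) - C' * τ ^ 2 ≤ 1 - D.rho₂ σ kmax (τ ^ 9) p₁ q₁ p₂ q₂ := by
    intro p₁ q₁ p₂ q₂ y hq₁ hq₂ hy hy1 hZ
    have := rho₂_le (D := D) (σ := σ) (kmax := kmax) (δ := τ ^ 9) hkk fun k hk _ =>
      h₂ σ p₁ q₁ p₂ q₂ y hq₁ hq₂ hy hy1 hZ k hk
    linarith
  set O := optZero 1 D.Kmode (t * τ) with hO
  have hOpos : ∀ i, 0 < O i := fun i => optZero_pos one_pos hK hT i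
  have hOmono : ∀ {i j : ℕ}, i ≤ j → O i ≤ O j := fun h =>
    optZero_mono one_pos hK hT (by linarith) h
  have hopt : t * τ - C' * τ ^ 2 ≤ 1 - D.rho₂ σ kmax (τ ^ 9) (O 0) (1 / O 3) (O 1) (1 / O 2) := by
    have := lower (O 0) (1 / O 3) (O 1) (1 / O 2) 1 (one_div_pos.2 (hOpos 3))
      (one_div_pos.2 (hOpos 2)) (by norm_num) le_rfl fun i => by
        rw [one_div_one_div, one_div_one_div, one_mul, mul_one]
        fin_cases i <;> exact ⟨le_rfl, le_rfl⟩
    rwa [one_mul] at this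
  -- Parameters with at least half the optimal gain have `x ≥ 1/4`, so by the localization all zeros
  -- and poles lie between `(1/4)^8` times the smallest and `4^8` times the largest optimal one. The
  -- box below is symmetric under inversion so as to hold both `p` and `q`.
  set m := (1 / 4 : ℝ) ^ 8 * O 0 with hm
  set M := (4 : ℝ) ^ 8 * O 3 with hM
  have hm0 : 0 < m := mul_pos (by positivity) (hOpos 0)
  have hbox : ∀ p₁ q₁ p₂ q₂, 0 < p₁ → 0 < q₁ → 0 < p₂ → 0 < q₂ →
      t / 2 * τ ≤ 1 - D.rho₂ σ kmax (τ ^ 9) p₁ q₁ p₂ q₂ →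
      ∀ j : Fin 4, m ≤ ![p₁, 1 / q₁, p₂, 1 / q₂] j ∧ ![p₁, 1 / q₁, p₂, 1 / q₂] j ≤ M := by
    intro p₁ q₁ p₂ q₂ hp₁ hq₁ hp₂ hq₂ hE j
    obtain ⟨-, π, hπ⟩ := h₁ σ kmax p₁ q₁ p₂ q₂ hp₁ hq₁ hp₂ hq₂ hk hE
    have hx : 1 / 4 ≤ (1 - D.rho₂ σ kmax (τ ^ 9) p₁ q₁ p₂ q₂ - C * τ ^ 2) / (t * τ) := by
      rw [le_div_iff₀ hT]
      nlinarith
    have h5 := (hπ _ rfl (lt_of_lt_of_le (by norm_num) hx)).2 (π.symm j)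
    rw [Equiv.apply_symm_apply] at h5
    exact mem_box_of_near hx (hOpos _) (hOmono (Nat.zero_le _))
      (hOmono (by have := (π.symm j).isLt; omega)) h5.1 h5.2
  have hleast : ∃ x ∈ {v : Fin 4 → ℝ | ∀ i, 0 < v i},
      IsLeast ((fun v : Fin 4 → ℝ => D.rho₂ σ kmax (τ ^ 9) (v 0) (v 1) (v 2) (v 3)) ''
        {v : Fin 4 → ℝ | ∀ i, 0 < v i}) (D.rho₂ σ kmax (τ ^ 9) (x 0) (x 1) (x 2) (x 3)) := by
    have hM0 : 0 < M := mul_pos (by positivity) (hOpos 3)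
    refine isLeast_of_isMinOn (f := fun v : Fin 4 → ℝ => D.rho₂ σ kmax (τ ^ 9) (v 0) (v 1) (v 2) (v 3))
      (Box := Set.Icc (fun _ => min m (1 / M)) (fun _ => max M (1 / m)))
      -- The reference point is the optimal configuration, whose gain `tτ - C'τ²` exceeds the
      -- threshold `tτ/2`.
      (v := 1 - t / 2 * τ) (x₀ := ![O 0, 1 / O 3, O 1, 1 / O 2]) ?_ ?_ ?_ ?_ ?_
    · exact fun v hv i => lt_of_lt_of_le (lt_min hm0 (by positivity)) (hv.1 i)
    · intro i
      have h0 := hOpos 0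
      have h1 := hOpos 1
      have h2 := one_div_pos.2 (hOpos 2)
      have h3 := one_div_pos.2 (hOpos 3)
      fin_cases i <;> assumption
    · change D.rho₂ σ kmax (τ ^ 9) (O 0) (1 / O 3) (O 1) (1 / O 2) ≤ _
      nlinarith
    · intro v hv hle
      have h5 := hbox (v 0) (v 1) (v 2) (v 3) (hv 0) (hv 1) (hv 2) (hv 3)
        (by linarith : t / 2 * τ ≤ 1 - D.rho₂ σ kmax (τ ^ 9) (v 0) (v 1) (v 2) (v 3))
      have i0 := mem_Icc_of_pos (h5 0).1 (h5 0).2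
      have i1 := mem_Icc_of_inv hm0 (hv 1) (h5 1).1 (h5 1).2
      have i2 := mem_Icc_of_pos (h5 2).1 (h5 2).2
      have i3 := mem_Icc_of_inv hm0 (hv 3) (h5 3).1 (h5 3).2
      constructor <;> intro i <;> fin_cases i
      exacts [i0.1, i1.1, i2.1, i3.1, i0.2, i1.2, i2.2, i3.2]
    · intro hne
      refine hD.exists_isMinOn_rho₂ isCompact_Icc hne (continuous_apply 0) (continuous_apply 1)
        (continuous_apply 2) (continuous_apply 3) (fun v hv => ?_) σ hδ.le hkk
      have hpos : ∀ i, 0 < v i := fun i => lt_of_lt_of_le (lt_min hm0 (by positivity)) (hv.1 i)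
      exact ⟨hpos 0, hpos 1, hpos 2, hpos 3⟩
  obtain ⟨v, hv, hvl⟩ := hleast
  have hset : {r | ∃ p₁ q₁ p₂ q₂ : ℝ, 0 < p₁ ∧ 0 < q₁ ∧ 0 < p₂ ∧ 0 < q₂ ∧
      r = D.rho₂ σ kmax (τ ^ 9) p₁ q₁ p₂ q₂} =
      (fun v : Fin 4 → ℝ => D.rho₂ σ kmax (τ ^ 9) (v 0) (v 1) (v 2) (v 3)) ''
        {v : Fin 4 → ℝ | ∀ i, 0 < v i} := by
    ext r
    constructor
    · rintro ⟨p₁, q₁, p₂, q₂, hp₁, hq₁, hp₂, hq₂, rfl⟩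
      exact ⟨![p₁, q₁, p₂, q₂], fun i => by fin_cases i <;> assumption, rfl⟩
    · rintro ⟨v, hv, rfl⟩
      exact ⟨v 0, v 1, v 2, v 3, hv 0, hv 1, hv 2, hv 3, rfl⟩
  have hopt_eq : D.rho₂ σ kmax (τ ^ 9) (v 0) (v 1) (v 2) (v 3) = D.opt₂ σ kmax (τ ^ 9) := by
    rw [opt₂, hset]
    exact hvl.csInf_eq.symm
  refine ⟨upper, lower, ?_, ⟨v 0, v 1, v 2, v 3, hv 0, hv 1, hv 2, hv 3, hopt_eq⟩, ?_, ?_⟩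
  · intro p₁ q₁ p₂ q₂ x hp₁ hq₁ hp₂ hq₂ hp hq hx hx0 hx8 hE
    obtain ⟨-, π, hπ⟩ := h₁ σ kmax p₁ q₁ p₂ q₂ hp₁ hq₁ hp₂ hq₂ hk (by linarith)
    exact h₃ σ kmax p₁ q₁ p₂ q₂ (x ^ 8) hp₁ hq₁ hp₂ hq₂ hp hq hk hx8 hE π (hπ x hx hx0).2
  · rw [← hopt_eq]
    exact upper _ _ _ _ (hv 0) (hv 1) (hv 2) (hv 3)
  · rw [← hopt_eq]
    refine hopt.trans (sub_le_sub_left (hvl.2 ⟨![O 0, 1 / O 3, O 1, 1 / O 2], fun i => ?_, rfl⟩) _)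
    have h0 := hOpos 0
    have h1 := hOpos 1
    have h2 := one_div_pos.2 (hOpos 2)
    have h3 := one_div_pos.2 (hOpos 3)
    fin_cases i <;> assumption

/-- Everything about one-sided conditions at a fixed small overlap `τ ^ 5`. -/
theorem Admissible.summary_oneSided (hD : D.Admissible) {c t : ℝ} (hc : 0 < c)
    (ht : 0 < t) (ht5 : t ^ 5 = 256 * D.Kmode) : ∃ C C' : ℝ, 0 < C ∧ 0 < C' ∧
      ∀ᶠ τ in 𝓝[>] (0 : ℝ), ∀ kmax : ℝ, c / τ ^ 5 ≤ kmax →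
      (∀ p q, 0 < p → 0 < q → 1 - D.rho₁ kmax (τ ^ 5) p q ≤ t * τ + C * τ ^ 2) ∧
      (∀ p q y, 0 < q → 1 / 2 ≤ y → y ≤ 1 →
        (∀ i : Fin 2, y * optZero 2 D.Kmode (t * τ) i ≤ ![p, 1 / q] i ∧
          ![p, 1 / q] i * y ≤ optZero 2 D.Kmode (t * τ) i) →
        y * (t * τ) - C' * τ ^ 2 ≤ 1 - D.rho₁ kmax (τ ^ 5) p q) ∧
      (∀ p q x, 0 < p → 0 < q →
        x = (1 - D.rho₁ kmax (τ ^ 5) p q - C * τ ^ 2) / (t * τ) → 0 < x →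
        9 / 10 ≤ x ^ 4 → 9 / 10 * (t * τ) ≤ 1 - D.rho₁ kmax (τ ^ 5) p q →
        (∀ i : Fin 2, x ^ 4 * optZero 2 D.Kmode (t * τ) i ≤ ![p, 1 / q] i ∧
          ![p, 1 / q] i * x ^ 4 ≤ optZero 2 D.Kmode (t * τ) i)) ∧
      (∃ p q, 0 < p ∧ 0 < q ∧ D.rho₁ kmax (τ ^ 5) p q = D.opt₁ kmax (τ ^ 5)) ∧
      1 - D.opt₁ kmax (τ ^ 5) ≤ t * τ + C * τ ^ 2 ∧
      t * τ - C' * τ ^ 2 ≤ 1 - D.opt₁ kmax (τ ^ 5) := by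
  have hK := Kmode_pos hD.L_pos hD.Lhat_pos hD.eta_nonneg hD.eps_nonneg
  obtain ⟨C, hC, h₁⟩ := hD.sharp_oneSided hc (by positivity : 0 < t / 2) ht ht5
  obtain ⟨C', hC', h₂⟩ := hD.rate_le_oneSided ht ht5
  refine ⟨C, C', hC, hC', ?_⟩
  filter_upwards [self_mem_nhdsWithin, h₁, h₂, hD.order_oneSided hc ht,
    eventually_le_div D.kmin hc 5 (by norm_num), eventually_mul_lt C (by positivity : 0 < t / 4),
    eventually_mul_lt C' (by positivity : 0 < t / 2), eventually_mul_lt t one_pos]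
    with τ hτ h₁ h₂ h₃ e1 e2 e3 e4 kmax hk
  have hτ : 0 < τ := hτ
  have hT : 0 < t * τ := by positivity
  have hkk : D.kmin ≤ kmax := e1.trans hk
  have hδ : (0 : ℝ) < τ ^ 5 := by positivity
  have upper : ∀ p q, 0 < p → 0 < q → 1 - D.rho₁ kmax (τ ^ 5) p q ≤ t * τ + C * τ ^ 2 := by
    intro p q hp hq
    rcases le_or_gt (t / 2 * τ) (1 - D.rho₁ kmax (τ ^ 5) p q) with h | h
    · exact (h₁ kmax p q hp hq hk h).1
    · have : 0 ≤ C * τ ^ 2 := by positivity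
      linarith
  have lower : ∀ p q y, 0 < q → 1 / 2 ≤ y → y ≤ 1 →
        (∀ i : Fin 2, y * optZero 2 D.Kmode (t * τ) i ≤ ![p, 1 / q] i ∧
          ![p, 1 / q] i * y ≤ optZero 2 D.Kmode (t * τ) i) →
        y * (t * τ) - C' * τ ^ 2 ≤ 1 - D.rho₁ kmax (τ ^ 5) p q := by
    intro p q y hq hy hy1 hZ
    rw [rho₁_eq fun _ => true]
    have := rho₂_le (D := D) (σ := fun _ => true) (kmax := kmax) (δ := τ ^ 5) hkk fun k hk _ =>
      h₂ (fun _ => true) p q y hq hy hy1 hZ k hk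
    linarith
  set O := optZero 2 D.Kmode (t * τ) with hO
  have hOpos : ∀ i, 0 < O i := fun i => optZero_pos two_pos hK hT i
  have hOmono : ∀ {i j : ℕ}, i ≤ j → O i ≤ O j := fun h =>
    optZero_mono two_pos hK hT (by linarith) h
  have hopt : t * τ - C' * τ ^ 2 ≤ 1 - D.rho₁ kmax (τ ^ 5) (O 0) (1 / O 1) := by
    have := lower (O 0) (1 / O 1) 1 (one_div_pos.2 (hOpos 1)) (by norm_num) le_rfl fun i => by
        rw [one_div_one_div, one_mul, mul_one]
        fin_cases i <;> exact ⟨le_rfl, le_rfl⟩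
    rwa [one_mul] at this
  set m := (1 / 4 : ℝ) ^ 4 * O 0 with hm
  set M := (4 : ℝ) ^ 4 * O 1 with hM
  have hm0 : 0 < m := mul_pos (by positivity) (hOpos 0)
  have hbox : ∀ p q, 0 < p → 0 < q → t / 2 * τ ≤ 1 - D.rho₁ kmax (τ ^ 5) p q →
      ∀ j : Fin 2, m ≤ ![p, 1 / q] j ∧ ![p, 1 / q] j ≤ M := by
    intro p q hp hq hE j
    obtain ⟨-, π, hπ⟩ := h₁ kmax p q hp hq hk hE
    have hx : 1 / 4 ≤ (1 - D.rho₁ kmax (τ ^ 5) p q - C * τ ^ 2) / (t * τ) := by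
      rw [le_div_iff₀ hT]
      nlinarith
    have h5 := (hπ _ rfl (lt_of_lt_of_le (by norm_num) hx)).2 (π.symm j)
    rw [Equiv.apply_symm_apply] at h5
    exact mem_box_of_near hx (hOpos _) (hOmono (Nat.zero_le _))
      (hOmono (by have := (π.symm j).isLt; omega)) h5.1 h5.2
  have hleast : ∃ x ∈ {v : Fin 2 → ℝ | ∀ i, 0 < v i},
      IsLeast ((fun v : Fin 2 → ℝ => D.rho₁ kmax (τ ^ 5) (v 0) (v 1)) ''
        {v : Fin 2 → ℝ | ∀ i, 0 < v i}) (D.rho₁ kmax (τ ^ 5) (x 0) (x 1)) := by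
    have hM0 : 0 < M := mul_pos (by positivity) (hOpos 1)
    refine isLeast_of_isMinOn (f := fun v : Fin 2 → ℝ => D.rho₁ kmax (τ ^ 5) (v 0) (v 1))
      (Box := Set.Icc (fun _ => min m (1 / M)) (fun _ => max M (1 / m)))
      (v := 1 - t / 2 * τ) (x₀ := ![O 0, 1 / O 1]) ?_ ?_ ?_ ?_ ?_
    · exact fun v hv i => lt_of_lt_of_le (lt_min hm0 (by positivity)) (hv.1 i)
    · intro i
      have h0 := hOpos 0
      have h1 := one_div_pos.2 (hOpos 1)
      fin_cases i <;> assumption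
    · change D.rho₁ kmax (τ ^ 5) (O 0) (1 / O 1) ≤ _
      nlinarith
    · intro v hv hle
      have h5 := hbox (v 0) (v 1) (hv 0) (hv 1)
        (by linarith : t / 2 * τ ≤ 1 - D.rho₁ kmax (τ ^ 5) (v 0) (v 1))
      have i0 := mem_Icc_of_pos (h5 0).1 (h5 0).2
      have i1 := mem_Icc_of_inv hm0 (hv 1) (h5 1).1 (h5 1).2
      constructor <;> intro i <;> fin_cases i
      exacts [i0.1, i1.1, i0.2, i1.2]
    · intro hne
      simp only [rho₁_eq fun _ => true]
      refine hD.exists_isMinOn_rho₂ isCompact_Icc hne (continuous_apply 0) (continuous_apply 1)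
        (continuous_apply 0) (continuous_apply 1) (fun v hv => ?_) _ hδ.le hkk
      have hpos : ∀ i, 0 < v i := fun i => lt_of_lt_of_le (lt_min hm0 (by positivity)) (hv.1 i)
      exact ⟨hpos 0, hpos 1, hpos 0, hpos 1⟩
  obtain ⟨v, hv, hvl⟩ := hleast
  have hset : {r | ∃ p q : ℝ, 0 < p ∧ 0 < q ∧ r = D.rho₁ kmax (τ ^ 5) p q} =
      (fun v : Fin 2 → ℝ => D.rho₁ kmax (τ ^ 5) (v 0) (v 1)) '' {v : Fin 2 → ℝ | ∀ i, 0 < v i} := by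
    ext r
    constructor
    · rintro ⟨p, q, hp, hq, rfl⟩
      exact ⟨![p, q], fun i => by fin_cases i <;> assumption, rfl⟩
    · rintro ⟨v, hv, rfl⟩
      exact ⟨v 0, v 1, hv 0, hv 1, rfl⟩
  have hopt_eq : D.rho₁ kmax (τ ^ 5) (v 0) (v 1) = D.opt₁ kmax (τ ^ 5) := by
    rw [opt₁, hset]
    exact hvl.csInf_eq.symm
  refine ⟨upper, lower, ?_, ⟨v 0, v 1, hv 0, hv 1, hopt_eq⟩, ?_, ?_⟩
  · intro p q x hp hq hx hx0 hx4 hE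
    obtain ⟨-, π, hπ⟩ := h₁ kmax p q hp hq hk (by linarith)
    exact h₃ kmax p q (x ^ 4) hq hk hx4 hE π (hπ x hx hx0).2
  · rw [← hopt_eq]
    exact upper _ _ (hv 0) (hv 1)
  · rw [← hopt_eq]
    refine hopt.trans (sub_le_sub_left (hvl.2 ⟨![O 0, 1 / O 1], fun i => ?_, rfl⟩) _)
    have h0 := hOpos 0
    have h1 := one_div_pos.2 (hOpos 1)
    fin_cases i <;> assumption

end Problem

end OSM

/-! ### Asymptotic equivalences and monomials -/

namespace OSM

/-- If the parameters can only reach the leading rate `t * τ` by being close to `O`, and do reach it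
when they are close to `O`, then the optimal rate characterizes the asymptotics of the parameters. -/
theorem isEquivalent_rate_iff {l : Filter ℝ} {n N : ℕ} {E τ : ℝ → ℝ} {t C C' : ℝ}
    {Z O : Fin n → ℝ → ℝ} (hτ : Tendsto τ l (𝓝[>] 0)) (ht : 0 < t)
    (hO : ∀ᶠ δ in l, ∀ i, 0 < O i δ)
    (hub : ∀ᶠ δ in l, E δ ≤ t * τ δ + C * τ δ ^ 2)
    (hlb : ∀ᶠ δ in l, ∀ y, 1 / 2 ≤ y → y ≤ 1 →
      (∀ i, y * O i δ ≤ Z i δ ∧ Z i δ * y ≤ O i δ) → y * (t * τ δ) - C' * τ δ ^ 2 ≤ E δ)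
    (hnear : ∀ᶠ δ in l, ∀ x, x = (E δ - C * τ δ ^ 2) / (t * τ δ) → 0 < x → 9 / 10 ≤ x ^ N →
      9 / 10 * (t * τ δ) ≤ E δ → ∀ i, x ^ N * O i δ ≤ Z i δ ∧ Z i δ * x ^ N ≤ O i δ) :
    (E ~[l] fun δ => t * τ δ) ↔ ∀ i, Z i ~[l] O i := by
  have hτpos : ∀ᶠ δ in l, 0 < τ δ := hτ.eventually self_mem_nhdsWithin
  have hτ0 : Tendsto τ l (𝓝 0) := hτ.mono_right nhdsWithin_le_nhds
  have hsmall : ∀ B : ℝ, Tendsto (fun δ => B / t * τ δ) l (𝓝 0) := fun B => by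
    simpa using hτ0.const_mul (B / t)
  have hne : ∀ᶠ δ in l, t * τ δ ≠ 0 := hτpos.mono fun δ h => by positivity
  rw [isEquivalent_iff_tendsto_one hne]
  constructor
  · intro hE i
    -- A gain equivalent to `tτ` makes the localization parameter `x` tend to `1`, and its power
    -- squeezes every ratio `Z i / O i`.
    have hx : Tendsto (fun δ => (E δ - C * τ δ ^ 2) / (t * τ δ)) l (𝓝 1) := by
      have := hE.sub (hsmall C)
      rw [sub_zero] at this
      refine this.congr' ?_
      filter_upwards [hτpos] with δ h
      simp only [Pi.div_apply]
      field_simp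
    have hxN := hx.pow N
    rw [one_pow] at hxN
    have hnearN : ∀ᶠ δ in l, 0 < ((E δ - C * τ δ ^ 2) / (t * τ δ)) ^ N ∧
        ((E δ - C * τ δ ^ 2) / (t * τ δ)) ^ N * O i δ ≤ Z i δ ∧
        Z i δ * ((E δ - C * τ δ ^ 2) / (t * τ δ)) ^ N ≤ O i δ := by
      filter_upwards [hnear, hx.eventually_const_lt one_pos,
        hxN.eventually_const_lt (by norm_num : (9 / 10 : ℝ) < 1),
        hE.eventually_const_lt (by norm_num : (9 / 10 : ℝ) < 1), hτpos] with δ h1 h2 h3 h4 h5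
      rw [Pi.div_apply, lt_div_iff₀ (by positivity)] at h4
      exact ⟨by positivity, h1 _ rfl h2 h3.le h4.le i⟩
    rw [isEquivalent_iff_tendsto_one (hO.mono fun δ h => (h i).ne')]
    have hinv := hxN.inv₀ one_ne_zero
    rw [inv_one] at hinv
    refine tendsto_of_tendsto_of_tendsto_of_le_of_le' hxN hinv ?_ ?_
    · filter_upwards [hnearN, hO] with δ h h'
      rw [Pi.div_apply, le_div_iff₀ (h' i)]
      exact h.2.1
    · filter_upwards [hnearN, hO] with δ h h'
      rw [Pi.div_apply, div_le_iff₀ (h' i), inv_mul_eq_div, le_div_iff₀ h.1]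
      exact h.2.2
  · intro hZ
    have hratio : ∀ i, Tendsto (Z i / O i) l (𝓝 1) := fun i =>
      (isEquivalent_iff_tendsto_one (hO.mono fun δ h => (h i).ne')).1 (hZ i)
    refine tendsto_order.2 ⟨fun a ha => ?_, fun a ha => ?_⟩
    -- Any `y < 1` is eventually an admissible tolerance, so every `a < 1` is exceeded by choosing
    -- `y` between `max a (1/2)` and `1`.
    · obtain ⟨y, hy, hy1⟩ := exists_between (max_lt ha (by norm_num : (1 / 2 : ℝ) < 1))
      obtain ⟨hay, hy2⟩ := max_lt_iff.1 hy
      have hy0 : 0 < y := by linarith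
      have hclose : ∀ᶠ δ in l, ∀ i, y * O i δ ≤ Z i δ ∧ Z i δ * y ≤ O i δ := by
        rw [eventually_all]
        intro i
        filter_upwards [(hratio i).eventually_const_lt hy1,
          (hratio i).eventually_lt_const (one_lt_one_div hy0 hy1), hO] with δ h1 h2 h3
        rw [Pi.div_apply, lt_div_iff₀ (h3 i)] at h1
        rw [Pi.div_apply, div_lt_iff₀ (h3 i), one_div_mul_eq_div, lt_div_iff₀ hy0] at h2
        exact ⟨h1.le, h2.le⟩
      filter_upwards [hclose, hlb, hτpos, (hsmall C').eventually_lt_const (sub_pos.2 hay)]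
        with δ h1 h2 h3 h4
      rw [Pi.div_apply, lt_div_iff₀ (by positivity)]
      have h5 := h2 y hy2.le hy1.le h1
      have h6 : C' / t * τ δ * (t * τ δ) < (y - a) * (t * τ δ) := by gcongr
      have h7 : C' / t * τ δ * (t * τ δ) = C' * τ δ ^ 2 := by field_simp
      linarith
    · filter_upwards [hub, hτpos, (hsmall C).eventually_lt_const (sub_pos.2 ha)] with δ h1 h3 h4
      rw [Pi.div_apply, div_lt_iff₀ (by positivity)]
      have h6 : C / t * τ δ * (t * τ δ) < (a - 1) * (t * τ δ) := by gcongr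
      have h7 : C / t * τ δ * (t * τ δ) = C * τ δ ^ 2 := by field_simp
      linarith

/-- The two-sided bound is the degenerate case of `isEquivalent_rate_iff` with a single parameter
that is already at its optimum. -/
theorem isEquivalent_of_abs_sub_le {l : Filter ℝ} {E τ : ℝ → ℝ} {t C C' : ℝ}
    (hτ : Tendsto τ l (𝓝[>] 0)) (ht : 0 < t) (hub : ∀ᶠ δ in l, E δ ≤ t * τ δ + C * τ δ ^ 2)
    (hlb : ∀ᶠ δ in l, t * τ δ - C' * τ δ ^ 2 ≤ E δ) : E ~[l] fun δ => t * τ δ := by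
  refine (isEquivalent_rate_iff (n := 1) (N := 0) (Z := fun _ _ => 1) (O := fun _ _ => 1) (C' := C')
    hτ ht (by simp) hub ?_ (by simp)).2 fun _ => IsEquivalent.refl
  filter_upwards [hlb, hτ.eventually self_mem_nhdsWithin] with δ h h0 y _ hy1 _
  have h0 : 0 < τ δ := h0
  have : y * (t * τ δ) ≤ t * τ δ := mul_le_of_le_one_left (by positivity) hy1
  linarith

theorem tendsto_rpow_inv_nhdsGT_zero {N : ℕ} (hN : N ≠ 0) :
    Tendsto (fun δ : ℝ => δ ^ (1 / N : ℝ)) (𝓝[>] 0) (𝓝[>] 0) := by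
  have hpos : (0 : ℝ) < 1 / N := by positivity
  refine tendsto_nhdsWithin_iff.2 ⟨?_, ?_⟩
  · have := (Real.continuousAt_rpow_const (0 : ℝ) (1 / N : ℝ) (Or.inr hpos.le)).tendsto
    rw [Real.zero_rpow hpos.ne'] at this
    exact this.mono_left nhdsWithin_le_nhds
  · filter_upwards [self_mem_nhdsWithin] with δ hδ
    exact Real.rpow_pos_of_pos hδ _

/-- Every factor is a monomial in `2`, `K` and `δ`. After taking logarithms the identity is linear
in the exponents. -/
theorem optZero_monomial {w K δ : ℝ} (hK : 0 < K) (hδ : 0 < δ) (ω a b c : ℝ)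
    (hw : w = (2 : ℝ) ^ ω) (i : ℕ) :
    optZero w K ((2 : ℝ) ^ a * K ^ b * δ ^ c) i =
      (2 : ℝ) ^ (ω - a + (2 + 2 * ω - 2 * a) * i) * K ^ (1 - b - 2 * b * i) *
        δ ^ (-c - 2 * c * i) := by
  have h2 : (0 : ℝ) < 2 := two_pos
  have p2 : ∀ e : ℝ, 0 < (2 : ℝ) ^ e := fun e => Real.rpow_pos_of_pos h2 e
  have pK : ∀ e : ℝ, 0 < K ^ e := fun e => Real.rpow_pos_of_pos hK e
  have pδ : ∀ e : ℝ, 0 < δ ^ e := fun e => Real.rpow_pos_of_pos hδ e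
  have hT : 0 < (2 : ℝ) ^ a * K ^ b * δ ^ c := mul_pos (mul_pos (p2 a) (pK b)) (pδ c)
  have hw0 : 0 < w := hw ▸ p2 ω
  have hlogw : Real.log w = ω * Real.log 2 := by rw [hw, Real.log_rpow h2]
  have hlogT : Real.log ((2 : ℝ) ^ a * K ^ b * δ ^ c) =
      a * Real.log 2 + b * Real.log K + c * Real.log δ := by
    rw [Real.log_mul (mul_pos (p2 a) (pK b)).ne' (pδ c).ne', Real.log_mul (p2 a).ne' (pK b).ne',
      Real.log_rpow h2, Real.log_rpow hK, Real.log_rpow hδ]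
  have hlog4 : Real.log 4 = 2 * Real.log 2 := by
    rw [show (4 : ℝ) = 2 ^ 2 by norm_num, Real.log_pow]; norm_num
  refine Real.log_injOn_pos (optZero_pos hw0 hK hT i)
    (mul_pos (mul_pos (p2 _) (pK _)) (pδ _)) ?_
  rw [Real.log_mul (mul_pos (p2 _) (pK _)).ne' (pδ _).ne', Real.log_mul (p2 _).ne' (pK _).ne',
    Real.log_rpow h2, Real.log_rpow hK, Real.log_rpow hδ]
  generalize (2 : ℝ) ^ a * K ^ b * δ ^ c = T at hT hlogT ⊢
  rw [optZero, Real.log_mul (by positivity) (by positivity), Real.log_div (by positivity) hT.ne',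
    Real.log_mul hw0.ne' hK.ne', Real.log_pow, Real.log_div (by positivity) (by positivity),
    Real.log_mul (by norm_num) (by positivity), Real.log_pow, Real.log_pow, hlog4, hlogw, hlogT]
  push_cast
  ring

theorem rpow_one_div_pow {x : ℝ} (hx : 0 ≤ x) {N : ℕ} (hN : N ≠ 0) : (x ^ (1 / N : ℝ)) ^ N = x := by
  rw [one_div]
  exact Real.rpow_inv_natCast_pow hx hN

theorem inv_monomial {K δ : ℝ} (hK : 0 < K) (hδ : 0 < δ) (a b c : ℝ) :
    ((2 : ℝ) ^ a * K ^ b * δ ^ c)⁻¹ = (2 : ℝ) ^ (-a) * K ^ (-b) * δ ^ (-c) := by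
  rw [mul_inv, mul_inv, Real.rpow_neg two_pos.le, Real.rpow_neg hK.le, Real.rpow_neg hδ.le]

/-- Passing from `1 / q` to `q`. -/
theorem isEquivalent_one_div_iff {l : Filter ℝ} {q O : ℝ → ℝ} :
    (fun δ => 1 / q δ) ~[l] O ↔ q ~[l] fun δ => (O δ)⁻¹ := by
  simp only [one_div]
  constructor
  · intro h
    simpa [Pi.inv_def] using h.inv
  · intro h
    simpa [Pi.inv_def] using h.inv

theorem isEquivalent_congr_right {l : Filter ℝ} {u v w : ℝ → ℝ} (h : v =ᶠ[l] w) :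
    u ~[l] v ↔ u ~[l] w :=
  ⟨fun H => H.congr_right h, fun H => H.congr_right h.symm⟩

end OSM

/-! ### The asymptotic statements -/

namespace OSM

theorem isEquivalent_optZero_iff {w K T₀ ω a b c e₁ e₂ e₃ : ℝ} {τ p : ℝ → ℝ} (hK : 0 < K)
    (hw : w = (2 : ℝ) ^ ω) (hT : ∀ δ, T₀ * τ δ = (2 : ℝ) ^ a * K ^ b * δ ^ c) (i : ℕ)
    (h₁ : ω - a + (2 + 2 * ω - 2 * a) * i = e₁) (h₂ : 1 - b - 2 * b * i = e₂)
    (h₃ : -c - 2 * c * i = e₃) :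
    (p ~[𝓝[>] (0 : ℝ)] fun δ => optZero w K (T₀ * τ δ) i) ↔
      p ~[𝓝[>] (0 : ℝ)] fun δ => (2 : ℝ) ^ e₁ * K ^ e₂ * δ ^ e₃ := by
  refine isEquivalent_congr_right ?_
  filter_upwards [self_mem_nhdsWithin] with δ hδ
  rw [hT, optZero_monomial hK hδ ω a b c hw, h₁, h₂, h₃]

theorem isEquivalent_one_div_optZero_iff {w K T₀ ω a b c e₁ e₂ e₃ : ℝ} {τ q : ℝ → ℝ} (hK : 0 < K)
    (hw : w = (2 : ℝ) ^ ω) (hT : ∀ δ, T₀ * τ δ = (2 : ℝ) ^ a * K ^ b * δ ^ c) (i : ℕ)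
    (h₁ : ω - a + (2 + 2 * ω - 2 * a) * i = -e₁) (h₂ : 1 - b - 2 * b * i = -e₂)
    (h₃ : -c - 2 * c * i = -e₃) :
    ((fun δ => 1 / q δ) ~[𝓝[>] (0 : ℝ)] fun δ => optZero w K (T₀ * τ δ) i) ↔
      q ~[𝓝[>] (0 : ℝ)] fun δ => (2 : ℝ) ^ e₁ * K ^ e₂ * δ ^ e₃ := by
  rw [isEquivalent_one_div_iff]
  refine isEquivalent_congr_right ?_
  filter_upwards [self_mem_nhdsWithin] with δ hδ
  rw [hT, optZero_monomial hK hδ ω a b c hw, inv_monomial hK hδ, h₁, h₂, h₃, neg_neg, neg_neg,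
    neg_neg]

namespace Problem

variable {D : Problem}

theorem Admissible.asymptotics_oneSided (hD : D.Admissible) {kmax : ℝ → ℝ}
    (hkmax : ∃ c : ℝ, 0 < c ∧ ∀ᶠ δ in 𝓝[>] (0 : ℝ), c / δ ≤ kmax δ) :
    (∀ᶠ δ in 𝓝[>] (0 : ℝ), ∃ p q : ℝ, 0 < p ∧ 0 < q ∧
        D.rho₁ (kmax δ) δ p q = D.opt₁ (kmax δ) δ) ∧
      ((fun δ : ℝ => D.opt₁ (kmax δ) δ
          - (1 - (2 : ℝ) ^ (8 / 5 : ℝ) * D.Kmode ^ (1 / 5 : ℝ) * δ ^ (1 / 5 : ℝ)))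
        =O[𝓝[>] (0 : ℝ)] fun δ : ℝ => δ ^ (2 / 5 : ℝ)) ∧
      ∀ p q : ℝ → ℝ, (∀ᶠ δ in 𝓝[>] (0 : ℝ), 0 < p δ ∧ 0 < q δ) →
        (((fun δ : ℝ => 1 - D.rho₁ (kmax δ) δ (p δ) (q δ))
            ~[𝓝[>] (0 : ℝ)] fun δ : ℝ => 1 - D.opt₁ (kmax δ) δ) ↔
          (p ~[𝓝[>] (0 : ℝ)] fun δ : ℝ =>
            (2 : ℝ) ^ (-(3 / 5) : ℝ) * D.Kmode ^ (4 / 5 : ℝ) * δ ^ (-(1 / 5) : ℝ)) ∧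
          (q ~[𝓝[>] (0 : ℝ)] fun δ : ℝ =>
            (2 : ℝ) ^ (-(1 / 5) : ℝ) * D.Kmode ^ (-(2 / 5) : ℝ) * δ ^ (3 / 5 : ℝ))) := by
  have hK := Kmode_pos hD.L_pos hD.Lhat_pos hD.eta_nonneg hD.eps_nonneg
  obtain ⟨c, hc, hkmax⟩ := hkmax
  obtain ⟨t, ht⟩ : ∃ t, t = (2 : ℝ) ^ (8 / 5 : ℝ) * D.Kmode ^ (1 / 5 : ℝ) := ⟨_, rfl⟩
  have ht0 : 0 < t := by rw [ht]; positivity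
  have ht5 : t ^ 5 = 256 * D.Kmode := by
    rw [ht, mul_pow, ← Real.rpow_mul_natCast two_pos.le, ← Real.rpow_mul_natCast hK.le]
    norm_num
  obtain ⟨τ, hτ⟩ : ∃ τ : ℝ → ℝ, τ = fun δ => δ ^ (1 / 5 : ℝ) := ⟨_, rfl⟩
  have hτ0 : Tendsto τ (𝓝[>] 0) (𝓝[>] 0) := by
    have := tendsto_rpow_inv_nhdsGT_zero (N := 5) (by norm_num)
    rw [hτ]
    exact_mod_cast this
  obtain ⟨C, C', hC, hC', hev⟩ := hD.summary_oneSided hc ht0 ht5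
  have hτ5 : ∀ᶠ δ in 𝓝[>] (0 : ℝ), τ δ ^ 5 = δ := by
    filter_upwards [self_mem_nhdsWithin] with δ hδ
    rw [hτ]
    exact_mod_cast rpow_one_div_pow (le_of_lt hδ) (N := 5) (by norm_num)
  -- Returns from `τ` to `δ = τ⁵`; the lower bound `c/δ` on `kmax` is what the summary at overlap
  -- `τ⁵` requires.
  have key := ((hτ0.eventually hev).and (hτ5.and hkmax)).mono fun δ h => by
    have h1 := h.1 (kmax δ) (by rw [h.2.1]; exact h.2.2)
    rw [h.2.1] at h1
    exact h1
  clear hev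
  have hopt : (fun δ => 1 - D.opt₁ (kmax δ) δ) ~[𝓝[>] (0 : ℝ)] fun δ => t * τ δ :=
    isEquivalent_of_abs_sub_le hτ0 ht0 (key.mono fun δ h => h.2.2.2.2.1)
      (key.mono fun δ h => h.2.2.2.2.2)
  have hT : ∀ δ, t * τ δ = (2 : ℝ) ^ (8 / 5 : ℝ) * D.Kmode ^ (1 / 5 : ℝ) * δ ^ (1 / 5 : ℝ) :=
    fun δ => by rw [ht, hτ]
  refine ⟨key.mono fun δ h => h.2.2.2.1, ?_, fun p q hpq => ?_⟩
  · refine IsBigO.of_bound (C + C') ?_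
    filter_upwards [key, self_mem_nhdsWithin] with δ h hδ
    have hδ : 0 < δ := hδ
    have hτ2 : τ δ ^ 2 = δ ^ (2 / 5 : ℝ) := by
      rw [hτ]
      simp only
      rw [← Real.rpow_mul_natCast hδ.le]
      norm_num
    rw [← hT, ← hτ2, Real.norm_eq_abs, Real.norm_eq_abs, abs_of_nonneg (sq_nonneg (τ δ)), abs_le]
    have h1 := h.2.2.2.2.1
    have h2 := h.2.2.2.2.2
    have h3 : 0 ≤ C * τ δ ^ 2 := by positivity
    have h4 : 0 ≤ C' * τ δ ^ 2 := by positivity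
    constructor <;> linarith
  · have hrate := isEquivalent_rate_iff (n := 2) (N := 4) (C := C) (C' := C')
      (E := fun δ => 1 - D.rho₁ (kmax δ) δ (p δ) (q δ))
      (Z := ![p, fun δ => 1 / q δ]) (O := fun i δ => optZero 2 D.Kmode (t * τ δ) i) hτ0 ht0
      ((hτ0.eventually self_mem_nhdsWithin).mono fun δ h i =>
        optZero_pos two_pos hK (mul_pos ht0 h) i)
      ((key.and hpq).mono fun δ h => h.1.1 _ _ h.2.1 h.2.2)
      ((key.and hpq).mono fun δ h y hy hy1 hZ => h.1.2.1 _ _ y h.2.2 hy hy1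
        fun i => by have := hZ i; fin_cases i <;> exact this)
      ((key.and hpq).mono fun δ h x hx hx0 hxN hE i => by
        have := h.1.2.2.1 _ _ x h.2.1 h.2.2 hx hx0 hxN hE i
        fin_cases i <;> exact this)
    have hw : (2 : ℝ) = (2 : ℝ) ^ (1 : ℝ) := by norm_num
    have hfin : (∀ i : Fin 2, (![p, fun δ => 1 / q δ] : Fin 2 → ℝ → ℝ) i ~[𝓝[>] (0 : ℝ)]
        fun δ => optZero 2 D.Kmode (t * τ δ) i) ↔
        (p ~[𝓝[>] (0 : ℝ)] fun δ => optZero 2 D.Kmode (t * τ δ) 0) ∧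
        ((fun δ => 1 / q δ) ~[𝓝[>] (0 : ℝ)] fun δ => optZero 2 D.Kmode (t * τ δ) 1) :=
      Fin.forall_fin_two
    have htrans : ((fun δ => 1 - D.rho₁ (kmax δ) δ (p δ) (q δ)) ~[𝓝[>] (0 : ℝ)]
        fun δ => 1 - D.opt₁ (kmax δ) δ) ↔
        ((fun δ => 1 - D.rho₁ (kmax δ) δ (p δ) (q δ)) ~[𝓝[>] (0 : ℝ)] fun δ => t * τ δ) :=
      ⟨fun h => h.trans hopt, fun h => h.trans hopt.symm⟩
    rw [htrans, hrate, hfin]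
    refine and_congr (isEquivalent_optZero_iff hK hw hT 0 ?_ ?_ ?_)
      (isEquivalent_one_div_optZero_iff hK hw hT 1 ?_ ?_ ?_) <;> norm_num

theorem Admissible.asymptotics_twoSided (hD : D.Admissible) {kmax : ℝ → ℝ}
    (hkmax : ∃ c : ℝ, 0 < c ∧ ∀ᶠ δ in 𝓝[>] (0 : ℝ), c / δ ≤ kmax δ) (σ : ℕ → Bool) :
    (∀ᶠ δ in 𝓝[>] (0 : ℝ), ∃ p₁ q₁ p₂ q₂ : ℝ, 0 < p₁ ∧ 0 < q₁ ∧ 0 < p₂ ∧ 0 < q₂ ∧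
        D.rho₂ σ (kmax δ) δ p₁ q₁ p₂ q₂ = D.opt₂ σ (kmax δ) δ) ∧
      ((fun δ : ℝ => 1 - D.opt₂ σ (kmax δ) δ) ~[𝓝[>] (0 : ℝ)] fun δ : ℝ =>
        (2 : ℝ) ^ (8 / 9 : ℝ) * D.Kmode ^ (1 / 9 : ℝ) * δ ^ (1 / 9 : ℝ)) ∧
      ∀ p₁ q₁ p₂ q₂ : ℝ → ℝ,
        (∀ᶠ δ in 𝓝[>] (0 : ℝ),
          0 < p₁ δ ∧ 0 < q₁ δ ∧ 0 < p₂ δ ∧ 0 < q₂ δ ∧ p₁ δ ≤ p₂ δ ∧ q₁ δ ≤ q₂ δ) →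
        (((fun δ : ℝ => 1 - D.rho₂ σ (kmax δ) δ (p₁ δ) (q₁ δ) (p₂ δ) (q₂ δ))
            ~[𝓝[>] (0 : ℝ)] fun δ : ℝ => 1 - D.opt₂ σ (kmax δ) δ) ↔
          (p₁ ~[𝓝[>] (0 : ℝ)] fun δ : ℝ =>
            (2 : ℝ) ^ (-(8 / 9) : ℝ) * D.Kmode ^ (8 / 9 : ℝ) * δ ^ (-(1 / 9) : ℝ)) ∧
          (q₁ ~[𝓝[>] (0 : ℝ)] fun δ : ℝ =>
            (2 : ℝ) ^ (2 / 9 : ℝ) * D.Kmode ^ (-(2 / 9) : ℝ) * δ ^ (7 / 9 : ℝ)) ∧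
          (p₂ ~[𝓝[>] (0 : ℝ)] fun δ : ℝ =>
            (2 : ℝ) ^ (-(2 / 3) : ℝ) * D.Kmode ^ (2 / 3 : ℝ) * δ ^ (-(1 / 3) : ℝ)) ∧
          (q₂ ~[𝓝[>] (0 : ℝ)] fun δ : ℝ =>
            (2 : ℝ) ^ (4 / 9 : ℝ) * D.Kmode ^ (-(4 / 9) : ℝ) * δ ^ (5 / 9 : ℝ))) := by
  have hK := Kmode_pos hD.L_pos hD.Lhat_pos hD.eta_nonneg hD.eps_nonneg
  obtain ⟨c, hc, hkmax⟩ := hkmax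
  obtain ⟨t, ht⟩ : ∃ t, t = (2 : ℝ) ^ (8 / 9 : ℝ) * D.Kmode ^ (1 / 9 : ℝ) := ⟨_, rfl⟩
  have ht0 : 0 < t := by rw [ht]; positivity
  have ht9 : t ^ 9 = 256 * D.Kmode := by
    rw [ht, mul_pow, ← Real.rpow_mul_natCast two_pos.le, ← Real.rpow_mul_natCast hK.le]
    norm_num
  obtain ⟨τ, hτ⟩ : ∃ τ : ℝ → ℝ, τ = fun δ => δ ^ (1 / 9 : ℝ) := ⟨_, rfl⟩
  have hτ0 : Tendsto τ (𝓝[>] 0) (𝓝[>] 0) := by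
    have := tendsto_rpow_inv_nhdsGT_zero (N := 9) (by norm_num)
    rw [hτ]
    exact_mod_cast this
  obtain ⟨C, C', hC, hC', hev⟩ := hD.summary_twoSided hc ht0 ht9
  have hτ9 : ∀ᶠ δ in 𝓝[>] (0 : ℝ), τ δ ^ 9 = δ := by
    filter_upwards [self_mem_nhdsWithin] with δ hδ
    rw [hτ]
    exact_mod_cast rpow_one_div_pow (le_of_lt hδ) (N := 9) (by norm_num)
  have key := ((hτ0.eventually hev).and (hτ9.and hkmax)).mono fun δ h => by
    have h1 := h.1 σ (kmax δ) (by rw [h.2.1]; exact h.2.2)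
    rw [h.2.1] at h1
    exact h1
  clear hev
  have hopt : (fun δ => 1 - D.opt₂ σ (kmax δ) δ) ~[𝓝[>] (0 : ℝ)] fun δ => t * τ δ :=
    isEquivalent_of_abs_sub_le hτ0 ht0 (key.mono fun δ h => h.2.2.2.2.1)
      (key.mono fun δ h => h.2.2.2.2.2)
  have hT : ∀ δ, t * τ δ = (2 : ℝ) ^ (8 / 9 : ℝ) * D.Kmode ^ (1 / 9 : ℝ) * δ ^ (1 / 9 : ℝ) :=
    fun δ => by rw [ht, hτ]
  refine ⟨key.mono fun δ h => h.2.2.2.1, ?_, fun p₁ q₁ p₂ q₂ hpq => ?_⟩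
  · simpa only [hT] using hopt
  · have hrate := isEquivalent_rate_iff (n := 4) (N := 8) (C := C) (C' := C')
      (E := fun δ => 1 - D.rho₂ σ (kmax δ) δ (p₁ δ) (q₁ δ) (p₂ δ) (q₂ δ))
      (Z := ![p₁, p₂, fun δ => 1 / q₂ δ, fun δ => 1 / q₁ δ])
      (O := fun i δ => optZero 1 D.Kmode (t * τ δ) i) hτ0 ht0
      ((hτ0.eventually self_mem_nhdsWithin).mono fun δ h i =>
        optZero_pos one_pos hK (mul_pos ht0 h) i)
      ((key.and hpq).mono fun δ h => h.1.1 _ _ _ _ h.2.1 h.2.2.1 h.2.2.2.1 h.2.2.2.2.1)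
      ((key.and hpq).mono fun δ h y hy hy1 hZ =>
        h.1.2.1 _ _ _ _ y h.2.2.1 h.2.2.2.2.1 hy hy1
          fun i => by have := hZ i; fin_cases i <;> exact this)
      ((key.and hpq).mono fun δ h x hx hx0 hxN hE i => by
        have := h.1.2.2.1 _ _ _ _ x h.2.1 h.2.2.1 h.2.2.2.1 h.2.2.2.2.1 h.2.2.2.2.2.1
          h.2.2.2.2.2.2 hx hx0 hxN hE i
        fin_cases i <;> exact this)
    have hw : (1 : ℝ) = (2 : ℝ) ^ (0 : ℝ) := by norm_num
    -- The order of the parameters in the statement, `p₁, q₁, p₂, q₂`, corresponds to the optimal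
    -- zeros `0, 3, 1, 2`: the two `p` come first, then the poles, with the larger `q` giving the
    -- smaller pole.
    have hfin : (∀ i : Fin 4, (![p₁, p₂, fun δ => 1 / q₂ δ, fun δ => 1 / q₁ δ] :
        Fin 4 → ℝ → ℝ) i ~[𝓝[>] (0 : ℝ)] fun δ => optZero 1 D.Kmode (t * τ δ) i) ↔
        (p₁ ~[𝓝[>] (0 : ℝ)] fun δ => optZero 1 D.Kmode (t * τ δ) 0) ∧
        ((fun δ => 1 / q₁ δ) ~[𝓝[>] (0 : ℝ)] fun δ => optZero 1 D.Kmode (t * τ δ) 3) ∧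
        (p₂ ~[𝓝[>] (0 : ℝ)] fun δ => optZero 1 D.Kmode (t * τ δ) 1) ∧
        ((fun δ => 1 / q₂ δ) ~[𝓝[>] (0 : ℝ)] fun δ => optZero 1 D.Kmode (t * τ δ) 2) :=
      ⟨fun h => ⟨h 0, h 3, h 1, h 2⟩, fun h i => by
        fin_cases i
        exacts [h.1, h.2.2.1, h.2.2.2, h.2.1]⟩
    have htrans : ((fun δ => 1 - D.rho₂ σ (kmax δ) δ (p₁ δ) (q₁ δ) (p₂ δ) (q₂ δ))
        ~[𝓝[>] (0 : ℝ)] fun δ => 1 - D.opt₂ σ (kmax δ) δ) ↔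
        ((fun δ => 1 - D.rho₂ σ (kmax δ) δ (p₁ δ) (q₁ δ) (p₂ δ) (q₂ δ)) ~[𝓝[>] (0 : ℝ)]
          fun δ => t * τ δ) :=
      ⟨fun h => h.trans hopt, fun h => h.trans hopt.symm⟩
    rw [htrans, hrate, hfin]
    refine and_congr (isEquivalent_optZero_iff hK hw hT 0 ?_ ?_ ?_)
      (and_congr (isEquivalent_one_div_optZero_iff hK hw hT 3 ?_ ?_ ?_)
        (and_congr (isEquivalent_optZero_iff hK hw hT 1 ?_ ?_ ?_)
          (isEquivalent_one_div_optZero_iff hK hw hT 2 ?_ ?_ ?_))) <;> norm_num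

end Problem

end OSM

theorem mainTheorem2 (D : OSM.Problem) (hJ : 2 ≤ D.J) (hL : 0 < D.L) (hLhat : 0 < D.Lhat)
    (hη : 0 ≤ D.η) (hε : 0 ≤ D.ε) (kmax : ℝ → ℝ)
    (hkmax : ∃ c : ℝ, 0 < c ∧ ∀ᶠ δ in 𝓝[>] (0 : ℝ), c / δ ≤ kmax δ) :
    -- the constant, and its closed form
    0 < D.Kmode ∧
    (D.J = 2 ∨ 0 ≤ (D.s / Complex.sinh (D.s * D.L)).re → D.Kmode = D.KJ) ∧
    -- one-sided conditions
    ((∀ᶠ δ in 𝓝[>] (0 : ℝ), ∃ p q : ℝ, 0 < p ∧ 0 < q ∧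
        D.rho₁ (kmax δ) δ p q = D.opt₁ (kmax δ) δ) ∧
      ((fun δ : ℝ => D.opt₁ (kmax δ) δ
          - (1 - (2 : ℝ) ^ (8 / 5 : ℝ) * D.Kmode ^ (1 / 5 : ℝ) * δ ^ (1 / 5 : ℝ)))
        =O[𝓝[>] (0 : ℝ)] fun δ : ℝ => δ ^ (2 / 5 : ℝ)) ∧
      ∀ p q : ℝ → ℝ, (∀ᶠ δ in 𝓝[>] (0 : ℝ), 0 < p δ ∧ 0 < q δ) →
        (((fun δ : ℝ => 1 - D.rho₁ (kmax δ) δ (p δ) (q δ))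
            ~[𝓝[>] (0 : ℝ)] fun δ : ℝ => 1 - D.opt₁ (kmax δ) δ) ↔
          (p ~[𝓝[>] (0 : ℝ)] fun δ : ℝ =>
            (2 : ℝ) ^ (-(3 / 5) : ℝ) * D.Kmode ^ (4 / 5 : ℝ) * δ ^ (-(1 / 5) : ℝ)) ∧
          (q ~[𝓝[>] (0 : ℝ)] fun δ : ℝ =>
            (2 : ℝ) ^ (-(1 / 5) : ℝ) * D.Kmode ^ (-(2 / 5) : ℝ) * δ ^ (3 / 5 : ℝ)))) ∧
    -- two-sided conditions, for every arrangement of the two pairs along the interfaces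
    ∀ σ : ℕ → Bool,
      (∀ᶠ δ in 𝓝[>] (0 : ℝ), ∃ p₁ q₁ p₂ q₂ : ℝ, 0 < p₁ ∧ 0 < q₁ ∧ 0 < p₂ ∧ 0 < q₂ ∧
        D.rho₂ σ (kmax δ) δ p₁ q₁ p₂ q₂ = D.opt₂ σ (kmax δ) δ) ∧
      ((fun δ : ℝ => 1 - D.opt₂ σ (kmax δ) δ) ~[𝓝[>] (0 : ℝ)] fun δ : ℝ =>
        (2 : ℝ) ^ (8 / 9 : ℝ) * D.Kmode ^ (1 / 9 : ℝ) * δ ^ (1 / 9 : ℝ)) ∧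
      ∀ p₁ q₁ p₂ q₂ : ℝ → ℝ,
        (∀ᶠ δ in 𝓝[>] (0 : ℝ),
          0 < p₁ δ ∧ 0 < q₁ δ ∧ 0 < p₂ δ ∧ 0 < q₂ δ ∧ p₁ δ ≤ p₂ δ ∧ q₁ δ ≤ q₂ δ) →
        (((fun δ : ℝ => 1 - D.rho₂ σ (kmax δ) δ (p₁ δ) (q₁ δ) (p₂ δ) (q₂ δ))
            ~[𝓝[>] (0 : ℝ)] fun δ : ℝ => 1 - D.opt₂ σ (kmax δ) δ) ↔
          (p₁ ~[𝓝[>] (0 : ℝ)] fun δ : ℝ =>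
            (2 : ℝ) ^ (-(8 / 9) : ℝ) * D.Kmode ^ (8 / 9 : ℝ) * δ ^ (-(1 / 9) : ℝ)) ∧
          (q₁ ~[𝓝[>] (0 : ℝ)] fun δ : ℝ =>
            (2 : ℝ) ^ (2 / 9 : ℝ) * D.Kmode ^ (-(2 / 9) : ℝ) * δ ^ (7 / 9 : ℝ)) ∧
          (p₂ ~[𝓝[>] (0 : ℝ)] fun δ : ℝ =>
            (2 : ℝ) ^ (-(2 / 3) : ℝ) * D.Kmode ^ (2 / 3 : ℝ) * δ ^ (-(1 / 3) : ℝ)) ∧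
          (q₂ ~[𝓝[>] (0 : ℝ)] fun δ : ℝ =>
            (2 : ℝ) ^ (4 / 9 : ℝ) * D.Kmode ^ (-(4 / 9) : ℝ) * δ ^ (5 / 9 : ℝ))) := by
  have hD : D.Admissible := ⟨hJ, hL, hLhat, hη, hε⟩
  exact ⟨OSM.Problem.Kmode_pos hL hLhat hη hε, OSM.Problem.Kmode_eq_KJ hJ hL hLhat hη,
    hD.asymptotics_oneSided hkmax, hD.asymptotics_twoSided hkmax⟩
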